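/- Let $M$ be a smooth surface with a smooth Riemannian metric $g$ whose isometric embedding system into $\mathbb R^3$ is Darboux integrable in the following sense. For a local orthonormal frame field $(v_1,v_2)$ of $g$ on an open set $U$, with dual coframe $\eta^1,\eta^2$ and connection form $\eta^1_2$ ($d\eta^1=-\eta^1_2\wedge\eta^2$, $d\eta^2=\eta^1_2\wedge\eta^1$, $d\eta^1_2=K\,\eta^1\wedge\eta^2$), and with the canonical and connection forms $\omega^a=e_a\cdot d\rho$, $\omega^a_b=e_a\cdot de_b$ of the orthonormal frame bundle $\mathcal F$ of $\mathbb R^3$, the embedding system is the Pfaffian system $\mathcal I=\{\omega^3,\ \omega^1-\eta^1,\ \omega^2-\eta^2,\ \omega^1_2-\eta^1_2\}$ on $U\times\mathcal F$. It is Darboux integrable if about every point there is a coframe $\theta^i,\hat\sigma^a,\check\sigma^\alpha$, with at least two $\hat\sigma^a$ and at least two $\check\sigma^\alpha$, consisting of real forms or of complex-valued forms, such that $\mathcal I$ is algebraically generated by the $\theta^i$ together with nonempty families of 2-forms $\hat\Omega^b\in\Lambda^2\langle\hat\sigma\rangle$ and $\check\Omega^\beta\in\Lambda^2\langle\check\sigma\rangle$;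 the singular systems $\{\theta,\hat\sigma,\check\Omega\}$ and $\{\theta,\check\sigma,\hat\Omega\}$ are Pfaffian; and their degree-one parts $\hat V,\check V$ form a Darboux pair: $\hat V+\check V^\infty$ and $\check V+\hat V^\infty$ are the whole (complexified) cotangent bundle, $\hat V^\infty\cap\check V^\infty=0$, and $d\omega\in\Omega^2(\hat V)+\Omega^2(\check V)$ for all local sections $\omega$ of $\hat V\cap\check V$. Here $V^\infty$ is the final element of the derived flag of $V$. Let $(v_1,v_2)$ be any smooth orthonormal frame field on an open set $U\subseteq M$, let $q=|K|^{-3/4}$, and let $V=J\nabla q=v_1(q)\,v_2-v_2(q)\,v_1$. Then $V$ is a Killing field of $g$ on $U$ whose zeros have empty interior, and near every point $p\in U$ with $V(p)\neq0$ the metric has, modulo rigid motions, exactly a 2-parameter family of local isometric immersions into $\mathbb R^3$ under which $V$ is the restriction of an ambient Killing field generating a screw motion. Precisely: there are a nonempty open set $P\subseteq\mathbb R^2$, an open set $D\subseteq P\times U$ containing $P\times\{p\}$, and a map $\Psi:D\to\mathbb R^3$, smooth jointly in parameter and point, such that, with $D_a=\{x:(a,x)\in D\}$: (i) for each $a\in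 P$, $\Psi_a=\Psi(a,\cdot):D_a\to\mathbb R^3$ is an isometric immersion, and there are constant vectors $A$ and $Z\ne0$ with $d\Psi_a(V)=A+\Psi_a\times Z$ on $D_a$; (ii) if $a\neq b$ in $P$, then $\Psi_a$ and $\Psi_b$ do not agree up to an isometry of $\mathbb R^3$ on any neighbourhood of $p$; (iii) every smooth isometric immersion $\varphi:W\to\mathbb R^3$ of an open set $W$ with $p\in W\subseteq U$ for which $d\varphi(V)=A+\varphi\times Z$ on $W$ with some constant vectors $A$ and $Z\neq0$ agrees near $p$, up to an isometry of $\mathbb R^3$, with $\Psi_a$ for some $a\in P$. -/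

import Mathlib

open scoped Manifold ContDiff

namespace IsoEmb

noncomputable section

/-! ### Pfaffian systems, derived flags and Darboux pairs

`E` is a real vector space in which an open set serves as coordinate domain. Forms take values in
`𝕜`, which is `ℝ` (real forms) or `ℂ` (complex-valued forms). A family `V : E → Submodule 𝕜 _` of
subspaces of the (complexified) cotangent spaces plays the part of a subbundle; only its values on
the coordinate domain matter. -/

section EDS

variable {𝕜 : Type*} [RCLike 𝕜] {E : Type*} [NormedAddCommGroup E] [NormedSpace ℝ E]

/-- The wedge product of two covectors, `(α ∧ β)(u, v) = α u * β v - β u * α v`. -/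
def wedge (α β : E →L[ℝ] 𝕜) : E →L[ℝ] E →L[ℝ] 𝕜 := α.smulRight β - β.smulRight α

/-- The exterior derivative of a 1-form, `dα(u, v) = (D_u α) v - (D_v α) u`. -/
def extD (α : E → E →L[ℝ] 𝕜) (x : E) : E →L[ℝ] E →L[ℝ] 𝕜 :=
  fderiv ℝ α x - (fderiv ℝ α x).flip

theorem wedge_apply (α β : E →L[ℝ] 𝕜) (u v : E) :
    wedge α β u v = α u * β v - β u * α v := by
  simp [wedge]

/-- The exterior derivative above is the one of Mathlib. -/
theorem extDeriv_eq_extD (α : E → E →L[ℝ] 𝕜) (x : E) (h : DifferentiableAt ℝ α x) (u v : E) :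
    extDeriv (fun y => ContinuousAlternatingMap.ofSubsingleton ℝ E 𝕜 (0 : Fin 1) (α y)) x ![u, v]
      = extD α x u v := by
  have h' : DifferentiableAt ℝ
      (fun y => ContinuousAlternatingMap.ofSubsingleton ℝ E 𝕜 (0 : Fin 1) (α y)) x :=
    (ContinuousAlternatingMap.ofSubsingletonLIE (𝕜 := ℝ) (E := E) (F := 𝕜) (ι := Fin 1)
      (0 : Fin 1)).toContinuousLinearEquiv.differentiableAt.comp x h
  rw [extDeriv_apply h']
  have key : ∀ w : E, fderiv ℝ (fun y => α y w) x = (fderiv ℝ α x).flip w := by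
    intro w
    ext z
    rw [fderiv_clm_apply h (differentiableAt_const w)]
    simp
  simp [Fin.sum_univ_two, extD, key, Fin.removeNth, sub_eq_add_neg]

/-- The 2-covectors in the algebraic ideal generated by the space `V` of 1-covectors. -/
def ideal2 (V : Submodule 𝕜 (E →L[ℝ] 𝕜)) : Submodule 𝕜 (E →L[ℝ] E →L[ℝ] 𝕜) :=
  Submodule.span 𝕜 {τ | ∃ α ∈ V, ∃ β : E →L[ℝ] 𝕜, τ = wedge α β}

/-- `Λ² V`, the 2-covectors spanned by the products of two elements of `V`. -/
def lambda2 (V : Submodule 𝕜 (E →L[ℝ] 𝕜)) : Submodule 𝕜 (E →L[ℝ] E →L[ℝ] 𝕜) :=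
  Submodule.span 𝕜 {τ | ∃ α ∈ V, ∃ β ∈ V, τ = wedge α β}

/-- `α` is a smooth section of `V` over the set `O`. -/
def IsSectionOn (V : E → Submodule 𝕜 (E →L[ℝ] 𝕜)) (α : E → E →L[ℝ] 𝕜) (O : Set E) : Prop :=
  ContDiffOn ℝ ∞ α O ∧ ∀ y ∈ O, α y ∈ V y

/-- The first derived system of `V`: the values of the local sections `α` of `V` such that
`dα ≡ 0` modulo `V`. -/
def derivedSystem (V : E → Submodule 𝕜 (E →L[ℝ] 𝕜)) (x : E) : Submodule 𝕜 (E →L[ℝ] 𝕜) :=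
  Submodule.span 𝕜 {a | ∃ (O : Set E) (α : E → E →L[ℝ] 𝕜), IsOpen O ∧ x ∈ O ∧
    IsSectionOn V α O ∧ (∀ y ∈ O, extD α y ∈ ideal2 (V y)) ∧ a = α x}

/-- The derived flag `V = V⁽⁰⁾ ⊇ V⁽¹⁾ ⊇ V⁽²⁾ ⊇ ⋯`. -/
def derivedFlag (V : E → Submodule 𝕜 (E →L[ℝ] 𝕜)) : ℕ → E → Submodule 𝕜 (E →L[ℝ] 𝕜)
  | 0 => V
  | k + 1 => derivedSystem (derivedFlag V k)

/-- `V^∞`, the final element of the derived flag. -/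
def derivedInf (V : E → Submodule 𝕜 (E →L[ℝ] 𝕜)) (x : E) : Submodule 𝕜 (E →L[ℝ] 𝕜) :=
  ⨅ k, derivedFlag V k x

/-- The Pfaffian systems `V` and `W` form a Darboux pair on the open set `O`. -/
structure IsDarbouxPairOn (V W : E → Submodule 𝕜 (E →L[ℝ] 𝕜)) (O : Set E) : Prop where
  sup_left : ∀ x ∈ O, V x ⊔ derivedInf W x = ⊤
  sup_right : ∀ x ∈ O, W x ⊔ derivedInf V x = ⊤
  inf_eq : ∀ x ∈ O, derivedInf V x ⊓ derivedInf W x = ⊥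
  extD_mem : ∀ (O' : Set E) (α : E → E →L[ℝ] 𝕜), IsOpen O' → O' ⊆ O →
    IsSectionOn (fun x => V x ⊓ W x) α O' →
    ∀ x ∈ O', extD α x ∈ lambda2 (V x) ⊔ lambda2 (W x)

/-- The subspace of the cotangent space at `x` spanned by a family of 1-forms. -/
def spanForms {r : ℕ} (θ : Fin r → E → E →L[ℝ] 𝕜) (x : E) : Submodule 𝕜 (E →L[ℝ] 𝕜) :=
  Submodule.span 𝕜 (Set.range fun i => θ i x)

/-- The degree 2 part of the differential ideal generated by a family of 1-forms, that is, of the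
algebraic ideal generated by the forms and their exterior derivatives. -/
def pfaff2 {r : ℕ} (θ : Fin r → E → E →L[ℝ] 𝕜) (x : E) :
    Submodule 𝕜 (E →L[ℝ] E →L[ℝ] 𝕜) :=
  ideal2 (spanForms θ x) ⊔ Submodule.span 𝕜 (Set.range fun i => extD (θ i) x)

/-- The degree 2 part of the algebraic ideal generated by 1-forms `θ` and 2-forms `Ω`. -/
def alg2 {r s : ℕ} (θ : Fin r → E → E →L[ℝ] 𝕜) (Ω : Fin s → E → E →L[ℝ] E →L[ℝ] 𝕜) (x : E) :
    Submodule 𝕜 (E →L[ℝ] E →L[ℝ] 𝕜) :=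
  ideal2 (spanForms θ x) ⊔ Submodule.span 𝕜 (Set.range fun i => Ω i x)

/-- A decomposition of type `[p, q]`, on the open set `O`, of the Pfaffian system generated by the
1-forms `ϑ`: a coframe `θ, σ, σ'` and 2-forms `Ω` in `Λ² ⟨σ⟩`, `Ω'` in `Λ² ⟨σ'⟩` such that
`{θ, Ω, Ω'}` are algebraic generators of the system. -/
structure IsDecompositionOn {m r p q s t : ℕ} (ϑ : Fin m → E → E →L[ℝ] 𝕜)
    (θ : Fin r → E → E →L[ℝ] 𝕜) (σ : Fin p → E → E →L[ℝ] 𝕜) (σ' : Fin q → E → E →L[ℝ] 𝕜)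
    (Ω : Fin s → E → E →L[ℝ] E →L[ℝ] 𝕜) (Ω' : Fin t → E → E →L[ℝ] E →L[ℝ] 𝕜)
    (O : Set E) : Prop where
  two_le_p : 2 ≤ p
  two_le_q : 2 ≤ q
  one_le_s : 1 ≤ s
  one_le_t : 1 ≤ t
  smooth_theta : ∀ i, ContDiffOn ℝ ∞ (θ i) O
  smooth_sigma : ∀ i, ContDiffOn ℝ ∞ (σ i) O
  smooth_sigma' : ∀ i, ContDiffOn ℝ ∞ (σ' i) O
  smooth_Omega : ∀ i, ContDiffOn ℝ ∞ (Ω i) O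
  smooth_Omega' : ∀ i, ContDiffOn ℝ ∞ (Ω' i) O
  linearIndependent : ∀ x ∈ O, LinearIndependent 𝕜
    (Fin.append (Fin.append (fun i => θ i x) (fun i => σ i x)) (fun i => σ' i x))
  span_eq_top : ∀ x ∈ O, spanForms θ x ⊔ spanForms σ x ⊔ spanForms σ' x = ⊤
  Omega_mem : ∀ x ∈ O, ∀ i, Ω i x ∈ lambda2 (spanForms σ x)
  Omega'_mem : ∀ x ∈ O, ∀ i, Ω' i x ∈ lambda2 (spanForms σ' x)
  deg1 : ∀ x ∈ O, spanForms ϑ x = spanForms θ x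
  deg2 : ∀ x ∈ O, pfaff2 ϑ x = alg2 θ (Fin.append Ω Ω') x

/-- The Pfaffian system generated by the 1-forms `ϑ` is Darboux integrable near `x₀`: it is
decomposable there, and the associated singular systems `{θ, σ, Ω'}` and `{θ, σ', Ω}` are Pfaffian
(equal to the differential ideals generated by `θ, σ`, resp. `θ, σ'`) and determine a Darboux
pair. -/
def IsDarbouxIntegrableAt {m : ℕ} (ϑ : Fin m → E → E →L[ℝ] 𝕜) (x₀ : E) : Prop :=
  ∃ (r p q s t : ℕ) (θ : Fin r → E → E →L[ℝ] 𝕜) (σ : Fin p → E → E →L[ℝ] 𝕜)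
    (σ' : Fin q → E → E →L[ℝ] 𝕜) (Ω : Fin s → E → E →L[ℝ] E →L[ℝ] 𝕜)
    (Ω' : Fin t → E → E →L[ℝ] E →L[ℝ] 𝕜) (O : Set E),
    IsOpen O ∧ x₀ ∈ O ∧ IsDecompositionOn ϑ θ σ σ' Ω Ω' O ∧
    (∀ x ∈ O, alg2 (Fin.append θ σ) Ω' x = pfaff2 (Fin.append θ σ) x) ∧
    (∀ x ∈ O, alg2 (Fin.append θ σ') Ω x = pfaff2 (Fin.append θ σ') x) ∧
    IsDarbouxPairOn (spanForms (Fin.append θ σ)) (spanForms (Fin.append θ σ')) O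

variable (𝕜) in
/-- Real 1-forms regarded as `𝕜`-valued 1-forms. -/
def extendScalars {m : ℕ} (ϑ : Fin m → E → E →L[ℝ] ℝ) : Fin m → E → E →L[ℝ] 𝕜 :=
  fun i y => (RCLike.ofRealCLM : ℝ →L[ℝ] 𝕜).comp (ϑ i y)

end EDS

/-! ### Surfaces, orthonormal frames, curvature -/

/-- Euclidean 3-space. -/
abbrev E3 : Type := EuclideanSpace ℝ (Fin 3)

/-- The model of local coordinates on the product of a surface with the orthonormal frame bundle
of Euclidean 3-space; its dimension is `2 + 6`. -/
abbrev E8 : Type := EuclideanSpace ℝ (Fin 8)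

section Surface

variable {M : Type*} [TopologicalSpace M] [ChartedSpace (EuclideanSpace ℝ (Fin 2)) M]
  [IsManifold (𝓡 2) ∞ M]

variable (M) in
/-- A smooth Riemannian metric on the surface `M`. -/
abbrev Metric2 : Type _ :=
  Bundle.ContMDiffRiemannianMetric (𝓡 2) ∞ (EuclideanSpace ℝ (Fin 2))
    (fun x : M => TangentSpace (𝓡 2) x)

/-- `v 0, v 1` is a smooth orthonormal frame field for `g` over the set `U`. -/
structure IsOrthonormalFrameOn (g : Metric2 M) (v : Fin 2 → (x : M) → TangentSpace (𝓡 2) x)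
    (U : Set M) : Prop where
  smooth : ∀ i, ContMDiffOn (𝓡 2) (𝓡 2).tangent ∞
    (fun x => (⟨x, v i x⟩ : TangentBundle (𝓡 2) M)) U
  orthonormal : ∀ x ∈ U, ∀ i j, g.inner x (v i x) (v j x) = if i = j then 1 else 0

/-- The derivative `w(f)` of a function in the direction of a vector field. -/
def dirDeriv (w : (x : M) → TangentSpace (𝓡 2) x) (f : M → ℝ) (x : M) : ℝ :=
  mfderiv (𝓡 2) 𝓘(ℝ, ℝ) f x (w x)

/-- The structure functions of an orthonormal frame field: `[v₁, v₂] = c₁ v₁ + c₂ v₂`. If `η¹, η²`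
is the dual coframe field, then the Levi-Civita connection form determined by `dη¹ = -η¹₂ ∧ η²`
and `dη² = η¹₂ ∧ η¹` is `η¹₂ = c₁ η¹ + c₂ η²`. -/
def structFun (g : Metric2 M) (v : Fin 2 → (x : M) → TangentSpace (𝓡 2) x) (i : Fin 2)
    (x : M) : ℝ :=
  g.inner x (VectorField.mlieBracket (𝓡 2) (v 0) (v 1) x) (v i x)

/-- The Gauss curvature, `dη¹₂ = K η¹ ∧ η²`, that is,
`K = v₁(c₂) - v₂(c₁) - c₁² - c₂²`. -/
def gaussCurv (g : Metric2 M) (v : Fin 2 → (x : M) → TangentSpace (𝓡 2) x) (x : M) : ℝ :=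
  dirDeriv (v 0) (structFun g v 1) x - dirDeriv (v 1) (structFun g v 0) x
    - structFun g v 0 x ^ 2 - structFun g v 1 x ^ 2

/-- The function `q = |K|^{-3/4}`. -/
def qFun (g : Metric2 M) (v : Fin 2 → (x : M) → TangentSpace (𝓡 2) x) (x : M) : ℝ :=
  |gaussCurv g v x| ^ (-(3 / 4) : ℝ)

/-- The vector field `J ∇q = q₁ v₂ - q₂ v₁`, where `J` is the rotation by a right angle in the
sense of the orientation given by the frame. -/
def JGradq (g : Metric2 M) (v : Fin 2 → (x : M) → TangentSpace (𝓡 2) x) (x : M) :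
    TangentSpace (𝓡 2) x :=
  dirDeriv (v 0) (qFun g v) x • v 1 x - dirDeriv (v 1) (qFun g v) x • v 0 x

/-- The smooth field `X` is a Killing field on `U`: the Lie derivative of `g` along `X`,
evaluated on the orthonormal frame field `v`, vanishes:
`(L_X g)(vᵢ, vⱼ) = X(g(vᵢ, vⱼ)) - g([X, vᵢ], vⱼ) - g(vᵢ, [X, vⱼ]) = 0`. -/
def IsKillingOn (g : Metric2 M) (v : Fin 2 → (x : M) → TangentSpace (𝓡 2) x)
    (X : (x : M) → TangentSpace (𝓡 2) x) (U : Set M) : Prop :=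
  ContMDiffOn (𝓡 2) (𝓡 2).tangent ∞ (fun x => (⟨x, X x⟩ : TangentBundle (𝓡 2) M)) U ∧
  ∀ x ∈ U, ∀ i j,
    dirDeriv X (fun y => g.inner y (v i y) (v j y)) x
      - g.inner x (VectorField.mlieBracket (𝓡 2) X (v i) x) (v j x)
      - g.inner x (v i x) (VectorField.mlieBracket (𝓡 2) X (v j) x) = 0

/-! ### The isometric embedding system -/

/-- Local coordinates, with domain the open set `O`, on the product of the open set `U` of `M`
with the orthonormal frame bundle of Euclidean 3-space: the point of `M`, the base point `ρ` of the
frame and the frame vectors `e` as functions of eight coordinates, forming an immersion (hence, by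
equality of dimensions, a local diffeomorphism). -/
structure IsLocalCoords (U : Set M) (O : Set E8) (x : E8 → M) (ρ : E8 → E3)
    (e : Fin 3 → E8 → E3) : Prop where
  isOpen : IsOpen O
  mapsTo : Set.MapsTo x O U
  smooth_x : ContMDiffOn 𝓘(ℝ, E8) (𝓡 2) ∞ x O
  smooth_rho : ContDiffOn ℝ ∞ ρ O
  smooth_e : ∀ a, ContDiffOn ℝ ∞ (e a) O
  orthonormal : ∀ y ∈ O, Orthonormal ℝ fun a => e a y
  immersion : ∀ y ∈ O, ∀ u : E8, mfderiv 𝓘(ℝ, E8) (𝓡 2) x y u = 0 → fderiv ℝ ρ y u = 0 →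
    (∀ a, fderiv ℝ (e a) y u = 0) → u = 0

/-- The form `ηⁱ = g(vᵢ, dx)` dual to the frame field `v`, in the coordinates. -/
def etaForm (g : Metric2 M) (v : Fin 2 → (x : M) → TangentSpace (𝓡 2) x) (x : E8 → M)
    (i : Fin 2) (y : E8) : E8 →L[ℝ] ℝ :=
  (g.inner (x y) (v i (x y))).comp (mfderiv 𝓘(ℝ, E8) (𝓡 2) x y)

/-- The connection form `η¹₂`, in the coordinates. -/
def etaConn (g : Metric2 M) (v : Fin 2 → (x : M) → TangentSpace (𝓡 2) x) (x : E8 → M)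
    (y : E8) : E8 →L[ℝ] ℝ :=
  structFun g v 0 (x y) • etaForm g v x 0 y + structFun g v 1 (x y) • etaForm g v x 1 y

/-- The canonical form `ωᵃ = eₐ · dρ`. -/
def omegaForm (ρ : E8 → E3) (e : Fin 3 → E8 → E3) (a : Fin 3) (y : E8) : E8 →L[ℝ] ℝ :=
  (innerSL ℝ (e a y)).comp (fderiv ℝ ρ y)

/-- The connection form `ωᵃ_b = eₐ · de_b`. -/
def omegaConn (e : Fin 3 → E8 → E3) (a b : Fin 3) (y : E8) : E8 →L[ℝ] ℝ :=
  (innerSL ℝ (e a y)).comp (fderiv ℝ (e b) y)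

/-- The generators `ω³, ω¹ - η¹, ω² - η², ω¹₂ - η¹₂` of the isometric embedding system, on the
product of the domain of the orthonormal frame field `v` with the frame bundle of Euclidean
3-space, in local coordinates. -/
def embeddingSystem (g : Metric2 M) (v : Fin 2 → (x : M) → TangentSpace (𝓡 2) x) (x : E8 → M)
    (ρ : E8 → E3) (e : Fin 3 → E8 → E3) : Fin 4 → E8 → E8 →L[ℝ] ℝ :=
  ![omegaForm ρ e 2,
    fun y => omegaForm ρ e 0 y - etaForm g v x 0 y,
    fun y => omegaForm ρ e 1 y - etaForm g v x 1 y,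
    fun y => omegaConn e 0 1 y - etaConn g v x y]

/-- The isometric embedding system of `g` is Darboux integrable, with real singular systems (which
happens only in the hyperbolic case) or with complex singular systems (as in the elliptic case).
The system is taken relative to orthonormal frame fields `v` of the surface, and the condition is
imposed about every point `(p, (o, f))` of the product of the domain of `v` with the frame bundle,
in local coordinates. -/
def IsDarbouxIntegrable (g : Metric2 M) : Prop :=
  ∀ (U : Set M) (v : Fin 2 → (x : M) → TangentSpace (𝓡 2) x), IsOpen U →
    IsOrthonormalFrameOn g v U → ∀ p ∈ U, ∀ (o : E3) (f : Fin 3 → E3), Orthonormal ℝ f →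
    ∃ (O : Set E8) (x : E8 → M) (ρ : E8 → E3) (e : Fin 3 → E8 → E3) (y : E8),
      IsLocalCoords U O x ρ e ∧ y ∈ O ∧ x y = p ∧ ρ y = o ∧ (∀ a, e a y = f a) ∧
      (IsDarbouxIntegrableAt (extendScalars ℝ (embeddingSystem g v x ρ e)) y ∨
        IsDarbouxIntegrableAt (extendScalars ℂ (embeddingSystem g v x ρ e)) y)

/-! ### Isometric immersions with extrinsic symmetry -/

/-- The image `dφ(u)` of a tangent vector `u` at `x`, as a vector of Euclidean 3-space. -/
def pushforward (φ : M → E3) (x : M) (u : TangentSpace (𝓡 2) x) : E3 :=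
  mfderiv (𝓡 2) 𝓘(ℝ, E3) φ x u

/-- `φ` is a smooth isometric immersion of the open set `W` into Euclidean 3-space. -/
def IsIsometricImmersionOn (g : Metric2 M) (φ : M → E3) (W : Set M) : Prop :=
  ContMDiffOn (𝓡 2) 𝓘(ℝ, E3) ∞ φ W ∧
  ∀ x ∈ W, ∀ u w : TangentSpace (𝓡 2) x,
    inner ℝ (pushforward φ x u) (pushforward φ x w) = g.inner x u w

/-- The cross product in Euclidean 3-space. -/
def cross (a b : E3) : E3 := WithLp.toLp 2 (crossProduct (WithLp.ofLp a) (WithLp.ofLp b))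

/-- Along the map `φ` on `W`, the image of the tangent field `X` is the restriction of a Killing
field `ρ ↦ A + ρ × Z` of Euclidean 3-space with `Z ≠ 0`, the generator of a screw motion. -/
def HasExtrinsicSymmetryOn (X : (x : M) → TangentSpace (𝓡 2) x) (φ : M → E3) (W : Set M) : Prop :=
  ∃ A Z : E3, Z ≠ 0 ∧
    ∀ x ∈ W, pushforward φ x (X x) = A + cross (φ x) Z

/-- Two maps into Euclidean 3-space agree near `p` up to a rigid motion. -/
def CongruentNear (φ ψ : M → E3) (p : M) : Prop :=
  ∃ R : E3 ≃ᵢ E3, ∀ᶠ x in nhds p, φ x = R (ψ x)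

end Surface

end

end IsoEmb

set_option linter.unusedSectionVars false

namespace IsoEmb

noncomputable section

/-! ### Calculus with vector fields on a surface -/

section SurfaceCalculus

variable {M : Type*} [TopologicalSpace M] [ChartedSpace (EuclideanSpace ℝ (Fin 2)) M]
  [IsManifold (𝓡 2) ∞ M]

/-! Modulo its 1-forms, the embedding system is generated in degree two by `ω³₁ ∧ ω¹ + ω³₂ ∧ ω²` and
`ω³₁ ∧ ω³₂ - K η¹ ∧ η²`. A dimension count shows that a decomposition has type `[2, 2]`, so each of
its two families of 2-forms consists of multiples of one decomposable form. By the Plücker relation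
such a form corresponds to a root of `κ² = -K`. The two families must be independent, hence `K ≠ 0`,
and the singular system `{θ, σ'}` annihilates the lifts `X₁`, `X₂` of the frame with `ω³₂(X₁) = κ`,
`ω³₁(X₂) = -κ` (`IsDecompositionOn.annihilates`).

The final derived system of `{θ, σ'}` annihilates all iterated brackets of `X₁` and `X₂`
(`FlagKills.bracket`). The Darboux pair condition makes its rank at least `8 - 6 = 2`, so at most
four dimensions remain for the vertical parts of these brackets. After rescaling by `κ` the vertical
parts become real functions on the surface (`HolSec`), generated from the curvature of the plane
field by two covariant derivatives. The curvature and its first derivatives already have rank three,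
seen in their first three components. Hence the generated sections with vanishing first three
components have rank at most one (`IsDarbouxIntegrable.cross_eq_zero`).

Write `G = dK / (4K)`. The rank condition on the second derivatives, together with its own
derivative, is an algebraic system for `∇G`. It is solved in `defect_algebra`, and its solution is
`∇G = 3 G ⊗ G - K g` (`IsDarbouxIntegrable.curvature_equation`). For `q = |K|^{-3/4}` this says that
the Hessian of `q` is `3 K q g`, so the rotated gradient `V = J ∇q` is a Killing field. If `V`
vanished on an open set then so would `G`, and the equation would give `K = 0`.

Where `V ≠ 0`, put `w = |K|^{-1/2}` and let `ε` be the sign of `K`. The curvature equation yields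
the first integral `|V|² = E + 9 ε w =: φ` and the closedness of `V♭ / |V|²`. So there are
coordinates `w, t` with `V = ∂/∂t` and metric `φ dt² + 9 w / (4 φ) dw²` (`exists_isScrewChart`).

For an immersion that carries `V` to a screw field of angular speed `m` and translation speed `c`,
cylindrical coordinates about the axis are determined one after another. The length of `V` gives the
radius, orthogonality to `∂/∂w` gives the derivative of the angle, and the length of `∂/∂w` gives
the square of the derivative of the height, `(9/4) w F / φ` with `F = 1 - c²/φ - 9/(m² w)`. The
inequality `F > 0` is open in `(m, c)`, and integration produces the family `screwFamily`. The
integration constants and the sign of the height derivative are absorbed by rigid motions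
(`IsScrewChart.exists_congruentNear`), once `screwF_pos` has shown that `F` cannot touch zero from
above. Conversely, distances along one orbit of `V` determine `m` and `c²`, and distances between
two orbits determine the sign of `c` (`screwMap_congruent`). -/

/-- A real function on the surface that is smooth on `W`. -/
abbrev SmoothOn (f : M → ℝ) (W : Set M) : Prop := ContMDiffOn (𝓡 2) 𝓘(ℝ, ℝ) ∞ f W

/-- A vector field on the surface that is smooth on `W`. -/
abbrev SmoothFieldOn (X : (x : M) → TangentSpace (𝓡 2) x) (W : Set M) : Prop :=
  ContMDiffOn (𝓡 2) (𝓡 2).tangent ∞ (fun x => (⟨x, X x⟩ : TangentBundle (𝓡 2) M)) W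

theorem SmoothOn.mdifferentiableAt {f : M → ℝ} {W : Set M} (hf : SmoothOn f W) (hW : IsOpen W)
    {x : M} (hx : x ∈ W) : MDifferentiableAt (𝓡 2) 𝓘(ℝ, ℝ) f x :=
  ((hf x hx).contMDiffAt (hW.mem_nhds hx)).mdifferentiableAt (by simp)

theorem dirDeriv_congr {X : (x : M) → TangentSpace (𝓡 2) x} {f g : M → ℝ} {x : M}
    (h : f =ᶠ[nhds x] g) : dirDeriv X f x = dirDeriv X g x := by
  unfold dirDeriv; rw [h.mfderiv_eq]; rfl

theorem SmoothOn.dirDeriv {X : (x : M) → TangentSpace (𝓡 2) x} {f : M → ℝ} {W : Set M}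
    (hf : SmoothOn f W) (hX : SmoothFieldOn X W) (hW : IsOpen W) :
    SmoothOn (dirDeriv X f) W := by
  have h1 := hf.contMDiffOn_tangentMapWithin (m := ∞) (by simp) hW.uniqueMDiffOn
  have h2 : ContMDiffOn (𝓡 2) 𝓘(ℝ, ℝ).tangent ∞
      (fun x => tangentMapWithin (𝓡 2) 𝓘(ℝ, ℝ) f W (⟨x, X x⟩ : TangentBundle (𝓡 2) M)) W :=
    h1.comp hX (fun x hx => hx)
  have h3 := (contMDiff_snd_tangentBundle_modelSpace (n := ∞) ℝ 𝓘(ℝ, ℝ)).comp_contMDiffOn h2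
  refine h3.congr fun x hx => ?_
  simp only [Function.comp, tangentMapWithin, IsoEmb.dirDeriv]
  rw [mfderivWithin_of_isOpen hW hx]

theorem dirDeriv_add {X : (x : M) → TangentSpace (𝓡 2) x} {f g : M → ℝ} {x : M}
    (hf : MDifferentiableAt (𝓡 2) 𝓘(ℝ, ℝ) f x) (hg : MDifferentiableAt (𝓡 2) 𝓘(ℝ, ℝ) g x) :
    dirDeriv X (f + g) x = dirDeriv X f x + dirDeriv X g x := by
  unfold dirDeriv; rw [mfderiv_add hf hg]; rfl

theorem dirDeriv_mul {X : (x : M) → TangentSpace (𝓡 2) x} {f g : M → ℝ} {x : M}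
    (hf : MDifferentiableAt (𝓡 2) 𝓘(ℝ, ℝ) f x) (hg : MDifferentiableAt (𝓡 2) 𝓘(ℝ, ℝ) g x) :
    dirDeriv X (f * g) x = f x * dirDeriv X g x + g x * dirDeriv X f x := by
  unfold dirDeriv; rw [(hf.hasMFDerivAt.mul hg.hasMFDerivAt).mfderiv]; rfl

theorem dirDeriv_const {X : (x : M) → TangentSpace (𝓡 2) x} {c : ℝ} {x : M} :
    dirDeriv X (fun _ => c) x = 0 := by
  unfold dirDeriv; rw [mfderiv_const]; rfl

/-- The chain rule for directional derivatives. -/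
theorem dirDeriv_comp {X : (x : M) → TangentSpace (𝓡 2) x} {f : M → ℝ} {h : ℝ → ℝ} {h' : ℝ} {x : M}
    (hh : HasDerivAt h h' (f x)) (hf : MDifferentiableAt (𝓡 2) 𝓘(ℝ, ℝ) f x) :
    dirDeriv X (fun y => h (f y)) x = h' * dirDeriv X f x := by
  unfold dirDeriv
  have h1 := (hh.hasFDerivAt.hasMFDerivAt.comp x hf.hasMFDerivAt).mfderiv
  change mfderiv (𝓡 2) 𝓘(ℝ, ℝ) (h ∘ f) x (X x) = _
  rw [h1]
  exact mul_comm (G := ℝ) _ _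

/-- The expression of a field in the chart at `x`. -/
theorem fderiv_chart (X : (x : M) → TangentSpace (𝓡 2) x) {f : M → ℝ} {x : M}
    {z : EuclideanSpace ℝ (Fin 2)} (hz : z ∈ (extChartAt (𝓡 2) x).target)
    (hf : MDifferentiableAt (𝓡 2) 𝓘(ℝ, ℝ) f ((extChartAt (𝓡 2) x).symm z)) :
    fderiv ℝ (f ∘ (extChartAt (𝓡 2) x).symm) z
      (VectorField.mpullbackWithin 𝓘(ℝ, EuclideanSpace ℝ (Fin 2)) (𝓡 2) (extChartAt (𝓡 2) x).symm X
        (Set.range (𝓡 2)) z) = dirDeriv X f ((extChartAt (𝓡 2) x).symm z) := by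
  have h1 : MDifferentiableAt 𝓘(ℝ, EuclideanSpace ℝ (Fin 2)) (𝓡 2) (extChartAt (𝓡 2) x).symm z := by
    have := mdifferentiableWithinAt_extChartAt_symm (I := 𝓡 2) hz
    exact this.mdifferentiableAt (by simp)
  have h2 := mfderiv_comp z hf h1
  rw [mfderiv_eq_fderiv] at h2
  rw [h2, VectorField.mpullbackWithin_apply]
  have h3 := isInvertible_mfderivWithin_extChartAt_symm (I := 𝓡 2) hz
  unfold dirDeriv
  simp only [ModelWithCorners.range_eq_univ, mfderivWithin_univ] at h3 ⊢
  show (mfderiv (𝓡 2) 𝓘(ℝ, ℝ) f ((extChartAt (𝓡 2) x).symm z)) ((mfderiv _ _ _ z) _) = _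
  rw [h3.self_apply_inverse]

/-- A vector field bracket acts on functions as the commutator. -/
theorem mfderiv_mlieBracket {X Y : (x : M) → TangentSpace (𝓡 2) x} {f : M → ℝ} {W : Set M}
    (hW : IsOpen W) (hX : SmoothFieldOn X W) (hY : SmoothFieldOn Y W) (hf : SmoothOn f W)
    {x : M} (hx : x ∈ W) :
    mfderiv (𝓡 2) 𝓘(ℝ, ℝ) f x (VectorField.mlieBracket (𝓡 2) X Y x)
      = dirDeriv X (dirDeriv Y f) x - dirDeriv Y (dirDeriv X f) x := by
  set φ := extChartAt (𝓡 2) x with hφ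
  set X' := VectorField.mpullbackWithin 𝓘(ℝ, EuclideanSpace ℝ (Fin 2)) (𝓡 2) φ.symm X
        (Set.range (𝓡 2)) with hX'
  set Y' := VectorField.mpullbackWithin 𝓘(ℝ, EuclideanSpace ℝ (Fin 2)) (𝓡 2) φ.symm Y
        (Set.range (𝓡 2)) with hY'
  have hxs : φ.symm (φ x) = x := extChartAt_to_inv x
  have hxt : φ x ∈ φ.target := mem_extChartAt_target x
  have hT : ∀ᶠ z in nhds (φ x), z ∈ φ.target ∧ φ.symm z ∈ W := by
    have h1 : φ.target ∈ nhds (φ x) := extChartAt_target_mem_nhds x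
    have h2 : ContinuousAt φ.symm (φ x) := continuousAt_extChartAt_symm x
    exact Filter.Eventually.and h1 (h2.preimage_mem_nhds (by rw [hxs]; exact hW.mem_nhds hx))
  -- In the chart a field acts on functions as it does on the surface. Both iterated derivatives can
  -- therefore be computed in the model space, where the commutator formula follows from the
  -- symmetry of the second derivative.
  have key : ∀ (Z : (x : M) → TangentSpace (𝓡 2) x) (h : M → ℝ), SmoothOn h W →
      (fun z => fderiv ℝ (h ∘ φ.symm) z (VectorField.mpullbackWithin
        𝓘(ℝ, EuclideanSpace ℝ (Fin 2)) (𝓡 2) φ.symm Z (Set.range (𝓡 2)) z))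
        =ᶠ[nhds (φ x)] dirDeriv Z h ∘ φ.symm := fun Z h hh => by
    filter_upwards [hT] with z hz
    exact fderiv_chart Z hz.1 (hh.mdifferentiableAt hW hz.2)
  have hd : ∀ Z : (x : M) → TangentSpace (𝓡 2) x, SmoothFieldOn Z W →
      DifferentiableAt ℝ (VectorField.mpullbackWithin
        𝓘(ℝ, EuclideanSpace ℝ (Fin 2)) (𝓡 2) φ.symm Z (Set.range (𝓡 2))) (φ x) := fun Z hZ => by
    have h1 : MDifferentiableWithinAt (𝓡 2) (𝓡 2).tangent
        (fun x => (⟨x, Z x⟩ : TangentBundle (𝓡 2) M)) Set.univ x :=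
      (((hZ x hx).contMDiffAt (hW.mem_nhds hx)).mdifferentiableAt (by simp)).mdifferentiableWithinAt
    have := h1.differentiableWithinAt_mpullbackWithin_vectorField
    exact this.differentiableAt (by simp)
  have hfs : ContDiffAt ℝ ∞ (f ∘ φ.symm) (φ x) := by
    have h1 : ContMDiffAt 𝓘(ℝ, EuclideanSpace ℝ (Fin 2)) (𝓡 2) ∞ φ.symm (φ x) := by
      have := contMDiffWithinAt_extChartAt_symm_target (I := 𝓡 2) (n := ∞) x hxt
      exact this.contMDiffAt (extChartAt_target_mem_nhds x)
    have h2 : ContMDiffAt (𝓡 2) 𝓘(ℝ, ℝ) ∞ f (φ.symm (φ x)) := by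
      rw [hxs]; exact (hf x hx).contMDiffAt (hW.mem_nhds hx)
    exact (h2.comp (φ x) h1).contDiffAt
  have hbr := VectorField.fderiv_apply_lieBracket (n := ∞) hfs (by
    rw [minSmoothness_of_isRCLikeNormedField]; exact WithTop.coe_le_coe.2 le_top) (hd Y hY) (hd X hX)
  have hXf := hf.dirDeriv hX hW
  have hYf := hf.dirDeriv hY hW
  have e1 : fderiv ℝ (fun z => fderiv ℝ (f ∘ φ.symm) z (Y' z)) (φ x) (X' (φ x))
      = dirDeriv X (dirDeriv Y f) x := by
    rw [(key Y f hf).fderiv_eq]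
    have := (key X _ hYf).self_of_nhds
    simpa only [Function.comp, hxs] using this
  have e2 : fderiv ℝ (fun z => fderiv ℝ (f ∘ φ.symm) z (X' z)) (φ x) (Y' (φ x))
      = dirDeriv Y (dirDeriv X f) x := by
    rw [(key X f hf).fderiv_eq]
    have := (key Y _ hXf).self_of_nhds
    simpa only [Function.comp, hxs] using this
  rw [← e1, ← e2, ← hbr]
  rw [VectorField.mlieBracket, VectorField.mlieBracketWithin_apply]
  simp only [Set.preimage_univ, Set.univ_inter]
  have hr : Set.range (𝓡 2) = Set.univ := by simp
  have hinv := isInvertible_mfderiv_extChartAt (I := 𝓡 2) (mem_extChartAt_source (I := 𝓡 2) x)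
  have hc : mfderiv (𝓡 2) 𝓘(ℝ, ℝ) ((f ∘ φ.symm) ∘ φ) x = (mfderiv 𝓘(ℝ, EuclideanSpace ℝ (Fin 2)) 𝓘(ℝ, ℝ) (f ∘ φ.symm) (φ x)).comp (mfderiv (𝓡 2) 𝓘(ℝ, EuclideanSpace ℝ (Fin 2)) φ x) := 
    mfderiv_comp x (hfs.differentiableAt (by simp)).mdifferentiableAt (mdifferentiableAt_extChartAt (mem_chart_source _ x))
  have hff : (f ∘ φ.symm) ∘ φ =ᶠ[nhds x] f := by
    filter_upwards [extChartAt_source_mem_nhds (I := 𝓡 2) x] with y hy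
    simp [Function.comp, φ.left_inv hy]
  rw [hff.mfderiv_eq] at hc
  rw [hc, mfderiv_eq_fderiv]
  show fderiv ℝ (f ∘ φ.symm) (φ x) ((mfderiv (𝓡 2) 𝓘(ℝ, EuclideanSpace ℝ (Fin 2)) φ x) _) = _
  refine congrArg _ ((hinv.self_apply_inverse _).trans ?_)
  have hS : ∀ S, S = Set.univ → VectorField.lieBracketWithin ℝ X' Y' S (φ x)
      = VectorField.lieBracket ℝ X' Y' (φ x) := by
    rintro _ rfl; exact congrFun VectorField.lieBracketWithin_univ _
  exact hS _ hr


variable {g : Metric2 M} {v : Fin 2 → (x : M) → TangentSpace (𝓡 2) x} {U : Set M}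

theorem IsOrthonormalFrameOn.mono (hv : IsOrthonormalFrameOn g v U) {W : Set M} (h : W ⊆ U) :
    IsOrthonormalFrameOn g v W :=
  ⟨fun i => (hv.smooth i).mono h, fun x hx => hv.orthonormal x (h hx)⟩

theorem IsOrthonormalFrameOn.inner_00 (hv : IsOrthonormalFrameOn g v U) {x : M} (hx : x ∈ U) :
    g.inner x (v 0 x) (v 0 x) = 1 := by simpa using hv.orthonormal x hx 0 0

theorem IsOrthonormalFrameOn.inner_01 (hv : IsOrthonormalFrameOn g v U) {x : M} (hx : x ∈ U) :
    g.inner x (v 0 x) (v 1 x) = 0 := by simpa using hv.orthonormal x hx 0 1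

theorem IsOrthonormalFrameOn.inner_10 (hv : IsOrthonormalFrameOn g v U) {x : M} (hx : x ∈ U) :
    g.inner x (v 1 x) (v 0 x) = 0 := by simpa using hv.orthonormal x hx 1 0

theorem IsOrthonormalFrameOn.inner_11 (hv : IsOrthonormalFrameOn g v U) {x : M} (hx : x ∈ U) :
    g.inner x (v 1 x) (v 1 x) = 1 := by simpa using hv.orthonormal x hx 1 1

/-- The expansion of a tangent vector in an orthonormal frame. -/
theorem IsOrthonormalFrameOn.expand (hv : IsOrthonormalFrameOn g v U) {x : M} (hx : x ∈ U)
    (u : TangentSpace (𝓡 2) x) :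
    u = g.inner x (v 0 x) u • v 0 x + g.inner x (v 1 x) u • v 1 x := by
  have h00 := hv.inner_00 hx
  have h01 := hv.inner_01 hx
  have h10 := hv.inner_10 hx
  have h11 := hv.inner_11 hx
  have hli : LinearIndependent ℝ ![v 0 x, v 1 x] := by
    rw [LinearIndependent.pair_iff]
    intro s t hst
    have e0 := congrArg (g.inner x (v 0 x)) hst
    have e1 := congrArg (g.inner x (v 1 x)) hst
    simp only [map_add, map_smul, map_zero, smul_eq_mul, h00, h01, h10, h11] at e0 e1
    constructor <;> linarith
  have hfr : Module.finrank ℝ (TangentSpace (𝓡 2) x) = 2 :=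
    (finrank_euclideanSpace_fin : Module.finrank ℝ (EuclideanSpace ℝ (Fin 2)) = 2)
  have : FiniteDimensional ℝ (TangentSpace (𝓡 2) x) :=
    inferInstanceAs (FiniteDimensional ℝ (EuclideanSpace ℝ (Fin 2)))
  have hsp := hli.span_eq_top_of_card_eq_finrank' (by rw [hfr]; simp)
  have hu : u ∈ Submodule.span ℝ (Set.range ![v 0 x, v 1 x]) := by rw [hsp]; trivial
  simp only [Matrix.range_cons, Matrix.range_empty, Set.union_empty, Set.singleton_union] at hu
  obtain ⟨s, t, rfl⟩ := Submodule.mem_span_pair.1 hu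
  simp only [map_add, map_smul, smul_eq_mul, h00, h01, h10, h11]
  simp

/-- The expansion of `[v₁, v₂]` in the frame, acting on functions. Later second-order computations
with functions use the bracket in this form. -/
theorem IsOrthonormalFrameOn.commutator (hv : IsOrthonormalFrameOn g v U) (hU : IsOpen U)
    {f : M → ℝ} (hf : SmoothOn f U) {x : M} (hx : x ∈ U) :
    dirDeriv (v 0) (dirDeriv (v 1) f) x - dirDeriv (v 1) (dirDeriv (v 0) f) x
      = structFun g v 0 x * dirDeriv (v 0) f x + structFun g v 1 x * dirDeriv (v 1) f x := by
  rw [← mfderiv_mlieBracket hU (hv.smooth 0) (hv.smooth 1) hf hx,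
    hv.expand hx (VectorField.mlieBracket (𝓡 2) (v 0) (v 1) x)]
  rw [map_add, map_smul, map_smul]
  unfold structFun dirDeriv
  rw [g.symm x (v 0 x), g.symm x (v 1 x)]
  rfl

/-- The coordinate functions of the chart at `p`. -/
noncomputable def chartCoord (p : M) (j : Fin 2) (x : M) : ℝ := (extChartAt (𝓡 2) p x : EuclideanSpace ℝ (Fin 2)) j

theorem smooth_chartCoord (p : M) (j : Fin 2) :
    SmoothOn (chartCoord p j) (extChartAt (𝓡 2) p).source := by
  have h1 : ContMDiffOn (𝓡 2) 𝓘(ℝ, EuclideanSpace ℝ (Fin 2)) ∞ (extChartAt (𝓡 2) p)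
      (extChartAt (𝓡 2) p).source := by
    have := contMDiffOn_extChartAt (I := 𝓡 2) (n := ∞) (x := p)
    rwa [← extChartAt_source (𝓡 2)] at this
  have h2 : ContMDiff 𝓘(ℝ, EuclideanSpace ℝ (Fin 2)) 𝓘(ℝ, ℝ) ∞
      (fun z : EuclideanSpace ℝ (Fin 2) => z j) :=
    (EuclideanSpace.proj (𝕜 := ℝ) j).contDiff.contMDiff
  exact h2.comp_contMDiffOn h1

theorem dirDeriv_chartCoord (X : (x : M) → TangentSpace (𝓡 2) x) {p x : M}
    (hx : x ∈ (extChartAt (𝓡 2) p).source) (j : Fin 2) :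
    dirDeriv X (chartCoord p j) x = (show EuclideanSpace ℝ (Fin 2) from
      mfderiv (𝓡 2) 𝓘(ℝ, EuclideanSpace ℝ (Fin 2)) (extChartAt (𝓡 2) p) x (X x)) j := by
  have hmd : MDifferentiableAt (𝓡 2) 𝓘(ℝ, EuclideanSpace ℝ (Fin 2)) (extChartAt (𝓡 2) p) x :=
    mdifferentiableAt_extChartAt (by simpa using hx)
  have := ((EuclideanSpace.proj (𝕜 := ℝ) (ι := Fin 2) j).hasFDerivAt.hasMFDerivAt.comp x
    hmd.hasMFDerivAt).mfderiv
  unfold dirDeriv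
  change mfderiv (𝓡 2) 𝓘(ℝ, ℝ) ((EuclideanSpace.proj (𝕜 := ℝ) j) ∘ extChartAt (𝓡 2) p) x (X x) = _
  rw [this]
  rfl

/-- A vanishing determinant would give a nontrivial combination of the frame vectors in the kernel
of the differential of the chart, which is injective. -/
theorem IsOrthonormalFrameOn.chartCoord_det_ne_zero (hv : IsOrthonormalFrameOn g v U) {p x : M}
    (hx : x ∈ U ∩ (extChartAt (𝓡 2) p).source) :
    dirDeriv (v 0) (chartCoord p 0) x * dirDeriv (v 1) (chartCoord p 1) x
        - dirDeriv (v 0) (chartCoord p 1) x * dirDeriv (v 1) (chartCoord p 0) x ≠ 0 := by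
  set φ := extChartAt (𝓡 2) p
  have hinv := isInvertible_mfderiv_extChartAt (I := 𝓡 2) hx.2
  have hd := fun i => dirDeriv_chartCoord (v i) hx.2
  intro h0
  simp only [hd] at h0
  obtain ⟨s, t, hst, hz⟩ : ∃ s t : ℝ, (s ≠ 0 ∨ t ≠ 0) ∧
      mfderiv (𝓡 2) 𝓘(ℝ, EuclideanSpace ℝ (Fin 2)) φ x (s • v 0 x + t • v 1 x) = 0 := by
    have hlin : ∀ (A B : EuclideanSpace ℝ (Fin 2)), A 0 * B 1 - A 1 * B 0 = 0 →
        ∃ s t : ℝ, (s ≠ 0 ∨ t ≠ 0) ∧ s • A + t • B = 0 := by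
      intro A B hAB
      by_cases h1 : A 0 = 0 ∧ B 0 = 0
      · by_cases h2 : A 1 = 0 ∧ B 1 = 0
        · refine ⟨1, 0, Or.inl one_ne_zero, ?_⟩
          ext k; fin_cases k <;> simp [h1, h2]
        · refine ⟨B 1, -A 1, ?_, ?_⟩
          · rw [neg_ne_zero]; tauto
          · ext k; fin_cases k <;> simp [h1]; ring
      · refine ⟨B 0, -A 0, ?_, ?_⟩
        · rw [neg_ne_zero]; tauto
        · ext k; fin_cases k <;> simp
          · ring
          · linarith
    obtain ⟨s, t, hst, hz⟩ := hlin _ _ h0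
    refine ⟨s, t, hst, ?_⟩
    rw [map_add, map_smul, map_smul]
    exact hz
  have hinj : Function.Injective (mfderiv (𝓡 2) 𝓘(ℝ, EuclideanSpace ℝ (Fin 2)) φ x) := 
    hinv.injective
  have h1 : s • v 0 x + t • v 1 x = 0 := hinj (hz.trans (map_zero _).symm)
  have e0 := congrArg (g.inner x (v 0 x)) h1
  have e1 := congrArg (g.inner x (v 1 x)) h1
  simp only [map_add, map_smul, map_zero, smul_eq_mul, hv.inner_00 hx.1, hv.inner_01 hx.1,
    hv.inner_10 hx.1, hv.inner_11 hx.1] at e0 e1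
  rcases hst with h | h
  · exact h (by linarith)
  · exact h (by linarith)

/-- Local coordinates. -/
theorem IsOrthonormalFrameOn.exists_coordinates (hv : IsOrthonormalFrameOn g v U) (hU : IsOpen U)
    {p : M} (hp : p ∈ U) : ∃ (W : Set M) (h : Fin 2 → M → ℝ), IsOpen W ∧ p ∈ W ∧ W ⊆ U ∧
      (∀ j, SmoothOn (h j) W) ∧ ∀ x ∈ W, dirDeriv (v 0) (h 0) x * dirDeriv (v 1) (h 1) x
        - dirDeriv (v 0) (h 1) x * dirDeriv (v 1) (h 0) x ≠ 0 :=
  ⟨U ∩ (extChartAt (𝓡 2) p).source, chartCoord p, hU.inter (isOpen_extChartAt_source p),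
    ⟨hp, mem_extChartAt_source p⟩, Set.inter_subset_left,
    fun j => (smooth_chartCoord p j).mono Set.inter_subset_right,
    fun _ hx => hv.chartCoord_det_ne_zero hx⟩

/-- The commutator applied to two coordinate functions is a linear system for the two structure
functions. Cramer's rule expresses them as smooth quotients, without any appeal to smoothness of the
bracket field. -/
theorem IsOrthonormalFrameOn.smooth_structFun (hv : IsOrthonormalFrameOn g v U) (hU : IsOpen U)
    (i : Fin 2) : SmoothOn (structFun g v i) U := by
  intro p hp
  obtain ⟨W, h, hW, hpW, hWU, hh, hdet⟩ := hv.exists_coordinates hU hp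
  have hvW := hv.mono hWU
  have s1 : ∀ i j, SmoothOn (IsoEmb.dirDeriv (v i) (h j)) W := fun i j =>
    (hh j).dirDeriv (hvW.smooth i) hW
  have s2 : ∀ i k j, SmoothOn (IsoEmb.dirDeriv (v i) (IsoEmb.dirDeriv (v k) (h j))) W := fun i k j =>
    (s1 k j).dirDeriv (hvW.smooth i) hW
  have key : SmoothOn (structFun g v i) W := by
    fin_cases i
    · have : SmoothOn (fun x => ((dirDeriv (v 0) (dirDeriv (v 1) (h 0)) x
          - dirDeriv (v 1) (dirDeriv (v 0) (h 0)) x) * dirDeriv (v 1) (h 1) x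
          - (dirDeriv (v 0) (dirDeriv (v 1) (h 1)) x - dirDeriv (v 1) (dirDeriv (v 0) (h 1)) x)
            * dirDeriv (v 1) (h 0) x) / (dirDeriv (v 0) (h 0) x * dirDeriv (v 1) (h 1) x
        - dirDeriv (v 0) (h 1) x * dirDeriv (v 1) (h 0) x)) W :=
        (((((s2 0 1 0).sub (s2 1 0 0)).mul (s1 1 1)).sub (((s2 0 1 1).sub (s2 1 0 1)).mul
          (s1 1 0)))).div₀ (((s1 0 0).mul (s1 1 1)).sub ((s1 0 1).mul (s1 1 0))) hdet
      refine this.congr fun x hx => ?_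
      rw [hvW.commutator hW (hh 0) hx, hvW.commutator hW (hh 1) hx, eq_div_iff (hdet x hx)]
      simp only [Fin.zero_eta]
      ring
    · have : SmoothOn (fun x => (dirDeriv (v 0) (h 0) x * (dirDeriv (v 0) (dirDeriv (v 1) (h 1)) x
          - dirDeriv (v 1) (dirDeriv (v 0) (h 1)) x)
          - dirDeriv (v 0) (h 1) x * (dirDeriv (v 0) (dirDeriv (v 1) (h 0)) x
            - dirDeriv (v 1) (dirDeriv (v 0) (h 0)) x))
              / (dirDeriv (v 0) (h 0) x * dirDeriv (v 1) (h 1) x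
        - dirDeriv (v 0) (h 1) x * dirDeriv (v 1) (h 0) x)) W :=
        (((s1 0 0).mul ((s2 0 1 1).sub (s2 1 0 1))).sub ((s1 0 1).mul ((s2 0 1 0).sub
          (s2 1 0 0)))).div₀ (((s1 0 0).mul (s1 1 1)).sub ((s1 0 1).mul (s1 1 0))) hdet
      refine this.congr fun x hx => ?_
      rw [hvW.commutator hW (hh 0) hx, hvW.commutator hW (hh 1) hx, eq_div_iff (hdet x hx)]
      simp only [Fin.mk_one]
      ring
  exact ((key p hpW).contMDiffAt (hW.mem_nhds hpW)).contMDiffWithinAt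

theorem IsOrthonormalFrameOn.smooth_gaussCurv (hv : IsOrthonormalFrameOn g v U) (hU : IsOpen U) :
    SmoothOn (gaussCurv g v) U := by
  have h := hv.smooth_structFun hU
  have h0 := hv.smooth 0
  have h1 := hv.smooth 1
  exact ((((h 1).dirDeriv h0 hU).sub ((h 0).dirDeriv h1 hU)).sub ((h 0).pow 2)).sub ((h 1).pow 2)

end SurfaceCalculus

/-! ### Coframes and the derived flag -/

section Coframe

variable {𝕜 : Type*} [RCLike 𝕜] {E : Type*} [NormedAddCommGroup E] [NormedSpace ℝ E] {n : ℕ}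

/-- `ϖ` is a smooth coframe on the open set `O` with dual frame `e`. -/
structure IsCoframeOn (ϖ : Fin n → E → E →L[ℝ] ℝ) (e : Fin n → E → E) (O : Set E) : Prop where
  isOpen : IsOpen O
  smooth_coframe : ∀ A, ContDiffOn ℝ ∞ (ϖ A) O
  smooth_frame : ∀ A, ContDiffOn ℝ ∞ (e A) O
  dual : ∀ y ∈ O, ∀ A B, ϖ A y (e B y) = if A = B then 1 else 0
  expand : ∀ y ∈ O, ∀ u, u = ∑ A, ϖ A y u • e A y

/-- A family of `n` smooth 1-forms without common zeros on a space of dimension `n` is a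
coframe. -/
theorem exists_frame [FiniteDimensional ℝ E] (hn : Module.finrank ℝ E = n)
    {ϖ : Fin n → E → E →L[ℝ] ℝ} {O : Set E} (hO : IsOpen O) (hϖ : ∀ A, ContDiffOn ℝ ∞ (ϖ A) O)
    (hinj : ∀ y ∈ O, ∀ u, (∀ A, ϖ A y u = 0) → u = 0) :
    ∃ e : Fin n → E → E, IsCoframeOn ϖ e O := by
  have : CompleteSpace E := FiniteDimensional.complete ℝ E
  let L : E → E →L[ℝ] (Fin n → ℝ) := fun y =>
    ∑ A, (ContinuousLinearMap.single ℝ (fun _ : Fin n => ℝ) A).comp (ϖ A y)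
  have hLa : ∀ y u, L y u = fun A => ϖ A y u := fun y u => by
    ext B; simp [L, Finset.sum_apply, Pi.single_apply]
  have hL : ∀ y ∈ O, ∃ l : E ≃L[ℝ] (Fin n → ℝ), (l : E →L[ℝ] (Fin n → ℝ)) = L y := by
    intro y hy
    have hi : Function.Injective (L y : E →ₗ[ℝ] (Fin n → ℝ)) := by
      rw [← LinearMap.ker_eq_bot, LinearMap.ker_eq_bot']
      exact fun u hu => hinj y hy u fun A => congrFun ((hLa y u).symm.trans hu) A
    let l := LinearEquiv.ofInjectiveOfFinrankEq (L y : E →ₗ[ℝ] (Fin n → ℝ)) hi (by simp [hn])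
    exact ⟨l.toContinuousLinearEquiv, by ext u; rfl⟩
  have hLs : ContDiffOn ℝ ∞ L O :=
    ContDiffOn.sum fun A _ => contDiffOn_const.clm_comp (hϖ A)
  refine ⟨fun A y => (L y).inverse (Pi.single A 1), hO, hϖ, fun A => ?_, fun y hy A B => ?_,
    fun y hy u => ?_⟩
  · intro y hy
    obtain ⟨l, hl⟩ := hL y hy
    have h1 : ContDiffAt ℝ ∞ ContinuousLinearMap.inverse (L y) := hl ▸ contDiffAt_map_inverse l
    have h2 := h1.comp y ((hLs y hy).contDiffAt (hO.mem_nhds hy))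
    exact (h2.clm_apply contDiffAt_const).contDiffWithinAt
  · obtain ⟨l, hl⟩ := hL y hy
    have h1 : L y ((L y).inverse (Pi.single B 1)) = Pi.single B 1 := by
      rw [← hl]; simp
    have h2 := congrFun h1 A
    simpa [hLa, Pi.single_apply] using h2
  · obtain ⟨l, hl⟩ := hL y hy
    have h1 : (L y).inverse (L y u) = u := by rw [← hl]; simp
    have h2 : L y u = ∑ A, ϖ A y u • (Pi.single A 1 : Fin n → ℝ) := by
      rw [hLa]; ext B; simp [Finset.sum_apply, Pi.single_apply]
    rw [h2, map_sum] at h1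
    simp only [map_smul] at h1
    exact h1.symm

variable {ϖ : Fin n → E → E →L[ℝ] ℝ} {e : Fin n → E → E} {O : Set E}

/-- The value of a 1-form on the complex vector with components `z` in the frame `e`. -/
def pair (e : Fin n → E → E) (y : E) (a : E →L[ℝ] 𝕜) (z : Fin n → 𝕜) : 𝕜 :=
  ∑ A, z A * a (e A y)

/-- The value of a 2-form on complex vectors with components `z`, `z'` in the frame `e`. -/
def pair2 (e : Fin n → E → E) (y : E) (τ : E →L[ℝ] E →L[ℝ] 𝕜) (z z' : Fin n → 𝕜) : 𝕜 :=
  ∑ A, ∑ B, z A * z' B * τ (e A y) (e B y)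

/-- The Lie bracket of complex vector fields, in components. -/
def bracket (ϖ : Fin n → E → E →L[ℝ] ℝ) (e : Fin n → E → E) (z z' : E → Fin n → 𝕜) (y : E)
    (D : Fin n) : 𝕜 :=
  ∑ A, (z y A * fderiv ℝ (fun x => z' x D) y (e A y)
    - z' y A * fderiv ℝ (fun x => z x D) y (e A y))
  - ∑ A, ∑ B, z y A * z' y B * (extD (ϖ D) y (e A y) (e B y) : ℝ)

theorem pair_wedge (y : E) (α β : E →L[ℝ] 𝕜) (z z' : Fin n → 𝕜) :
    pair2 e y (wedge α β) z z' = pair e y α z * pair e y β z' - pair e y β z * pair e y α z' := by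
  simp only [pair2, pair, wedge_apply, Finset.sum_mul_sum, ← Finset.sum_sub_distrib]
  exact Finset.sum_congr rfl fun A _ => Finset.sum_congr rfl fun B _ => by ring

theorem pair2_add (y : E) (τ τ' : E →L[ℝ] E →L[ℝ] 𝕜) (z z' : Fin n → 𝕜) :
    pair2 e y (τ + τ') z z' = pair2 e y τ z z' + pair2 e y τ' z z' := by
  simp only [pair2, add_apply, mul_add, Finset.sum_add_distrib]

theorem pair2_smul (y : E) (c : 𝕜) (τ : E →L[ℝ] E →L[ℝ] 𝕜) (z z' : Fin n → 𝕜) :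
    pair2 e y (c • τ) z z' = c * pair2 e y τ z z' := by
  simp only [pair2, smul_apply, smul_eq_mul, Finset.mul_sum]
  exact Finset.sum_congr rfl fun A _ => Finset.sum_congr rfl fun B _ => by ring

theorem pair2_zero (y : E) (z z' : Fin n → 𝕜) :
    pair2 e y (0 : E →L[ℝ] E →L[ℝ] 𝕜) z z' = 0 := by
  simp [pair2]

theorem pair_add (y : E) (α β : E →L[ℝ] 𝕜) (z : Fin n → 𝕜) :
    pair e y (α + β) z = pair e y α z + pair e y β z := by
  simp only [pair, add_apply, mul_add, Finset.sum_add_distrib]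

theorem pair_smul (y : E) (c : 𝕜) (α : E →L[ℝ] 𝕜) (z : Fin n → 𝕜) :
    pair e y (c • α) z = c * pair e y α z := by
  simp only [pair, smul_apply, smul_eq_mul, Finset.mul_sum]
  exact Finset.sum_congr rfl fun A _ => by ring

theorem pair_zero (y : E) (z : Fin n → 𝕜) : pair e y (0 : E →L[ℝ] 𝕜) z = 0 := by simp [pair]

theorem pair_span {y : E} {S : Set (E →L[ℝ] 𝕜)} {z : Fin n → 𝕜} (h : ∀ α ∈ S, pair e y α z = 0)
    {α : E →L[ℝ] 𝕜} (hα : α ∈ Submodule.span 𝕜 S) : pair e y α z = 0 := by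
  induction hα using Submodule.span_induction with
  | mem x hx => exact h x hx
  | zero => exact pair_zero y z
  | add x x' _ _ hx hx' => rw [pair_add, hx, hx', add_zero]
  | smul c x _ hx => rw [pair_smul, hx, mul_zero]

theorem pair2_ideal2 {y : E} {V : Submodule 𝕜 (E →L[ℝ] 𝕜)} {z z' : Fin n → 𝕜}
    (hz : ∀ α ∈ V, pair e y α z = 0) (hz' : ∀ α ∈ V, pair e y α z' = 0)
    {τ : E →L[ℝ] E →L[ℝ] 𝕜} (hτ : τ ∈ ideal2 V) : pair2 e y τ z z' = 0 := by
  induction hτ using Submodule.span_induction with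
  | mem x hx =>
    obtain ⟨α, hα, β, rfl⟩ := hx
    rw [pair_wedge, hz α hα, hz' α hα]; ring
  | zero => exact pair2_zero y z z'
  | add x x' _ _ hx hx' => rw [pair2_add, hx, hx', add_zero]
  | smul c x _ hx => rw [pair2_smul, hx, mul_zero]

theorem IsCoframeOn.apply_eq (h : IsCoframeOn ϖ e O) {y : E} (hy : y ∈ O) (a : E →L[ℝ] 𝕜) (u : E) :
    a u = ∑ D, a (e D y) * ((ϖ D y u : ℝ) : 𝕜) := by
  conv_lhs => rw [h.expand y hy u, map_sum]
  refine Finset.sum_congr rfl fun D _ => ?_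
  rw [map_smul, RCLike.real_smul_eq_coe_mul, mul_comm]

/-- The exterior derivative of a 1-form in a coframe. -/
theorem IsCoframeOn.extD_apply (h : IsCoframeOn ϖ e O) {α : E → E →L[ℝ] 𝕜}
    (hα : ContDiffOn ℝ ∞ α O) {y : E} (hy : y ∈ O) (A B : Fin n) :
    extD α y (e A y) (e B y) = fderiv ℝ (fun x => α x (e B x)) y (e A y)
      - fderiv ℝ (fun x => α x (e A x)) y (e B y)
      + ∑ D, α y (e D y) * (extD (ϖ D) y (e A y) (e B y) : ℝ) := by
  have hαd : DifferentiableAt ℝ α y :=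
    ((hα y hy).contDiffAt (h.isOpen.mem_nhds hy)).differentiableAt (by simp)
  have hϖd : ∀ D, DifferentiableAt ℝ (ϖ D) y := fun D =>
    ((h.smooth_coframe D y hy).contDiffAt (h.isOpen.mem_nhds hy)).differentiableAt (by simp)
  have hed : ∀ D, DifferentiableAt ℝ (e D) y := fun D =>
    ((h.smooth_frame D y hy).contDiffAt (h.isOpen.mem_nhds hy)).differentiableAt (by simp)
  -- Near `y` the form equals `∑ α(e_D) ϖ_D`. Differentiating this sum separates the derivatives of
  -- the coefficients from those of the coframe.
  have key : ∀ u w : E, fderiv ℝ α y w u = ∑ D,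
      (fderiv ℝ (fun x => α x (e D x)) y w * ((ϖ D y u : ℝ) : 𝕜)
        + α y (e D y) * ((fderiv ℝ (ϖ D) y w u : ℝ) : 𝕜)) := by
    intro u w
    have h1 : fderiv ℝ α y w u = fderiv ℝ (fun x => α x u) y w := by
      rw [fderiv_clm_apply hαd (differentiableAt_const u)]; simp
    have h2 : (fun x => α x u) =ᶠ[nhds y] fun x => ∑ D, α x (e D x) * ((ϖ D x u : ℝ) : 𝕜) := by
      filter_upwards [h.isOpen.mem_nhds hy] with x hx
      exact h.apply_eq hx (α x) u
    have h4 : ∀ D, HasFDerivAt (fun x => ((ϖ D x u : ℝ) : 𝕜))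
        ((RCLike.ofRealCLM : ℝ →L[ℝ] 𝕜).comp ((fderiv ℝ (ϖ D) y).flip u)) y := fun D => by
      have h5 : HasFDerivAt (fun x => ϖ D x u) ((fderiv ℝ (ϖ D) y).flip u) y := by
        have := (hϖd D).hasFDerivAt.clm_apply (hasFDerivAt_const u y)
        simpa using this
      exact (RCLike.ofRealCLM : ℝ →L[ℝ] 𝕜).hasFDerivAt.comp y h5
    have h6 : ∀ D, DifferentiableAt ℝ (fun x => α x (e D x)) y := fun D => hαd.clm_apply (hed D)
    have h3 := HasFDerivAt.fun_sum (u := Finset.univ) fun D _ => (h6 D).hasFDerivAt.fun_mul (h4 D)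
    rw [h1, h2.fderiv_eq, h3.fderiv]
    simp only [sum_apply]
    refine Finset.sum_congr rfl fun D _ => ?_
    simp only [add_apply, smul_apply,
      ContinuousLinearMap.comp_apply, ContinuousLinearMap.flip_apply, RCLike.ofRealCLM_apply,
      smul_eq_mul]
    ring
  simp only [extD, sub_apply, ContinuousLinearMap.flip_apply]
  rw [key, key, ← Finset.sum_sub_distrib]
  have h7 : ∀ D, ϖ D y (e B y) = if D = B then 1 else 0 := fun D => h.dual y hy D B
  have h8 : ∀ D, ϖ D y (e A y) = if D = A then 1 else 0 := fun D => h.dual y hy D A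
  have h9 : fderiv ℝ (fun x => α x (e B x)) y (e A y)
      = ∑ D, fderiv ℝ (fun x => α x (e D x)) y (e A y) * ((ϖ D y (e B y) : ℝ) : 𝕜) := by
    simp only [h7]; simp
  have h10 : fderiv ℝ (fun x => α x (e A x)) y (e B y)
      = ∑ D, fderiv ℝ (fun x => α x (e D x)) y (e B y) * ((ϖ D y (e A y) : ℝ) : 𝕜) := by
    simp only [h8]; simp
  rw [h9, h10, ← Finset.sum_sub_distrib, ← Finset.sum_add_distrib]
  refine Finset.sum_congr rfl fun D _ => ?_
  push_cast
  ring

/-- If a 1-form `α` annihilates two complex fields on which `dα` vanishes then it annihilates their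
bracket. -/
theorem IsCoframeOn.pair_bracket (h : IsCoframeOn ϖ e O) {α : E → E →L[ℝ] 𝕜}
    (hα : ContDiffOn ℝ ∞ α O) {z z' : E → Fin n → 𝕜}
    (hz : ∀ A, DifferentiableOn ℝ (fun x => z x A) O)
    (hz' : ∀ A, DifferentiableOn ℝ (fun x => z' x A) O)
    (h0 : ∀ x ∈ O, pair e x (α x) (z x) = 0) (h0' : ∀ x ∈ O, pair e x (α x) (z' x) = 0)
    {y : E} (hy : y ∈ O) (h2 : pair2 e y (extD α y) (z y) (z' y) = 0) :
    pair e y (α y) (bracket ϖ e z z' y) = 0 := by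
  have hαd : DifferentiableAt ℝ α y :=
    ((hα y hy).contDiffAt (h.isOpen.mem_nhds hy)).differentiableAt (by simp)
  have hed : ∀ D, DifferentiableAt ℝ (e D) y := fun D =>
    ((h.smooth_frame D y hy).contDiffAt (h.isOpen.mem_nhds hy)).differentiableAt (by simp)
  have hp : ∀ (ζ : E → Fin n → 𝕜), (∀ A, DifferentiableOn ℝ (fun x => ζ x A) O) →
      (∀ x ∈ O, pair e x (α x) (ζ x) = 0) → ∀ u, ∑ B, (ζ y B * fderiv ℝ (fun x => α x (e B x)) y u
        + α y (e B y) * fderiv ℝ (fun x => ζ x B) y u) = 0 := by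
    intro ζ hζ h0 u
    have h1 : (fun x => pair e x (α x) (ζ x)) =ᶠ[nhds y] fun _ => 0 := by
      filter_upwards [h.isOpen.mem_nhds hy] with x hx using h0 x hx
    have h6 : ∀ B, HasFDerivAt (fun x => ζ x B * α x (e B x))
        (ζ y B • fderiv ℝ (fun x => α x (e B x)) y + α y (e B y) • fderiv ℝ (fun x => ζ x B) y) y :=
      fun B => (((hζ B) y hy).differentiableAt (h.isOpen.mem_nhds hy)).hasFDerivAt.fun_mul
        (hαd.clm_apply (hed B)).hasFDerivAt
    have h3 := HasFDerivAt.fun_sum (u := Finset.univ) fun B _ => h6 B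
    have h4 := h1.fderiv_eq (𝕜 := ℝ)
    simp only [pair] at h4
    rw [h3.fderiv] at h4
    have h5 := congrArg (fun l : E →L[ℝ] 𝕜 => l u) h4
    simpa only [sum_apply, add_apply,
      smul_apply, smul_eq_mul, fderiv_fun_const, Pi.zero_apply,
      zero_apply] using h5
  -- Cartan's formula for complex fields: the derivative of `α(z') = 0` along `z`, minus that of
  -- `α(z) = 0` along `z'`, minus `dα(z, z')`, is `α` of the bracket. The rest only reorders sums.
  have e1 : ∑ A, z y A * ∑ B, (z' y B * fderiv ℝ (fun x => α x (e B x)) y (e A y)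
        + α y (e B y) * fderiv ℝ (fun x => z' x B) y (e A y)) = 0 :=
    Finset.sum_eq_zero fun A _ => by rw [hp z' hz' h0', mul_zero]
  have e2 : ∑ B, z' y B * ∑ A, (z y A * fderiv ℝ (fun x => α x (e A x)) y (e B y)
        + α y (e A y) * fderiv ℝ (fun x => z x A) y (e B y)) = 0 :=
    Finset.sum_eq_zero fun A _ => by rw [hp z hz h0, mul_zero]
  simp only [pair2, h.extD_apply hα hy] at h2
  simp only [pair, bracket]
  simp only [Finset.mul_sum, mul_add, mul_sub, sub_mul, Finset.sum_mul, Finset.sum_add_distrib,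
    Finset.sum_sub_distrib] at e1 e2 h2 ⊢
  have r1 : ∑ x, ∑ i, z' y x * (z y i * fderiv ℝ (fun x ↦ α x (e i x)) y (e x y))
      = ∑ x, ∑ i, z y x * z' y i * fderiv ℝ (fun x_1 ↦ α x_1 (e x x_1)) y (e i y) := by
    rw [Finset.sum_comm]
    exact Finset.sum_congr rfl fun A _ => Finset.sum_congr rfl fun B _ => by ring
  have r2 : ∑ x, ∑ i, z y x * (z' y i * fderiv ℝ (fun x ↦ α x (e i x)) y (e x y))
      = ∑ x, ∑ i, z y x * z' y i * fderiv ℝ (fun x_1 ↦ α x_1 (e i x_1)) y (e x y) :=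
    Finset.sum_congr rfl fun A _ => Finset.sum_congr rfl fun B _ => by ring
  have r3 : ∑ D, ∑ A, z y A * fderiv ℝ (fun x => z' x D) y (e A y) * α y (e D y)
      = ∑ x, ∑ i, z y x * (α y (e i y) * fderiv ℝ (fun x => z' x i) y (e x y)) := by
    rw [Finset.sum_comm]
    exact Finset.sum_congr rfl fun A _ => Finset.sum_congr rfl fun B _ => by ring
  have r4 : ∑ D, ∑ A, z' y A * fderiv ℝ (fun x => z x D) y (e A y) * α y (e D y)
      = ∑ x, ∑ i, z' y x * (α y (e i y) * fderiv ℝ (fun x => z x i) y (e x y)) := by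
    rw [Finset.sum_comm]
    exact Finset.sum_congr rfl fun A _ => Finset.sum_congr rfl fun B _ => by ring
  have r5 : ∑ D, ∑ A, ∑ B, z y A * z' y B * ((extD (ϖ D) y (e A y) (e B y) : ℝ) : 𝕜) * α y (e D y)
      = ∑ A, ∑ B, ∑ D, z y A * z' y B *
        (α y (e D y) * ((extD (ϖ D) y (e A y) (e B y) : ℝ) : 𝕜)) := by
    rw [Finset.sum_comm]
    refine Finset.sum_congr rfl fun A _ => ?_
    rw [Finset.sum_comm]
    exact Finset.sum_congr rfl fun B _ => Finset.sum_congr rfl fun D _ => by ring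
  rw [r1] at e2
  rw [r2] at e1
  rw [r3, r4, r5]
  linear_combination e1 - e2 - h2

theorem derivedSystem_le (V : E → Submodule 𝕜 (E →L[ℝ] 𝕜)) (x : E) : derivedSystem V x ≤ V x := by
  refine Submodule.span_le.2 ?_
  rintro a ⟨O, α, hO, hx, hα, -, rfl⟩
  exact hα.2 x hx

theorem derivedFlag_antitone (V : E → Submodule 𝕜 (E →L[ℝ] 𝕜)) (x : E) {j k : ℕ} (h : j ≤ k) :
    derivedFlag V k x ≤ derivedFlag V j x := by
  induction h with
  | refl => exact le_rfl
  | step _ ih => exact (derivedSystem_le _ x).trans ih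

/-- The elements of the derived flag of `V` annihilate `z` from some stage on. -/
def FlagKills (V : E → Submodule 𝕜 (E →L[ℝ] 𝕜)) (e : Fin n → E → E) (O : Set E)
    (z : E → Fin n → 𝕜) : Prop :=
  ∃ k, ∀ y ∈ O, ∀ a ∈ derivedFlag V k y, pair e y a (z y) = 0

variable {V : E → Submodule 𝕜 (E →L[ℝ] 𝕜)} {z z' : E → Fin n → 𝕜}

theorem FlagKills.pair_eq_zero (hz : FlagKills V e O z) {y : E} (hy : y ∈ O) {a : E →L[ℝ] 𝕜}
    (ha : a ∈ derivedInf V y) : pair e y a (z y) = 0 := by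
  obtain ⟨k, hk⟩ := hz
  exact hk y hy a ((Submodule.mem_iInf _).1 ha k)

theorem FlagKills.lincomb (hz : FlagKills V e O z) (hz' : FlagKills V e O z') (f f' : E → 𝕜) :
    FlagKills V e O (fun y A => f y * z y A + f' y * z' y A) := by
  obtain ⟨k, hk⟩ := hz
  obtain ⟨k', hk'⟩ := hz'
  refine ⟨max k k', fun y hy a ha => ?_⟩
  have h1 := hk y hy a (derivedFlag_antitone V y (le_max_left k k') ha)
  have h2 := hk' y hy a (derivedFlag_antitone V y (le_max_right k k') ha)
  have h3 : pair e y a (fun A => f y * z y A + f' y * z' y A)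
      = f y * pair e y a (z y) + f' y * pair e y a (z' y) := by
    simp only [pair, Finset.mul_sum, ← Finset.sum_add_distrib]
    exact Finset.sum_congr rfl fun A _ => by ring
  rw [h3, h1, h2]; ring

theorem FlagKills.congr (hz : FlagKills V e O z) (h : ∀ y ∈ O, z' y = z y) :
    FlagKills V e O z' := by
  obtain ⟨k, hk⟩ := hz
  exact ⟨k, fun y hy a ha => by rw [h y hy]; exact hk y hy a ha⟩

/-- A section of the next derived system has its exterior derivative in the ideal of the current
one. If the current stage annihilates both fields, that derivative vanishes on them, and Cartan's
formula applies. Each bracket thus costs one further stage of the flag. -/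
theorem FlagKills.bracket (h : IsCoframeOn ϖ e O) (hz : FlagKills V e O z)
    (hz' : FlagKills V e O z') (hzd : ∀ A, DifferentiableOn ℝ (fun x => z x A) O)
    (hzd' : ∀ A, DifferentiableOn ℝ (fun x => z' x A) O) :
    FlagKills V e O (bracket ϖ e z z') := by
  obtain ⟨k, hk⟩ := hz
  obtain ⟨k', hk'⟩ := hz'
  refine ⟨max k k' + 1, fun y hy a ha => ?_⟩
  refine pair_span (fun b hb => ?_) ha
  obtain ⟨O', α, hO', hy', hα, hd, rfl⟩ := hb
  have hW : IsCoframeOn ϖ e (O ∩ O') :=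
    ⟨h.isOpen.inter hO', fun A => (h.smooth_coframe A).mono Set.inter_subset_left,
      fun A => (h.smooth_frame A).mono Set.inter_subset_left, fun y hy => h.dual y hy.1,
      fun y hy => h.expand y hy.1⟩
  have k1 : ∀ x ∈ O, ∀ b ∈ derivedFlag V (max k k') x, pair e x b (z x) = 0 := fun x hx b hb =>
    hk x hx b (derivedFlag_antitone V x (le_max_left k k') hb)
  have k2 : ∀ x ∈ O, ∀ b ∈ derivedFlag V (max k k') x, pair e x b (z' x) = 0 := fun x hx b hb =>
    hk' x hx b (derivedFlag_antitone V x (le_max_right k k') hb)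
  exact hW.pair_bracket (hα.1.mono Set.inter_subset_right)
    (fun A => (hzd A).mono Set.inter_subset_left) (fun A => (hzd' A).mono Set.inter_subset_left)
    (fun x hx => k1 x hx.1 _ (hα.2 x hx.2)) (fun x hx => k2 x hx.1 _ (hα.2 x hx.2)) ⟨hy, hy'⟩
    (pair2_ideal2 (k1 y hy) (k2 y hy) (hd y hy'))

end Coframe

/-! ### Structure equations -/

section Structure

variable {M : Type*} [TopologicalSpace M] [ChartedSpace (EuclideanSpace ℝ (Fin 2)) M]
  [IsManifold (𝓡 2) ∞ M]
  {g : Metric2 M} {v : Fin 2 → (x : M) → TangentSpace (𝓡 2) x} {U : Set M}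
  {O : Set E8} {x : E8 → M} {ρ : E8 → E3} {e : Fin 3 → E8 → E3}

theorem extD_congr {E F : Type*} [NormedAddCommGroup E] [NormedSpace ℝ E] [RCLike F]
    {α β : E → E →L[ℝ] F} {y : E} (h : α =ᶠ[nhds y] β) : extD α y = extD β y := by
  simp only [extD, h.fderiv_eq]

theorem extD_add {E : Type*} [NormedAddCommGroup E] [NormedSpace ℝ E]
    {α β : E → E →L[ℝ] ℝ} {y : E} (hα : DifferentiableAt ℝ α y) (hβ : DifferentiableAt ℝ β y) :
    extD (fun z => α z + β z) y = extD α y + extD β y := by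
  ext u w
  simp only [extD, fderiv_fun_add hα hβ, sub_apply, add_apply, ContinuousLinearMap.flip_apply]
  ring

theorem extD_sub {E : Type*} [NormedAddCommGroup E] [NormedSpace ℝ E]
    {α β : E → E →L[ℝ] ℝ} {y : E} (hα : DifferentiableAt ℝ α y) (hβ : DifferentiableAt ℝ β y) :
    extD (fun z => α z - β z) y = extD α y - extD β y := by
  ext u w
  simp only [extD, fderiv_fun_sub hα hβ, sub_apply, ContinuousLinearMap.flip_apply]
  ring

theorem extD_smul {E : Type*} [NormedAddCommGroup E] [NormedSpace ℝ E] {f : E → ℝ}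
    {α : E → E →L[ℝ] ℝ} {y : E} (hf : DifferentiableAt ℝ f y) (hα : DifferentiableAt ℝ α y) :
    extD (fun z => f z • α z) y = wedge (fderiv ℝ f y) (α y) + f y • extD α y := by
  ext u w
  simp only [extD, fderiv_fun_smul hf hα, sub_apply, add_apply, smul_apply,
    ContinuousLinearMap.flip_apply, wedge_apply, ContinuousLinearMap.smulRight_apply, smul_eq_mul]
  ring

theorem extD_fderiv {E : Type*} [NormedAddCommGroup E] [NormedSpace ℝ E] {f : E → ℝ} {y : E}
    (hf : ContDiffAt ℝ ∞ f y) : extD (fderiv ℝ f) y = 0 := by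
  ext u w
  have h : IsSymmSndFDerivAt ℝ f y := hf.isSymmSndFDerivAt (by
    rw [minSmoothness_of_isRCLikeNormedField]; exact WithTop.coe_le_coe.2 le_top)
  simp only [extD, sub_apply, ContinuousLinearMap.flip_apply, zero_apply]
  rw [h.eq u w, sub_self]

/-- The differential of the pull-back of a function to the coordinate domain. -/
theorem fderiv_comp_eq (hv : IsOrthonormalFrameOn g v U) (hc : IsLocalCoords U O x ρ e)
    {f : M → ℝ} {y : E8} (hy : y ∈ O) (hf : MDifferentiableAt (𝓡 2) 𝓘(ℝ, ℝ) f (x y)) :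
    fderiv ℝ (fun y => f (x y)) y = dirDeriv (v 0) f (x y) • etaForm g v x 0 y
      + dirDeriv (v 1) f (x y) • etaForm g v x 1 y := by
  have hx : MDifferentiableAt 𝓘(ℝ, E8) (𝓡 2) x y :=
    ((hc.smooth_x y hy).contMDiffAt (hc.isOpen.mem_nhds hy)).mdifferentiableAt (by simp)
  have h1 := (hf.hasMFDerivAt.comp y hx.hasMFDerivAt).mfderiv
  rw [mfderiv_eq_fderiv] at h1
  ext u
  change fderiv ℝ (f ∘ x) y u = _
  rw [h1]
  change mfderiv (𝓡 2) 𝓘(ℝ, ℝ) f (x y) (mfderiv 𝓘(ℝ, E8) (𝓡 2) x y u) = _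
  rw [hv.expand (hc.mapsTo hy) (mfderiv 𝓘(ℝ, E8) (𝓡 2) x y u), map_add, map_smul, map_smul]
  simp only [add_apply, smul_apply, smul_eq_mul]
  unfold dirDeriv etaForm
  exact congrArg₂ (· + ·) (mul_comm (G := ℝ) _ _) (mul_comm (G := ℝ) _ _)

theorem IsLocalCoords.contDiffOn_comp (hc : IsLocalCoords U O x ρ e) {f : M → ℝ} {W : Set M}
    (hf : SmoothOn f W) : ContDiffOn ℝ ∞ (fun y => f (x y)) (O ∩ x ⁻¹' W) :=
  (ContMDiffOn.comp hf (hc.smooth_x.mono Set.inter_subset_left) fun _ h => h.2).contDiffOn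

theorem IsLocalCoords.isOpen_preimage (hc : IsLocalCoords U O x ρ e) {W : Set M} (hW : IsOpen W) :
    IsOpen (O ∩ x ⁻¹' W) := hc.smooth_x.continuousOn.isOpen_inter_preimage hc.isOpen hW

/-- The differentials of two coordinate functions are smooth forms and are combinations of the dual
forms with an invertible matrix of coefficients; Cramer's rule recovers the dual forms from them. -/
theorem smooth_etaForm (hv : IsOrthonormalFrameOn g v U) (hU : IsOpen U)
    (hc : IsLocalCoords U O x ρ e) (i : Fin 2) : ContDiffOn ℝ ∞ (etaForm g v x i) O := by
  intro y hy
  obtain ⟨W, h, hW, hpW, hWU, hh, hdet⟩ := hv.exists_coordinates hU (hc.mapsTo hy)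
  have hvW := hv.mono hWU
  have hO := hc.isOpen_preimage hW
  have hsd : ∀ i j, ContDiffOn ℝ ∞ (fun y => dirDeriv (v i) (h j) (x y)) (O ∩ x ⁻¹' W) :=
    fun i j => hc.contDiffOn_comp ((hh j).dirDeriv (hvW.smooth i) hW)
  have hsf : ∀ j, ContDiffOn ℝ ∞ (fderiv ℝ (fun y => h j (x y))) (O ∩ x ⁻¹' W) := fun j =>
    (hc.contDiffOn_comp (hh j)).fderiv_of_isOpen hO (by simp)
  have hD : ContDiffOn ℝ ∞ (fun y => (dirDeriv (v 0) (h 0) (x y) * dirDeriv (v 1) (h 1) (x y)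
        - dirDeriv (v 0) (h 1) (x y) * dirDeriv (v 1) (h 0) (x y))⁻¹) (O ∩ x ⁻¹' W) :=
    (((hsd 0 0).mul (hsd 1 1)).sub ((hsd 0 1).mul (hsd 1 0))).inv fun y hy => hdet _ hy.2
  have key : ContDiffOn ℝ ∞ (etaForm g v x i) (O ∩ x ⁻¹' W) := by
    fin_cases i
    · have h1 : ContDiffOn ℝ ∞ (fun y =>
        (dirDeriv (v 0) (h 0) (x y) * dirDeriv (v 1) (h 1) (x y)
          - dirDeriv (v 0) (h 1) (x y) * dirDeriv (v 1) (h 0) (x y))⁻¹ •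
        (dirDeriv (v 1) (h 1) (x y) • fderiv ℝ (fun y => h 0 (x y)) y
          - dirDeriv (v 1) (h 0) (x y) • fderiv ℝ (fun y => h 1 (x y)) y)) (O ∩ x ⁻¹' W) :=
        hD.smul (((hsd 1 1).smul (hsf 0)).sub ((hsd 1 0).smul (hsf 1)))
      refine h1.congr ?_
      intro y hy
      have hn := hdet _ hy.2
      simp only [fderiv_comp_eq hv hc hy.1 ((hh _).mdifferentiableAt hW hy.2)]
      ext u
      simp only [smul_apply, sub_apply, add_apply, smul_eq_mul, Fin.zero_eta]
      field_simp
      ring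
    · have h1 : ContDiffOn ℝ ∞ (fun y =>
        (dirDeriv (v 0) (h 0) (x y) * dirDeriv (v 1) (h 1) (x y)
          - dirDeriv (v 0) (h 1) (x y) * dirDeriv (v 1) (h 0) (x y))⁻¹ •
        (dirDeriv (v 0) (h 0) (x y) • fderiv ℝ (fun y => h 1 (x y)) y
          - dirDeriv (v 0) (h 1) (x y) • fderiv ℝ (fun y => h 0 (x y)) y)) (O ∩ x ⁻¹' W) :=
        hD.smul (((hsd 0 0).smul (hsf 1)).sub ((hsd 0 1).smul (hsf 0)))
      refine h1.congr ?_
      intro y hy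
      have hn := hdet _ hy.2
      simp only [fderiv_comp_eq hv hc hy.1 ((hh _).mdifferentiableAt hW hy.2)]
      ext u
      simp only [smul_apply, sub_apply, add_apply, smul_eq_mul, Fin.mk_one]
      field_simp
      ring
  exact ((key y ⟨hy, hpW⟩).contDiffAt (hO.mem_nhds ⟨hy, hpW⟩)).contDiffWithinAt

theorem differentiableAt_of_contDiffOn {E F : Type*} [NormedAddCommGroup E] [NormedSpace ℝ E]
    [NormedAddCommGroup F] [NormedSpace ℝ F] {f : E → F} {O : Set E} (h : ContDiffOn ℝ ∞ f O)
    (hO : IsOpen O) {y : E} (hy : y ∈ O) : DifferentiableAt ℝ f y :=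
  ((h y hy).contDiffAt (hO.mem_nhds hy)).differentiableAt (by simp)

/-- `dη¹ = -η¹₂ ∧ η²`, `dη² = η¹₂ ∧ η¹`. -/
theorem extD_etaForm (hv : IsOrthonormalFrameOn g v U) (hU : IsOpen U)
    (hc : IsLocalCoords U O x ρ e) (i : Fin 2) {y : E8} (hy : y ∈ O) :
    extD (etaForm g v x i) y
      = -structFun g v i (x y) • wedge (etaForm g v x 0 y) (etaForm g v x 1 y) := by
  obtain ⟨W, h, hW, hpW, hWU, hh, hdet⟩ := hv.exists_coordinates hU (hc.mapsTo hy)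
  have hvW := hv.mono hWU
  have hO := hc.isOpen_preimage hW
  have hd : ∀ i j, DifferentiableAt ℝ (fun y => dirDeriv (v i) (h j) (x y)) y :=
    fun i j => differentiableAt_of_contDiffOn
      (hc.contDiffOn_comp ((hh j).dirDeriv (hvW.smooth i) hW)) hO ⟨hy, hpW⟩
  have hη : ∀ i, DifferentiableAt ℝ (etaForm g v x i) y := fun i =>
    differentiableAt_of_contDiffOn (smooth_etaForm hv hU hc i) hc.isOpen hy
  -- Expand `d(dh) = 0` for each of the two coordinate functions. The two relations determine both
  -- exterior derivatives, again by Cramer's rule.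
  have key : ∀ j, dirDeriv (v 0) (h j) (x y) • extD (etaForm g v x 0) y
      + dirDeriv (v 1) (h j) (x y) • extD (etaForm g v x 1) y
      = -(structFun g v 0 (x y) * dirDeriv (v 0) (h j) (x y)
        + structFun g v 1 (x y) * dirDeriv (v 1) (h j) (x y)) •
          wedge (etaForm g v x 0 y) (etaForm g v x 1 y) := by
    intro j
    have h1 : extD (fderiv ℝ (fun y => h j (x y))) y = 0 :=
      extD_fderiv (((hc.contDiffOn_comp (hh j)) y ⟨hy, hpW⟩).contDiffAt (hO.mem_nhds ⟨hy, hpW⟩))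
    have h2 : fderiv ℝ (fun y => h j (x y)) =ᶠ[nhds y] fun y =>
        dirDeriv (v 0) (h j) (x y) • etaForm g v x 0 y
          + dirDeriv (v 1) (h j) (x y) • etaForm g v x 1 y := by
      filter_upwards [hO.mem_nhds ⟨hy, hpW⟩] with z hz
      exact fderiv_comp_eq hv hc hz.1 ((hh j).mdifferentiableAt hW hz.2)
    rw [extD_congr h2, extD_add ((hd 0 j).fun_smul (hη 0)) ((hd 1 j).fun_smul (hη 1)),
      extD_smul (hd 0 j) (hη 0), extD_smul (hd 1 j) (hη 1),
      fderiv_comp_eq hv hc hy (((hh j).dirDeriv (hvW.smooth 0) hW).mdifferentiableAt hW hpW),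
      fderiv_comp_eq hv hc hy (((hh j).dirDeriv (hvW.smooth 1) hW).mdifferentiableAt hW hpW)] at h1
    rw [← hvW.commutator hW (hh j) hpW]
    ext u w
    have h3 := congrArg (fun l : E8 →L[ℝ] E8 →L[ℝ] ℝ => l u w) h1
    simp only [wedge_apply, add_apply, smul_apply, smul_eq_mul, zero_apply] at h3 ⊢
    linear_combination h3
  have k0 := key 0
  have k1 := key 1
  have hn := hdet _ hpW
  ext u w
  have k0 := congrArg (fun l : E8 →L[ℝ] E8 →L[ℝ] ℝ => l u w) k0
  have k1 := congrArg (fun l : E8 →L[ℝ] E8 →L[ℝ] ℝ => l u w) k1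
  simp only [add_apply, smul_apply, smul_eq_mul] at k0 k1 ⊢
  refine mul_left_cancel₀ hn ?_
  fin_cases i
  · simp only [Fin.zero_eta]
    linear_combination dirDeriv (v 1) (h 1) (x y) * k0 - dirDeriv (v 1) (h 0) (x y) * k1
  · simp only [Fin.mk_one]
    linear_combination dirDeriv (v 0) (h 0) (x y) * k1 - dirDeriv (v 0) (h 1) (x y) * k0

/-- `dη¹₂ = K η¹ ∧ η²`. -/
theorem extD_etaConn (hv : IsOrthonormalFrameOn g v U) (hU : IsOpen U)
    (hc : IsLocalCoords U O x ρ e) {y : E8} (hy : y ∈ O) :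
    extD (etaConn g v x) y
      = gaussCurv g v (x y) • wedge (etaForm g v x 0 y) (etaForm g v x 1 y) := by
  have hη : ∀ i, DifferentiableAt ℝ (etaForm g v x i) y := fun i =>
    differentiableAt_of_contDiffOn (smooth_etaForm hv hU hc i) hc.isOpen hy
  have hs : ∀ i, DifferentiableAt ℝ (fun y => structFun g v i (x y)) y := fun i =>
    differentiableAt_of_contDiffOn (hc.contDiffOn_comp (hv.smooth_structFun hU i))
      (hc.isOpen_preimage hU) ⟨hy, hc.mapsTo hy⟩
  have h1 : etaConn g v x = fun y => structFun g v 0 (x y) • etaForm g v x 0 y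
      + structFun g v 1 (x y) • etaForm g v x 1 y := rfl
  rw [h1, extD_add ((hs 0).fun_smul (hη 0)) ((hs 1).fun_smul (hη 1)), extD_smul (hs 0) (hη 0),
    extD_smul (hs 1) (hη 1), extD_etaForm hv hU hc 0 hy, extD_etaForm hv hU hc 1 hy,
    fderiv_comp_eq hv hc hy ((hv.smooth_structFun hU 0).mdifferentiableAt hU (hc.mapsTo hy)),
    fderiv_comp_eq hv hc hy ((hv.smooth_structFun hU 1).mdifferentiableAt hU (hc.mapsTo hy))]
  ext u w
  simp only [wedge_apply, add_apply, smul_apply, smul_eq_mul, gaussCurv]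
  ring

/-- The exterior derivative of a form `P · dQ`. -/
theorem extD_inner_fderiv {P Q : E8 → E3} {y : E8} (hP : DifferentiableAt ℝ P y)
    (hQ : ContDiffAt ℝ ∞ Q y) (u w : E8) :
    extD (fun y => (innerSL ℝ (P y)).comp (fderiv ℝ Q y)) y u w
      = inner ℝ (fderiv ℝ P y u) (fderiv ℝ Q y w) - inner ℝ (fderiv ℝ P y w) (fderiv ℝ Q y u) := by
  have hQ' : DifferentiableAt ℝ (fderiv ℝ Q) y :=
    (hQ.fderiv_right (m := ∞) (by simp)).differentiableAt (by simp)
  have h : IsSymmSndFDerivAt ℝ Q y := hQ.isSymmSndFDerivAt (by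
    rw [minSmoothness_of_isRCLikeNormedField]; exact WithTop.coe_le_coe.2 le_top)
  have h1 : HasFDerivAt (fun y => innerSL ℝ (P y)) ((innerSL ℝ).comp (fderiv ℝ P y)) y :=
    (innerSL ℝ (E := E3)).hasFDerivAt.comp y hP.hasFDerivAt
  have h2 := (h1.clm_comp hQ'.hasFDerivAt).fderiv
  simp only [extD, sub_apply, ContinuousLinearMap.flip_apply]
  rw [h2]
  simp only [add_apply, ContinuousLinearMap.comp_apply, ContinuousLinearMap.compL_apply,
    ContinuousLinearMap.flip_apply, innerSL_apply_apply]
  rw [h.eq u w]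
  ring

variable (g v x ρ e) in
/-- The coframe `η¹, η², ω¹, ω², ω³, ω¹₂, ω³₁, ω³₂`. -/
def adaptedCoframe : Fin 8 → E8 → E8 →L[ℝ] ℝ :=
  ![etaForm g v x 0, etaForm g v x 1, omegaForm ρ e 0, omegaForm ρ e 1, omegaForm ρ e 2,
    omegaConn e 0 1, omegaConn e 2 0, omegaConn e 2 1]

theorem IsLocalCoords.sum_inner (hc : IsLocalCoords U O x ρ e) {y : E8} (hy : y ∈ O) (a b : E3) :
    inner ℝ a b = ∑ c, inner ℝ (e c y) a * inner ℝ (e c y) b := by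
  have ho := hc.orthonormal y hy
  let B := (basisOfOrthonormalOfCardEqFinrank ho (by simp)).toOrthonormalBasis (by simpa using ho)
  have hB : ∀ c, B c = e c y := fun c => by simp [B]
  rw [← B.sum_inner_mul_inner a b]
  simp only [hB]
  exact Finset.sum_congr rfl fun c _ => by rw [real_inner_comm]

theorem IsLocalCoords.omegaConn_skew (hc : IsLocalCoords U O x ρ e) {y : E8} (hy : y ∈ O)
    (a b : Fin 3) (u : E8) : omegaConn e a b y u = -omegaConn e b a y u := by
  have hd : ∀ a, DifferentiableAt ℝ (e a) y := fun a =>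
    differentiableAt_of_contDiffOn (hc.smooth_e a) hc.isOpen hy
  have h1 : (fun z => inner ℝ (e a z) (e b z)) =ᶠ[nhds y] fun _ => (if a = b then (1 : ℝ) else 0) := by
    filter_upwards [hc.isOpen.mem_nhds hy] with z hz
    exact orthonormal_iff_ite.1 (hc.orthonormal z hz) a b
  have h2 := congrArg (fun l : E8 →L[ℝ] ℝ => l u) (h1.fderiv_eq (𝕜 := ℝ))
  simp only [fderiv_inner_apply ℝ (hd a) (hd b), fderiv_fun_const, Pi.zero_apply,
    zero_apply] at h2
  simp only [omegaConn, ContinuousLinearMap.comp_apply, innerSL_apply_apply]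
  rw [real_inner_comm (e b y)] at h2
  linarith

theorem IsLocalCoords.contDiffOn_inner_fderiv (hc : IsLocalCoords U O x ρ e) {P Q : E8 → E3}
    (hP : ContDiffOn ℝ ∞ P O) (hQ : ContDiffOn ℝ ∞ Q O) :
    ContDiffOn ℝ ∞ (fun y => (innerSL ℝ (P y)).comp (fderiv ℝ Q y)) O :=
  ((innerSL ℝ (E := E3)).contDiff.comp_contDiffOn hP).clm_comp
    (hQ.fderiv_of_isOpen hc.isOpen (by simp))

/-- By the immersion condition no nonzero vector is killed by `dx`, `dρ` and every `de_a`.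
Skew-symmetry of the connection forms reduces this vanishing to that of the eight forms of the
coframe. -/
theorem exists_adaptedFrame (hv : IsOrthonormalFrameOn g v U) (hU : IsOpen U)
    (hc : IsLocalCoords U O x ρ e) :
    ∃ F : Fin 8 → E8 → E8, IsCoframeOn (adaptedCoframe g v x ρ e) F O := by
  refine exists_frame (by simp) hc.isOpen (fun A => ?_) fun y hy u hu => ?_
  · fin_cases A
    exacts [smooth_etaForm hv hU hc 0, smooth_etaForm hv hU hc 1,
      hc.contDiffOn_inner_fderiv (hc.smooth_e 0) hc.smooth_rho,
      hc.contDiffOn_inner_fderiv (hc.smooth_e 1) hc.smooth_rho,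
      hc.contDiffOn_inner_fderiv (hc.smooth_e 2) hc.smooth_rho,
      hc.contDiffOn_inner_fderiv (hc.smooth_e 0) (hc.smooth_e 1),
      hc.contDiffOn_inner_fderiv (hc.smooth_e 2) (hc.smooth_e 0),
      hc.contDiffOn_inner_fderiv (hc.smooth_e 2) (hc.smooth_e 1)]
  · have h0 : etaForm g v x 0 y u = 0 := hu 0
    have h1 : etaForm g v x 1 y u = 0 := hu 1
    have h2 : omegaForm ρ e 0 y u = 0 := hu 2
    have h3 : omegaForm ρ e 1 y u = 0 := hu 3
    have h4 : omegaForm ρ e 2 y u = 0 := hu 4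
    have h5 : omegaConn e 0 1 y u = 0 := hu 5
    have h6 : omegaConn e 2 0 y u = 0 := hu 6
    have h7 : omegaConn e 2 1 y u = 0 := hu 7
    have hz : ∀ w : E3, (∀ c, inner ℝ (e c y) w = 0) → w = 0 := fun w hw => by
      rw [← inner_self_eq_zero (𝕜 := ℝ), hc.sum_inner hy]
      simp [hw]
    have hs : ∀ a, omegaConn e a a y u = 0 := fun a => by
      have := hc.omegaConn_skew hy a a u; linarith
    refine hc.immersion y hy u ?_ (hz _ fun c => ?_) fun a => hz _ fun c => ?_
    · rw [hv.expand (hc.mapsTo hy) (mfderiv 𝓘(ℝ, E8) (𝓡 2) x y u)]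
      unfold etaForm at h0 h1
      have h0' : g.inner (x y) (v 0 (x y)) (mfderiv 𝓘(ℝ, E8) (𝓡 2) x y u) = 0 := h0
      have h1' : g.inner (x y) (v 1 (x y)) (mfderiv 𝓘(ℝ, E8) (𝓡 2) x y u) = 0 := h1
      rw [h0', h1', zero_smul, zero_smul, add_zero]
    · fin_cases c
      exacts [h2, h3, h4]
    · change omegaConn e c a y u = 0
      fin_cases a <;> fin_cases c
      exacts [hs 0, by rw [hc.omegaConn_skew hy]; simpa using h5, h6, h5, hs 1, h7,
        by rw [hc.omegaConn_skew hy]; simpa using h6, by rw [hc.omegaConn_skew hy]; simpa using h7,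
        hs 2]

/-- The structure equations of the adapted coframe. -/
theorem extD_adaptedCoframe (hv : IsOrthonormalFrameOn g v U) (hU : IsOpen U)
    (hc : IsLocalCoords U O x ρ e) {y : E8} (hy : y ∈ O) (D : Fin 8) :
    extD (adaptedCoframe g v x ρ e D) y =
      (![-structFun g v 0 (x y) • wedge (adaptedCoframe g v x ρ e 0 y) (adaptedCoframe g v x ρ e 1 y),
        -structFun g v 1 (x y) • wedge (adaptedCoframe g v x ρ e 0 y) (adaptedCoframe g v x ρ e 1 y),
        wedge (adaptedCoframe g v x ρ e 6 y) (adaptedCoframe g v x ρ e 4 y)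
          - wedge (adaptedCoframe g v x ρ e 5 y) (adaptedCoframe g v x ρ e 3 y),
        wedge (adaptedCoframe g v x ρ e 5 y) (adaptedCoframe g v x ρ e 2 y)
          + wedge (adaptedCoframe g v x ρ e 7 y) (adaptedCoframe g v x ρ e 4 y),
        -wedge (adaptedCoframe g v x ρ e 6 y) (adaptedCoframe g v x ρ e 2 y)
          - wedge (adaptedCoframe g v x ρ e 7 y) (adaptedCoframe g v x ρ e 3 y),
        wedge (adaptedCoframe g v x ρ e 6 y) (adaptedCoframe g v x ρ e 7 y),
        wedge (adaptedCoframe g v x ρ e 7 y) (adaptedCoframe g v x ρ e 5 y),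
        -wedge (adaptedCoframe g v x ρ e 6 y) (adaptedCoframe g v x ρ e 5 y)] :
          Fin 8 → E8 →L[ℝ] E8 →L[ℝ] ℝ) D := by
  have hd : ∀ a, DifferentiableAt ℝ (e a) y := fun a =>
    differentiableAt_of_contDiffOn (hc.smooth_e a) hc.isOpen hy
  have hcd : ∀ a, ContDiffAt ℝ ∞ (e a) y := fun a =>
    (hc.smooth_e a y hy).contDiffAt (hc.isOpen.mem_nhds hy)
  have hρ : ContDiffAt ℝ ∞ ρ y := (hc.smooth_rho y hy).contDiffAt (hc.isOpen.mem_nhds hy)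
  -- Since `d(e_a · dρ) = de_a ∧ dρ`, and similarly for `e_a · de_b`, it remains to expand inner
  -- products in the moving frame.
  have hform : ∀ a u w, extD (omegaForm ρ e a) y u w = ∑ c, (omegaConn e c a y u *
      omegaForm ρ e c y w - omegaConn e c a y w * omegaForm ρ e c y u) := fun a u w => by
    refine (extD_inner_fderiv (hd a) hρ u w).trans ?_
    rw [hc.sum_inner hy, hc.sum_inner hy, ← Finset.sum_sub_distrib]
    rfl
  have hconn : ∀ a b u w, extD (omegaConn e a b) y u w = ∑ c, (omegaConn e c a y u *
      omegaConn e c b y w - omegaConn e c a y w * omegaConn e c b y u) := fun a b u w => by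
    refine (extD_inner_fderiv (hd a) (hcd b) u w).trans ?_
    rw [hc.sum_inner hy, hc.sum_inner hy, ← Finset.sum_sub_distrib]
    rfl
  have hs : ∀ a u, omegaConn e a a y u = 0 := fun a u => by
    have := hc.omegaConn_skew hy a a u; linarith
  have s10 := hc.omegaConn_skew hy 1 0
  have s02 := hc.omegaConn_skew hy 0 2
  have s12 := hc.omegaConn_skew hy 1 2
  have k2 : extD (omegaForm ρ e 0) y = wedge (omegaConn e 2 0 y) (omegaForm ρ e 2 y)
      - wedge (omegaConn e 0 1 y) (omegaForm ρ e 1 y) := by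
    ext u w
    simp only [hform, Fin.sum_univ_three, wedge_apply, sub_apply, hs, s10]
    ring
  have k3 : extD (omegaForm ρ e 1) y = wedge (omegaConn e 0 1 y) (omegaForm ρ e 0 y)
      + wedge (omegaConn e 2 1 y) (omegaForm ρ e 2 y) := by
    ext u w
    simp only [hform, Fin.sum_univ_three, wedge_apply, add_apply, hs]
    ring
  have k4 : extD (omegaForm ρ e 2) y = -wedge (omegaConn e 2 0 y) (omegaForm ρ e 0 y)
      - wedge (omegaConn e 2 1 y) (omegaForm ρ e 1 y) := by
    ext u w
    simp only [hform, Fin.sum_univ_three, wedge_apply, sub_apply, neg_apply, hs, s02, s12]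
    ring
  have k5 : extD (omegaConn e 0 1) y = wedge (omegaConn e 2 0 y) (omegaConn e 2 1 y) := by
    ext u w
    simp only [hconn, Fin.sum_univ_three, wedge_apply, hs]
    ring
  have k6 : extD (omegaConn e 2 0) y = wedge (omegaConn e 2 1 y) (omegaConn e 0 1 y) := by
    ext u w
    simp only [hconn, Fin.sum_univ_three, wedge_apply, hs, s10, s12]
    ring
  have k7 : extD (omegaConn e 2 1) y = -wedge (omegaConn e 2 0 y) (omegaConn e 0 1 y) := by
    ext u w
    simp only [hconn, Fin.sum_univ_three, wedge_apply, neg_apply, hs, s02]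
    ring
  fin_cases D
  exacts [extD_etaForm hv hU hc 0 hy, extD_etaForm hv hU hc 1 hy, k2, k3, k4, k5, k6, k7]

end Structure

/-! ### Decompositions of the embedding system -/

section Decomposition

variable {𝕜 : Type*} [RCLike 𝕜]

section General

variable {E : Type*} [NormedAddCommGroup E] [NormedSpace ℝ E] {n : ℕ}
  {ϖ : Fin n → E → E →L[ℝ] ℝ} {F : Fin n → E → E} {O : Set E}

/-- The value of a real 2-form on complex vectors with components `z`, `z'` in the frame `F`. -/
def rpair2 (F : Fin n → E → E) (y : E) (τ : E →L[ℝ] E →L[ℝ] ℝ) (z z' : Fin n → 𝕜) : 𝕜 :=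
  ∑ A, ∑ B, z A * z' B * ((τ (F A y) (F B y) : ℝ) : 𝕜)

theorem rpair2_add (y : E) (τ τ' : E →L[ℝ] E →L[ℝ] ℝ) (z z' : Fin n → 𝕜) :
    rpair2 F y (τ + τ') z z' = rpair2 F y τ z z' + rpair2 F y τ' z z' := by
  simp only [rpair2, add_apply, RCLike.ofReal_add, mul_add, Finset.sum_add_distrib]

theorem rpair2_smul (y : E) (c : ℝ) (τ : E →L[ℝ] E →L[ℝ] ℝ) (z z' : Fin n → 𝕜) :
    rpair2 F y (c • τ) z z' = (c : 𝕜) * rpair2 F y τ z z' := by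
  simp only [rpair2, smul_apply, smul_eq_mul, RCLike.ofReal_mul, Finset.mul_sum]
  exact Finset.sum_congr rfl fun A _ => Finset.sum_congr rfl fun B _ => by ring

theorem rpair2_neg (y : E) (τ : E →L[ℝ] E →L[ℝ] ℝ) (z z' : Fin n → 𝕜) :
    rpair2 F y (-τ) z z' = -rpair2 F y τ z z' := by
  simp only [rpair2, neg_apply, RCLike.ofReal_neg, mul_neg, Finset.sum_neg_distrib]

theorem rpair2_sub (y : E) (τ τ' : E →L[ℝ] E →L[ℝ] ℝ) (z z' : Fin n → 𝕜) :
    rpair2 F y (τ - τ') z z' = rpair2 F y τ z z' - rpair2 F y τ' z z' := by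
  simp only [rpair2, sub_apply, RCLike.ofReal_sub, mul_sub, Finset.sum_sub_distrib]

theorem IsCoframeOn.rpair2_wedge (h : IsCoframeOn ϖ F O) {y : E} (hy : y ∈ O) (i j : Fin n)
    (z z' : Fin n → 𝕜) :
    rpair2 F y (wedge (ϖ i y) (ϖ j y)) z z' = z i * z' j - z j * z' i := by
  simp only [rpair2, wedge_apply, h.dual y hy]
  have h1 : ∀ A B, z A * z' B * (((((if i = A then 1 else 0) * (if j = B then 1 else 0)
      - (if j = A then 1 else 0) * (if i = B then 1 else 0) : ℝ)) : ℝ) : 𝕜)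
      = (if i = A then z A else 0) * (if j = B then z' B else 0)
        - (if j = A then z A else 0) * (if i = B then z' B else 0) := by
    intro A B
    split_ifs <;> simp
  simp only [h1, Finset.sum_sub_distrib, ← Finset.sum_mul_sum]
  simp

theorem extD_extendScalars {m : ℕ} (ϑ : Fin m → E → E →L[ℝ] ℝ) (i : Fin m) {y : E}
    (h : DifferentiableAt ℝ (ϑ i) y) (u w : E) :
    extD (extendScalars 𝕜 ϑ i) y u w = ((extD (ϑ i) y u w : ℝ) : 𝕜) := by
  have h1 : HasFDerivAt (extendScalars 𝕜 ϑ i)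
      ((ContinuousLinearMap.compL ℝ E ℝ 𝕜 RCLike.ofRealCLM).comp (fderiv ℝ (ϑ i) y)) y :=
    (ContinuousLinearMap.compL ℝ E ℝ 𝕜 RCLike.ofRealCLM).hasFDerivAt.comp y h.hasFDerivAt
  simp [extD, h1.fderiv]

theorem pair2_extendScalars {m : ℕ} (ϑ : Fin m → E → E →L[ℝ] ℝ) (i : Fin m) {y : E}
    (h : DifferentiableAt ℝ (ϑ i) y) (z z' : Fin n → 𝕜) :
    pair2 F y (extD (extendScalars 𝕜 ϑ i) y) z z' = rpair2 F y (extD (ϑ i) y) z z' := by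
  simp only [pair2, rpair2, extD_extendScalars ϑ i h]

/-- The number of elements of a coframe is the dimension. -/
theorem IsCoframeOn.finrank_dual (h : IsCoframeOn ϖ F O) {y : E} (hy : y ∈ O) :
    Module.Finite 𝕜 (E →L[ℝ] 𝕜) ∧ Module.finrank 𝕜 (E →L[ℝ] 𝕜) = n := by
  let l : (E →L[ℝ] 𝕜) →ₗ[𝕜] (Fin n → 𝕜) :=
    { toFun := fun a A => a (F A y), map_add' := fun a b => rfl, map_smul' := fun c a => rfl }
  have hl : Function.Bijective l := by
    constructor
    · intro a b hab
      ext u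
      rw [h.apply_eq hy a, h.apply_eq hy b]
      exact Finset.sum_congr rfl fun D _ => by rw [show a (F D y) = b (F D y) from congrFun hab D]
    · intro c
      refine ⟨∑ A, c A • (RCLike.ofRealCLM : ℝ →L[ℝ] 𝕜).comp (ϖ A y), ?_⟩
      ext B
      simp [l, h.dual y hy]
  let l' := LinearEquiv.ofBijective l hl
  exact ⟨Module.Finite.equiv l'.symm, by rw [l'.finrank_eq]; simp⟩

theorem range_finAppend {α : Type*} {p q : ℕ} (a : Fin p → α) (b : Fin q → α) :
    Set.range (Fin.append a b) = Set.range a ∪ Set.range b := by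
  ext z
  constructor
  · rintro ⟨i, rfl⟩
    refine Fin.addCases (fun i => ?_) (fun i => ?_) i
    · left; exact ⟨i, by simp⟩
    · right; exact ⟨i, by simp⟩
  · rintro (⟨i, rfl⟩ | ⟨i, rfl⟩)
    · exact ⟨Fin.castAdd q i, by simp⟩
    · exact ⟨Fin.natAdd p i, by simp⟩

theorem spanForms_append {p q : ℕ} (a : Fin p → E → E →L[ℝ] 𝕜) (b : Fin q → E → E →L[ℝ] 𝕜)
    (y : E) : spanForms (Fin.append a b) y = spanForms a y ⊔ spanForms b y := by
  have : (fun i => Fin.append a b i y) = Fin.append (fun i => a i y) (fun i => b i y) := by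
    ext1 i
    refine Fin.addCases (fun i => ?_) (fun i => ?_) i <;> simp
  rw [spanForms, this, range_finAppend, Submodule.span_union]
  rfl

/-- `Λ²` of a plane is a line. Hence, in type `[2, 2]`, each family of 2-forms consists of multiples
of a single decomposable form. -/
theorem mem_lambda2_two {σ : Fin 2 → E → E →L[ℝ] 𝕜} {y : E} {τ : E →L[ℝ] E →L[ℝ] 𝕜}
    (h : τ ∈ lambda2 (spanForms σ y)) : ∃ c : 𝕜, τ = c • wedge (σ 0 y) (σ 1 y) := by
  induction h using Submodule.span_induction with
  | mem τ hτ =>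
    obtain ⟨α, hα, β, hβ, rfl⟩ := hτ
    obtain ⟨a, rfl⟩ := (Submodule.mem_span_range_iff_exists_fun 𝕜).1 hα
    obtain ⟨b, rfl⟩ := (Submodule.mem_span_range_iff_exists_fun 𝕜).1 hβ
    refine ⟨a 0 * b 1 - a 1 * b 0, ?_⟩
    ext u w
    simp only [wedge_apply, Fin.sum_univ_two, add_apply, smul_apply, smul_eq_mul]
    ring
  | zero => exact ⟨0, by ext u w; simp [wedge_apply]⟩
  | add τ τ' _ _ h h' =>
    obtain ⟨c, rfl⟩ := h
    obtain ⟨c', rfl⟩ := h'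
    exact ⟨c + c', by ext u w; simp [add_mul]⟩
  | smul d τ _ h =>
    obtain ⟨c, rfl⟩ := h
    exact ⟨d * c, by ext u w; simp [mul_assoc]⟩

/-- A decomposition of a system of four forms on a space of dimension eight has type `[2, 2]`. -/
theorem IsDecompositionOn.type_eq {r p q s t : ℕ} {ϑ : Fin 4 → E → E →L[ℝ] 𝕜}
    {θ : Fin r → E → E →L[ℝ] 𝕜} {σ : Fin p → E → E →L[ℝ] 𝕜} {σ' : Fin q → E → E →L[ℝ] 𝕜}
    {Ω : Fin s → E → E →L[ℝ] E →L[ℝ] 𝕜} {Ω' : Fin t → E → E →L[ℝ] E →L[ℝ] 𝕜} {O' : Set E}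
    (hd : IsDecompositionOn ϑ θ σ σ' Ω Ω' O') {y : E} (hy : y ∈ O')
    (hfin : Module.finrank 𝕜 (E →L[ℝ] 𝕜) = 8) (hϑ : LinearIndependent 𝕜 fun i => ϑ i y) :
    r = 4 ∧ p = 2 ∧ q = 2 := by
  have hli := hd.linearIndependent y hy
  have h1 := finrank_span_eq_card hli
  rw [range_finAppend, range_finAppend, Submodule.span_union, Submodule.span_union] at h1
  have h2 := hd.span_eq_top y hy
  unfold spanForms at h2
  rw [h2, finrank_top, hfin, Fintype.card_fin] at h1
  have hθ : LinearIndependent 𝕜 fun i => θ i y := by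
    have := hli.comp (Fin.castAdd q ∘ Fin.castAdd p)
      ((Fin.castAdd_injective _ _).comp (Fin.castAdd_injective _ _))
    convert this using 1
    ext1 i
    simp
  have h3 := finrank_span_eq_card hθ
  have h4 := finrank_span_eq_card hϑ
  -- Both `θ` and the given generators are bases of the same space, so `r = 4` and `p + q = 4`; the
  -- bounds `2 ≤ p` and `2 ≤ q` leave one possibility.
  have h5 := hd.deg1 y hy
  unfold spanForms at h5
  rw [h5, h3] at h4
  simp only [Fintype.card_fin] at h4
  have := hd.two_le_p
  have := hd.two_le_q
  omega

end General

/-! ### Generators of the embedding system in the adapted coframe. -/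

variable {M : Type*} [TopologicalSpace M] [ChartedSpace (EuclideanSpace ℝ (Fin 2)) M]
  [IsManifold (𝓡 2) ∞ M]
  {g : Metric2 M} {v : Fin 2 → (x : M) → TangentSpace (𝓡 2) x} {U : Set M}
  {O : Set E8} {x : E8 → M} {ρ : E8 → E3} {e : Fin 3 → E8 → E3} {F : Fin 8 → E8 → E8}

theorem embeddingSystem_zero : embeddingSystem g v x ρ e 0 = adaptedCoframe g v x ρ e 4 := rfl

theorem embeddingSystem_one : embeddingSystem g v x ρ e 1
    = fun y => adaptedCoframe g v x ρ e 2 y - adaptedCoframe g v x ρ e 0 y := rfl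

theorem embeddingSystem_two : embeddingSystem g v x ρ e 2
    = fun y => adaptedCoframe g v x ρ e 3 y - adaptedCoframe g v x ρ e 1 y := rfl

theorem embeddingSystem_three : embeddingSystem g v x ρ e 3
    = fun y => adaptedCoframe g v x ρ e 5 y - (structFun g v 0 (x y) • adaptedCoframe g v x ρ e 0 y
      + structFun g v 1 (x y) • adaptedCoframe g v x ρ e 1 y) := rfl

theorem smooth_etaConn (hv : IsOrthonormalFrameOn g v U) (hU : IsOpen U)
    (hc : IsLocalCoords U O x ρ e) : ContDiffOn ℝ ∞ (etaConn g v x) O := by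
  have h : ∀ i, ContDiffOn ℝ ∞ (fun y => structFun g v i (x y)) O := fun i =>
    (hc.contDiffOn_comp (hv.smooth_structFun hU i)).mono fun y hy => ⟨hy, hc.mapsTo hy⟩
  exact ((h 0).smul (smooth_etaForm hv hU hc 0)).add ((h 1).smul (smooth_etaForm hv hU hc 1))

theorem differentiableAt_embeddingSystem (hv : IsOrthonormalFrameOn g v U) (hU : IsOpen U)
    (hc : IsLocalCoords U O x ρ e) (hF : IsCoframeOn (adaptedCoframe g v x ρ e) F O) {y : E8}
    (hy : y ∈ O) (i : Fin 4) : DifferentiableAt ℝ (embeddingSystem g v x ρ e i) y := by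
  have h : ∀ A, DifferentiableAt ℝ (adaptedCoframe g v x ρ e A) y := fun A =>
    differentiableAt_of_contDiffOn (hF.smooth_coframe A) hF.isOpen hy
  fin_cases i
  exacts [h 4, (h 2).sub (h 0), (h 3).sub (h 1),
    (h 5).sub (differentiableAt_of_contDiffOn (smooth_etaConn hv hU hc) hc.isOpen hy)]

/-- The horizontal vectors `X₁ = (η¹ = 1, ω¹ = 1, ω¹₂ = c₁, ω³₂ = κ)`. -/
def hor0 (c κ : 𝕜) : Fin 8 → 𝕜 := ![1, 0, 1, 0, 0, c, 0, κ]

/-- The horizontal vectors `X₂ = (η² = 1, ω² = 1, ω¹₂ = c₂, ω³₁ = -κ)`. -/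
def hor1 (c κ : 𝕜) : Fin 8 → 𝕜 := ![0, 1, 0, 1, 0, c, -κ, 0]

theorem pair_embeddingSystem (hF : IsCoframeOn (adaptedCoframe g v x ρ e) F O) {y : E8}
    (hy : y ∈ O) (i : Fin 4) (z : Fin 8 → 𝕜) :
    pair F y (extendScalars 𝕜 (embeddingSystem g v x ρ e) i y) z
      = (![z 4, z 2 - z 0, z 3 - z 1,
        z 5 - (structFun g v 0 (x y) : 𝕜) * z 0 - (structFun g v 1 (x y) : 𝕜) * z 1] :
          Fin 4 → 𝕜) i := by
  have h : ∀ A, ∑ B, z B * ((adaptedCoframe g v x ρ e A y (F B y) : ℝ) : 𝕜) = z A := fun A => by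
    simp [hF.dual y hy]
  simp only [pair, extendScalars, ContinuousLinearMap.comp_apply, RCLike.ofRealCLM_apply]
  fin_cases i
  · exact h 4
  · rw [← h 2, ← h 0]
    simp [embeddingSystem_one, mul_sub, Finset.sum_sub_distrib]
  · rw [← h 3, ← h 1]
    simp [embeddingSystem_two, mul_sub, Finset.sum_sub_distrib]
  · change ∑ B, z B * ((embeddingSystem g v x ρ e 3 y (F B y) : ℝ) : 𝕜)
      = z 5 - (structFun g v 0 (x y) : 𝕜) * z 0 - (structFun g v 1 (x y) : 𝕜) * z 1
    rw [← h 5, ← h 0, ← h 1]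
    simp only [embeddingSystem_three, Finset.mul_sum, sub_apply, add_apply,
      smul_apply, smul_eq_mul, ← Finset.sum_sub_distrib]
    exact Finset.sum_congr rfl fun B _ => by push_cast; ring

theorem linearIndependent_embeddingSystem (hF : IsCoframeOn (adaptedCoframe g v x ρ e) F O) {y : E8}
    (hy : y ∈ O) :
    LinearIndependent 𝕜 fun i => extendScalars 𝕜 (embeddingSystem g v x ρ e) i y := by
  rw [Fintype.linearIndependent_iff]
  intro c hc
  have key : ∀ z : Fin 8 → 𝕜, c 0 * z 4 + c 1 * (z 2 - z 0) + c 2 * (z 3 - z 1)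
      + c 3 * (z 5 - (structFun g v 0 (x y) : 𝕜) * z 0 - (structFun g v 1 (x y) : 𝕜) * z 1) = 0 := by
    intro z
    have h1 := congrArg (fun a => pair F y a z) hc
    simp only [Fin.sum_univ_four, pair_add, pair_smul, pair_zero, pair_embeddingSystem hF hy] at h1
    exact h1
  -- The vectors dual to `ω³, ω¹, ω², ω¹₂` each detect exactly one of the four generators.
  have k4 := key (Pi.single 4 1)
  have k2 := key (Pi.single 2 1)
  have k3 := key (Pi.single 3 1)
  have k5 := key (Pi.single 5 1)
  simp at k4 k2 k3 k5
  intro i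
  fin_cases i
  exacts [k4, k2, k3, k5]

/-- The generators of degree two on the vectors annihilated by the generators of degree one. -/
theorem pfaff2_embeddingSystem (hv : IsOrthonormalFrameOn g v U) (hU : IsOpen U)
    (hc : IsLocalCoords U O x ρ e) (hF : IsCoframeOn (adaptedCoframe g v x ρ e) F O) {y : E8}
    (hy : y ∈ O) :
    (∀ τ ∈ pfaff2 (extendScalars 𝕜 (embeddingSystem g v x ρ e)) y, ∃ s t : 𝕜,
      pair2 F y τ (hor0 (structFun g v 0 (x y) : 𝕜) 0) (hor1 (structFun g v 1 (x y) : 𝕜) 0)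
        = -(gaussCurv g v (x y) : 𝕜) * t ∧
      pair2 F y τ (hor0 (structFun g v 0 (x y) : 𝕜) 0) (Pi.single 6 1) = s ∧
      pair2 F y τ (hor0 (structFun g v 0 (x y) : 𝕜) 0) (Pi.single 7 1) = 0 ∧
      pair2 F y τ (hor1 (structFun g v 1 (x y) : 𝕜) 0) (Pi.single 6 1) = 0 ∧
      pair2 F y τ (hor1 (structFun g v 1 (x y) : 𝕜) 0) (Pi.single 7 1) = s ∧
      pair2 F y τ (Pi.single 6 1) (Pi.single 7 1) = t) ∧
    (∀ s t : 𝕜, ∃ τ ∈ pfaff2 (extendScalars 𝕜 (embeddingSystem g v x ρ e)) y,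
      pair2 F y τ (hor0 (structFun g v 0 (x y) : 𝕜) 0) (Pi.single 6 1) = s ∧
      pair2 F y τ (Pi.single 6 1) (Pi.single 7 1) = t) := by
  have hd := differentiableAt_embeddingSystem hv hU hc hF hy
  have hdc : ∀ A, DifferentiableAt ℝ (adaptedCoframe g v x ρ e A) y := fun A =>
    differentiableAt_of_contDiffOn (hF.smooth_coframe A) hF.isOpen hy
  have hw := fun i j (z z' : Fin 8 → 𝕜) => hF.rpair2_wedge hy i j z z'
  -- The four exterior derivatives in components. On the test vectors only the first and the last
  -- survive; in the middle two the structure functions cancel.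
  have k0 : ∀ z z' : Fin 8 → 𝕜, pair2 F y (extD (extendScalars 𝕜 (embeddingSystem g v x ρ e) 0) y)
      z z' = -(z 6 * z' 2 - z 2 * z' 6) - (z 7 * z' 3 - z 3 * z' 7) := fun z z' => by
    rw [pair2_extendScalars _ _ (hd 0), embeddingSystem_zero,
      extD_adaptedCoframe hv hU hc hy 4]
    simp only [Matrix.cons_val]
    rw [rpair2_sub, rpair2_neg, hw, hw]
  have k1 : ∀ z z' : Fin 8 → 𝕜, pair2 F y (extD (extendScalars 𝕜 (embeddingSystem g v x ρ e) 1) y)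
      z z' = (z 6 * z' 4 - z 4 * z' 6) - (z 5 * z' 3 - z 3 * z' 5)
        + (structFun g v 0 (x y) : 𝕜) * (z 0 * z' 1 - z 1 * z' 0) := fun z z' => by
    rw [pair2_extendScalars _ _ (hd 1), embeddingSystem_one, extD_sub (hdc 2) (hdc 0),
      extD_adaptedCoframe hv hU hc hy 2, extD_adaptedCoframe hv hU hc hy 0]
    simp only [Matrix.cons_val]
    rw [rpair2_sub, rpair2_sub, rpair2_smul, hw, hw, hw]
    push_cast
    ring
  have k2 : ∀ z z' : Fin 8 → 𝕜, pair2 F y (extD (extendScalars 𝕜 (embeddingSystem g v x ρ e) 2) y)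
      z z' = (z 5 * z' 2 - z 2 * z' 5) + (z 7 * z' 4 - z 4 * z' 7)
        + (structFun g v 1 (x y) : 𝕜) * (z 0 * z' 1 - z 1 * z' 0) := fun z z' => by
    rw [pair2_extendScalars _ _ (hd 2), embeddingSystem_two, extD_sub (hdc 3) (hdc 1),
      extD_adaptedCoframe hv hU hc hy 3, extD_adaptedCoframe hv hU hc hy 1]
    simp only [Matrix.cons_val]
    rw [rpair2_sub, rpair2_add, rpair2_smul, hw, hw, hw]
    push_cast
    ring
  have k3 : ∀ z z' : Fin 8 → 𝕜, pair2 F y (extD (extendScalars 𝕜 (embeddingSystem g v x ρ e) 3) y)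
      z z' = (z 6 * z' 7 - z 7 * z' 6)
        - (gaussCurv g v (x y) : 𝕜) * (z 0 * z' 1 - z 1 * z' 0) := fun z z' => by
    have h1 : embeddingSystem g v x ρ e 3
        = fun y => adaptedCoframe g v x ρ e 5 y - etaConn g v x y := rfl
    rw [pair2_extendScalars _ _ (hd 3), h1, extD_sub (hdc 5)
      (differentiableAt_of_contDiffOn (smooth_etaConn hv hU hc) hc.isOpen hy),
      extD_adaptedCoframe hv hU hc hy 5, extD_etaConn hv hU hc hy]
    simp only [Matrix.cons_val]
    rw [rpair2_sub, rpair2_smul, hw]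
    congr 2
    exact hw 0 1 z z'
  have h4 : ∀ z : Fin 8 → 𝕜, (z 4 = 0 ∧ z 2 = z 0 ∧ z 3 = z 1 ∧
      z 5 = (structFun g v 0 (x y) : 𝕜) * z 0 + (structFun g v 1 (x y) : 𝕜) * z 1) →
      ∀ a ∈ spanForms (extendScalars 𝕜 (embeddingSystem g v x ρ e)) y, pair F y a z = 0 := by
    rintro z ⟨e4, e2, e3, e5⟩ a ha
    refine pair_span ?_ ha
    rintro _ ⟨i, rfl⟩
    dsimp only
    rw [pair_embeddingSystem hF hy]
    fin_cases i <;> simp [e4, e2, e3, e5]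
  have i0 := h4 (hor0 (structFun g v 0 (x y) : 𝕜) 0) (by simp [hor0])
  have i1 := h4 (hor1 (structFun g v 1 (x y) : 𝕜) 0) (by simp [hor1])
  have i6 := h4 (Pi.single 6 1) (by simp)
  have i7 := h4 (Pi.single 7 1) (by simp)
  refine ⟨fun τ hτ => ?_, fun s t => ?_⟩
  · obtain ⟨τ1, h1, τ2, h2, rfl⟩ := Submodule.mem_sup.1 hτ
    obtain ⟨c, rfl⟩ := (Submodule.mem_span_range_iff_exists_fun 𝕜).1 h2
    refine ⟨c 0, c 3, ?_⟩
    simp only [Fin.sum_univ_four, pair2_add, pair2_smul, k0, k1, k2, k3, pair2_ideal2 i0 i1 h1,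
      pair2_ideal2 i0 i6 h1, pair2_ideal2 i0 i7 h1, pair2_ideal2 i1 i6 h1, pair2_ideal2 i1 i7 h1,
      pair2_ideal2 i6 i7 h1]
    simp [hor0, hor1]
    ring
  · refine ⟨s • extD (extendScalars 𝕜 (embeddingSystem g v x ρ e) 0) y
      + t • extD (extendScalars 𝕜 (embeddingSystem g v x ρ e) 3) y,
      Submodule.mem_sup_right (Submodule.add_mem _ (Submodule.smul_mem _ _ (Submodule.subset_span
        ⟨0, rfl⟩)) (Submodule.smul_mem _ _ (Submodule.subset_span ⟨3, rfl⟩))), ?_⟩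
    simp only [pair2_add, pair2_smul, k0, k3]
    simp [hor0]

end Decomposition

/-! ### The common kernel of a singular system -/

section SingularKernel

variable {𝕜 : Type*} [RCLike 𝕜]
variable {M : Type*} [TopologicalSpace M] [ChartedSpace (EuclideanSpace ℝ (Fin 2)) M]
  [IsManifold (𝓡 2) ∞ M]
  {g : Metric2 M} {v : Fin 2 → (x : M) → TangentSpace (𝓡 2) x} {U : Set M}
  {O : Set E8} {x : E8 → M} {ρ : E8 → E3} {e : Fin 3 → E8 → E3} {F : Fin 8 → E8 → E8}

theorem pair_hor0 (y : E8) (a : E8 →L[ℝ] 𝕜) (c κ : 𝕜) :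
    pair F y a (hor0 c κ) = pair F y a (hor0 c 0) + κ * pair F y a (Pi.single 7 1) := by
  simp [pair, hor0, Fin.sum_univ_eight]

theorem pair_hor1 (y : E8) (a : E8 →L[ℝ] 𝕜) (c κ : 𝕜) :
    pair F y a (hor1 c κ) = pair F y a (hor1 c 0) - κ * pair F y a (Pi.single 6 1) := by
  simp [pair, hor1, Fin.sum_univ_eight]
  ring

/-- The 2-covectors of `Λ² ⟨σ⟩` among the generators of degree two. -/
theorem wedge_values {m : ℕ} (hv : IsOrthonormalFrameOn g v U) (hU : IsOpen U)
    (hc : IsLocalCoords U O x ρ e) (hF : IsCoframeOn (adaptedCoframe g v x ρ e) F O) {y : E8}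
    (hy : y ∈ O) {σ : Fin 2 → E8 → E8 →L[ℝ] 𝕜} {Ω : Fin m → E8 → E8 →L[ℝ] E8 →L[ℝ] 𝕜}
    (hΩ : ∀ i, Ω i y ∈ lambda2 (spanForms σ y))
    (hΩ' : ∀ i, Ω i y ∈ pfaff2 (extendScalars 𝕜 (embeddingSystem g v x ρ e)) y)
    (h0 : ∃ i, Ω i y ≠ 0) : ∃ s t : 𝕜,
      pair2 F y (wedge (σ 0 y) (σ 1 y)) (hor0 (structFun g v 0 (x y) : 𝕜) 0)
        (hor1 (structFun g v 1 (x y) : 𝕜) 0) = -(gaussCurv g v (x y) : 𝕜) * t ∧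
      pair2 F y (wedge (σ 0 y) (σ 1 y)) (hor0 (structFun g v 0 (x y) : 𝕜) 0) (Pi.single 6 1) = s ∧
      pair2 F y (wedge (σ 0 y) (σ 1 y)) (hor0 (structFun g v 0 (x y) : 𝕜) 0) (Pi.single 7 1) = 0 ∧
      pair2 F y (wedge (σ 0 y) (σ 1 y)) (hor1 (structFun g v 1 (x y) : 𝕜) 0) (Pi.single 6 1) = 0 ∧
      pair2 F y (wedge (σ 0 y) (σ 1 y)) (hor1 (structFun g v 1 (x y) : 𝕜) 0) (Pi.single 7 1) = s ∧
      pair2 F y (wedge (σ 0 y) (σ 1 y)) (Pi.single 6 1) (Pi.single 7 1) = t ∧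
      s ^ 2 = -(gaussCurv g v (x y) : 𝕜) * t ^ 2 := by
  obtain ⟨i, hi⟩ := h0
  obtain ⟨c, hc'⟩ := mem_lambda2_two (hΩ i)
  have hc0 : c ≠ 0 := by
    rintro rfl
    exact hi (by rw [hc']; ext u w; simp)
  obtain ⟨s, t, e1, e2, e3, e4, e5, e6⟩ := (pfaff2_embeddingSystem hv hU hc hF hy).1 _ (hΩ' i)
  rw [hc', pair2_smul] at e1 e2 e3 e4 e5 e6
  have f1 : ∀ {a b : 𝕜}, c * a = b → a = c⁻¹ * b := fun h => by
    rw [← h, inv_mul_cancel_left₀ hc0]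
  have g1 := f1 e1
  have g2 := f1 e2
  have g3 := f1 e3
  have g4 := f1 e4
  have g5 := f1 e5
  have g6 := f1 e6
  refine ⟨c⁻¹ * s, c⁻¹ * t, by rw [g1]; ring, g2, by rw [g3, mul_zero], by rw [g4, mul_zero], g5, g6,
    ?_⟩
  rw [mul_zero] at g3 g4
  simp only [pair_wedge] at g1 g2 g3 g4 g5 g6
  generalize pair F y (σ 0 y) (hor0 (structFun g v 0 (x y) : 𝕜) 0) = a0 at *
  generalize pair F y (σ 1 y) (hor0 (structFun g v 0 (x y) : 𝕜) 0) = b0 at *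
  generalize pair F y (σ 0 y) (hor1 (structFun g v 1 (x y) : 𝕜) 0) = a1 at *
  generalize pair F y (σ 1 y) (hor1 (structFun g v 1 (x y) : 𝕜) 0) = b1 at *
  generalize pair F y (σ 0 y) (Pi.single 6 1) = a6 at *
  generalize pair F y (σ 1 y) (Pi.single 6 1) = b6 at *
  generalize pair F y (σ 0 y) (Pi.single 7 1) = a7 at *
  generalize pair F y (σ 1 y) (Pi.single 7 1) = b7 at *
  -- The Plücker relation for the six minors of the decomposable form. With the values found above
  -- it becomes `s² = -K t²`.
  have P : (a0 * b1 - b0 * a1) * (a6 * b7 - b6 * a7) - (a0 * b6 - b0 * a6) * (a1 * b7 - b1 * a7)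
      + (a0 * b7 - b0 * a7) * (a1 * b6 - b1 * a6) = 0 := by ring
  rw [g1, g2, g3, g4, g5, g6] at P
  linear_combination -P

/-- The forms of a singular system annihilate two horizontal fields. -/
theorem IsDecompositionOn.annihilates (hv : IsOrthonormalFrameOn g v U) (hU : IsOpen U)
    (hc : IsLocalCoords U O x ρ e) (hF : IsCoframeOn (adaptedCoframe g v x ρ e) F O)
    {r p q s t : ℕ}
    {θ : Fin r → E8 → E8 →L[ℝ] 𝕜} {σ : Fin p → E8 → E8 →L[ℝ] 𝕜} {σ' : Fin q → E8 → E8 →L[ℝ] 𝕜}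
    {Ω : Fin s → E8 → E8 →L[ℝ] E8 →L[ℝ] 𝕜} {Ω' : Fin t → E8 → E8 →L[ℝ] E8 →L[ℝ] 𝕜} {O' : Set E8}
    (hd : IsDecompositionOn (extendScalars 𝕜 (embeddingSystem g v x ρ e)) θ σ σ' Ω Ω' O') {y : E8}
    (hy : y ∈ O) (hy' : y ∈ O') :
    gaussCurv g v (x y) ≠ 0 ∧ Module.finrank 𝕜 (spanForms (Fin.append θ σ) y) = 6 ∧
    ∃ κ : 𝕜, κ ^ 2 = -(gaussCurv g v (x y) : 𝕜) ∧
      (∀ a ∈ spanForms (Fin.append θ σ') y,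
        pair F y a (hor0 (structFun g v 0 (x y) : 𝕜) κ) = 0 ∧
        pair F y a (hor1 (structFun g v 1 (x y) : 𝕜) κ) = 0) ∧
      ∃ j, pair F y (σ' j y) (Pi.single 7 1) ≠ 0 := by
  obtain ⟨hfin, h8⟩ := hF.finrank_dual (𝕜 := 𝕜) hy
  obtain ⟨rfl, rfl, rfl⟩ := hd.type_eq hy' h8 (linearIndependent_embeddingSystem hF hy)
  have hrank : Module.finrank 𝕜 (spanForms (Fin.append θ σ) y) = 6 := by
    have h1 := (hd.linearIndependent y hy').comp (Fin.castAdd 2) (Fin.castAdd_injective _ _)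
    have h2 := finrank_span_eq_card h1
    have h3 : spanForms (Fin.append θ σ) y = Submodule.span 𝕜 (Set.range
        ((Fin.append (Fin.append (fun i => θ i y) fun i => σ i y) fun i => σ' i y)
          ∘ Fin.castAdd 2)) := by
      unfold spanForms
      congr 2
      ext1 i
      rw [Function.comp_apply, Fin.append_left]
      refine Fin.addCases (fun i => ?_) (fun i => ?_) i <;> simp
    rw [h3, h2, Fintype.card_fin]
  set H0 : Fin 8 → 𝕜 := hor0 (structFun g v 0 (x y) : 𝕜) 0 with hH0
  set H1 : Fin 8 → 𝕜 := hor1 (structFun g v 1 (x y) : 𝕜) 0 with hH1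
  have hϑ : ∀ z : Fin 8 → 𝕜, z 4 = 0 → z 2 = z 0 → z 3 = z 1 →
      z 5 = (structFun g v 0 (x y) : 𝕜) * z 0 + (structFun g v 1 (x y) : 𝕜) * z 1 →
      ∀ a ∈ spanForms θ y, pair F y a z = 0 := by
    intro z e4 e2 e3 e5 a ha
    rw [← hd.deg1 y hy'] at ha
    refine pair_span ?_ ha
    rintro _ ⟨i, rfl⟩
    dsimp only
    rw [pair_embeddingSystem hF hy]
    fin_cases i <;> simp [e4, e2, e3, e5]
  have i0 := hϑ H0 (by simp [hH0, hor0]) (by simp [hH0, hor0]) (by simp [hH0, hor0])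
    (by simp [hH0, hor0])
  have i6 := hϑ (Pi.single 6 1) (by simp) (by simp) (by simp) (by simp)
  have i7 := hϑ (Pi.single 7 1) (by simp) (by simp) (by simp) (by simp)
  have hΩp : ∀ i, Fin.append Ω Ω' i y ∈ pfaff2 (extendScalars 𝕜 (embeddingSystem g v x ρ e)) y := by
    intro i
    rw [hd.deg2 y hy']
    exact Submodule.mem_sup_right (Submodule.subset_span ⟨i, rfl⟩)
  have hatt := (pfaff2_embeddingSystem (𝕜 := 𝕜) hv hU hc hF hy).2
  rw [← hH0] at hatt
  choose cΩ hcΩ using fun i => mem_lambda2_two (hd.Omega_mem y hy' i)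
  choose cΩ' hcΩ' using fun i => mem_lambda2_two (hd.Omega'_mem y hy' i)
  -- On pairs of vectors killed by `θ`, every generator of degree two acts as a combination of the
  -- two decomposable forms, with coefficients that serve both test pairs. A coefficient is recorded
  -- to vanish when its family vanishes at `y`, which is used below to exclude that case.
  have hform : ∀ τ ∈ pfaff2 (extendScalars 𝕜 (embeddingSystem g v x ρ e)) y, ∃ l l' : 𝕜,
      ((∀ i, Ω i y = 0) → l = 0) ∧ ((∀ i, Ω' i y = 0) → l' = 0) ∧
      pair2 F y τ H0 (Pi.single 6 1) = l * pair2 F y (wedge (σ 0 y) (σ 1 y)) H0 (Pi.single 6 1)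
        + l' * pair2 F y (wedge (σ' 0 y) (σ' 1 y)) H0 (Pi.single 6 1) ∧
      pair2 F y τ (Pi.single 6 1) (Pi.single 7 1)
        = l * pair2 F y (wedge (σ 0 y) (σ 1 y)) (Pi.single 6 1) (Pi.single 7 1)
        + l' * pair2 F y (wedge (σ' 0 y) (σ' 1 y)) (Pi.single 6 1) (Pi.single 7 1) := by
    intro τ hτ
    rw [hd.deg2 y hy'] at hτ
    obtain ⟨τ1, h1, τ2, h2, rfl⟩ := Submodule.mem_sup.1 hτ
    simp only [pair2_add, pair2_ideal2 i0 i6 h1, pair2_ideal2 i6 i7 h1, zero_add]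
    clear hτ
    induction h2 using Submodule.span_induction with
    | mem a ha =>
      obtain ⟨i, rfl⟩ := ha
      dsimp only
      refine Fin.addCases (fun i => ?_) (fun i => ?_) i
      · rw [Fin.append_left]
        by_cases hz : Ω i y = 0
        · exact ⟨0, 0, fun _ => rfl, fun _ => rfl, by rw [hz, pair2_zero]; ring,
            by rw [hz, pair2_zero]; ring⟩
        · exact ⟨cΩ i, 0, fun h => (hz (h i)).elim, fun _ => rfl,
            by rw [hcΩ, pair2_smul]; ring, by rw [hcΩ, pair2_smul]; ring⟩
      · rw [Fin.append_right]
        by_cases hz : Ω' i y = 0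
        · exact ⟨0, 0, fun _ => rfl, fun _ => rfl, by rw [hz, pair2_zero]; ring,
            by rw [hz, pair2_zero]; ring⟩
        · exact ⟨0, cΩ' i, fun _ => rfl, fun h => (hz (h i)).elim,
            by rw [hcΩ', pair2_smul]; ring, by rw [hcΩ', pair2_smul]; ring⟩
    | zero => exact ⟨0, 0, fun _ => rfl, fun _ => rfl, by rw [pair2_zero]; ring,
        by rw [pair2_zero]; ring⟩
    | add a b _ _ ha hb =>
      obtain ⟨l, l', h1, h2, h3, h4⟩ := ha
      obtain ⟨m, m', k1, k2, k3, k4⟩ := hb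
      exact ⟨l + m, l' + m', fun h => by rw [h1 h, k1 h, add_zero],
        fun h => by rw [h2 h, k2 h, add_zero], by rw [pair2_add, h3, k3]; ring,
        by rw [pair2_add, h4, k4]; ring⟩
    | smul c a _ ha =>
      obtain ⟨l, l', h1, h2, h3, h4⟩ := ha
      exact ⟨c * l, c * l', fun h => by rw [h1 h, mul_zero],
        fun h => by rw [h2 h, mul_zero], by rw [pair2_smul, h3]; ring,
        by rw [pair2_smul, h4]; ring⟩
  -- The value vectors `(1, 0)` and `(0, 1)` are both attained. Multiplicativity of determinants
  -- then shows that neither family vanishes at `y` and that the value vectors `(s, t)` of the two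
  -- decomposable forms are independent.
  obtain ⟨τ, hτ, hτ1, hτ2⟩ := hatt 1 0
  obtain ⟨τ', hτ', hτ1', hτ2'⟩ := hatt 0 1
  obtain ⟨l, l', h1, h2, h3, h4⟩ := hform τ hτ
  obtain ⟨m, m', k1, k2, k3, k4⟩ := hform τ' hτ'
  rw [hτ1] at h3
  rw [hτ2] at h4
  rw [hτ1'] at k3
  rw [hτ2'] at k4
  have hdet : (l * m' - l' * m) * (pair2 F y (wedge (σ 0 y) (σ 1 y)) H0 (Pi.single 6 1)
      * pair2 F y (wedge (σ' 0 y) (σ' 1 y)) (Pi.single 6 1) (Pi.single 7 1)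
      - pair2 F y (wedge (σ' 0 y) (σ' 1 y)) H0 (Pi.single 6 1)
      * pair2 F y (wedge (σ 0 y) (σ 1 y)) (Pi.single 6 1) (Pi.single 7 1)) = 1 := by
    generalize pair2 F y (wedge (σ 0 y) (σ 1 y)) H0 (Pi.single 6 1) = a at *
    generalize pair2 F y (wedge (σ' 0 y) (σ' 1 y)) H0 (Pi.single 6 1) = a' at *
    generalize pair2 F y (wedge (σ 0 y) (σ 1 y)) (Pi.single 6 1) (Pi.single 7 1) = b at *
    generalize pair2 F y (wedge (σ' 0 y) (σ' 1 y)) (Pi.single 6 1) (Pi.single 7 1) = b' at *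
    calc (l * m' - l' * m) * (a * b' - a' * b)
        = (l * a + l' * a') * (m * b + m' * b') - (l * b + l' * b') * (m * a + m' * a') := by ring
      _ = 1 := by rw [← h3, ← h4, ← k3, ← k4]; ring
  have hΩ0 : ∃ i, Ω i y ≠ 0 := by
    by_contra! h
    rw [h1 h, k1 h] at hdet
    simp at hdet
  have hΩ0' : ∃ i, Ω' i y ≠ 0 := by
    by_contra! h
    rw [h2 h, k2 h] at hdet
    simp at hdet
  obtain ⟨a, b, -, e2, -, -, -, e6, e7⟩ := wedge_values hv hU hc hF hy (hd.Omega_mem y hy')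
    (fun i => by simpa using hΩp (Fin.castAdd _ i)) hΩ0
  obtain ⟨a', b', f1, f2, f3, f4, f5, f6, f7⟩ := wedge_values hv hU hc hF hy (hd.Omega'_mem y hy')
    (fun i => by simpa using hΩp (Fin.natAdd _ i)) hΩ0'
  rw [← hH0] at e2 f1 f2 f3
  rw [← hH1] at f1 f4 f5
  rw [e2, e6, f2, f6] at hdet
  have hb' : b' ≠ 0 := by
    rintro rfl
    have : a' = 0 := by simpa using f7
    rw [this] at hdet
    simp at hdet
  -- For `K = 0` the relation `s² = -K t²` makes `s = 0` for both forms, which contradicts their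
  -- independence.
  have hK : gaussCurv g v (x y) ≠ 0 := by
    intro hK
    have z1 : a = 0 := by simpa [hK] using e7
    have z2 : a' = 0 := by simpa [hK] using f7
    rw [z1, z2] at hdet
    simp at hdet
  -- With `κ = s' / t'` the horizontal vectors contract to zero with `σ'₀ ∧ σ'₁` against both
  -- vertical directions `6` and `7`.
  refine ⟨hK, hrank, a' / b', ?_, ?_, ?_⟩
  · rw [div_pow, f7]
    field_simp
  · simp only [pair_wedge] at f1 f2 f3 f4 f5 f6
    -- Because `t' ≠ 0`, the two forms `σ'` restrict to independent forms on the span of the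
    -- directions `6` and `7`. A vector whose contractions with `σ'₀ ∧ σ'₁` vanish there is
    -- therefore annihilated by both of them.
    have c1 : ∀ {u w a6 a7 b6 b7 : 𝕜}, a6 * b7 - b6 * a7 = b' → u * b6 - w * a6 = 0 →
        u * b7 - w * a7 = 0 → u = 0 ∧ w = 0 := by
      intro u w a6 a7 b6 b7 h1 h2 h3
      constructor
      · refine (mul_eq_zero.1 (?_ : u * b' = 0)).resolve_right hb'
        rw [← h1]; linear_combination a6 * h3 - a7 * h2
      · refine (mul_eq_zero.1 (?_ : w * b' = 0)).resolve_right hb'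
        rw [← h1]; linear_combination b6 * h3 - b7 * h2
    have hκ : a' / b' * b' = a' := div_mul_cancel₀ a' hb'
    have c2 := c1 (u := pair F y (σ' 0 y) (hor0 (structFun g v 0 (x y) : 𝕜) (a' / b')))
      (w := pair F y (σ' 1 y) (hor0 (structFun g v 0 (x y) : 𝕜) (a' / b'))) f6
      (by rw [pair_hor0, pair_hor0 (a := σ' 1 y), ← hH0]
          linear_combination f2 - a' / b' * f6 - hκ)
      (by rw [pair_hor0, pair_hor0 (a := σ' 1 y), ← hH0]; linear_combination f3)
    have c3 := c1 (u := pair F y (σ' 0 y) (hor1 (structFun g v 1 (x y) : 𝕜) (a' / b')))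
      (w := pair F y (σ' 1 y) (hor1 (structFun g v 1 (x y) : 𝕜) (a' / b'))) f6
      (by rw [pair_hor1, pair_hor1 (a := σ' 1 y), ← hH1]; linear_combination f4)
      (by rw [pair_hor1, pair_hor1 (a := σ' 1 y), ← hH1]
          linear_combination f5 - a' / b' * f6 - hκ)
    intro a ha
    rw [spanForms_append] at ha
    obtain ⟨a1, h1, a2, h2, rfl⟩ := Submodule.mem_sup.1 ha
    rw [pair_add, pair_add, hϑ _ (by simp [hor0]) (by simp [hor0]) (by simp [hor0])
      (by simp [hor0]) a1 h1, hϑ _ (by simp [hor1]) (by simp [hor1]) (by simp [hor1])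
      (by simp [hor1]) a1 h1, zero_add, zero_add]
    refine ⟨pair_span ?_ h2, pair_span ?_ h2⟩
    · rintro _ ⟨j, rfl⟩
      fin_cases j
      exacts [c2.1, c2.2]
    · rintro _ ⟨j, rfl⟩
      fin_cases j
      exacts [c3.1, c3.2]
  · simp only [pair_wedge] at f6
    by_contra! h
    rw [h 0, h 1] at f6
    exact hb' (by rw [← f6]; ring)

end SingularKernel

/-! ### Brackets of lifted sections -/

section Holonomy

variable {M : Type*} [TopologicalSpace M] [ChartedSpace (EuclideanSpace ℝ (Fin 2)) M]
  [IsManifold (𝓡 2) ∞ M]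
  {g : Metric2 M} {v : Fin 2 → (x : M) → TangentSpace (𝓡 2) x} {U : Set M}

/-- The coefficients `∂ᵢK / (4K)`. -/
def logGrad (g : Metric2 M) (v : Fin 2 → (x : M) → TangentSpace (𝓡 2) x) (i : Fin 2) (x : M) : ℝ :=
  dirDeriv (v i) (gaussCurv g v) x / (4 * gaussCurv g v x)

/-- The covariant derivative of a vertical section in the direction `v₁`. -/
def covDeriv0 (g : Metric2 M) (v : Fin 2 → (x : M) → TangentSpace (𝓡 2) x) (ζ : Fin 6 → M → ℝ) :
    Fin 6 → M → ℝ :=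
  ![fun x => dirDeriv (v 0) (ζ 0) x + structFun g v 0 x * ζ 1 x,
    fun x => dirDeriv (v 0) (ζ 1) x - structFun g v 0 x * ζ 0 x + ζ 3 x + gaussCurv g v x * ζ 2 x,
    fun x => dirDeriv (v 0) (ζ 2) x + 2 * logGrad g v 0 x * ζ 2 x - ζ 4 x + ζ 1 x,
    fun x => dirDeriv (v 0) (ζ 3) x - gaussCurv g v x * ζ 4 x,
    fun x => dirDeriv (v 0) (ζ 4) x + 2 * logGrad g v 0 x * ζ 4 x - ζ 3 x
      + structFun g v 0 x * ζ 5 x,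
    fun x => dirDeriv (v 0) (ζ 5) x + 2 * logGrad g v 0 x * ζ 5 x - structFun g v 0 x * ζ 4 x]

/-- The covariant derivative of a vertical section in the direction `v₂`. -/
def covDeriv1 (g : Metric2 M) (v : Fin 2 → (x : M) → TangentSpace (𝓡 2) x) (ζ : Fin 6 → M → ℝ) :
    Fin 6 → M → ℝ :=
  ![fun x => dirDeriv (v 1) (ζ 0) x + structFun g v 1 x * ζ 1 x - ζ 3 x - gaussCurv g v x * ζ 2 x,
    fun x => dirDeriv (v 1) (ζ 1) x - structFun g v 1 x * ζ 0 x,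
    fun x => dirDeriv (v 1) (ζ 2) x + 2 * logGrad g v 1 x * ζ 2 x - ζ 0 x - ζ 5 x,
    fun x => dirDeriv (v 1) (ζ 3) x - gaussCurv g v x * ζ 5 x,
    fun x => dirDeriv (v 1) (ζ 4) x + 2 * logGrad g v 1 x * ζ 4 x + structFun g v 1 x * ζ 5 x,
    fun x => dirDeriv (v 1) (ζ 5) x + 2 * logGrad g v 1 x * ζ 5 x - ζ 3 x
      - structFun g v 1 x * ζ 4 x]

/-- The curvature of the horizontal distribution. -/
def curvSection (g : Metric2 M) (v : Fin 2 → (x : M) → TangentSpace (𝓡 2) x) : Fin 6 → M → ℝ :=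
  ![fun _ => 0, fun _ => 0, fun _ => 1, gaussCurv g v, fun x => -logGrad g v 0 x,
    fun x => -logGrad g v 1 x]

/-- The vertical sections generated by the curvature under covariant differentiation. -/
inductive HolSec (g : Metric2 M) (v : Fin 2 → (x : M) → TangentSpace (𝓡 2) x) (U : Set M) :
    (Fin 6 → M → ℝ) → Prop
  | curv : HolSec g v U (curvSection g v)
  | deriv0 {ζ : Fin 6 → M → ℝ} : HolSec g v U ζ → HolSec g v U (covDeriv0 g v ζ)
  | deriv1 {ζ : Fin 6 → M → ℝ} : HolSec g v U ζ → HolSec g v U (covDeriv1 g v ζ)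
  | lincomb {ζ ζ' : Fin 6 → M → ℝ} {f f' : M → ℝ} : SmoothOn f U → SmoothOn f' U →
      HolSec g v U ζ → HolSec g v U ζ' → HolSec g v U (fun i x => f x * ζ i x + f' x * ζ' i x)
  | congr {ζ ζ' : Fin 6 → M → ℝ} : HolSec g v U ζ → (∀ i, ∀ x ∈ U, ζ' i x = ζ i x) →
      HolSec g v U ζ'

theorem SmoothOn.div' {f h : M → ℝ} {W : Set M} (hf : SmoothOn f W) (hh : SmoothOn h W)
    (h0 : ∀ x ∈ W, h x ≠ 0) : SmoothOn (fun x => f x / h x) W := fun x hx =>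
  (contDiffAt_fst.div contDiffAt_snd (h0 x hx) :
    ContDiffAt ℝ ∞ (fun z : ℝ × ℝ => z.1 / z.2) (f x, h x)).contMDiffAt.comp_contMDiffWithinAt x
    ((hf x hx).prodMk_space (hh x hx))

theorem smooth_logGrad (hv : IsOrthonormalFrameOn g v U) (hU : IsOpen U)
    (hK : ∀ x ∈ U, gaussCurv g v x ≠ 0) (i : Fin 2) : SmoothOn (logGrad g v i) U :=
  SmoothOn.div' ((hv.smooth_gaussCurv hU).dirDeriv (hv.smooth i) hU)
    (contMDiffOn_const.mul (hv.smooth_gaussCurv hU)) fun x hx => mul_ne_zero four_ne_zero (hK x hx)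

theorem HolSec.smooth (hv : IsOrthonormalFrameOn g v U) (hU : IsOpen U)
    (hK : ∀ x ∈ U, gaussCurv g v x ≠ 0) {ζ : Fin 6 → M → ℝ} (h : HolSec g v U ζ) (i : Fin 6) :
    SmoothOn (ζ i) U := by
  have hc := hv.smooth_structFun hU
  have hKs := hv.smooth_gaussCurv hU
  have hG := smooth_logGrad hv hU hK
  have h2 : SmoothOn (fun _ : M => (2 : ℝ)) U := contMDiffOn_const
  induction h generalizing i with
  | curv =>
    fin_cases i
    exacts [contMDiffOn_const, contMDiffOn_const, contMDiffOn_const, hKs, (hG 0).neg, (hG 1).neg]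
  | deriv0 _ ih =>
    have hd := fun i => (ih i).dirDeriv (hv.smooth 0) hU
    fin_cases i
    · exact (hd 0).add ((hc 0).mul (ih 1))
    · exact (((hd 1).sub ((hc 0).mul (ih 0))).add (ih 3)).add (hKs.mul (ih 2))
    · exact (((hd 2).add ((h2.mul (hG 0)).mul (ih 2))).sub (ih 4)).add (ih 1)
    · exact (hd 3).sub (hKs.mul (ih 4))
    · exact (((hd 4).add ((h2.mul (hG 0)).mul (ih 4))).sub (ih 3)).add ((hc 0).mul (ih 5))
    · exact ((hd 5).add ((h2.mul (hG 0)).mul (ih 5))).sub ((hc 0).mul (ih 4))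
  | deriv1 _ ih =>
    have hd := fun i => (ih i).dirDeriv (hv.smooth 1) hU
    fin_cases i
    · exact (((hd 0).add ((hc 1).mul (ih 1))).sub (ih 3)).sub (hKs.mul (ih 2))
    · exact (hd 1).sub ((hc 1).mul (ih 0))
    · exact (((hd 2).add ((h2.mul (hG 1)).mul (ih 2))).sub (ih 0)).sub (ih 5)
    · exact (hd 3).sub (hKs.mul (ih 5))
    · exact ((hd 4).add ((h2.mul (hG 1)).mul (ih 4))).add ((hc 1).mul (ih 5))
    · exact (((hd 5).add ((h2.mul (hG 1)).mul (ih 5))).sub (ih 3)).sub ((hc 1).mul (ih 4))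
  | lincomb hf hf' _ _ ih ih' => exact (hf.mul (ih i)).add (hf'.mul (ih' i))
  | congr _ h ih => exact (ih i).congr (h i)

variable {𝕜 : Type*} [RCLike 𝕜]
  {O : Set E8} {x : E8 → M} {ρ : E8 → E3} {e : Fin 3 → E8 → E3} {F : Fin 8 → E8 → E8}

/-- The complex vector field with components `κ A * f A`. -/
def wlift (κ : Fin 8 → 𝕜) (x : E8 → M) (f : Fin 8 → M → ℝ) (y : E8) (A : Fin 8) : 𝕜 :=
  κ A * (f A (x y) : 𝕜)

theorem fderiv_wlift (hv : IsOrthonormalFrameOn g v U) (hc : IsLocalCoords U O x ρ e)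
    (hF : IsCoframeOn (adaptedCoframe g v x ρ e) F O) (κ : Fin 8 → 𝕜) {f : Fin 8 → M → ℝ} {y : E8}
    (hy : y ∈ O) {D : Fin 8} (hf : MDifferentiableAt (𝓡 2) 𝓘(ℝ, ℝ) (f D) (x y)) :
    DifferentiableAt ℝ (fun y => wlift κ x f y D) y ∧ ∀ A,
    fderiv ℝ (fun y => wlift κ x f y D) y (F A y) = κ D *
      ((if 0 = A then (dirDeriv (v 0) (f D) (x y) : 𝕜) else 0)
        + if 1 = A then (dirDeriv (v 1) (f D) (x y) : 𝕜) else 0) := by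
  have hx : MDifferentiableAt 𝓘(ℝ, E8) (𝓡 2) x y :=
    ((hc.smooth_x y hy).contMDiffAt (hc.isOpen.mem_nhds hy)).mdifferentiableAt (by simp)
  have h1 : DifferentiableAt ℝ (fun y => f D (x y)) y :=
    mdifferentiableAt_iff_differentiableAt.1 (hf.comp y hx)
  have h2 : HasFDerivAt (fun y => wlift κ x f y D)
      (κ D • (RCLike.ofRealCLM : ℝ →L[ℝ] 𝕜).comp (fderiv ℝ (fun y => f D (x y)) y)) y :=
    ((RCLike.ofRealCLM : ℝ →L[ℝ] 𝕜).hasFDerivAt.comp y h1.hasFDerivAt).const_mul (κ D)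
  refine ⟨h2.differentiableAt, fun A => ?_⟩
  rw [h2.fderiv, fderiv_comp_eq hv hc hy hf]
  have d0 := hF.dual y hy 0 A
  have d1 := hF.dual y hy 1 A
  change etaForm g v x 0 y (F A y) = _ at d0
  change etaForm g v x 1 y (F A y) = _ at d1
  simp only [smul_apply, ContinuousLinearMap.comp_apply, add_apply, d0, d1, smul_eq_mul,
    RCLike.ofRealCLM_apply]
  split_ifs <;> simp

/-- The components are functions on the surface times constants, so only the two frame directions
dual to `η¹` and `η²` differentiate them. -/
theorem bracket_wlift (hv : IsOrthonormalFrameOn g v U) (hc : IsLocalCoords U O x ρ e)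
    (hF : IsCoframeOn (adaptedCoframe g v x ρ e) F O) (κ : Fin 8 → 𝕜) {f f' : Fin 8 → M → ℝ} {y : E8}
    (hy : y ∈ O) (hf : ∀ D, MDifferentiableAt (𝓡 2) 𝓘(ℝ, ℝ) (f D) (x y))
    (hf' : ∀ D, MDifferentiableAt (𝓡 2) 𝓘(ℝ, ℝ) (f' D) (x y)) (D : Fin 8) :
    bracket (adaptedCoframe g v x ρ e) F (wlift κ x f) (wlift κ x f') y D
      = κ D * (wlift κ x f y 0 * (dirDeriv (v 0) (f' D) (x y) : 𝕜)
          + wlift κ x f y 1 * (dirDeriv (v 1) (f' D) (x y) : 𝕜)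
          - wlift κ x f' y 0 * (dirDeriv (v 0) (f D) (x y) : 𝕜)
          - wlift κ x f' y 1 * (dirDeriv (v 1) (f D) (x y) : 𝕜))
        - rpair2 F y (extD (adaptedCoframe g v x ρ e D) y) (wlift κ x f y) (wlift κ x f' y) := by
  simp only [bracket, rpair2, (fderiv_wlift hv hc hF κ hy (hf D)).2,
    (fderiv_wlift hv hc hF κ hy (hf' D)).2]
  congr 1
  rw [Finset.sum_sub_distrib]
  have h : ∀ (w : Fin 8 → 𝕜) (a b : 𝕜), ∑ A, w A * (κ D * ((if 0 = A then a else 0)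
      + if 1 = A then b else 0)) = κ D * (w 0 * a + w 1 * b) := by
    intro w a b
    simp [mul_add, Finset.sum_add_distrib]
    ring
  rw [h, h]
  ring

/-- The bracket after inserting the structure equations. Values and derivatives enter through
equations, so explicit vectors can be substituted for particular lifts. -/
theorem bracket_wlift_eq (hv : IsOrthonormalFrameOn g v U) (hU : IsOpen U)
    (hc : IsLocalCoords U O x ρ e)
    (hF : IsCoframeOn (adaptedCoframe g v x ρ e) F O) (κ : Fin 8 → 𝕜) {f f' : Fin 8 → M → ℝ} {y : E8}
    (hy : y ∈ O) (hf : ∀ D, MDifferentiableAt (𝓡 2) 𝓘(ℝ, ℝ) (f D) (x y))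
    (hf' : ∀ D, MDifferentiableAt (𝓡 2) 𝓘(ℝ, ℝ) (f' D) (x y)) {z z' : Fin 8 → 𝕜}
    {d0 d1 d0' d1' : Fin 8 → ℝ}
    (hz : wlift κ x f y = z) (hz' : wlift κ x f' y = z')
    (hd0 : ∀ D, dirDeriv (v 0) (f D) (x y) = d0 D) (hd1 : ∀ D, dirDeriv (v 1) (f D) (x y) = d1 D)
    (hd0' : ∀ D, dirDeriv (v 0) (f' D) (x y) = d0' D)
    (hd1' : ∀ D, dirDeriv (v 1) (f' D) (x y) = d1' D) (D : Fin 8) :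
    bracket (adaptedCoframe g v x ρ e) F (wlift κ x f) (wlift κ x f') y D
      = κ D * (z 0 * (d0' D : 𝕜) + z 1 * (d1' D : 𝕜) - z' 0 * (d0 D : 𝕜) - z' 1 * (d1 D : 𝕜))
        - (![-(structFun g v 0 (x y) : 𝕜) * (z 0 * z' 1 - z 1 * z' 0),
          -(structFun g v 1 (x y) : 𝕜) * (z 0 * z' 1 - z 1 * z' 0),
          (z 6 * z' 4 - z 4 * z' 6) - (z 5 * z' 3 - z 3 * z' 5),
          (z 5 * z' 2 - z 2 * z' 5) + (z 7 * z' 4 - z 4 * z' 7),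
          -(z 6 * z' 2 - z 2 * z' 6) - (z 7 * z' 3 - z 3 * z' 7),
          z 6 * z' 7 - z 7 * z' 6, z 7 * z' 5 - z 5 * z' 7, -(z 6 * z' 5 - z 5 * z' 6)] :
            Fin 8 → 𝕜) D := by
  have hw := fun i j (z z' : Fin 8 → 𝕜) => hF.rpair2_wedge hy i j z z'
  rw [bracket_wlift hv hc hF κ hy hf hf', hz, hz', hd0, hd1, hd0', hd1',
    extD_adaptedCoframe hv hU hc hy D]
  congr 1
  fin_cases D <;>
  simp only [Matrix.cons_val, Fin.reduceFinMk, Fin.zero_eta, Fin.mk_one, Fin.isValue, rpair2_sub, rpair2_add, rpair2_smul,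
    rpair2_neg, hw, RCLike.ofReal_neg]

/-- The weights of the lift. -/
def liftWeight (k₀ : 𝕜) : Fin 8 → 𝕜 := ![1, 1, 1, 1, k₀, 1, k₀, k₀]

/-- The components of the lift of a vertical section. -/
def vertComp (s : M → ℝ) (ζ : Fin 6 → M → ℝ) : Fin 8 → M → ℝ :=
  ![fun _ => 0, fun _ => 0, ζ 0, ζ 1, fun x => s x * ζ 2 x, ζ 3, fun x => s x * ζ 4 x,
    fun x => s x * ζ 5 x]

/-- The components of the first horizontal field. -/
def horComp0 (g : Metric2 M) (v : Fin 2 → (x : M) → TangentSpace (𝓡 2) x) (s : M → ℝ) :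
    Fin 8 → M → ℝ :=
  ![fun _ => 1, fun _ => 0, fun _ => 1, fun _ => 0, fun _ => 0, structFun g v 0, fun _ => 0, s]

/-- The components of the second horizontal field. -/
def horComp1 (g : Metric2 M) (v : Fin 2 → (x : M) → TangentSpace (𝓡 2) x) (s : M → ℝ) :
    Fin 8 → M → ℝ :=
  ![fun _ => 0, fun _ => 1, fun _ => 0, fun _ => 1, fun _ => 0, structFun g v 1, fun x => -s x,
    fun _ => 0]

/-! ### Lifts of horizontal and vertical sections, and their brackets. -/

section Lift

variable {s : M → ℝ} {k₀ : 𝕜} {V : E8 → Submodule 𝕜 (E8 →L[ℝ] 𝕜)} {W : Set M}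

theorem smooth_horComp0 (hv : IsOrthonormalFrameOn g v U) (hU : IsOpen U) (hWU : W ⊆ U)
    (hs : SmoothOn s W) (A : Fin 8) : SmoothOn (horComp0 g v s A) W := by
  have hc := (hv.smooth_structFun hU 0).mono hWU
  fin_cases A
  exacts [contMDiffOn_const, contMDiffOn_const, contMDiffOn_const, contMDiffOn_const,
    contMDiffOn_const, hc, contMDiffOn_const, hs]

theorem smooth_horComp1 (hv : IsOrthonormalFrameOn g v U) (hU : IsOpen U) (hWU : W ⊆ U)
    (hs : SmoothOn s W) (A : Fin 8) : SmoothOn (horComp1 g v s A) W := by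
  have hc := (hv.smooth_structFun hU 1).mono hWU
  fin_cases A
  exacts [contMDiffOn_const, contMDiffOn_const, contMDiffOn_const, contMDiffOn_const,
    contMDiffOn_const, hc, hs.neg, contMDiffOn_const]

theorem smooth_vertComp (hs : SmoothOn s W) {ζ : Fin 6 → M → ℝ} (hζ : ∀ i, SmoothOn (ζ i) W)
    (A : Fin 8) : SmoothOn (vertComp s ζ A) W := by
  fin_cases A
  exacts [contMDiffOn_const, contMDiffOn_const, hζ 0, hζ 1, hs.mul (hζ 2), hζ 3, hs.mul (hζ 4),
    hs.mul (hζ 5)]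

/-- The scale `s` varies like `√|K|`, that is, `ds = 2 s G`. This is the source of the terms `2 G`
in the covariant derivatives of the rescaled components. -/
theorem dirDeriv_mul_scale {i : Fin 2} {f : M → ℝ} {p : M}
    (hs : MDifferentiableAt (𝓡 2) 𝓘(ℝ, ℝ) s p) (hf : MDifferentiableAt (𝓡 2) 𝓘(ℝ, ℝ) f p)
    (h : dirDeriv (v i) s p = 2 * logGrad g v i p * s p) :
    dirDeriv (v i) (fun x => s x * f x) p
      = s p * (dirDeriv (v i) f p + 2 * logGrad g v i p * f p) := by
  have := dirDeriv_mul (X := v i) hs hf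
  rw [h] at this
  refine Eq.trans ?_ (this.trans (by ring))
  rfl

theorem dirDeriv_neg {X : (x : M) → TangentSpace (𝓡 2) x} {f : M → ℝ} {p : M} :
    dirDeriv X (fun x => -f x) p = -dirDeriv X f p := by
  unfold dirDeriv
  have := mfderiv_neg (I := 𝓡 2) (f := f) (x := p)
  change mfderiv (𝓡 2) 𝓘(ℝ, ℝ) (-f) p (X p) = _
  rw [this]; rfl

theorem wlift_horComp0 (x : E8 → M) (k₀ : 𝕜) (y : E8) :
    wlift (liftWeight k₀) x (horComp0 g v s) y
      = ![1, 0, 1, 0, 0, (structFun g v 0 (x y) : 𝕜), 0, k₀ * (s (x y) : 𝕜)] := by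
  ext D; fin_cases D <;> simp [wlift, liftWeight, horComp0]

theorem wlift_horComp1 (x : E8 → M) (k₀ : 𝕜) (y : E8) :
    wlift (liftWeight k₀) x (horComp1 g v s) y
      = ![0, 1, 0, 1, 0, (structFun g v 1 (x y) : 𝕜), -(k₀ * (s (x y) : 𝕜)), 0] := by
  ext D; fin_cases D <;> simp [wlift, liftWeight, horComp1]

theorem wlift_vertComp (x : E8 → M) (k₀ : 𝕜) (ζ : Fin 6 → M → ℝ) (y : E8) :
    wlift (liftWeight k₀) x (vertComp s ζ) y
      = ![0, 0, (ζ 0 (x y) : 𝕜), (ζ 1 (x y) : 𝕜), k₀ * ((s (x y) : 𝕜) * (ζ 2 (x y) : 𝕜)),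
        (ζ 3 (x y) : 𝕜), k₀ * ((s (x y) : 𝕜) * (ζ 4 (x y) : 𝕜)),
        k₀ * ((s (x y) : 𝕜) * (ζ 5 (x y) : 𝕜))] := by
  ext D; fin_cases D <;> simp [wlift, liftWeight, vertComp]

theorem dirDeriv_horComp0 (i : Fin 2) {p : M}
    (h : dirDeriv (v i) s p = 2 * logGrad g v i p * s p) (D : Fin 8) :
    dirDeriv (v i) (horComp0 g v s D) p
      = (![0, 0, 0, 0, 0, dirDeriv (v i) (structFun g v 0) p, 0, 2 * logGrad g v i p * s p] :
        Fin 8 → ℝ) D := by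
  fin_cases D
  exacts [dirDeriv_const, dirDeriv_const, dirDeriv_const, dirDeriv_const, dirDeriv_const, rfl,
    dirDeriv_const, h]

theorem dirDeriv_horComp1 (i : Fin 2) {p : M}
    (h : dirDeriv (v i) s p = 2 * logGrad g v i p * s p) (D : Fin 8) :
    dirDeriv (v i) (horComp1 g v s D) p
      = (![0, 0, 0, 0, 0, dirDeriv (v i) (structFun g v 1) p, -(2 * logGrad g v i p * s p), 0] :
        Fin 8 → ℝ) D := by
  fin_cases D
  exacts [dirDeriv_const, dirDeriv_const, dirDeriv_const, dirDeriv_const, dirDeriv_const, rfl,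
    dirDeriv_neg.trans (congrArg _ h), dirDeriv_const]

theorem dirDeriv_vertComp (i : Fin 2) {p : M} {ζ : Fin 6 → M → ℝ}
    (hs : MDifferentiableAt (𝓡 2) 𝓘(ℝ, ℝ) s p)
    (hζ : ∀ j, MDifferentiableAt (𝓡 2) 𝓘(ℝ, ℝ) (ζ j) p)
    (h : dirDeriv (v i) s p = 2 * logGrad g v i p * s p) (D : Fin 8) :
    dirDeriv (v i) (vertComp s ζ D) p
      = (![0, 0, dirDeriv (v i) (ζ 0) p, dirDeriv (v i) (ζ 1) p,
        s p * (dirDeriv (v i) (ζ 2) p + 2 * logGrad g v i p * ζ 2 p), dirDeriv (v i) (ζ 3) p,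
        s p * (dirDeriv (v i) (ζ 4) p + 2 * logGrad g v i p * ζ 4 p),
        s p * (dirDeriv (v i) (ζ 5) p + 2 * logGrad g v i p * ζ 5 p)] : Fin 8 → ℝ) D := by
  fin_cases D
  exacts [dirDeriv_const, dirDeriv_const, rfl, rfl, dirDeriv_mul_scale hs (hζ 2) h, rfl,
    dirDeriv_mul_scale hs (hζ 4) h, dirDeriv_mul_scale hs (hζ 5) h]

section BracketLift

variable (hv : IsOrthonormalFrameOn g v U) (hU : IsOpen U) (hc : IsLocalCoords U O x ρ e)
  (hF : IsCoframeOn (adaptedCoframe g v x ρ e) F O) (hW : IsOpen W) (hWU : W ⊆ U)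
  (hs : SmoothOn s W) (hds : ∀ i, ∀ p ∈ W, dirDeriv (v i) s p = 2 * logGrad g v i p * s p)
  (hsk : ∀ p ∈ W, k₀ ^ 2 * (s p : 𝕜) ^ 2 = -(gaussCurv g v p : 𝕜))
  {y : E8} (hy : y ∈ O) (hyW : x y ∈ W)

include hv hU hc hF hW hWU hs hds hsk hy hyW

/-- The bracket of the horizontal fields has horizontal part `c₁ X₁ + c₂ X₂`; what remains is twice
`curvSection`. In the component along `ω¹₂` the Gauss equation contributes one `K` and `-κ²`
contributes another. -/
theorem bracket_horComp (D : Fin 8) :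
    wlift (liftWeight k₀) x (vertComp s (curvSection g v)) y D
      = 1 / 2 * bracket (adaptedCoframe g v x ρ e) F (wlift (liftWeight k₀) x (horComp0 g v s))
          (wlift (liftWeight k₀) x (horComp1 g v s)) y D
        + -(1 / 2) * ((structFun g v 0 (x y) : 𝕜) * wlift (liftWeight k₀) x (horComp0 g v s) y D
          + (structFun g v 1 (x y) : 𝕜) * wlift (liftWeight k₀) x (horComp1 g v s) y D) := by
  have hk := hsk _ hyW
  have hgc : (gaussCurv g v (x y) : 𝕜) = (dirDeriv (v 0) (structFun g v 1) (x y) : 𝕜)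
      - (dirDeriv (v 1) (structFun g v 0) (x y) : 𝕜)
      - (structFun g v 0 (x y) : 𝕜) ^ 2 - (structFun g v 1 (x y) : 𝕜) ^ 2 := by
    simp only [gaussCurv]; push_cast; ring
  rw [bracket_wlift_eq hv hU hc hF (liftWeight k₀) hy
    (fun D => (smooth_horComp0 hv hU hWU hs D).mdifferentiableAt hW hyW)
    (fun D => (smooth_horComp1 hv hU hWU hs D).mdifferentiableAt hW hyW)
    (wlift_horComp0 x k₀ y) (wlift_horComp1 x k₀ y) (dirDeriv_horComp0 0 (hds 0 _ hyW))
    (dirDeriv_horComp0 1 (hds 1 _ hyW)) (dirDeriv_horComp1 0 (hds 0 _ hyW))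
    (dirDeriv_horComp1 1 (hds 1 _ hyW)) D, wlift_horComp0, wlift_horComp1, wlift_vertComp]
  fin_cases D <;>
  simp only [Matrix.cons_val, liftWeight, curvSection, Fin.reduceFinMk, Fin.zero_eta, Fin.mk_one,
    Fin.isValue] <;> push_cast
  · ring
  · ring
  · ring
  · ring
  · ring
  · linear_combination (1 / 2) * hgc + (1 / 2) * hk
  · ring
  · ring

/-- This identity dictates the formula for `covDeriv0`. The constant `k₀` enters it only through
`k₀² s² = -K`, so the resulting components are real even when the root is imaginary. -/
theorem bracket_horComp0_vertComp {ζ : Fin 6 → M → ℝ} (hζ : ∀ i, SmoothOn (ζ i) W) (D : Fin 8) :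
    wlift (liftWeight k₀) x (vertComp s (covDeriv0 g v ζ)) y D
      = bracket (adaptedCoframe g v x ρ e) F (wlift (liftWeight k₀) x (horComp0 g v s))
          (wlift (liftWeight k₀) x (vertComp s ζ)) y D := by
  have hk := hsk _ hyW
  have hsd := hs.mdifferentiableAt hW hyW
  have hζd := fun i => (hζ i).mdifferentiableAt hW hyW
  rw [bracket_wlift_eq hv hU hc hF (liftWeight k₀) hy
    (fun D => (smooth_horComp0 hv hU hWU hs D).mdifferentiableAt hW hyW)
    (fun D => (smooth_vertComp hs hζ D).mdifferentiableAt hW hyW)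
    (wlift_horComp0 x k₀ y) (wlift_vertComp x k₀ ζ y) (dirDeriv_horComp0 0 (hds 0 _ hyW))
    (dirDeriv_horComp0 1 (hds 1 _ hyW)) (dirDeriv_vertComp 0 hsd hζd (hds 0 _ hyW))
    (dirDeriv_vertComp 1 hsd hζd (hds 1 _ hyW)) D, wlift_vertComp]
  fin_cases D <;>
  simp only [Matrix.cons_val, liftWeight, covDeriv0, Fin.reduceFinMk, Fin.zero_eta, Fin.mk_one,
    Fin.isValue] <;> push_cast
  · ring
  · ring
  · ring
  · linear_combination (ζ 2 (x y) : 𝕜) * hk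
  · ring
  · linear_combination -(ζ 4 (x y) : 𝕜) * hk
  · ring
  · ring

theorem bracket_horComp1_vertComp {ζ : Fin 6 → M → ℝ} (hζ : ∀ i, SmoothOn (ζ i) W) (D : Fin 8) :
    wlift (liftWeight k₀) x (vertComp s (covDeriv1 g v ζ)) y D
      = bracket (adaptedCoframe g v x ρ e) F (wlift (liftWeight k₀) x (horComp1 g v s))
          (wlift (liftWeight k₀) x (vertComp s ζ)) y D := by
  have hk := hsk _ hyW
  have hsd := hs.mdifferentiableAt hW hyW
  have hζd := fun i => (hζ i).mdifferentiableAt hW hyW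
  rw [bracket_wlift_eq hv hU hc hF (liftWeight k₀) hy
    (fun D => (smooth_horComp1 hv hU hWU hs D).mdifferentiableAt hW hyW)
    (fun D => (smooth_vertComp hs hζ D).mdifferentiableAt hW hyW)
    (wlift_horComp1 x k₀ y) (wlift_vertComp x k₀ ζ y) (dirDeriv_horComp1 0 (hds 0 _ hyW))
    (dirDeriv_horComp1 1 (hds 1 _ hyW)) (dirDeriv_vertComp 0 hsd hζd (hds 0 _ hyW))
    (dirDeriv_vertComp 1 hsd hζd (hds 1 _ hyW)) D, wlift_vertComp]
  fin_cases D <;>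
  simp only [Matrix.cons_val, liftWeight, covDeriv1, Fin.reduceFinMk, Fin.zero_eta, Fin.mk_one,
    Fin.isValue] <;> push_cast
  · ring
  · ring
  · linear_combination -(ζ 2 (x y) : 𝕜) * hk
  · ring
  · ring
  · linear_combination -(ζ 5 (x y) : 𝕜) * hk
  · ring
  · ring

end BracketLift

/-- The lifts of the sections generated by the curvature are annihilated by the derived flag of a
system which annihilates the horizontal fields. -/
theorem HolSec.flagKills (hv : IsOrthonormalFrameOn g v U) (hU : IsOpen U)
    (hK : ∀ x ∈ U, gaussCurv g v x ≠ 0) (hc : IsLocalCoords U O x ρ e)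
    (hF : IsCoframeOn (adaptedCoframe g v x ρ e) F O) {O₁ : Set E8} (hO₁ : IsOpen O₁)
    (hO₁O : O₁ ⊆ O) (hW : IsOpen W) (hWU : W ⊆ U) (hxW : ∀ y ∈ O₁, x y ∈ W) (hs : SmoothOn s W)
    (hds : ∀ i, ∀ p ∈ W, dirDeriv (v i) s p = 2 * logGrad g v i p * s p)
    (hsk : ∀ p ∈ W, k₀ ^ 2 * (s p : 𝕜) ^ 2 = -(gaussCurv g v p : 𝕜))
    (h0 : FlagKills V F O₁ (wlift (liftWeight k₀) x (horComp0 g v s)))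
    (h1 : FlagKills V F O₁ (wlift (liftWeight k₀) x (horComp1 g v s)))
    {ζ : Fin 6 → M → ℝ} (h : HolSec g v U ζ) :
    FlagKills V F O₁ (wlift (liftWeight k₀) x (vertComp s ζ)) := by
  have hF₁ : IsCoframeOn (adaptedCoframe g v x ρ e) F O₁ :=
    ⟨hO₁, fun A => (hF.smooth_coframe A).mono hO₁O, fun A => (hF.smooth_frame A).mono hO₁O,
      fun y hy => hF.dual y (hO₁O hy), fun y hy => hF.expand y (hO₁O hy)⟩
  have hd : ∀ {f : Fin 8 → M → ℝ}, (∀ A, SmoothOn (f A) W) → ∀ A,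
      DifferentiableOn ℝ (fun y => wlift (liftWeight k₀) x f y A) O₁ := fun {f} hf A y hy =>
    (fderiv_wlift hv hc hF (liftWeight k₀) (hO₁O hy)
      ((hf A).mdifferentiableAt hW (hxW y hy))).1.differentiableWithinAt
  have hH0 := smooth_horComp0 hv hU hWU hs
  have hH1 := smooth_horComp1 hv hU hWU hs
  induction h with
  | curv =>
    have hb := FlagKills.bracket hF₁ h0 h1 (hd hH0) (hd hH1)
    refine (hb.lincomb (h0.lincomb h1 (fun y => (structFun g v 0 (x y) : 𝕜))
      (fun y => (structFun g v 1 (x y) : 𝕜))) (fun _ => 1 / 2) (fun _ => -(1 / 2))).congr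
      fun y hy => funext fun D => ?_
    exact bracket_horComp hv hU hc hF hW hWU hs hds hsk (hO₁O hy) (hxW y hy) D
  | @deriv0 ζ hζ ih =>
    have hζs := fun i => (hζ.smooth hv hU hK i).mono hWU
    exact (FlagKills.bracket hF₁ h0 ih (hd hH0) (hd (smooth_vertComp hs hζs))).congr
      fun y hy => funext fun D =>
        bracket_horComp0_vertComp hv hU hc hF hW hWU hs hds hsk (hO₁O hy) (hxW y hy) hζs D
  | @deriv1 ζ hζ ih =>
    have hζs := fun i => (hζ.smooth hv hU hK i).mono hWU
    exact (FlagKills.bracket hF₁ h1 ih (hd hH1) (hd (smooth_vertComp hs hζs))).congr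
      fun y hy => funext fun D =>
        bracket_horComp1_vertComp hv hU hc hF hW hWU hs hds hsk (hO₁O hy) (hxW y hy) hζs D
  | @lincomb ζ ζ' f f' _ _ _ _ ih ih' =>
    refine (ih.lincomb ih' (fun y => (f (x y) : 𝕜)) fun y => (f' (x y) : 𝕜)).congr fun y hy => ?_
    ext D
    fin_cases D <;> simp [wlift, liftWeight, vertComp] <;> ring
  | @congr ζ ζ' _ h ih =>
    refine ih.congr fun y hy => ?_
    have h' := fun i => h i (x y) (hWU (hxW y hy))
    ext D
    fin_cases D <;> simp [wlift, liftWeight, vertComp, h']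

end Lift

end Holonomy

/-! ### Darboux integrability and the rank of the holonomy sections -/

section DarbouxRank

variable {M : Type*} [TopologicalSpace M] [ChartedSpace (EuclideanSpace ℝ (Fin 2)) M]
  [IsManifold (𝓡 2) ∞ M]
  {g : Metric2 M} {v : Fin 2 → (x : M) → TangentSpace (𝓡 2) x} {U : Set M}

/-- The function `√(K / K(p))`. -/
def curvScale (g : Metric2 M) (v : Fin 2 → (x : M) → TangentSpace (𝓡 2) x) (p x : M) : ℝ :=
  √(gaussCurv g v x / gaussCurv g v p)

/-- The points where the curvature has the same sign as at `p`. -/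
def sameSign (g : Metric2 M) (v : Fin 2 → (x : M) → TangentSpace (𝓡 2) x) (U : Set M) (p : M) :
    Set M := U ∩ (fun x => gaussCurv g v x / gaussCurv g v p) ⁻¹' Set.Ioi 0

theorem isOpen_sameSign (hv : IsOrthonormalFrameOn g v U) (hU : IsOpen U) (p : M) :
    IsOpen (sameSign g v U p) :=
  ((hv.smooth_gaussCurv hU).continuousOn.div_const _).isOpen_inter_preimage hU isOpen_Ioi

theorem mem_sameSign {p : M} (hp : p ∈ U) (hK : gaussCurv g v p ≠ 0) : p ∈ sameSign g v U p :=
  ⟨hp, by simp [hK]⟩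

theorem curvScale_sq {p x : M} (hx : x ∈ sameSign g v U p) :
    curvScale g v p x ^ 2 = gaussCurv g v x / gaussCurv g v p := Real.sq_sqrt (le_of_lt hx.2)

theorem curvScale_self {p : M} (hK : gaussCurv g v p ≠ 0) : curvScale g v p p = 1 := by
  simp [curvScale, hK]

theorem smooth_curvScale (hv : IsOrthonormalFrameOn g v U) (hU : IsOpen U) (p : M) :
    SmoothOn (curvScale g v p) (sameSign g v U p) := by
  intro x hx
  have h1 : ContMDiffWithinAt (𝓡 2) 𝓘(ℝ, ℝ) ∞ (fun x => gaussCurv g v x / gaussCurv g v p)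
      (sameSign g v U p) x :=
    SmoothOn.div' ((hv.smooth_gaussCurv hU).mono Set.inter_subset_left) contMDiffOn_const
      (fun y hy h => by simpa [h] using hy.2) x hx
  exact (Real.contDiffAt_sqrt (ne_of_gt hx.2)).contMDiffAt.comp_contMDiffWithinAt x h1

/-- The function is a constant multiple of `√|K|`, and `G` is a quarter of the logarithmic
derivative of `K`. -/
theorem dirDeriv_curvScale (hv : IsOrthonormalFrameOn g v U) (hU : IsOpen U) {p : M}
    (hK : gaussCurv g v p ≠ 0) (i : Fin 2) {x : M} (hx : x ∈ sameSign g v U p) :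
    dirDeriv (v i) (curvScale g v p) x = 2 * logGrad g v i x * curvScale g v p x := by
  have h0 : 0 < gaussCurv g v x / gaussCurv g v p := hx.2
  have h1 : HasDerivAt (fun t : ℝ => √(t / gaussCurv g v p))
      (1 / (2 * √(gaussCurv g v x / gaussCurv g v p)) * (1 / gaussCurv g v p)) (gaussCurv g v x) :=
    (Real.hasDerivAt_sqrt h0.ne').comp (h := fun t : ℝ => t / gaussCurv g v p) _
      ((hasDerivAt_id _).div_const _)
  have h2 := dirDeriv_comp (X := v i) h1 ((hv.smooth_gaussCurv hU).mdifferentiableAt hU hx.1)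
  have hKx : gaussCurv g v x ≠ 0 := fun h => by rw [h] at h0; simp at h0
  have hs : curvScale g v p x ≠ 0 := (Real.sqrt_pos.2 h0).ne'
  have hs2 := curvScale_sq hx
  rw [eq_div_iff hK] at hs2
  change dirDeriv (v i) (curvScale g v p) x = 1 / (2 * curvScale g v p x) * _ * _ at h2
  rw [h2, logGrad, ← hs2]
  field_simp
  ring

variable {𝕜 : Type*} [RCLike 𝕜]
  {O : Set E8} {x : E8 → M} {ρ : E8 → E3} {e : Fin 3 → E8 → E3} {F : Fin 8 → E8 → E8}

theorem pair_hor0_eq (y : E8) (a : E8 →L[ℝ] 𝕜) (c κ : 𝕜) :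
    pair F y a (hor0 c κ) = a (F 0 y) + a (F 2 y) + c * a (F 5 y) + κ * a (F 7 y) := by
  simp [pair, hor0, Fin.sum_univ_eight]

/-- A nonzero element of the kernel of a linear form on a space of dimension at least two. -/
theorem exists_ne_zero_of_two_le_finrank {E : Type*} [AddCommGroup E] [Module 𝕜 E]
    [Module.Finite 𝕜 E] (N : Submodule 𝕜 E) (hN : 2 ≤ Module.finrank 𝕜 N) (l : E →ₗ[𝕜] 𝕜) :
    ∃ a ∈ N, a ≠ 0 ∧ l a = 0 := by
  by_contra! h
  have hi : Function.Injective (l.comp N.subtype) := by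
    rw [← LinearMap.ker_eq_bot, LinearMap.ker_eq_bot']
    intro a ha
    by_contra h0
    exact h a a.2 (by simpa using h0) ha
  have := LinearMap.finrank_le_finrank_of_injective hi
  simp at this
  omega

/-- A linear system annihilating the holonomy sections: the data obtained from a Darboux pair. -/
theorem exists_annihilator (hv : IsOrthonormalFrameOn g v U) (hU : IsOpen U)
    (hK : ∀ x ∈ U, gaussCurv g v x ≠ 0) (hc : IsLocalCoords U O x ρ e)
    (hF : IsCoframeOn (adaptedCoframe g v x ρ e) F O) {y : E8} (hy : y ∈ O)
    (hd : IsDarbouxIntegrableAt (extendScalars 𝕜 (embeddingSystem g v x ρ e)) y) :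
    ∃ (N : Submodule 𝕜 (E8 →L[ℝ] 𝕜)) (k₀ : 𝕜), k₀ ≠ 0 ∧ 2 ≤ Module.finrank 𝕜 N ∧ ∀ a ∈ N,
      pair F y a (wlift (liftWeight k₀) x (horComp0 g v (curvScale g v (x y))) y) = 0 ∧
      pair F y a (wlift (liftWeight k₀) x (horComp1 g v (curvScale g v (x y))) y) = 0 ∧
      ∀ ζ, HolSec g v U ζ →
        pair F y a (wlift (liftWeight k₀) x (vertComp (curvScale g v (x y)) ζ) y) = 0 := by
  obtain ⟨r, p, q, s, t, θ, σ, σ', Ω, Ω', O', hO', hy', hdec, -, -, hpair⟩ := hd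
  obtain ⟨hKy, hrank, k₀, hk₀, hkill, j, hj⟩ := hdec.annihilates hv hU hc hF hy hy'
  obtain ⟨hfin, h8⟩ := hF.finrank_dual (𝕜 := 𝕜) hy
  have hxy := hc.mapsTo hy
  set S := curvScale g v (x y) with hS
  set W := sameSign g v U (x y) with hW
  have hWo : IsOpen W := isOpen_sameSign hv hU _
  have hWU : W ⊆ U := Set.inter_subset_left
  have hyW : x y ∈ W := mem_sameSign hxy hKy
  have hSs : SmoothOn S W := smooth_curvScale hv hU _
  have hk₀0 : k₀ ≠ 0 := by
    rintro rfl
    have : (gaussCurv g v (x y) : 𝕜) = 0 := by simpa using hk₀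
    exact hKy (by exact_mod_cast this)
  have hsk : ∀ p ∈ W, k₀ ^ 2 * (S p : 𝕜) ^ 2 = -(gaussCurv g v p : 𝕜) := by
    intro p hp
    rw [hk₀, ← RCLike.ofReal_pow, curvScale_sq hp]
    have : (gaussCurv g v (x y) : 𝕜) ≠ 0 := by exact_mod_cast hKy
    push_cast
    field_simp
  set O₂ : Set E8 := O' ∩ (O ∩ x ⁻¹' W) with hO₂
  have hO₂o : IsOpen O₂ := hO'.inter (hc.isOpen_preimage hWo)
  have hO₂O : O₂ ⊆ O := fun y h => h.2.1
  -- The root furnished at each nearby point is `± k₀ S`, with a sign that could a priori jump. The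
  -- function `φ` evaluates a form of the singular system on the horizontal vector of the wrong
  -- sign. It is continuous and nonzero at `y`, so the sign is constant where `φ ≠ 0`.
  set φ : E8 → 𝕜 := fun y => pair F y (σ' j y)
    (hor0 (structFun g v 0 (x y) : 𝕜) (-(k₀ * (S (x y) : 𝕜)))) with hφ
  have hφc : ContinuousOn φ O₂ := by
    have hFc : ∀ A, ContinuousOn (fun y => σ' j y (F A y)) O₂ := fun A =>
      ((hdec.smooth_sigma' j).continuousOn.mono Set.inter_subset_left).clm_apply
        ((hF.smooth_frame A).continuousOn.mono hO₂O)
    have hcc : ∀ {f : M → ℝ}, SmoothOn f W → ContinuousOn (fun y => (f (x y) : 𝕜)) O₂ := fun hf =>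
      RCLike.continuous_ofReal.comp_continuousOn
        ((hc.contDiffOn_comp hf).continuousOn.mono Set.inter_subset_right)
    simp only [hφ, pair_hor0_eq]
    exact (((hFc 0).add (hFc 2)).add ((hcc ((hv.smooth_structFun hU 0).mono hWU)).mul (hFc 5))).add
      ((continuousOn_const.mul (hcc hSs)).neg.mul (hFc 7))
  have hσ' : ∀ y, σ' j y ∈ spanForms (Fin.append θ σ') y := fun y =>
    Submodule.subset_span ⟨Fin.natAdd r j, by simp⟩
  have hφy : φ y ≠ 0 := by
    have h1 := (hkill _ (hσ' y)).1
    simp only [hφ]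
    rw [pair_hor0] at h1 ⊢
    rw [hS, curvScale_self hKy]
    intro h2
    have h3 : k₀ * pair F y (σ' j y) (Pi.single 7 1) = 0 := by
      have : (2 : 𝕜) * (k₀ * pair F y (σ' j y) (Pi.single 7 1)) = 0 := by
        push_cast at h2
        linear_combination h1 - h2
      simpa using this
    exact hj ((mul_eq_zero.1 h3).resolve_left hk₀0)
  set O₁ : Set E8 := O₂ ∩ φ ⁻¹' {0}ᶜ with hO₁
  have hO₁o : IsOpen O₁ := hφc.isOpen_inter_preimage hO₂o isOpen_compl_singleton
  have hyO₁ : y ∈ O₁ := ⟨⟨hy', hy, hyW⟩, hφy⟩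
  have hO₁O : O₁ ⊆ O := fun z hz => hO₂O hz.1
  have hann : ∀ z ∈ O₁, ∀ a ∈ spanForms (Fin.append θ σ') z,
      pair F z a (wlift (liftWeight k₀) x (horComp0 g v S) z) = 0 ∧
      pair F z a (wlift (liftWeight k₀) x (horComp1 g v S) z) = 0 := by
    intro z hz a ha
    obtain ⟨-, -, κ, hκ, hkz, -⟩ := hdec.annihilates hv hU hc hF (hO₁O hz) hz.1.1
    have h1 : κ = k₀ * (S (x z) : 𝕜) := by
      have h2 : (κ - k₀ * (S (x z) : 𝕜)) * (κ + k₀ * (S (x z) : 𝕜)) = 0 := by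
        linear_combination hκ - hsk (x z) hz.1.2.2
      rcases mul_eq_zero.1 h2 with h3 | h3
      · exact sub_eq_zero.1 h3
      · refine (hz.2 ?_).elim
        change φ z = 0
        have h4 : -(k₀ * (S (x z) : 𝕜)) = κ := by linear_combination -h3
        simp only [hφ]
        rw [h4]
        exact (hkz _ (hσ' z)).1
    rw [wlift_horComp0, wlift_horComp1, ← h1]
    exact hkz a ha
  have h0 : FlagKills (spanForms (Fin.append θ σ')) F O₁
    (wlift (liftWeight k₀) x (horComp0 g v S)) := ⟨0, fun z hz a ha => (hann z hz a ha).1⟩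
  have h1 : FlagKills (spanForms (Fin.append θ σ')) F O₁
    (wlift (liftWeight k₀) x (horComp1 g v S)) := ⟨0, fun z hz a ha => (hann z hz a ha).2⟩
  refine ⟨derivedInf (spanForms (Fin.append θ σ')) y, k₀, hk₀0, ?_, fun a ha =>
    ⟨h0.pair_eq_zero hyO₁ ha, h1.pair_eq_zero hyO₁ ha, fun ζ hζ => ?_⟩⟩
  · have h2 := hpair.sup_left y hy'
    -- The sum of the two spaces is the whole cotangent space, so `8 ≤ 6 + dim`.
    have h3 := Submodule.finrank_add_le_finrank_add_finrank (spanForms (Fin.append θ σ) y)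
      (derivedInf (spanForms (Fin.append θ σ')) y)
    rw [h2, finrank_top, h8, hrank] at h3
    omega
  · exact (hζ.flagKills hv hU hK hc hF hO₁o hO₁O hWo hWU (fun z hz => hz.1.2.2) hSs
      (fun i p hp => dirDeriv_curvScale hv hU hKy i hp) hsk h0 h1).pair_eq_zero hyO₁ ha

theorem pair_eight (y : E8) (a : E8 →L[ℝ] 𝕜) (z : Fin 8 → 𝕜) :
    pair F y a z = z 0 * a (F 0 y) + z 1 * a (F 1 y) + z 2 * a (F 2 y) + z 3 * a (F 3 y)
      + z 4 * a (F 4 y) + z 5 * a (F 5 y) + z 6 * a (F 6 y) + z 7 * a (F 7 y) := by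
  simp [pair, Fin.sum_univ_eight]

/-- The first three components of the curvature section are `(0, 0, 1)`. Together with those of its
two derivatives they form a matrix of rank three as soon as `K ≠ 0`. -/
theorem curvSection_deriv (g : Metric2 M) (v : Fin 2 → (x : M) → TangentSpace (𝓡 2) x) (p : M) :
    covDeriv0 g v (curvSection g v) 0 p = 0 ∧
    covDeriv0 g v (curvSection g v) 1 p = 2 * gaussCurv g v p ∧
    covDeriv0 g v (curvSection g v) 2 p = 3 * logGrad g v 0 p ∧
    covDeriv1 g v (curvSection g v) 0 p = -(2 * gaussCurv g v p) ∧
    covDeriv1 g v (curvSection g v) 1 p = 0 ∧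
    covDeriv1 g v (curvSection g v) 2 p = 3 * logGrad g v 1 p := by
  refine ⟨?_, ?_, ?_, ?_, ?_, ?_⟩ <;>
  simp only [covDeriv0, covDeriv1, curvSection, Matrix.cons_val, dirDeriv_const] <;> ring

/-- The annihilator has dimension at least two, and its elements are determined by three numbers,
their values on the vertical directions `5`, `6`, `7`. Two independent sections concentrated in
these directions would cut it down to dimension at most one. -/
theorem cross_eq_zero_of_isDarbouxIntegrableAt (hv : IsOrthonormalFrameOn g v U) (hU : IsOpen U)
    (hK : ∀ x ∈ U, gaussCurv g v x ≠ 0) (hc : IsLocalCoords U O x ρ e) {y : E8} (hy : y ∈ O)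
    (hd : IsDarbouxIntegrableAt (extendScalars 𝕜 (embeddingSystem g v x ρ e)) y)
    {ζ ζ' : Fin 6 → M → ℝ} (hζ : HolSec g v U ζ) (hζ' : HolSec g v U ζ')
    (h0 : ζ 0 (x y) = 0 ∧ ζ 1 (x y) = 0 ∧ ζ 2 (x y) = 0)
    (h0' : ζ' 0 (x y) = 0 ∧ ζ' 1 (x y) = 0 ∧ ζ' 2 (x y) = 0) :
    ζ 3 (x y) * ζ' 4 (x y) - ζ 4 (x y) * ζ' 3 (x y) = 0 ∧
    ζ 3 (x y) * ζ' 5 (x y) - ζ 5 (x y) * ζ' 3 (x y) = 0 ∧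
    ζ 4 (x y) * ζ' 5 (x y) - ζ 5 (x y) * ζ' 4 (x y) = 0 := by
  obtain ⟨F, hF⟩ := exists_adaptedFrame hv hU hc
  obtain ⟨N, k, hk, hN, hann⟩ := exists_annihilator hv hU hK hc hF hy hd
  obtain ⟨hfin, h8⟩ := hF.finrank_dual (𝕜 := 𝕜) hy
  have hKy := hK _ (hc.mapsTo hy)
  have hKy' : (gaussCurv g v (x y) : 𝕜) ≠ 0 := by exact_mod_cast hKy
  obtain ⟨d1, d2, d3, d4, d5, d6⟩ := curvSection_deriv g v (x y)
  -- The curvature section recovers the value on direction `4`, its derivatives those on `3` and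
  -- `2`, and the horizontal fields those on `0` and `1`.
  have hz : ∀ a ∈ N, a (F 5 y) = 0 → a (F 6 y) = 0 → a (F 7 y) = 0 → a = 0 := by
    intro a ha e5 e6 e7
    obtain ⟨H0, H1, H⟩ := hann a ha
    have S0 := H _ .curv
    have S1 := H _ (.deriv0 .curv)
    have S2 := H _ (.deriv1 .curv)
    rw [wlift_vertComp, pair_eight, curvScale_self hKy] at S0 S1 S2
    rw [wlift_horComp0, pair_eight, curvScale_self hKy] at H0
    rw [wlift_horComp1, pair_eight, curvScale_self hKy] at H1
    simp only [d1, d2, d3, d4, d5, d6] at S1 S2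
    simp only [Matrix.cons_val, e5, e6, e7, curvSection] at H0 H1 S0 S1 S2
    have e4 : a (F 4 y) = 0 := by simpa [hk] using S0
    have e3 : a (F 3 y) = 0 := by simpa [e4, hKy] using S1
    have e2 : a (F 2 y) = 0 := by simpa [e4, hKy] using S2
    have e0 : a (F 0 y) = 0 := by simpa [e2] using H0
    have e1 : a (F 1 y) = 0 := by simpa [e3] using H1
    ext u
    rw [hF.apply_eq hy, Fin.sum_univ_eight, e0, e1, e2, e3, e4, e5, e6, e7]
    simp
  have hr : ∀ {ξ : Fin 6 → M → ℝ}, HolSec g v U ξ →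
      (ξ 0 (x y) = 0 ∧ ξ 1 (x y) = 0 ∧ ξ 2 (x y) = 0) → ∀ a ∈ N,
      (ξ 3 (x y) : 𝕜) * a (F 5 y) + k * (ξ 4 (x y) : 𝕜) * a (F 6 y)
        + k * (ξ 5 (x y) : 𝕜) * a (F 7 y) = 0 := by
    intro ξ hξ ⟨z0, z1, z2⟩ a ha
    have H := (hann a ha).2.2 ξ hξ
    rw [wlift_vertComp, pair_eight, curvScale_self hKy, z0, z1, z2] at H
    simp only [Matrix.cons_val] at H
    rw [← H]
    push_cast
    ring
  let l : Fin 8 → (E8 →L[ℝ] 𝕜) →ₗ[𝕜] 𝕜 := fun A =>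
    { toFun := fun a => a (F A y), map_add' := fun a b => rfl, map_smul' := fun c a => rfl }
  have key : ∀ {c d : ℝ} {u w : 𝕜}, (c : 𝕜) * u + (d : 𝕜) * w = 0 → ∀ {c' d' : ℝ},
      (c' : 𝕜) * u + (d' : 𝕜) * w = 0 → c * d' - d * c' ≠ 0 → u = 0 ∧ w = 0 := by
    intro c d u w h1 c' d' h2 h3
    have h3' : (c : 𝕜) * (d' : 𝕜) - (d : 𝕜) * (c' : 𝕜) ≠ 0 := by exact_mod_cast h3
    constructor
    · refine (mul_eq_zero.1 (?_ : ((c : 𝕜) * (d' : 𝕜) - (d : 𝕜) * (c' : 𝕜)) * u = 0)).resolve_left h3'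
      linear_combination (d' : 𝕜) * h1 - (d : 𝕜) * h2
    · refine (mul_eq_zero.1 (?_ : ((c : 𝕜) * (d' : 𝕜) - (d : 𝕜) * (c' : 𝕜)) * w = 0)).resolve_left h3'
      linear_combination (c : 𝕜) * h2 - (c' : 𝕜) * h1
  -- For each minor, choose a nonzero annihilator vanishing on the direction that is absent from the
  -- minor. If the minor were nonzero, the two sections would make it vanish on the other two
  -- directions as well.
  refine ⟨?_, ?_, ?_⟩ <;> by_contra hne
  · obtain ⟨a, ha, ha0, hl⟩ := exists_ne_zero_of_two_le_finrank N hN (l 7)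
    have hl' : a (F 7 y) = 0 := hl
    have r1 := hr hζ h0 a ha
    have r2 := hr hζ' h0' a ha
    rw [hl'] at r1 r2
    obtain ⟨k1, k2⟩ := key (u := a (F 5 y)) (w := k * a (F 6 y)) (by linear_combination r1)
      (by linear_combination r2) hne
    exact ha0 (hz a ha k1 ((mul_eq_zero.1 k2).resolve_left hk) hl')
  · obtain ⟨a, ha, ha0, hl⟩ := exists_ne_zero_of_two_le_finrank N hN (l 6)
    have hl' : a (F 6 y) = 0 := hl
    have r1 := hr hζ h0 a ha
    have r2 := hr hζ' h0' a ha
    rw [hl'] at r1 r2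
    obtain ⟨k1, k2⟩ := key (u := a (F 5 y)) (w := k * a (F 7 y)) (by linear_combination r1)
      (by linear_combination r2) hne
    exact ha0 (hz a ha k1 hl' ((mul_eq_zero.1 k2).resolve_left hk))
  · obtain ⟨a, ha, ha0, hl⟩ := exists_ne_zero_of_two_le_finrank N hN (l 5)
    have hl' : a (F 5 y) = 0 := hl
    have r1 := hr hζ h0 a ha
    have r2 := hr hζ' h0' a ha
    rw [hl'] at r1 r2
    obtain ⟨k1, k2⟩ := key (u := k * a (F 6 y)) (w := k * a (F 7 y)) (by linear_combination r1)
      (by linear_combination r2) hne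
    exact ha0 (hz a ha hl' ((mul_eq_zero.1 k1).resolve_left hk) ((mul_eq_zero.1 k2).resolve_left hk))

/-- Already the decomposition excludes zeros of the curvature, and any orthonormal frame of the
ambient space may be used over the given point. -/
theorem IsDarbouxIntegrable.gaussCurv_ne_zero (hg : IsDarbouxIntegrable g)
    (hv : IsOrthonormalFrameOn g v U) (hU : IsOpen U) {p : M} (hp : p ∈ U) :
    gaussCurv g v p ≠ 0 := by
  have hort : Orthonormal ℝ (fun i : Fin 3 => EuclideanSpace.basisFun (Fin 3) ℝ i) :=
    (EuclideanSpace.basisFun (Fin 3) ℝ).orthonormal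
  obtain ⟨O, x, ρ, e, y, hc, hy, rfl, -, -, hd⟩ := hg U v hU hv p hp 0 _ hort
  obtain ⟨F, hF⟩ := exists_adaptedFrame hv hU hc
  rcases hd with hd | hd
  all_goals
    obtain ⟨r, p, q, s, t, θ, σ, σ', Ω, Ω', O', hO', hy', hdec, -, -, -⟩ := hd
    exact (hdec.annihilates hv hU hc hF hy hy').1

/-- Darboux integrability forces the reduced holonomy sections to have rank one. -/
theorem IsDarbouxIntegrable.cross_eq_zero (hg : IsDarbouxIntegrable g)
    (hv : IsOrthonormalFrameOn g v U) (hU : IsOpen U) {p : M} (hp : p ∈ U)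
    {ζ ζ' : Fin 6 → M → ℝ} (hζ : HolSec g v U ζ) (hζ' : HolSec g v U ζ')
    (h0 : ζ 0 p = 0 ∧ ζ 1 p = 0 ∧ ζ 2 p = 0) (h0' : ζ' 0 p = 0 ∧ ζ' 1 p = 0 ∧ ζ' 2 p = 0) :
    ζ 3 p * ζ' 4 p - ζ 4 p * ζ' 3 p = 0 ∧ ζ 3 p * ζ' 5 p - ζ 5 p * ζ' 3 p = 0 ∧
    ζ 4 p * ζ' 5 p - ζ 5 p * ζ' 4 p = 0 := by
  have hort : Orthonormal ℝ (fun i : Fin 3 => EuclideanSpace.basisFun (Fin 3) ℝ i) :=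
    (EuclideanSpace.basisFun (Fin 3) ℝ).orthonormal
  obtain ⟨O, x, ρ, e, y, hc, hy, rfl, -, -, hd⟩ := hg U v hU hv p hp 0 _ hort
  have hK := fun x (hx : x ∈ U) => hg.gaussCurv_ne_zero hv hU hx
  rcases hd with hd | hd
  · exact cross_eq_zero_of_isDarbouxIntegrableAt hv hU hK hc hy hd hζ hζ' h0 h0'
  · exact cross_eq_zero_of_isDarbouxIntegrableAt hv hU hK hc hy hd hζ hζ' h0 h0'

end DarbouxRank

/-! ### The differential equation for the curvature -/

section CurvatureEquation

variable {M : Type*} [TopologicalSpace M] [ChartedSpace (EuclideanSpace ℝ (Fin 2)) M]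
  [IsManifold (𝓡 2) ∞ M]
  {g : Metric2 M} {v : Fin 2 → (x : M) → TangentSpace (𝓡 2) x} {U : Set M}

theorem dirDeriv_fun_add {X : (x : M) → TangentSpace (𝓡 2) x} {f h : M → ℝ} {x : M}
    (hf : MDifferentiableAt (𝓡 2) 𝓘(ℝ, ℝ) f x) (hh : MDifferentiableAt (𝓡 2) 𝓘(ℝ, ℝ) h x) :
    dirDeriv X (fun y => f y + h y) x = dirDeriv X f x + dirDeriv X h x := dirDeriv_add hf hh

theorem dirDeriv_fun_mul {X : (x : M) → TangentSpace (𝓡 2) x} {f h : M → ℝ} {x : M}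
    (hf : MDifferentiableAt (𝓡 2) 𝓘(ℝ, ℝ) f x) (hh : MDifferentiableAt (𝓡 2) 𝓘(ℝ, ℝ) h x) :
    dirDeriv X (fun y => f y * h y) x = f x * dirDeriv X h x + h x * dirDeriv X f x :=
  dirDeriv_mul hf hh

theorem dirDeriv_fun_sub {X : (x : M) → TangentSpace (𝓡 2) x} {f h : M → ℝ} {x : M}
    (hf : MDifferentiableAt (𝓡 2) 𝓘(ℝ, ℝ) f x) (hh : MDifferentiableAt (𝓡 2) 𝓘(ℝ, ℝ) h x) :
    dirDeriv X (fun y => f y - h y) x = dirDeriv X f x - dirDeriv X h x := by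
  simp only [sub_eq_add_neg]
  rw [dirDeriv_fun_add (h := fun y => -h y) hf hh.neg, dirDeriv_neg]

theorem dirDeriv_const_mul {X : (x : M) → TangentSpace (𝓡 2) x} {f : M → ℝ} {x : M} (c : ℝ)
    (hf : MDifferentiableAt (𝓡 2) 𝓘(ℝ, ℝ) f x) :
    dirDeriv X (fun y => c * f y) x = c * dirDeriv X f x := by
  rw [dirDeriv_fun_mul mdifferentiableAt_const hf, dirDeriv_const, mul_zero, add_zero]

theorem dirDeriv_eq_zero {X : (x : M) → TangentSpace (𝓡 2) x} {f : M → ℝ} {W : Set M}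
    (hW : IsOpen W) (h : ∀ x ∈ W, f x = 0) {x : M} (hx : x ∈ W) : dirDeriv X f x = 0 := by
  rw [dirDeriv_congr (g := fun _ => 0) (Filter.eventuallyEq_of_mem (hW.mem_nhds hx) h),
    dirDeriv_const]

/-- The components of the defect `u = K g + G ⊗ G - ∇G`. -/
def defect00 (g : Metric2 M) (v : Fin 2 → (x : M) → TangentSpace (𝓡 2) x) (x : M) : ℝ :=
  gaussCurv g v x + logGrad g v 0 x ^ 2
    - (dirDeriv (v 0) (logGrad g v 0) x + structFun g v 0 x * logGrad g v 1 x)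

def defect01 (g : Metric2 M) (v : Fin 2 → (x : M) → TangentSpace (𝓡 2) x) (x : M) : ℝ :=
  logGrad g v 0 x * logGrad g v 1 x
    - (dirDeriv (v 0) (logGrad g v 1) x - structFun g v 0 x * logGrad g v 0 x)

def defect11 (g : Metric2 M) (v : Fin 2 → (x : M) → TangentSpace (𝓡 2) x) (x : M) : ℝ :=
  gaussCurv g v x + logGrad g v 1 x ^ 2
    - (dirDeriv (v 1) (logGrad g v 1) x - structFun g v 1 x * logGrad g v 0 x)

section

variable (hv : IsOrthonormalFrameOn g v U) (hU : IsOpen U) (hK : ∀ x ∈ U, gaussCurv g v x ≠ 0)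

include hv hU hK

theorem smooth_defect : SmoothOn (defect00 g v) U ∧ SmoothOn (defect01 g v) U ∧
    SmoothOn (defect11 g v) U := by
  have hc := hv.smooth_structFun hU
  have hKs := hv.smooth_gaussCurv hU
  have hG := smooth_logGrad hv hU hK
  have hd := fun i j => (hG j).dirDeriv (hv.smooth i) hU
  exact ⟨(hKs.add ((hG 0).pow 2)).sub ((hd 0 0).add ((hc 0).mul (hG 1))),
    ((hG 0).mul (hG 1)).sub ((hd 0 1).sub ((hc 0).mul (hG 0))),
    (hKs.add ((hG 1).pow 2)).sub ((hd 1 1).sub ((hc 1).mul (hG 0)))⟩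

theorem dirDeriv_gaussCurv (i : Fin 2) {x : M} (hx : x ∈ U) :
    dirDeriv (v i) (gaussCurv g v) x = 4 * gaussCurv g v x * logGrad g v i x := by
  have := hK x hx
  rw [logGrad]
  field_simp

/-- `∇G` is symmetric because `G` is a quarter of `d log |K|`; the identity is the commutator
applied to `K`, divided by `4 K`. -/
theorem logGrad_symm {x : M} (hx : x ∈ U) :
    dirDeriv (v 1) (logGrad g v 0) x + structFun g v 1 x * logGrad g v 1 x
      = dirDeriv (v 0) (logGrad g v 1) x - structFun g v 0 x * logGrad g v 0 x := by
  have hKs := hv.smooth_gaussCurv hU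
  have hG := smooth_logGrad hv hU hK
  have h1 := hv.commutator hU hKs hx
  have h2 : ∀ i j, dirDeriv (v i) (dirDeriv (v j) (gaussCurv g v)) x
      = 4 * (gaussCurv g v x * dirDeriv (v i) (logGrad g v j) x
        + logGrad g v j x * (4 * gaussCurv g v x * logGrad g v i x)) := by
    intro i j
    have e : dirDeriv (v j) (gaussCurv g v) =ᶠ[nhds x]
        fun y => 4 * (gaussCurv g v y * logGrad g v j y) :=
      Filter.eventuallyEq_of_mem (hU.mem_nhds hx) fun y hy => by
        rw [dirDeriv_gaussCurv hv hU hK j hy, mul_assoc]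
    rw [dirDeriv_congr e, dirDeriv_const_mul (f := fun y => gaussCurv g v y * logGrad g v j y) _
        ((hKs.mdifferentiableAt hU hx).mul ((hG j).mdifferentiableAt hU hx)),
      dirDeriv_fun_mul (hKs.mdifferentiableAt hU hx) ((hG j).mdifferentiableAt hU hx),
      dirDeriv_gaussCurv hv hU hK i hx]
  rw [h2, h2, dirDeriv_gaussCurv hv hU hK 0 hx, dirDeriv_gaussCurv hv hU hK 1 hx] at h1
  have := hK x hx
  apply mul_left_cancel₀ this
  linear_combination -(1 / 4) * h1

/-- The first covariant derivative of the curvature section, reduced. -/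
def firstSection0 (g : Metric2 M) (v : Fin 2 → (x : M) → TangentSpace (𝓡 2) x) :
    Fin 6 → M → ℝ :=
  ![fun _ => 0, fun x => 2 * gaussCurv g v x, fun _ => 0,
    fun x => 2 * (logGrad g v 0 x * gaussCurv g v x),
    fun x => defect00 g v x - 2 * gaussCurv g v x, defect01 g v]

def firstSection1 (g : Metric2 M) (v : Fin 2 → (x : M) → TangentSpace (𝓡 2) x) :
    Fin 6 → M → ℝ :=
  ![fun x => -2 * gaussCurv g v x, fun _ => 0, fun _ => 0,
    fun x => 2 * (logGrad g v 1 x * gaussCurv g v x),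
    defect01 g v, fun x => defect11 g v x - 2 * gaussCurv g v x]

/-- The third component of the covariant derivative is `3 G₁`, and the third component of the
curvature section is `1`. Subtracting this multiple clears it. -/
theorem holSec_firstSection0 : HolSec g v U (firstSection0 g v) := by
  have h := HolSec.lincomb (g := g) (v := v) (U := U) (f := fun _ => 1) (f' := fun x => -3 * logGrad g v 0 x)
    contMDiffOn_const (contMDiffOn_const.mul (smooth_logGrad hv hU hK 0))
    (HolSec.deriv0 .curv) .curv
  refine h.congr fun i x hx => ?_
  have hd := dirDeriv_gaussCurv hv hU hK 0 hx
  fin_cases i <;>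
  simp only [firstSection0, covDeriv0, curvSection, Matrix.cons_val, Fin.reduceFinMk, Fin.zero_eta,
    Fin.mk_one, Fin.isValue, dirDeriv_const, dirDeriv_neg, hd, defect00, defect01] <;> ring

theorem holSec_firstSection1 : HolSec g v U (firstSection1 g v) := by
  have h := HolSec.lincomb (g := g) (v := v) (U := U) (f := fun _ => 1) (f' := fun x => -3 * logGrad g v 1 x)
    contMDiffOn_const (contMDiffOn_const.mul (smooth_logGrad hv hU hK 1))
    (HolSec.deriv1 .curv) .curv
  refine h.congr fun i x hx => ?_
  have hd := dirDeriv_gaussCurv hv hU hK 1 hx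
  have hs := logGrad_symm hv hU hK hx
  fin_cases i <;>
  simp only [firstSection1, covDeriv1, curvSection, Matrix.cons_val, Fin.reduceFinMk, Fin.zero_eta,
    Fin.mk_one, Fin.isValue, dirDeriv_const, dirDeriv_neg, hd, defect11, defect01]
  · ring
  · ring
  · ring
  · ring
  · linear_combination hs
  · ring

theorem dirDeriv_firstSection (i : Fin 2) {x : M} (hx : x ∈ U) :
    (∀ c : ℝ, dirDeriv (v i) (fun x => c * gaussCurv g v x) x
      = c * (4 * gaussCurv g v x * logGrad g v i x)) ∧
    (∀ j, dirDeriv (v i) (fun x => 2 * (logGrad g v j x * gaussCurv g v x)) x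
      = 2 * (logGrad g v j x * (4 * gaussCurv g v x * logGrad g v i x)
        + gaussCurv g v x * dirDeriv (v i) (logGrad g v j) x)) ∧
    (dirDeriv (v i) (fun x => defect00 g v x - 2 * gaussCurv g v x) x
      = dirDeriv (v i) (defect00 g v) x - 2 * (4 * gaussCurv g v x * logGrad g v i x)) ∧
    (dirDeriv (v i) (fun x => defect11 g v x - 2 * gaussCurv g v x) x
      = dirDeriv (v i) (defect11 g v) x - 2 * (4 * gaussCurv g v x * logGrad g v i x)) := by
  have hKd := (hv.smooth_gaussCurv hU).mdifferentiableAt hU hx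
  have hGd := fun j => (smooth_logGrad hv hU hK j).mdifferentiableAt hU hx
  obtain ⟨s0, -, s2⟩ := smooth_defect hv hU hK
  have h1 : ∀ c : ℝ, dirDeriv (v i) (fun x => c * gaussCurv g v x) x
      = c * (4 * gaussCurv g v x * logGrad g v i x) := fun c => by
    rw [dirDeriv_const_mul c hKd, dirDeriv_gaussCurv hv hU hK i hx]
  refine ⟨h1, fun j => ?_, ?_, ?_⟩
  · rw [dirDeriv_const_mul (f := fun x => logGrad g v j x * gaussCurv g v x) _ ((hGd j).mul hKd), dirDeriv_fun_mul (hGd j) hKd,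
      dirDeriv_gaussCurv hv hU hK i hx]
  · rw [dirDeriv_fun_sub (h := fun x => 2 * gaussCurv g v x) (s0.mdifferentiableAt hU hx) (mdifferentiableAt_const.mul hKd), h1]
  · rw [dirDeriv_fun_sub (h := fun x => 2 * gaussCurv g v x) (s2.mdifferentiableAt hU hx) (mdifferentiableAt_const.mul hKd), h1]

/-- The reduced second covariant derivatives of the curvature section. -/
def secondSection00 (g : Metric2 M) (v : Fin 2 → (x : M) → TangentSpace (𝓡 2) x) :
    Fin 6 → M → ℝ :=
  ![fun _ => 0, fun _ => 0, fun _ => 0, fun x => -2 * gaussCurv g v x * defect00 g v x,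
    fun x => dirDeriv (v 0) (defect00 g v) x + 2 * structFun g v 0 x * defect01 g v x
      - 4 * logGrad g v 0 x * defect00 g v x,
    fun x => dirDeriv (v 0) (defect01 g v) x
      + structFun g v 0 x * (defect11 g v x - defect00 g v x) - 3 * logGrad g v 0 x * defect01 g v x
      - logGrad g v 1 x * defect00 g v x + 4 * gaussCurv g v x * logGrad g v 1 x]

def secondSection10 (g : Metric2 M) (v : Fin 2 → (x : M) → TangentSpace (𝓡 2) x) :
    Fin 6 → M → ℝ :=
  ![fun _ => 0, fun _ => 0, fun _ => 0, fun x => -2 * gaussCurv g v x * defect01 g v x,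
    fun x => dirDeriv (v 1) (defect00 g v) x + 2 * structFun g v 1 x * defect01 g v x
      - 2 * logGrad g v 1 x * defect00 g v x - 2 * logGrad g v 0 x * defect01 g v x
      - 4 * gaussCurv g v x * logGrad g v 1 x,
    fun x => dirDeriv (v 1) (defect01 g v) x
      + structFun g v 1 x * (defect11 g v x - defect00 g v x) - 3 * logGrad g v 1 x * defect01 g v x
      - logGrad g v 0 x * defect11 g v x]

def secondSection01 (g : Metric2 M) (v : Fin 2 → (x : M) → TangentSpace (𝓡 2) x) :
    Fin 6 → M → ℝ :=
  ![fun _ => 0, fun _ => 0, fun _ => 0, fun x => -2 * gaussCurv g v x * defect01 g v x,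
    fun x => dirDeriv (v 0) (defect01 g v) x
      + structFun g v 0 x * (defect11 g v x - defect00 g v x) - 3 * logGrad g v 0 x * defect01 g v x
      - logGrad g v 1 x * defect00 g v x,
    fun x => dirDeriv (v 0) (defect11 g v) x - 2 * structFun g v 0 x * defect01 g v x
      - 2 * logGrad g v 0 x * defect11 g v x - 2 * logGrad g v 1 x * defect01 g v x
      - 4 * gaussCurv g v x * logGrad g v 0 x]

def secondSection11 (g : Metric2 M) (v : Fin 2 → (x : M) → TangentSpace (𝓡 2) x) :
    Fin 6 → M → ℝ :=
  ![fun _ => 0, fun _ => 0, fun _ => 0, fun x => -2 * gaussCurv g v x * defect11 g v x,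
    fun x => dirDeriv (v 1) (defect01 g v) x
      + structFun g v 1 x * (defect11 g v x - defect00 g v x) - 3 * logGrad g v 1 x * defect01 g v x
      - logGrad g v 0 x * defect11 g v x + 4 * gaussCurv g v x * logGrad g v 0 x,
    fun x => dirDeriv (v 1) (defect11 g v) x - 2 * structFun g v 1 x * defect01 g v x
      - 4 * logGrad g v 1 x * defect11 g v x]

/-- The curvature section and the two first sections have initial parts `(0, 0, 1)`, `(0, 2K, 0)`,
`(-2K, 0, 0)`. Suitable multiples of them clear the first three components of every second
derivative; the coefficients `f`, `h`, `k` below are read off from the third, second and first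
component. -/
theorem holSec_secondSection : HolSec g v U (secondSection00 g v) ∧
    HolSec g v U (secondSection10 g v) ∧ HolSec g v U (secondSection01 g v) ∧
    HolSec g v U (secondSection11 g v) := by
  have hc := hv.smooth_structFun hU
  have hKs := hv.smooth_gaussCurv hU
  have hG := smooth_logGrad hv hU hK
  obtain ⟨s0, s1, s2⟩ := smooth_defect hv hU hK
  have T0 := holSec_firstSection0 hv hU hK
  have T1 := holSec_firstSection1 hv hU hK
  have hcomb : ∀ {ζ : Fin 6 → M → ℝ}, HolSec g v U ζ → ∀ {f h k : M → ℝ}, SmoothOn f U →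
      SmoothOn h U → SmoothOn k U → HolSec g v U (fun i x => 1 * (1 * ζ i x + f x *
        curvSection g v i x) + 1 * (h x * firstSection0 g v i x + k x * firstSection1 g v i x)) :=
    fun hζ _ _ _ hf hh hk => HolSec.lincomb (f := fun _ => 1) (f' := fun _ => 1) contMDiffOn_const
      contMDiffOn_const (HolSec.lincomb (f := fun _ => 1) contMDiffOn_const hf hζ .curv)
      (HolSec.lincomb hh hk T0 T1)
  refine ⟨?_, ?_, ?_, ?_⟩
  · refine (hcomb (.deriv0 T0) (f := fun x => defect00 g v x - 4 * gaussCurv g v x)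
      (h := fun x => -5 * logGrad g v 0 x) (k := structFun g v 0) (s0.sub (contMDiffOn_const.mul hKs))
      (contMDiffOn_const.mul (hG 0)) (hc 0)).congr fun i x hx => ?_
    obtain ⟨d1, d2, d3, d4⟩ := dirDeriv_firstSection hv hU hK 0 hx
    have hd := dirDeriv_gaussCurv hv hU hK 0 hx
    fin_cases i <;>
    simp only [firstSection0, firstSection1, secondSection00, covDeriv0, curvSection,
      Matrix.cons_val, Fin.reduceFinMk, Fin.zero_eta, Fin.mk_one, Fin.isValue, dirDeriv_const, d1,
      d2, d3]
    · ring
    · ring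
    · ring
    · simp only [defect00]; ring
    · ring
    · ring
  · refine (hcomb (.deriv1 T0) (f := defect01 g v)
      (h := fun x => -4 * logGrad g v 1 x) (k := fun x => structFun g v 1 x - logGrad g v 0 x) s1
      (contMDiffOn_const.mul (hG 1)) ((hc 1).sub (hG 0))).congr fun i x hx => ?_
    obtain ⟨d1, d2, d3, d4⟩ := dirDeriv_firstSection hv hU hK 1 hx
    have hd := dirDeriv_gaussCurv hv hU hK 1 hx
    have hs := logGrad_symm hv hU hK hx
    fin_cases i <;>
    simp only [firstSection0, firstSection1, secondSection10, covDeriv1, curvSection,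
      Matrix.cons_val, Fin.reduceFinMk, Fin.zero_eta, Fin.mk_one, Fin.isValue, dirDeriv_const, d1,
      d2, d3]
    · ring
    · ring
    · ring
    · simp only [defect01]; linear_combination (-2 * gaussCurv g v x) * hs
    · ring
    · ring
  · refine (hcomb (.deriv0 T1) (f := defect01 g v)
      (h := fun x => -(structFun g v 0 x + logGrad g v 1 x)) (k := fun x => -4 * logGrad g v 0 x) s1
      ((hc 0).add (hG 1)).neg (contMDiffOn_const.mul (hG 0))).congr fun i x hx => ?_
    obtain ⟨d1, d2, d3, d4⟩ := dirDeriv_firstSection hv hU hK 0 hx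
    have hd := dirDeriv_gaussCurv hv hU hK 0 hx
    fin_cases i <;>
    simp only [firstSection0, firstSection1, secondSection01, covDeriv0, curvSection,
      Matrix.cons_val, Fin.reduceFinMk, Fin.zero_eta, Fin.mk_one, Fin.isValue, dirDeriv_const, d1,
      d2, d4]
    · ring
    · ring
    · ring
    · simp only [defect01]; ring
    · ring
    · ring
  · refine (hcomb (.deriv1 T1) (f := fun x => defect11 g v x - 4 * gaussCurv g v x)
      (h := fun x => -structFun g v 1 x) (k := fun x => -5 * logGrad g v 1 x)
      (s2.sub (contMDiffOn_const.mul hKs)) (hc 1).neg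
      (contMDiffOn_const.mul (hG 1))).congr fun i x hx => ?_
    obtain ⟨d1, d2, d3, d4⟩ := dirDeriv_firstSection hv hU hK 1 hx
    have hd := dirDeriv_gaussCurv hv hU hK 1 hx
    fin_cases i <;>
    simp only [firstSection0, firstSection1, secondSection11, covDeriv1, curvSection,
      Matrix.cons_val, Fin.reduceFinMk, Fin.zero_eta, Fin.mk_one, Fin.isValue, dirDeriv_const, d1,
      d2, d4]
    · ring
    · ring
    · ring
    · simp only [defect11]; ring
    · ring
    · ring

/-- The reduced covariant derivatives of a normalised section `(0, 0, 0; 1, p, q)`. -/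
theorem exists_reduced_deriv {ℓ : Fin 6 → M → ℝ} (hℓ : HolSec g v U ℓ)
    (h0 : ∀ x ∈ U, ℓ 0 x = 0 ∧ ℓ 1 x = 0 ∧ ℓ 2 x = 0 ∧ ℓ 3 x = 1) :
    (∃ ζ, HolSec g v U ζ ∧ ∀ x ∈ U, ζ 0 x = 0 ∧ ζ 1 x = 0 ∧ ζ 2 x = 0 ∧
      ζ 3 x = -logGrad g v 0 x ∧
      ζ 4 x = dirDeriv (v 0) (ℓ 4) x + logGrad g v 0 x * ℓ 4 x + structFun g v 0 x * ℓ 5 x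
        - defect00 g v x / (2 * gaussCurv g v x) ∧
      ζ 5 x = dirDeriv (v 0) (ℓ 5) x + 2 * logGrad g v 0 x * ℓ 5 x - structFun g v 0 x * ℓ 4 x
        - logGrad g v 1 x * ℓ 4 x - defect01 g v x / (2 * gaussCurv g v x)) ∧
    (∃ ζ, HolSec g v U ζ ∧ ∀ x ∈ U, ζ 0 x = 0 ∧ ζ 1 x = 0 ∧ ζ 2 x = 0 ∧
      ζ 3 x = -logGrad g v 1 x ∧
      ζ 4 x = dirDeriv (v 1) (ℓ 4) x + 2 * logGrad g v 1 x * ℓ 4 x + structFun g v 1 x * ℓ 5 x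
        - logGrad g v 0 x * ℓ 5 x - defect01 g v x / (2 * gaussCurv g v x) ∧
      ζ 5 x = dirDeriv (v 1) (ℓ 5) x + logGrad g v 1 x * ℓ 5 x - structFun g v 1 x * ℓ 4 x
        - defect11 g v x / (2 * gaussCurv g v x)) := by
  have hKs := hv.smooth_gaussCurv hU
  have hs := hℓ.smooth hv hU hK
  have hi : SmoothOn (fun x => -1 / (2 * gaussCurv g v x)) U :=
    SmoothOn.div' contMDiffOn_const (contMDiffOn_const.mul hKs)
      fun x hx => mul_ne_zero two_ne_zero (hK x hx)
  have hd3 : ∀ i, ∀ x ∈ U, dirDeriv (v i) (ℓ 3) x = 0 := fun i x hx => by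
    rw [dirDeriv_congr (g := fun _ => 1) (Filter.eventuallyEq_of_mem (hU.mem_nhds hx)
      fun y hy => (h0 y hy).2.2.2), dirDeriv_const]
  have hd0 := fun i x (hx : x ∈ U) => dirDeriv_eq_zero (X := v i) hU (fun y hy => (h0 y hy).1) hx
  have hd1 := fun i x (hx : x ∈ U) => dirDeriv_eq_zero (X := v i) hU (fun y hy => (h0 y hy).2.1) hx
  have hd2 := fun i x (hx : x ∈ U) =>
    dirDeriv_eq_zero (X := v i) hU (fun y hy => (h0 y hy).2.2.1) hx
  constructor
  -- Differentiation adds `ℓ 3 = 1` to the second component and `-ℓ 4` to the third. The first is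
  -- cancelled by `-1/(2K)` times `firstSection0`, the second by `ℓ 4` times the curvature section.
  · refine ⟨_, HolSec.lincomb (f := fun _ => 1) (f' := fun _ => 1) contMDiffOn_const
      contMDiffOn_const (HolSec.lincomb (f := fun _ => 1) contMDiffOn_const (hs 4)
      (HolSec.deriv0 hℓ) .curv)
      (HolSec.lincomb (f := fun _ => 0) contMDiffOn_const hi (holSec_firstSection1 hv hU hK)
        (holSec_firstSection0 hv hU hK)), fun x hx => ?_⟩
    obtain ⟨z0, z1, z2, z3⟩ := h0 x hx
    have hKx := hK x hx
    simp only [covDeriv0, curvSection, firstSection0, firstSection1, Matrix.cons_val, hd0 _ x hx,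
      hd1 _ x hx, hd2 _ x hx, hd3 _ x hx, z0, z1, z2, z3]
    refine ⟨?_, ?_, ?_, ?_, ?_, ?_⟩ <;> field_simp <;> ring
  · refine ⟨_, HolSec.lincomb (f := fun _ => 1) (f' := fun _ => 1) contMDiffOn_const
      contMDiffOn_const (HolSec.lincomb (f := fun _ => 1) contMDiffOn_const (hs 5)
      (HolSec.deriv1 hℓ) .curv)
      (HolSec.lincomb (f := fun _ => 0) contMDiffOn_const hi (holSec_firstSection0 hv hU hK)
        (holSec_firstSection1 hv hU hK)), fun x hx => ?_⟩
    obtain ⟨z0, z1, z2, z3⟩ := h0 x hx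
    have hKx := hK x hx
    simp only [covDeriv1, curvSection, firstSection0, firstSection1, Matrix.cons_val, hd0 _ x hx,
      hd1 _ x hx, hd2 _ x hx, hd3 _ x hx, z0, z1, z2, z3]
    refine ⟨?_, ?_, ?_, ?_, ?_, ?_⟩ <;> field_simp <;> ring

end

/-- The algebraic consequences of the integrability conditions. -/
theorem defect_algebra {K a b p q u w z da db dc : ℝ} (hK : K ≠ 0) (hne : ¬(u = 0 ∧ w = 0 ∧ z = 0))
    (hu : u = K + a ^ 2 - da) (hw : w = a * b - db) (hz : z = K + b ^ 2 - dc)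
    (R1 : 2 * a = q * w - p * z) (R2 : 2 * b = p * w - q * u)
    (E1 : 2 * db = 2 * a * b - 4 * K * p * b)
    (E2 : 2 * dc = -2 * a ^ 2 - (u * z - w ^ 2) / (2 * K) - 4 * b * K * q)
    (E3 : 2 * da = -2 * b ^ 2 - (u * z - w ^ 2) / (2 * K) - 4 * a * K * p)
    (E4 : 2 * db = 2 * a * b - 4 * K * q * a) :
    u = 2 * K - 2 * a ^ 2 ∧ w = -2 * a * b ∧ z = 2 * K - 2 * b ^ 2 := by
  have w1 : w = 2 * K * p * b := by linear_combination hw - E1 / 2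
  have w2 : w = 2 * K * q * a := by linear_combination hw - E4 / 2
  -- With this `t` the determinant disappears from the equations: `u = t + 2 a K p`, `z = t + 2 b K
  -- q`, and the relations `R1`, `R2` become `p t = -2 a`, `q t = -2 b`.
  obtain ⟨t, ht⟩ : ∃ t, t = K + a ^ 2 + b ^ 2 + (u * z - w ^ 2) / (4 * K) := ⟨_, rfl⟩
  have ht' : 4 * K * t = 4 * K * (K + a ^ 2 + b ^ 2) + (u * z - w ^ 2) := by
    rw [ht]; field_simp
  have hdet : (u * z - w ^ 2) / (2 * K) = 2 * (t - K - a ^ 2 - b ^ 2) := by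
    rw [ht]; field_simp; ring
  rw [hdet] at E2 E3
  have u1 : u = t + 2 * a * K * p := by linear_combination hu - E3 / 2
  have z1 : z = t + 2 * b * K * q := by linear_combination hz - E2 / 2
  have P1 : p * t = -2 * a := by linear_combination R1 - p * z1 + q * w1
  have P2 : q * t = -2 * b := by linear_combination R2 - q * u1 + p * w2
  -- For `t = 0` these relations give `a = b = 0`, and then the whole defect vanishes.
  have ht0 : t ≠ 0 := by
    rintro rfl
    have ha : a = 0 := by linarith
    have hb : b = 0 := by linarith
    exact hne ⟨by rw [u1, ha]; ring, by rw [w1, hb]; ring, by rw [z1, hb]; ring⟩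
  have hpq : p = -2 * a / t ∧ q = -2 * b / t :=
    ⟨by rw [← P1]; field_simp, by rw [← P2]; field_simp⟩
  -- The determinant is now `t² - 4K(a² + b²)`; comparison with the definition of `t` gives a
  -- perfect square, whence `t = 2K`.
  have key : (t - 2 * K) ^ 2 = 0 := by
    have h1 : u * z - w ^ 2 = t ^ 2 - 4 * K * (a ^ 2 + b ^ 2) := by
      have : w ^ 2 = (2 * K * p * b) * (2 * K * q * a) := by rw [sq]; nth_rewrite 1 [w1]; rw [w2]
      rw [this, u1, z1]
      linear_combination 2 * b * K * P2 + 2 * a * K * P1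
    linear_combination -ht' - h1
  have t2 : t = 2 * K := by
    have := pow_eq_zero_iff (two_ne_zero) |>.1 key
    linarith
  subst t2
  obtain ⟨rfl, rfl⟩ := hpq
  refine ⟨?_, ?_, ?_⟩
  · rw [u1]; field_simp; ring
  · rw [w1]; field_simp
  · rw [z1]; field_simp; ring

/-- If the defect vanished on an open set, the only entries left in the second sections would be `±
4 K G₁` and `± 4 K G₂`. The rank condition makes their squares vanish, so `G = 0` there, and the
defect reduces to `K g`, which is not zero. -/
theorem IsDarbouxIntegrable.exists_defect_ne_zero (hg : IsDarbouxIntegrable g)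
    (hv : IsOrthonormalFrameOn g v U) (hU : IsOpen U) (hne : U.Nonempty) :
    ∃ x ∈ U, ¬(defect00 g v x = 0 ∧ defect01 g v x = 0 ∧ defect11 g v x = 0) := by
  by_contra! h
  have hK : ∀ x ∈ U, gaussCurv g v x ≠ 0 := fun x hx => hg.gaussCurv_ne_zero hv hU hx
  obtain ⟨h1, h2, h3, h4⟩ := holSec_secondSection hv hU hK
  have hG : ∀ x ∈ U, logGrad g v 0 x = 0 ∧ logGrad g v 1 x = 0 := by
    intro x hx
    have hKx := hK x hx
    have d0 := fun i => dirDeriv_eq_zero (X := v i) hU (fun y hy => (h y hy).1) hx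
    have d1 := fun i => dirDeriv_eq_zero (X := v i) hU (fun y hy => (h y hy).2.1) hx
    have d2 := fun i => dirDeriv_eq_zero (X := v i) hU (fun y hy => (h y hy).2.2) hx
    obtain ⟨z0, z1, z2⟩ := h x hx
    have c1 := (hg.cross_eq_zero hv hU hx h1 h2 ⟨rfl, rfl, rfl⟩ ⟨rfl, rfl, rfl⟩).2.2
    have c2 := (hg.cross_eq_zero hv hU hx h3 h4 ⟨rfl, rfl, rfl⟩ ⟨rfl, rfl, rfl⟩).2.2
    simp only [secondSection00, secondSection10, secondSection01, secondSection11, Matrix.cons_val,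
      d0, d1, d2, z0, z1, z2] at c1 c2
    constructor
    · have : 16 * gaussCurv g v x ^ 2 * logGrad g v 0 x ^ 2 = 0 := by linear_combination c2
      simpa [hKx] using this
    · have : 16 * gaussCurv g v x ^ 2 * logGrad g v 1 x ^ 2 = 0 := by linear_combination c1
      simpa [hKx] using this
  obtain ⟨x, hx⟩ := hne
  have e := (h x hx).1
  have d0 := dirDeriv_eq_zero (X := v 0) hU (fun y hy => (hG y hy).1) hx
  rw [defect00, d0, (hG x hx).1, (hG x hx).2] at e
  exact hK x hx (by linear_combination e)

/-- A reduced section with nonvanishing fourth component is normalised to `ℓ = (0, 0, 0; 1, p, q)`,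
and by rank one every other reduced section is a multiple of it. Applied to the second sections and
to the derivatives of `ℓ`, this gives the algebraic system of `defect_algebra`. -/
theorem IsDarbouxIntegrable.defect_eq_of_section (hg : IsDarbouxIntegrable g)
    (hv : IsOrthonormalFrameOn g v U) (hU : IsOpen U) {ζ : Fin 6 → M → ℝ} (hζ : HolSec g v U ζ)
    (h0 : ∀ x ∈ U, ζ 0 x = 0 ∧ ζ 1 x = 0 ∧ ζ 2 x = 0 ∧ ζ 3 x ≠ 0) {x : M} (hx : x ∈ U)
    (hne : ¬(defect00 g v x = 0 ∧ defect01 g v x = 0 ∧ defect11 g v x = 0)) :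
    defect00 g v x = 2 * gaussCurv g v x - 2 * logGrad g v 0 x ^ 2 ∧
    defect01 g v x = -2 * logGrad g v 0 x * logGrad g v 1 x ∧
    defect11 g v x = 2 * gaussCurv g v x - 2 * logGrad g v 1 x ^ 2 := by
  have hK : ∀ x ∈ U, gaussCurv g v x ≠ 0 := fun x hx => hg.gaussCurv_ne_zero hv hU hx
  have hζs := hζ.smooth hv hU hK
  have hG := smooth_logGrad hv hU hK
  obtain ⟨s0, s1, s2⟩ := smooth_defect hv hU hK
  obtain ⟨ℓ, hℓ, hℓ0⟩ : ∃ ℓ, HolSec g v U ℓ ∧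
      ∀ x ∈ U, ℓ 0 x = 0 ∧ ℓ 1 x = 0 ∧ ℓ 2 x = 0 ∧ ℓ 3 x = 1 := by
    refine ⟨_, HolSec.lincomb (f := fun x => 1 / ζ 3 x) (f' := fun _ => 0)
      (SmoothOn.div' contMDiffOn_const (hζs 3) fun x hx => (h0 x hx).2.2.2) contMDiffOn_const hζ hζ,
      fun x hx => ?_⟩
    obtain ⟨z0, z1, z2, z3⟩ := h0 x hx
    rw [z0, z1, z2]
    exact ⟨by ring, by ring, by ring, by field_simp; ring⟩
  have hℓs := hℓ.smooth hv hU hK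
  have hcr : ∀ {ξ : Fin 6 → M → ℝ}, HolSec g v U ξ → ∀ x ∈ U,
      (ξ 0 x = 0 ∧ ξ 1 x = 0 ∧ ξ 2 x = 0) → ξ 4 x = ξ 3 x * ℓ 4 x ∧ ξ 5 x = ξ 3 x * ℓ 5 x := by
    intro ξ hξ x hx hz
    obtain ⟨z0, z1, z2, z3⟩ := hℓ0 x hx
    obtain ⟨e1, e2, -⟩ := hg.cross_eq_zero hv hU hx hξ hℓ hz ⟨z0, z1, z2⟩
    rw [z3] at e1 e2
    exact ⟨by linear_combination -e1, by linear_combination -e2⟩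
  obtain ⟨⟨ξ, hξ, hξ0⟩, ⟨χ, hχ, hχ0⟩⟩ := exists_reduced_deriv hv hU hK hℓ hℓ0
  obtain ⟨g1, g2, g3, g4⟩ := holSec_secondSection hv hU hK
  have A00 := fun x hx => hcr g1 x hx ⟨rfl, rfl, rfl⟩
  have A10 := fun x hx => hcr g2 x hx ⟨rfl, rfl, rfl⟩
  have A01 := fun x hx => hcr g3 x hx ⟨rfl, rfl, rfl⟩
  have A11 := fun x hx => hcr g4 x hx ⟨rfl, rfl, rfl⟩
  simp only [secondSection00, secondSection10, secondSection01, secondSection11,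
    Matrix.cons_val] at A00 A10 A01 A11
  -- The two components compared here differ only by `4 K G₁`, so the derivatives of the defect drop
  -- out. The same happens with `4 K G₂` in `hR2`.
  have hR1 : ∀ y ∈ U, 2 * logGrad g v 0 y = ℓ 5 y * defect01 g v y - ℓ 4 y * defect11 g v y := by
    intro y hy
    apply mul_left_cancel₀ (mul_ne_zero two_ne_zero (hK y hy))
    linear_combination (A11 y hy).1 - (A10 y hy).2
  have hR2 : ∀ y ∈ U, 2 * logGrad g v 1 y = ℓ 4 y * defect01 g v y - ℓ 5 y * defect00 g v y := by
    intro y hy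
    apply mul_left_cancel₀ (mul_ne_zero two_ne_zero (hK y hy))
    linear_combination (A00 y hy).2 - (A01 y hy).1
  have md : ∀ {f : M → ℝ}, SmoothOn f U → MDifferentiableAt (𝓡 2) 𝓘(ℝ, ℝ) f x := fun hf =>
    hf.mdifferentiableAt hU hx
  have dR : ∀ i j (f₁ f₂ h₁ h₂ : M → ℝ), SmoothOn f₁ U → SmoothOn f₂ U → SmoothOn h₁ U →
      SmoothOn h₂ U → (∀ y ∈ U, 2 * logGrad g v j y = f₁ y * h₁ y - f₂ y * h₂ y) →
      2 * dirDeriv (v i) (logGrad g v j) x = f₁ x * dirDeriv (v i) h₁ x + h₁ x * dirDeriv (v i) f₁ x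
        - (f₂ x * dirDeriv (v i) h₂ x + h₂ x * dirDeriv (v i) f₂ x) := by
    intro i j f₁ f₂ h₁ h₂ hf₁ hf₂ hh₁ hh₂ h
    rw [← dirDeriv_const_mul 2 (md (hG j)),
      dirDeriv_congr (Filter.eventuallyEq_of_mem (hU.mem_nhds hx) h),
      dirDeriv_fun_sub (f := fun y => f₁ y * h₁ y) (h := fun y => f₂ y * h₂ y)
        ((md hf₁).mul (md hh₁)) ((md hf₂).mul (md hh₂)),
      dirDeriv_fun_mul (md hf₁) (md hh₁), dirDeriv_fun_mul (md hf₂) (md hh₂)]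
  -- The algebraic relations are differentiated once. The derivatives of `ℓ` and of the defect that
  -- appear are then eliminated by the rank-one equations, which leaves only those of `G`.
  have D01 := dR 0 0 _ _ _ _ (hℓs 5) (hℓs 4) s1 s2 hR1
  have D11 := dR 1 0 _ _ _ _ (hℓs 5) (hℓs 4) s1 s2 hR1
  have D02 := dR 0 1 _ _ _ _ (hℓs 4) (hℓs 5) s1 s0 hR2
  have D12 := dR 1 1 _ _ _ _ (hℓs 4) (hℓs 5) s1 s0 hR2
  obtain ⟨x0, x1, x2, x3, x4, x5⟩ := hξ0 x hx
  obtain ⟨y0, y1, y2, y3, y4, y5⟩ := hχ0 x hx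
  obtain ⟨L1, L2⟩ := hcr hξ x hx ⟨x0, x1, x2⟩
  obtain ⟨L3, L4⟩ := hcr hχ x hx ⟨y0, y1, y2⟩
  rw [x3, x4] at L1
  rw [x3, x5] at L2
  rw [y3, y4] at L3
  rw [y3, y5] at L4
  obtain ⟨B1, B2⟩ := A00 x hx
  obtain ⟨B3, B4⟩ := A10 x hx
  obtain ⟨B5, B6⟩ := A01 x hx
  obtain ⟨B7, B8⟩ := A11 x hx
  have R1 := hR1 x hx
  have R2 := hR2 x hx
  have hKx := hK x hx
  have hsym := logGrad_symm hv hU hK hx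
  have hu : defect00 g v x = gaussCurv g v x + logGrad g v 0 x ^ 2
    - (dirDeriv (v 0) (logGrad g v 0) x + structFun g v 0 x * logGrad g v 1 x) := rfl
  have hw : defect01 g v x = logGrad g v 0 x * logGrad g v 1 x
    - (dirDeriv (v 0) (logGrad g v 1) x - structFun g v 0 x * logGrad g v 0 x) := rfl
  have hz : defect11 g v x = gaussCurv g v x + logGrad g v 1 x ^ 2
    - (dirDeriv (v 1) (logGrad g v 1) x - structFun g v 1 x * logGrad g v 0 x) := rfl
  generalize structFun g v 0 x = c₀ at *
  generalize structFun g v 1 x = c₁ at *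
  refine defect_algebra hKx hne hu hw hz R1 R2 ?_ ?_ ?_ ?_
  · linear_combination D02 + ℓ 4 x * B5 + defect01 g v x * L1 - ℓ 5 x * B1 - defect00 g v x * L2
      - (logGrad g v 0 x - 2 * gaussCurv g v x * ℓ 4 x) * R2 - c₀ * R1
  · linear_combination D12 + ℓ 4 x * B4 + defect01 g v x * L3 - ℓ 5 x * B3 - defect00 g v x * L4
      + (logGrad g v 0 x - c₁) * R1
  · linear_combination D01 + ℓ 5 x * B5 + defect01 g v x * L2 - ℓ 4 x * B6 - defect11 g v x * L1
      + (logGrad g v 1 x + c₀) * R2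
  · linear_combination -2 * hsym + D11 + ℓ 5 x * B4 + defect01 g v x * L4 - ℓ 4 x * B8
      - defect11 g v x * L3 - (logGrad g v 1 x - 2 * gaussCurv g v x * ℓ 5 x) * R1 + c₁ * R2

/-- The fourth components of the second sections are `-2 K` times the components of the defect. A
component that is nonzero at the point provides the required section on the open set where it is
nonzero. -/
theorem IsDarbouxIntegrable.defect_eq_of_ne_zero (hg : IsDarbouxIntegrable g)
    (hv : IsOrthonormalFrameOn g v U) (hU : IsOpen U) {x : M} (hx : x ∈ U)
    (hne : ¬(defect00 g v x = 0 ∧ defect01 g v x = 0 ∧ defect11 g v x = 0)) :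
    defect00 g v x = 2 * gaussCurv g v x - 2 * logGrad g v 0 x ^ 2 ∧
    defect01 g v x = -2 * logGrad g v 0 x * logGrad g v 1 x ∧
    defect11 g v x = 2 * gaussCurv g v x - 2 * logGrad g v 1 x ^ 2 := by
  have hK : ∀ x ∈ U, gaussCurv g v x ≠ 0 := fun x hx => hg.gaussCurv_ne_zero hv hU hx
  obtain ⟨s0, s1, s2⟩ := smooth_defect hv hU hK
  have main : ∀ (d : M → ℝ), SmoothOn d U → d x ≠ 0 → (∀ W : Set M, IsOpen W → W ⊆ U →
      ∃ ζ, HolSec g v W ζ ∧ ∀ y, ζ 0 y = 0 ∧ ζ 1 y = 0 ∧ ζ 2 y = 0 ∧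
        ζ 3 y = -2 * gaussCurv g v y * d y) →
      defect00 g v x = 2 * gaussCurv g v x - 2 * logGrad g v 0 x ^ 2 ∧
      defect01 g v x = -2 * logGrad g v 0 x * logGrad g v 1 x ∧
      defect11 g v x = 2 * gaussCurv g v x - 2 * logGrad g v 1 x ^ 2 := by
    intro d hd hdx h
    have hW : IsOpen (U ∩ d ⁻¹' {0}ᶜ) :=
      hd.continuousOn.isOpen_inter_preimage hU isOpen_compl_singleton
    obtain ⟨ζ, hζ, h0⟩ := h _ hW Set.inter_subset_left
    refine hg.defect_eq_of_section (hv.mono Set.inter_subset_left) hW hζ (fun y hy => ?_)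
      (⟨hx, hdx⟩ : x ∈ U ∩ d ⁻¹' {0}ᶜ) hne
    obtain ⟨z0, z1, z2, z3⟩ := h0 y
    refine ⟨z0, z1, z2, ?_⟩
    rw [z3]
    exact mul_ne_zero (mul_ne_zero (by norm_num) (hK y hy.1)) hy.2
  have hsec := fun (W : Set M) (hW : IsOpen W) (hWU : W ⊆ U) =>
    holSec_secondSection (hv.mono hWU) hW fun y hy => hK y (hWU hy)
  by_cases h0 : defect00 g v x = 0
  · by_cases h1 : defect01 g v x = 0
    · exact main _ s2 (fun h2 => hne ⟨h0, h1, h2⟩)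
        fun W hW hWU => ⟨_, (hsec W hW hWU).2.2.2, fun y => ⟨rfl, rfl, rfl, rfl⟩⟩
    · exact main _ s1 h1 fun W hW hWU => ⟨_, (hsec W hW hWU).2.1, fun y => ⟨rfl, rfl, rfl, rfl⟩⟩
  · exact main _ s0 h0 fun W hW hWU => ⟨_, (hsec W hW hWU).1, fun y => ⟨rfl, rfl, rfl, rfl⟩⟩

/-- The differential equations of second order satisfied by the curvature of a metric whose
embedding system is Darboux integrable. -/
theorem IsDarbouxIntegrable.curvature_equation (hg : IsDarbouxIntegrable g)
    (hv : IsOrthonormalFrameOn g v U) (hU : IsOpen U) {x : M} (hx : x ∈ U) :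
    dirDeriv (v 0) (logGrad g v 0) x
      = 3 * logGrad g v 0 x ^ 2 - gaussCurv g v x - structFun g v 0 x * logGrad g v 1 x ∧
    dirDeriv (v 0) (logGrad g v 1) x
      = 3 * logGrad g v 0 x * logGrad g v 1 x + structFun g v 0 x * logGrad g v 0 x ∧
    dirDeriv (v 1) (logGrad g v 0) x
      = 3 * logGrad g v 0 x * logGrad g v 1 x - structFun g v 1 x * logGrad g v 1 x ∧
    dirDeriv (v 1) (logGrad g v 1) x
      = 3 * logGrad g v 1 x ^ 2 - gaussCurv g v x + structFun g v 1 x * logGrad g v 0 x := by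
  have hK : ∀ x ∈ U, gaussCurv g v x ≠ 0 := fun x hx => hg.gaussCurv_ne_zero hv hU hx
  obtain ⟨s0, s1, s2⟩ := smooth_defect hv hU hK
  have hKs := hv.smooth_gaussCurv hU
  have hG := smooth_logGrad hv hU hK
  -- By `IsDarbouxIntegrable.exists_defect_ne_zero` the points with nonzero defect are dense, so an
  -- identity between smooth functions that holds there holds everywhere.
  have main : ∀ f : M → ℝ, SmoothOn f U → (∀ y ∈ U,
      ¬(defect00 g v y = 0 ∧ defect01 g v y = 0 ∧ defect11 g v y = 0) → f y = 0) → f x = 0 := by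
    intro f hf h
    by_contra hfx
    have hW : IsOpen (U ∩ f ⁻¹' {0}ᶜ) :=
      hf.continuousOn.isOpen_inter_preimage hU isOpen_compl_singleton
    obtain ⟨y, hy, hne⟩ := hg.exists_defect_ne_zero (hv.mono Set.inter_subset_left) hW ⟨x, hx, hfx⟩
    exact hy.2 (h y hy.1 hne)
  have c2 : SmoothOn (fun _ : M => (2 : ℝ)) U := contMDiffOn_const
  have e0 := main (fun y => defect00 g v y - (2 * gaussCurv g v y - 2 * logGrad g v 0 y ^ 2))
    (s0.sub ((c2.mul hKs).sub (c2.mul ((hG 0).pow 2)))) fun y hy hne => by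
      rw [(hg.defect_eq_of_ne_zero hv hU hy hne).1, sub_self]
  have e1 := main (fun y => defect01 g v y - (-2 * logGrad g v 0 y * logGrad g v 1 y))
    (s1.sub ((contMDiffOn_const.mul (hG 0)).mul (hG 1))) fun y hy hne => by
      rw [(hg.defect_eq_of_ne_zero hv hU hy hne).2.1, sub_self]
  have e2 := main (fun y => defect11 g v y - (2 * gaussCurv g v y - 2 * logGrad g v 1 y ^ 2))
    (s2.sub ((c2.mul hKs).sub (c2.mul ((hG 1).pow 2)))) fun y hy hne => by
      rw [(hg.defect_eq_of_ne_zero hv hU hy hne).2.2, sub_self]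
  have hsym := logGrad_symm hv hU hK hx
  simp only [defect00, defect01, defect11] at e0 e1 e2
  exact ⟨by linear_combination -e0, by linear_combination -e1,
    by linear_combination hsym - e1, by linear_combination -e2⟩

end CurvatureEquation

/-! ### The Killing field -/

section KillingField

variable {M : Type*} [TopologicalSpace M] [ChartedSpace (EuclideanSpace ℝ (Fin 2)) M]
  [IsManifold (𝓡 2) ∞ M]
  {g : Metric2 M} {v : Fin 2 → (x : M) → TangentSpace (𝓡 2) x} {U : Set M}

theorem SmoothOn.rpow {f : M → ℝ} {W : Set M} (hf : SmoothOn f W) (h0 : ∀ x ∈ W, f x ≠ 0)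
    (r : ℝ) : SmoothOn (fun x => f x ^ r) W := fun x hx =>
  (Real.contDiffAt_rpow_const_of_ne (h0 x hx)).contMDiffAt.comp_contMDiffWithinAt x (hf x hx)

theorem SmoothOn.abs {f : M → ℝ} {W : Set M} (hf : SmoothOn f W) (h0 : ∀ x ∈ W, f x ≠ 0) :
    SmoothOn (fun x => |f x|) W := fun x hx =>
  (contDiffAt_abs (h0 x hx)).contMDiffAt.comp_contMDiffWithinAt x (hf x hx)

/-- Powers of the absolute value of the curvature. -/
theorem dirDeriv_abs_gaussCurv_rpow (hv : IsOrthonormalFrameOn g v U) (hU : IsOpen U)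
    (hK : ∀ x ∈ U, gaussCurv g v x ≠ 0) (r : ℝ) (i : Fin 2) {x : M} (hx : x ∈ U) :
    dirDeriv (v i) (fun x => |gaussCurv g v x| ^ r) x
      = 4 * r * |gaussCurv g v x| ^ r * logGrad g v i x := by
  have hKs := (hv.smooth_gaussCurv hU).mdifferentiableAt hU hx
  have h0 := hK x hx
  have h1 := (hasDerivAt_abs h0).rpow_const (p := r) (Or.inl (abs_pos.2 h0).ne')
  rw [dirDeriv_comp h1 hKs, dirDeriv_gaussCurv hv hU hK i hx, Real.rpow_sub_one (abs_pos.2 h0).ne']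
  have h2 : (SignType.sign (gaussCurv g v x) : ℝ) * gaussCurv g v x = |gaussCurv g v x| :=
    sign_mul_self _
  have h3 := (abs_pos.2 h0).ne'
  field_simp
  linear_combination r * logGrad g v i x * h2

theorem smooth_abs_gaussCurv_rpow (hv : IsOrthonormalFrameOn g v U) (hU : IsOpen U)
    (hK : ∀ x ∈ U, gaussCurv g v x ≠ 0) (r : ℝ) :
    SmoothOn (fun x => |gaussCurv g v x| ^ r) U :=
  ((hv.smooth_gaussCurv hU).abs hK).rpow (fun x hx => (abs_pos.2 (hK x hx)).ne') r

section

variable (hg : IsDarbouxIntegrable g) (hv : IsOrthonormalFrameOn g v U) (hU : IsOpen U)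

include hg hv hU

theorem qFun_pos {x : M} (hx : x ∈ U) : 0 < qFun g v x :=
  Real.rpow_pos_of_pos (abs_pos.2 (hg.gaussCurv_ne_zero hv hU hx)) _

theorem smooth_qFun : SmoothOn (qFun g v) U :=
  smooth_abs_gaussCurv_rpow hv hU (fun _ hx => hg.gaussCurv_ne_zero hv hU hx) _

theorem dirDeriv_qFun (i : Fin 2) {x : M} (hx : x ∈ U) :
    dirDeriv (v i) (qFun g v) x = -3 * qFun g v x * logGrad g v i x := by
  have := dirDeriv_abs_gaussCurv_rpow hv hU (fun x hx => hg.gaussCurv_ne_zero hv hU hx)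
    (-(3 / 4)) i hx
  refine this.trans ?_
  rw [qFun]
  ring

/-- The exponent `-3/4` makes `dq = -3 q G`, and the quadratic term produced by a second derivative
is exactly the `3 G ⊗ G` of the curvature equation. -/
theorem dirDeriv_dirDeriv_qFun (i j : Fin 2) {x : M} (hx : x ∈ U) :
    dirDeriv (v i) (dirDeriv (v j) (qFun g v)) x
      = -3 * qFun g v x * (dirDeriv (v i) (logGrad g v j) x
        - 3 * logGrad g v i x * logGrad g v j x) := by
  have hq := (smooth_qFun hg hv hU).mdifferentiableAt hU hx
  have hG := (smooth_logGrad hv hU (fun x hx => hg.gaussCurv_ne_zero hv hU hx) j).mdifferentiableAt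
    hU hx
  have h : dirDeriv (v j) (qFun g v) =ᶠ[nhds x] fun y => -3 * (qFun g v y * logGrad g v j y) :=
    Filter.eventuallyEq_of_mem (hU.mem_nhds hx) fun y hy => by
      rw [dirDeriv_qFun hg hv hU j hy, mul_assoc]
  rw [dirDeriv_congr h, dirDeriv_const_mul (f := fun y => qFun g v y * logGrad g v j y) _
    (hq.mul hG), dirDeriv_fun_mul hq hG, dirDeriv_qFun hg hv hU i hx]
  ring

theorem JGradq_eq : JGradq g v = (dirDeriv (v 0) (qFun g v)) • v 1
    + (fun x => -dirDeriv (v 1) (qFun g v) x) • v 0 := by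
  funext x
  simp [JGradq, sub_eq_add_neg]

theorem smooth_JGradq : SmoothFieldOn (JGradq g v) U := by
  have h := fun i => (smooth_qFun hg hv hU).dirDeriv (hv.smooth i) hU
  exact ((h 0).smul_section (hv.smooth 1)).sub_section ((h 1).smul_section (hv.smooth 0))

theorem mlieBracket_JGradq (i : Fin 2) {x : M} (hx : x ∈ U) :
    VectorField.mlieBracket (𝓡 2) (JGradq g v) (v i) x
      = (-dirDeriv (v i) (dirDeriv (v 0) (qFun g v)) x) • v 1 x
        + dirDeriv (v 0) (qFun g v) x • VectorField.mlieBracket (𝓡 2) (v 1) (v i) x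
        + (dirDeriv (v i) (dirDeriv (v 1) (qFun g v)) x) • v 0 x
        + (-dirDeriv (v 1) (qFun g v) x) • VectorField.mlieBracket (𝓡 2) (v 0) (v i) x := by
  have h := fun i => ((smooth_qFun hg hv hU).dirDeriv (hv.smooth i) hU)
  have hd := fun i => (h i).mdifferentiableAt hU hx
  have hvd : ∀ i, MDifferentiableAt (𝓡 2) (𝓡 2).tangent
      (fun x => (⟨x, v i x⟩ : TangentBundle (𝓡 2) M)) x := fun i =>
    ((hv.smooth i x hx).contMDiffAt (hU.mem_nhds hx)).mdifferentiableAt (by simp)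
  have hs : ∀ {f : M → ℝ}, SmoothOn f U → ∀ i, MDifferentiableAt (𝓡 2) (𝓡 2).tangent
      (fun x => (⟨x, (f • v i) x⟩ : TangentBundle (𝓡 2) M)) x := fun hf i =>
    ((hf.smul_section (hv.smooth i) x hx).contMDiffAt (hU.mem_nhds hx)).mdifferentiableAt (by simp)
  rw [JGradq_eq hg hv hU, VectorField.mlieBracket_add_left (hs (h 0) 1) (hs (h 1).neg 0),
    VectorField.mlieBracket_smul_left (hd 0) (hvd 1),
    VectorField.mlieBracket_smul_left (f := fun x => -dirDeriv (v 1) (qFun g v) x) (hd 1).neg (hvd 0)]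
  have e : (mvfderiv (𝓡 2) (fun x => -dirDeriv (v 1) (qFun g v) x) x) (v i x)
      = -dirDeriv (v i) (dirDeriv (v 1) (qFun g v)) x := dirDeriv_neg (X := v i)
  rw [← add_assoc]
  congr 2
  rw [e, neg_neg]

/-- The field `J ∇q` is a Killing field. -/
theorem isKillingOn_JGradq : IsKillingOn g v (JGradq g v) U := by
  refine ⟨smooth_JGradq hg hv hU, fun x hx i j => ?_⟩
  have h0 : dirDeriv (JGradq g v) (fun y => g.inner y (v i y) (v j y)) x = 0 := by
    rw [dirDeriv_congr (g := fun _ => if i = j then 1 else 0) (Filter.eventuallyEq_of_mem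
      (hU.mem_nhds hx) fun y hy => hv.orthonormal y hy i j), dirDeriv_const]
  have hb : ∀ k l, g.inner x (VectorField.mlieBracket (𝓡 2) (JGradq g v) (v k) x) (v l x)
      = -dirDeriv (v k) (dirDeriv (v 0) (qFun g v)) x * (if (1 : Fin 2) = l then 1 else 0)
        + dirDeriv (v 0) (qFun g v) x * (if k = 0 then -structFun g v l x else 0)
        + dirDeriv (v k) (dirDeriv (v 1) (qFun g v)) x * (if (0 : Fin 2) = l then 1 else 0)
        - dirDeriv (v 1) (qFun g v) x * (if k = 1 then structFun g v l x else 0) := by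
    intro k l
    have o := hv.orthonormal x hx
    rw [mlieBracket_JGradq hg hv hU k hx]
    simp only [map_add, map_smul, add_apply, smul_apply, smul_eq_mul, o]
    have e1 : g.inner x (VectorField.mlieBracket (𝓡 2) (v 1) (v k) x) (v l x)
        = if k = 0 then -structFun g v l x else 0 := by
      fin_cases k
      · change g.inner x (VectorField.mlieBracket (𝓡 2) (v 1) (v 0) x) (v l x)
          = -g.inner x (VectorField.mlieBracket (𝓡 2) (v 0) (v 1) x) (v l x)
        rw [VectorField.mlieBracket_swap_apply, map_neg]
        rfl
      · change g.inner x (VectorField.mlieBracket (𝓡 2) (v 1) (v 1) x) (v l x) = 0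
        rw [VectorField.mlieBracket_self]
        simp
    have e2 : g.inner x (VectorField.mlieBracket (𝓡 2) (v 0) (v k) x) (v l x)
        = if k = 1 then structFun g v l x else 0 := by
      fin_cases k
      · change g.inner x (VectorField.mlieBracket (𝓡 2) (v 0) (v 0) x) (v l x) = 0
        rw [VectorField.mlieBracket_self]
        simp
      · rfl
    rw [e1, e2]
    ring
  rw [h0, g.symm x (v i x), hb, hb]
  simp only [dirDeriv_dirDeriv_qFun hg hv hU _ _ hx, dirDeriv_qFun hg hv hU _ hx]
  -- By these equations the Hessian of `q` is `3 K q g`. The covariant derivative of the rotated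
  -- gradient is then skew, which is the Killing equation.
  obtain ⟨E1, E2, E3, E4⟩ := hg.curvature_equation hv hU hx
  fin_cases i <;> fin_cases j <;> simp [E1, E2, E3, E4] <;> ring

theorem JGradq_eq_zero_iff {x : M} (hx : x ∈ U) :
    JGradq g v x = 0 ↔ logGrad g v 0 x = 0 ∧ logGrad g v 1 x = 0 := by
  have hq := qFun_pos hg hv hU hx
  constructor
  · intro h
    have e0 := congrArg (g.inner x (v 0 x)) h
    have e1 := congrArg (g.inner x (v 1 x)) h
    simp only [JGradq, map_sub, map_smul, map_zero, smul_eq_mul, hv.inner_00 hx, hv.inner_01 hx,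
      hv.inner_10 hx, hv.inner_11 hx, dirDeriv_qFun hg hv hU _ hx] at e0 e1
    have hq' := hq.ne'
    constructor
    · apply mul_left_cancel₀ hq'; linarith
    · apply mul_left_cancel₀ hq'; linarith
  · rintro ⟨h0, h1⟩
    simp [JGradq, dirDeriv_qFun hg hv hU _ hx, h0, h1]

/-- The zeros of `J ∇q` have empty interior. -/
theorem exists_JGradq_ne_zero {W : Set M} (hW : IsOpen W) (hWU : W ⊆ U) (hne : W.Nonempty) :
    ∃ p ∈ W, JGradq g v p ≠ 0 := by
  by_contra! h
  obtain ⟨p, hp⟩ := hne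
  have hG := fun x (hx : x ∈ W) => (JGradq_eq_zero_iff hg hv hU (hWU hx)).1 (h x hx)
  have d0 := dirDeriv_eq_zero (X := v 0) hW (fun y hy => (hG y hy).1) hp
  -- With `G = 0` on an open set the first equation reads `0 = -K`.
  obtain ⟨E1, -⟩ := hg.curvature_equation hv hU (hWU hp)
  rw [d0, (hG p hp).1, (hG p hp).2] at E1
  exact hg.gaussCurv_ne_zero hv hU (hWU hp) (by linear_combination E1)

end

end KillingField

/-! ### Closed forms and constant functions -/

section Integration

variable {M : Type*} [TopologicalSpace M] [ChartedSpace (EuclideanSpace ℝ (Fin 2)) M]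
  [IsManifold (𝓡 2) ∞ M]
  {g : Metric2 M} {v : Fin 2 → (x : M) → TangentSpace (𝓡 2) x} {U : Set M}

/-- The part of the range of the chart at `p` that corresponds to `W`. -/
def chartRange (p : M) (W : Set M) : Set (EuclideanSpace ℝ (Fin 2)) :=
  (extChartAt (𝓡 2) p).target ∩ (extChartAt (𝓡 2) p).symm ⁻¹' W

theorem isOpen_chartRange (p : M) {W : Set M} (hW : IsOpen W) : IsOpen (chartRange p W) :=
  (continuousOn_extChartAt_symm p).isOpen_inter_preimage (isOpen_extChartAt_target p) hW

theorem mem_chartRange {p x : M} {W : Set M} (hx : x ∈ W)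
    (hs : x ∈ (extChartAt (𝓡 2) p).source) : extChartAt (𝓡 2) p x ∈ chartRange p W :=
  ⟨(extChartAt (𝓡 2) p).map_source hs, by
    rw [Set.mem_preimage, (extChartAt (𝓡 2) p).left_inv hs]; exact hx⟩

theorem SmoothOn.contDiffOn_chartRange {f : M → ℝ} {W : Set M} (hf : SmoothOn f W) (p : M) :
    ContDiffOn ℝ ∞ (f ∘ (extChartAt (𝓡 2) p).symm) (chartRange p W) := by
  have h := contMDiffOn_extChartAt_symm (I := 𝓡 2) (n := ∞) p
  exact (hf.comp (h.mono Set.inter_subset_left) fun z hz => hz.2).contDiffOn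

/-- The derivative of a function in the chart. -/
theorem dirDeriv_eq_chart (X : (x : M) → TangentSpace (𝓡 2) x) {p x : M}
    {F : EuclideanSpace ℝ (Fin 2) → ℝ} (hx : x ∈ (extChartAt (𝓡 2) p).source)
    (hF : DifferentiableAt ℝ F (extChartAt (𝓡 2) p x)) :
    dirDeriv X (F ∘ extChartAt (𝓡 2) p) x
      = fderiv ℝ F (extChartAt (𝓡 2) p x) (EuclideanSpace.single 0 1) * dirDeriv X (chartCoord p 0) x
        + fderiv ℝ F (extChartAt (𝓡 2) p x) (EuclideanSpace.single 1 1)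
          * dirDeriv X (chartCoord p 1) x := by
  have hmd : MDifferentiableAt (𝓡 2) 𝓘(ℝ, EuclideanSpace ℝ (Fin 2)) (extChartAt (𝓡 2) p) x :=
    mdifferentiableAt_extChartAt (by simpa using hx)
  have h1 := (hF.hasFDerivAt.hasMFDerivAt.comp x hmd.hasMFDerivAt).mfderiv
  have h2 : dirDeriv X (F ∘ extChartAt (𝓡 2) p) x = fderiv ℝ F (extChartAt (𝓡 2) p x)
      (mfderiv (𝓡 2) 𝓘(ℝ, EuclideanSpace ℝ (Fin 2)) (extChartAt (𝓡 2) p) x (X x)) := by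
    unfold dirDeriv; rw [h1]; rfl
  rw [h2, dirDeriv_chartCoord X hx, dirDeriv_chartCoord X hx]
  generalize (mfderiv (𝓡 2) 𝓘(ℝ, EuclideanSpace ℝ (Fin 2)) (extChartAt (𝓡 2) p) x (X x)) = u
  change fderiv ℝ F _ (show EuclideanSpace ℝ (Fin 2) from u) = _
  have h3 : (show EuclideanSpace ℝ (Fin 2) from u)
      = (show EuclideanSpace ℝ (Fin 2) from u) 0 • EuclideanSpace.single 0 (1 : ℝ)
        + (show EuclideanSpace ℝ (Fin 2) from u) 1 • EuclideanSpace.single 1 (1 : ℝ) := by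
    ext j; fin_cases j <;> simp
  conv_lhs => rw [h3]
  rw [map_add, map_smul, map_smul, smul_eq_mul, smul_eq_mul, mul_comm, mul_comm (_ : ℝ) (fderiv _ _ _ _)]

theorem dirDeriv_eq_chart' (X : (x : M) → TangentSpace (𝓡 2) x) {p x : M} {f : M → ℝ} {W : Set M}
    (hW : IsOpen W) (hf : SmoothOn f W) (hxW : x ∈ W) (hx : x ∈ (extChartAt (𝓡 2) p).source) :
    dirDeriv X f x
      = fderiv ℝ (f ∘ (extChartAt (𝓡 2) p).symm) (extChartAt (𝓡 2) p x) (EuclideanSpace.single 0 1)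
          * dirDeriv X (chartCoord p 0) x
        + fderiv ℝ (f ∘ (extChartAt (𝓡 2) p).symm) (extChartAt (𝓡 2) p x)
          (EuclideanSpace.single 1 1) * dirDeriv X (chartCoord p 1) x := by
  have hd : DifferentiableAt ℝ (f ∘ (extChartAt (𝓡 2) p).symm) (extChartAt (𝓡 2) p x) :=
    ((hf.contDiffOn_chartRange p).contDiffAt ((isOpen_chartRange p hW).mem_nhds
      (mem_chartRange hxW hx))).differentiableAt (by simp)
  rw [← dirDeriv_eq_chart X hx hd]
  refine dirDeriv_congr ?_
  filter_upwards [(isOpen_extChartAt_source p).mem_nhds hx] with y hy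
  exact congrArg f ((extChartAt (𝓡 2) p).left_inv hy).symm

theorem clm_two_ext {F : Type*} [NormedAddCommGroup F] [NormedSpace ℝ F]
    {A B : EuclideanSpace ℝ (Fin 2) →L[ℝ] F}
    (h : ∀ j, A (EuclideanSpace.single j 1) = B (EuclideanSpace.single j 1)) : A = B := by
  ext u
  have h3 : u = u 0 • EuclideanSpace.single 0 (1 : ℝ) + u 1 • EuclideanSpace.single 1 (1 : ℝ) := by
    ext j; fin_cases j <;> simp
  rw [h3]
  simp only [map_add, map_smul, h]

/-- A function with vanishing derivatives is locally constant. -/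
theorem IsOrthonormalFrameOn.eventually_eq_of_dirDeriv_eq_zero (hv : IsOrthonormalFrameOn g v U)
    {W : Set M} (hW : IsOpen W) (hWU : W ⊆ U) {p : M} (hp : p ∈ W) {f : M → ℝ} (hf : SmoothOn f W)
    (h : ∀ x ∈ W, ∀ i, dirDeriv (v i) f x = 0) : ∀ᶠ x in nhds p, f x = f p := by
  set φ := extChartAt (𝓡 2) p with hφ
  obtain ⟨r, hr, hB⟩ := Metric.isOpen_iff.1 (isOpen_chartRange p hW) _
    (mem_chartRange hp (mem_extChartAt_source p))
  have hF := hf.contDiffOn_chartRange p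
  have h0 : Set.EqOn (fderiv ℝ (f ∘ φ.symm)) 0 (Metric.ball (φ p) r) := by
    intro z hz
    have hzt := (hB hz).1
    have hzW := (hB hz).2
    have hzs : φ.symm z ∈ φ.source := φ.map_target hzt
    have hdet := hv.chartCoord_det_ne_zero (p := p) ⟨hWU hzW, hzs⟩
    have e := fun i => dirDeriv_eq_chart' (v i) hW hf hzW hzs
    have er : extChartAt (𝓡 2) p (φ.symm z) = z := φ.right_inv hzt
    rw [er] at e
    have e0 := (h _ hzW 0).symm.trans (e 0)
    have e1 := (h _ hzW 1).symm.trans (e 1)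
    refine clm_two_ext fun j => ?_
    have hz0 : fderiv ℝ (f ∘ φ.symm) z (EuclideanSpace.single 0 1) = 0 := by
      apply mul_left_cancel₀ hdet
      linear_combination dirDeriv (v 0) (chartCoord p 1) (φ.symm z) * e1
        - dirDeriv (v 1) (chartCoord p 1) (φ.symm z) * e0
    have hz1 : fderiv ℝ (f ∘ φ.symm) z (EuclideanSpace.single 1 1) = 0 := by
      apply mul_left_cancel₀ hdet
      linear_combination dirDeriv (v 1) (chartCoord p 0) (φ.symm z) * e0
        - dirDeriv (v 0) (chartCoord p 0) (φ.symm z) * e1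
    fin_cases j
    · exact hz0
    · exact hz1
  have hc := fun z (hz : z ∈ Metric.ball (φ p) r) => Metric.isOpen_ball.is_const_of_fderiv_eq_zero
    (convex_ball _ _).isPreconnected ((hF.mono hB).differentiableOn (by simp)) h0 hz
    (Metric.mem_ball_self hr)
  have hcont : ContinuousAt φ p := continuousAt_extChartAt p
  filter_upwards [hcont.preimage_mem_nhds (Metric.ball_mem_nhds _ hr),
    extChartAt_source_mem_nhds (I := 𝓡 2) p] with x hx hxs
  have e := hc _ hx
  simp only [Function.comp] at e
  rwa [φ.left_inv hxs, φ.left_inv (mem_extChartAt_source p)] at e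

/-- The Poincaré lemma. -/
theorem IsOrthonormalFrameOn.exists_potential (hv : IsOrthonormalFrameOn g v U) {W : Set M}
    (hW : IsOpen W) (hWU : W ⊆ U) {p : M} (hp : p ∈ W) {α : Fin 2 → M → ℝ}
    (hα : ∀ i, SmoothOn (α i) W)
    (hcl : ∀ x ∈ W, dirDeriv (v 0) (α 1) x - dirDeriv (v 1) (α 0) x
      = structFun g v 0 x * α 0 x + structFun g v 1 x * α 1 x) :
    ∃ (W' : Set M) (t : M → ℝ), IsOpen W' ∧ p ∈ W' ∧ W' ⊆ W ∧ SmoothOn t W' ∧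
      ∀ x ∈ W', ∀ i, dirDeriv (v i) t x = α i x := by
  set φ := extChartAt (𝓡 2) p with hφ
  set W₁ : Set M := W ∩ φ.source with hW₁
  have hW₁o : IsOpen W₁ := hW.inter (isOpen_extChartAt_source p)
  have hv₁ : IsOrthonormalFrameOn g v W₁ := hv.mono (Set.inter_subset_left.trans hWU)
  have hu : ∀ j, SmoothOn (chartCoord p j) W₁ := fun j =>
    (smooth_chartCoord p j).mono Set.inter_subset_right
  have hdu : ∀ i j, SmoothOn (dirDeriv (v i) (chartCoord p j)) W₁ := fun i j =>
    (hu j).dirDeriv (hv₁.smooth i) hW₁o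
  have hα₁ : ∀ i, SmoothOn (α i) W₁ := fun i => (hα i).mono Set.inter_subset_left
  set δ : M → ℝ := fun x => dirDeriv (v 0) (chartCoord p 0) x * dirDeriv (v 1) (chartCoord p 1) x
        - dirDeriv (v 0) (chartCoord p 1) x * dirDeriv (v 1) (chartCoord p 0) x with hδ
  have hδ0 : ∀ x ∈ W₁, δ x ≠ 0 := fun x hx =>
    hv.chartCoord_det_ne_zero (p := p) ⟨hWU hx.1, hx.2⟩
  have hδs : SmoothOn δ W₁ := ((hdu 0 0).mul (hdu 1 1)).sub ((hdu 0 1).mul (hdu 1 0))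
  -- The coefficients, by Cramer's rule, of the form `α 0 η¹ + α 1 η²` with respect to the
  -- differentials of the chart coordinates.
  set A : Fin 2 → M → ℝ := ![
    fun x => (α 0 x * dirDeriv (v 1) (chartCoord p 1) x
      - α 1 x * dirDeriv (v 0) (chartCoord p 1) x) / δ x,
    fun x => (α 1 x * dirDeriv (v 0) (chartCoord p 0) x
      - α 0 x * dirDeriv (v 1) (chartCoord p 0) x) / δ x] with hA
  have hAs : ∀ j, SmoothOn (A j) W₁ := fun j => by
    fin_cases j
    · exact SmoothOn.div' (((hα₁ 0).mul (hdu 1 1)).sub ((hα₁ 1).mul (hdu 0 1))) hδs hδ0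
    · exact SmoothOn.div' (((hα₁ 1).mul (hdu 0 0)).sub ((hα₁ 0).mul (hdu 1 0))) hδs hδ0
  have hAα : ∀ x ∈ W₁, ∀ i, α i x = A 0 x * dirDeriv (v i) (chartCoord p 0) x
      + A 1 x * dirDeriv (v i) (chartCoord p 1) x := by
    intro x hx i
    have := hδ0 x hx
    fin_cases i
    · simp only [hA, Matrix.cons_val, Fin.zero_eta, Fin.isValue]
      field_simp
      simp only [hδ]; ring
    · simp only [hA, Matrix.cons_val, Fin.mk_one, Fin.isValue]
      field_simp
      simp only [hδ]; ring
  -- Closedness in coordinate form: the commutators of the coordinate functions absorb the structure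
  -- functions in `hcl`.
  have hcurl : ∀ x ∈ W₁,
      (dirDeriv (v 0) (A 0) x * dirDeriv (v 1) (chartCoord p 0) x
        - dirDeriv (v 1) (A 0) x * dirDeriv (v 0) (chartCoord p 0) x)
      + (dirDeriv (v 0) (A 1) x * dirDeriv (v 1) (chartCoord p 1) x
        - dirDeriv (v 1) (A 1) x * dirDeriv (v 0) (chartCoord p 1) x) = 0 := by
    intro x hx
    have hm : ∀ {f : M → ℝ}, SmoothOn f W₁ → MDifferentiableAt (𝓡 2) 𝓘(ℝ, ℝ) f x := fun hf =>
      hf.mdifferentiableAt hW₁o hx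
    have hd : ∀ k i, dirDeriv (v k) (α i) x
        = A 0 x * dirDeriv (v k) (dirDeriv (v i) (chartCoord p 0)) x
          + dirDeriv (v i) (chartCoord p 0) x * dirDeriv (v k) (A 0) x
          + (A 1 x * dirDeriv (v k) (dirDeriv (v i) (chartCoord p 1)) x
          + dirDeriv (v i) (chartCoord p 1) x * dirDeriv (v k) (A 1) x) := by
      intro k i
      rw [dirDeriv_congr (f := α i) (g := A 0 * dirDeriv (v i) (chartCoord p 0)
        + A 1 * dirDeriv (v i) (chartCoord p 1)) (Filter.eventuallyEq_of_mem (hW₁o.mem_nhds hx)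
          fun y hy => hAα y hy i),
        dirDeriv_add (hm ((hAs 0).mul (hdu i 0))) (hm ((hAs 1).mul (hdu i 1))),
        dirDeriv_mul (hm (hAs 0)) (hm (hdu i 0)), dirDeriv_mul (hm (hAs 1)) (hm (hdu i 1))]
    have c := fun j => hv₁.commutator hW₁o (hu j) hx
    have h1 := hcl x hx.1
    rw [hd, hd, hAα x hx 0, hAα x hx 1] at h1
    linear_combination h1 - A 0 x * c 0 - A 1 x * c 1
  obtain ⟨r, hr, hB⟩ := Metric.isOpen_iff.1 (isOpen_chartRange p hW₁o) _
    (mem_chartRange (⟨hp, mem_extChartAt_source p⟩ : p ∈ W₁) (mem_extChartAt_source p))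
  set Â : Fin 2 → EuclideanSpace ℝ (Fin 2) → ℝ := fun j => A j ∘ φ.symm with hÂ
  have hÂs : ∀ j, ContDiffOn ℝ ∞ (Â j) (Metric.ball (φ p) r) := fun j =>
    ((hAs j).contDiffOn_chartRange p).mono hB
  set η : EuclideanSpace ℝ (Fin 2) → EuclideanSpace ℝ (Fin 2) →L[ℝ] ℝ := fun z =>
    Â 0 z • EuclideanSpace.proj 0 + Â 1 z • EuclideanSpace.proj 1 with hη
  have hηs : ContDiffOn ℝ ∞ η (Metric.ball (φ p) r) :=
    ((hÂs 0).smul contDiffOn_const).add ((hÂs 1).smul contDiffOn_const)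
  have hηd : ∀ z ∈ Metric.ball (φ p) r, ∀ u w, fderiv ℝ η z u w
      = fderiv ℝ (Â 0) z u * w 0 + fderiv ℝ (Â 1) z u * w 1 := by
    intro z hz u w
    have hd := fun j => ((hÂs j).contDiffAt (Metric.isOpen_ball.mem_nhds hz)).differentiableAt
      (by simp)
    have := (((hd 0).hasFDerivAt.smul_const (EuclideanSpace.proj (𝕜 := ℝ) (0 : Fin 2))).add
      ((hd 1).hasFDerivAt.smul_const (EuclideanSpace.proj (𝕜 := ℝ) (1 : Fin 2)))).fderiv
    have h2 : fderiv ℝ η z = _ := this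
    rw [h2]
    simp
  have hsymm : ∀ z ∈ Metric.ball (φ p) r, ∀ u w, fderiv ℝ η z u w = fderiv ℝ η z w u := by
    intro z hz u w
    rw [hηd z hz, hηd z hz]
    have hzt := (hB hz).1
    have hzW : φ.symm z ∈ W₁ := (hB hz).2
    have e := fun i j => dirDeriv_eq_chart' (v i) hW₁o (hAs j) hzW hzW.2
    have er : extChartAt (𝓡 2) p (φ.symm z) = z := φ.right_inv hzt
    simp only [er] at e
    have hc := hcurl _ hzW
    simp only [e] at hc
    have hlin : ∀ j u, fderiv ℝ (Â j) z u = u 0 * fderiv ℝ (Â j) z (EuclideanSpace.single 0 1)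
        + u 1 * fderiv ℝ (Â j) z (EuclideanSpace.single 1 1) := by
      intro j u
      have h3 : u = u 0 • EuclideanSpace.single 0 (1 : ℝ) + u 1 • EuclideanSpace.single 1 (1 : ℝ) := by
        ext j; fin_cases j <;> simp
      conv_lhs => rw [h3]
      simp
    have key : fderiv ℝ (Â 1) z (EuclideanSpace.single 0 1)
        = fderiv ℝ (Â 0) z (EuclideanSpace.single 1 1) := by
      apply mul_left_cancel₀ (hδ0 _ hzW)
      simp only [hδ, hÂ]
      linear_combination hc
    rw [hlin 0 u, hlin 1 u, hlin 0 w, hlin 1 w, key]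
    ring
  -- On a ball in the chart the form has a symmetric derivative, and so it has a primitive.
  obtain ⟨T, hT⟩ := (convex_ball (φ p) r).exists_forall_hasFDerivAt_of_fderiv_symmetric
    Metric.isOpen_ball (hηs.differentiableOn (by simp)) hsymm
  have hTs : ContDiffOn ℝ ∞ T (Metric.ball (φ p) r) := by
    rw [contDiffOn_infty_iff_fderiv_of_isOpen Metric.isOpen_ball]
    exact ⟨fun z hz => (hT z hz).differentiableAt.differentiableWithinAt,
      hηs.congr fun z hz => (hT z hz).fderiv⟩
  have hφs : ContMDiffOn (𝓡 2) 𝓘(ℝ, EuclideanSpace ℝ (Fin 2)) ∞ φ φ.source := by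
    have := contMDiffOn_extChartAt (I := 𝓡 2) (n := ∞) (x := p)
    rwa [← extChartAt_source (𝓡 2)] at this
  refine ⟨φ.source ∩ φ ⁻¹' Metric.ball (φ p) r, T ∘ φ,
    (continuousOn_extChartAt p).isOpen_inter_preimage (isOpen_extChartAt_source p)
      Metric.isOpen_ball, ⟨mem_extChartAt_source p, Metric.mem_ball_self hr⟩, fun x hx => ?_,
    hTs.contMDiffOn.comp (hφs.mono Set.inter_subset_left) fun x hx => hx.2, fun x hx i => ?_⟩
  · have := (hB hx.2).2.1
    rwa [← hφ, φ.left_inv hx.1] at this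
  · have hxW : x ∈ W₁ := by
      have := (hB hx.2).2
      rwa [Set.mem_preimage, ← hφ, φ.left_inv hx.1] at this
    rw [dirDeriv_eq_chart (v i) hx.1 (hT _ hx.2).differentiableAt, hAα x hxW, (hT _ hx.2).fderiv]
    simp [hη, hÂ, φ.left_inv hx.1]

end Integration

/-! ### Integrals depending on parameters -/

section ParametricIntegral

open MeasureTheory

variable {E F : Type} [NormedAddCommGroup E] [NormedSpace ℝ E] [NormedAddCommGroup F]
  [NormedSpace ℝ F]

/-- The parameters for which the whole unit interval lies in `O`. -/
def unitFiber (O : Set (E × ℝ)) : Set E := {e | ∀ s ∈ Set.Icc (0 : ℝ) 1, (e, s) ∈ O}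

theorem exists_tube {O : Set (E × ℝ)} (hO : IsOpen O) {e : E} (he : e ∈ unitFiber O) :
    ∃ u, IsOpen u ∧ e ∈ u ∧ ∀ e' ∈ u, e' ∈ unitFiber O := by
  obtain ⟨u, w, hu, hw, heu, hsw, h⟩ := generalized_tube_lemma (isCompact_singleton (x := e))
    (isCompact_Icc (a := (0 : ℝ)) (b := 1)) hO (by
      rintro ⟨e', s⟩ ⟨h1, h2⟩
      obtain rfl : e' = e := h1
      exact he s h2)
  exact ⟨u, hu, heu rfl, fun e' he' s hs => h ⟨he', hsw hs⟩⟩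

theorem isOpen_unitFiber {O : Set (E × ℝ)} (hO : IsOpen O) : IsOpen (unitFiber O) :=
  isOpen_iff_forall_mem_open.2 fun _ he =>
    let ⟨u, hu, heu, h⟩ := exists_tube hO he
    ⟨u, h, hu, heu⟩

/-- The tube lemma over the compact unit interval makes the bound uniform for nearby parameters, as
domination under the integral sign requires. -/
theorem exists_bound {O : Set (E × ℝ)} (hO : IsOpen O) {G : E × ℝ → F} (hG : ContinuousOn G O)
    {e : E} (he : e ∈ unitFiber O) :
    ∃ C, ∃ u ∈ nhds e, u ⊆ unitFiber O ∧ ∀ e' ∈ u, ∀ s ∈ Set.Icc (0 : ℝ) 1, ‖G (e', s)‖ ≤ C := by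
  have h1 : ContinuousOn (fun s : ℝ => ‖G (e, s)‖) (Set.Icc 0 1) :=
    (hG.comp (by fun_prop) fun s hs => he s hs).norm
  obtain ⟨C, hC⟩ := isCompact_Icc.bddAbove_image h1
  have h2 : IsOpen (O ∩ (fun z => ‖G z‖) ⁻¹' Set.Iio (C + 1)) :=
    hG.norm.isOpen_inter_preimage hO isOpen_Iio
  obtain ⟨u, hu, heu, h⟩ := exists_tube (e := e) h2 fun s hs =>
    ⟨he s hs, lt_of_le_of_lt (hC ⟨s, hs, rfl⟩) (lt_add_one C)⟩
  exact ⟨C + 1, u, hu.mem_nhds heu, fun e' he' s hs => (h e' he' s hs).1,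
    fun e' he' s hs => (h e' he' s hs).2.le⟩

theorem intervalIntegrable_fiber {O : Set (E × ℝ)} {G : E × ℝ → F} (hG : ContinuousOn G O)
    {e : E} (he : e ∈ unitFiber O) :
    IntervalIntegrable (fun s => G (e, s)) volume 0 1 := by
  apply ContinuousOn.intervalIntegrable
  rw [Set.uIcc_of_le zero_le_one]
  exact hG.comp (by fun_prop) fun s hs => he s hs

theorem hasFDerivAt_unitIntegral {O : Set (E × ℝ)} (hO : IsOpen O) {H : E × ℝ → F}
    (hH : ContDiffOn ℝ ∞ H O) {e : E} (he : e ∈ unitFiber O) :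
    HasFDerivAt (fun e => ∫ s in (0 : ℝ)..1, H (e, s))
      (∫ s in (0 : ℝ)..1, (fderiv ℝ H (e, s)).comp (ContinuousLinearMap.inl ℝ E ℝ)) e := by
  have hD : ContinuousOn (fun z => (fderiv ℝ H z).comp (ContinuousLinearMap.inl ℝ E ℝ)) O :=
    ((hH.fderiv_of_isOpen (m := ∞) hO (by simp)).clm_comp contDiffOn_const).continuousOn
  obtain ⟨C, u, hu, huO, hC⟩ := exists_bound hO hD he
  have hIoc : ∀ s, s ∈ Set.uIoc (0 : ℝ) 1 → s ∈ Set.Icc (0 : ℝ) 1 := fun s hs => by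
    rw [Set.uIoc_of_le zero_le_one] at hs
    exact Set.Ioc_subset_Icc_self hs
  refine intervalIntegral.hasFDerivAt_integral_of_dominated_of_fderiv_le (bound := fun _ => C)
    (F' := fun e s => (fderiv ℝ H (e, s)).comp (ContinuousLinearMap.inl ℝ E ℝ)) hu ?_
    (intervalIntegrable_fiber hH.continuousOn he)
    (intervalIntegrable_iff.1 (intervalIntegrable_fiber hD he)).aestronglyMeasurable ?_ (by simp) ?_
  · filter_upwards [hu] with e' he'
    exact (intervalIntegrable_iff.1
      (intervalIntegrable_fiber hH.continuousOn (huO he'))).aestronglyMeasurable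
  · exact Filter.Eventually.of_forall fun s hs e' he' => hC e' he' s (hIoc s hs)
  · refine Filter.Eventually.of_forall fun s hs e' he' => ?_
    have h1 : HasFDerivAt H (fderiv ℝ H (e', s)) (e', s) :=
      ((hH.contDiffAt (hO.mem_nhds (huO he' s (hIoc s hs)))).differentiableAt
        (by simp)).hasFDerivAt
    have h2 : HasFDerivAt (fun e : E => (e, s)) (ContinuousLinearMap.inl ℝ E ℝ) e' :=
      hasFDerivAt_prodMk_left e' s
    exact h1.comp e' h2

/-- The derivative of the integral is an integral of the same kind, with values in a space of linear
maps; the induction therefore varies the target space. -/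
theorem contDiffOn_unitIntegral_nat (n : ℕ) {O : Set (E × ℝ)} (hO : IsOpen O) {H : E × ℝ → F}
    (hH : ContDiffOn ℝ ∞ H O) :
    ContDiffOn ℝ n (fun e => ∫ s in (0 : ℝ)..1, H (e, s)) (unitFiber O) := by
  induction n generalizing F with
  | zero =>
    rw [Nat.cast_zero, contDiffOn_zero]
    exact fun e he => (hasFDerivAt_unitIntegral hO hH he).continuousAt.continuousWithinAt
  | succ n ih =>
    rw [Nat.cast_succ, contDiffOn_succ_iff_fderiv_of_isOpen (isOpen_unitFiber hO)]
    refine ⟨fun e he =>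
      (hasFDerivAt_unitIntegral hO hH he).differentiableAt.differentiableWithinAt, by simp, ?_⟩
    have h := ih ((hH.fderiv_of_isOpen (m := ∞) hO (by simp)).clm_comp
      (contDiffOn_const (c := ContinuousLinearMap.inl ℝ E ℝ)))
    exact h.congr fun e he => (hasFDerivAt_unitIntegral hO hH he).fderiv

/-- Smooth dependence of an integral on parameters. -/
theorem contDiffOn_unitIntegral {O : Set (E × ℝ)} (hO : IsOpen O) {H : E × ℝ → F}
    (hH : ContDiffOn ℝ ∞ H O) :
    ContDiffOn ℝ ∞ (fun e => ∫ s in (0 : ℝ)..1, H (e, s)) (unitFiber O) :=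
  contDiffOn_infty.2 fun n => contDiffOn_unitIntegral_nat n hO hH

variable {A : Type} [NormedAddCommGroup A] [NormedSpace ℝ A]

/-- The pairs `(a, y)` such that `O` contains the segment from `(a, y₀)` to `(a, y)`. -/
def segFiber (O : Set (A × ℝ)) (y₀ : ℝ) : Set (A × ℝ) :=
  {z | ∀ s ∈ Set.Icc (0 : ℝ) 1, (z.1, y₀ + s * (z.2 - y₀)) ∈ O}

/-- The primitive with respect to the last variable that vanishes at `y₀`. -/
def primitiveFrom (h : A × ℝ → ℝ) (y₀ : ℝ) (z : A × ℝ) : ℝ :=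
  (z.2 - y₀) * ∫ s in (0 : ℝ)..1, h (z.1, y₀ + s * (z.2 - y₀))

theorem segFiber_eq (O : Set (A × ℝ)) (y₀ : ℝ) : segFiber O y₀ = unitFiber
    ((fun w : (A × ℝ) × ℝ => (w.1.1, y₀ + w.2 * (w.1.2 - y₀))) ⁻¹' O) := rfl

theorem isOpen_segFiber {O : Set (A × ℝ)} (hO : IsOpen O) (y₀ : ℝ) : IsOpen (segFiber O y₀) := by
  rw [segFiber_eq]
  exact isOpen_unitFiber (hO.preimage (by fun_prop))

theorem mem_of_mem_segFiber {O : Set (A × ℝ)} {y₀ : ℝ} {z : A × ℝ} (hz : z ∈ segFiber O y₀) :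
    z ∈ O := by
  simpa using hz 1 (by simp)

theorem base_mem_of_mem_segFiber {O : Set (A × ℝ)} {y₀ : ℝ} {z : A × ℝ}
    (hz : z ∈ segFiber O y₀) : (z.1, y₀) ∈ O := by
  simpa using hz 0 (by simp)

theorem base_mem_segFiber {O : Set (A × ℝ)} {y₀ : ℝ} {a : A} (h : (a, y₀) ∈ O) :
    (a, y₀) ∈ segFiber O y₀ := fun s _ => by simpa using h

/-- The primitive is defined by an integral over the fixed interval `[0, 1]`, so its endpoint has
become an ordinary parameter and smoothness in all variables follows at once. -/
theorem contDiffOn_primitiveFrom {O : Set (A × ℝ)} (hO : IsOpen O) {h : A × ℝ → ℝ}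
    (hh : ContDiffOn ℝ ∞ h O) (y₀ : ℝ) :
    ContDiffOn ℝ ∞ (primitiveFrom h y₀) (segFiber O y₀) := by
  have h1 : ContDiff ℝ ∞ fun w : (A × ℝ) × ℝ => (w.1.1, y₀ + w.2 * (w.1.2 - y₀)) := by fun_prop
  have h2 := contDiffOn_unitIntegral (hO.preimage h1.continuous)
    (hh.comp h1.contDiffOn fun w hw => hw)
  exact (ContDiff.contDiffOn (by fun_prop)).mul h2

theorem primitiveFrom_eq (h : A × ℝ → ℝ) (y₀ : ℝ) (a : A) (y : ℝ) :
    primitiveFrom h y₀ (a, y) = ∫ s in y₀..y, h (a, s) := by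
  have := intervalIntegral.smul_integral_comp_add_mul (a := 0) (b := 1) (fun s => h (a, s))
    (y - y₀) y₀
  simp only [mul_zero, add_zero, mul_one, add_sub_cancel, smul_eq_mul] at this
  rw [← this, primitiveFrom]
  simp only [mul_comm (y - y₀)]

theorem primitiveFrom_self (h : A × ℝ → ℝ) (y₀ : ℝ) (a : A) :
    primitiveFrom h y₀ (a, y₀) = 0 := by simp [primitiveFrom]

theorem hasDerivAt_primitiveFrom {O : Set (A × ℝ)} (hO : IsOpen O) {h : A × ℝ → ℝ}
    (hh : ContDiffOn ℝ ∞ h O) {y₀ : ℝ} {a : A} {y : ℝ} (hy : (a, y) ∈ segFiber O y₀) :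
    HasDerivAt (fun y => primitiveFrom h y₀ (a, y)) (h (a, y)) y := by
  simp only [primitiveFrom_eq]
  have hc : ContinuousOn (fun s => h (a, s)) ((fun s => (a, s)) ⁻¹' O) :=
    hh.continuousOn.comp (by fun_prop) fun s hs => hs
  have ho : IsOpen ((fun s : ℝ => (a, s)) ⁻¹' O) := hO.preimage (by fun_prop)
  have hyO : y ∈ (fun s : ℝ => (a, s)) ⁻¹' O := mem_of_mem_segFiber hy
  refine intervalIntegral.integral_hasDerivAt_right ?_
    (hc.stronglyMeasurableAtFilter ho _ hyO) (hc.continuousAt (ho.mem_nhds hyO))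
  apply ContinuousOn.intervalIntegrable
  refine hc.mono fun s hs => ?_
  rw [← segment_eq_uIcc, segment_eq_image'] at hs
  obtain ⟨θ, hθ, rfl⟩ := hs
  exact hy θ hθ

end ParametricIntegral

/-! ### Coordinates adapted to the Killing field -/

section ScrewChart

variable {M : Type*} [TopologicalSpace M] [ChartedSpace (EuclideanSpace ℝ (Fin 2)) M]
  [IsManifold (𝓡 2) ∞ M]
  {g : Metric2 M} {v : Fin 2 → (x : M) → TangentSpace (𝓡 2) x} {U : Set M}

/-- Coordinates `w, t` on `W` in which the Killing field `V = J ∇q` is `∂/∂t` and the metric is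
`φ dt² + 9 w / (4 φ) dw²` with `φ = E + 9 ε w`; the field `N` is `∂/∂w`. -/
structure IsScrewChart (g : Metric2 M) (v : Fin 2 → (x : M) → TangentSpace (𝓡 2) x) (U : Set M)
    (ε E : ℝ) (w t : M → ℝ) (N : (x : M) → TangentSpace (𝓡 2) x) (W : Set M) : Prop where
  isOpen : IsOpen W
  subset : W ⊆ U
  smooth_w : SmoothOn w W
  smooth_t : SmoothOn t W
  smooth_V : SmoothFieldOn (JGradq g v) W
  smooth_N : SmoothFieldOn N W
  sq_eq : ε ^ 2 = 1
  w_pos : ∀ x ∈ W, 0 < w x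
  phi_pos : ∀ x ∈ W, 0 < E + 9 * ε * w x
  V_w : ∀ x ∈ W, dirDeriv (JGradq g v) w x = 0
  N_w : ∀ x ∈ W, dirDeriv N w x = 1
  V_t : ∀ x ∈ W, dirDeriv (JGradq g v) t x = 1
  N_t : ∀ x ∈ W, dirDeriv N t x = 0
  inner_VV : ∀ x ∈ W, g.inner x (JGradq g v x) (JGradq g v x) = E + 9 * ε * w x
  inner_VN : ∀ x ∈ W, g.inner x (JGradq g v x) (N x) = 0
  inner_NN : ∀ x ∈ W, g.inner x (N x) (N x) = 9 * w x / (4 * (E + 9 * ε * w x))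
  frame : ∀ x ∈ W, ∀ i,
    v i x = dirDeriv (v i) t x • JGradq g v x + dirDeriv (v i) w x • N x

theorem dirDeriv_comb {X Y Z : (x : M) → TangentSpace (𝓡 2) x} {a b : ℝ} {x : M} {f : M → ℝ}
    (h : X x = a • Y x + b • Z x) : dirDeriv X f x = a * dirDeriv Y f x + b * dirDeriv Z f x := by
  unfold dirDeriv
  rw [h, map_add, map_smul, map_smul]
  rfl

theorem inner_comb (hv : IsOrthonormalFrameOn g v U) {x : M} (hx : x ∈ U) (a b c d : ℝ) :
    g.inner x (a • v 0 x + b • v 1 x) (c • v 0 x + d • v 1 x) = a * c + b * d := by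
  simp only [map_add, map_smul, add_apply, smul_apply, smul_eq_mul, hv.inner_00 hx, hv.inner_01 hx,
    hv.inner_10 hx, hv.inner_11 hx]
  ring

theorem exists_sign_eq_abs {p : M} (hK : gaussCurv g v p ≠ 0) :
    ∃ ε : ℝ, ε ^ 2 = 1 ∧ ∀ x ∈ sameSign g v U p, gaussCurv g v x = ε * |gaussCurv g v x| := by
  rcases lt_or_gt_of_ne hK with h | h
  · refine ⟨-1, by norm_num, fun x hx => ?_⟩
    have : gaussCurv g v x < 0 := by
      have h1 : 0 < gaussCurv g v x / gaussCurv g v p := hx.2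
      rcases div_pos_iff.1 h1 with h2 | h2
      · exact absurd h2.2 (not_lt.2 h.le)
      · exact h2.1
    rw [abs_of_neg this]; ring
  · refine ⟨1, by norm_num, fun x hx => ?_⟩
    have : 0 < gaussCurv g v x := by
      have h1 : 0 < gaussCurv g v x / gaussCurv g v p := hx.2
      rcases div_pos_iff.1 h1 with h2 | h2
      · exact h2.1
      · exact absurd h2.2 (not_lt.2 h.le)
    rw [abs_of_pos this]; ring

section

variable (hg : IsDarbouxIntegrable g) (hv : IsOrthonormalFrameOn g v U) (hU : IsOpen U)

include hg hv hU

theorem JGradq_apply {x : M} (hx : x ∈ U) :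
    JGradq g v x = (3 * qFun g v x * logGrad g v 1 x) • v 0 x
      + (-(3 * qFun g v x * logGrad g v 0 x)) • v 1 x := by
  rw [JGradq, dirDeriv_qFun hg hv hU 0 hx, dirDeriv_qFun hg hv hU 1 hx, sub_eq_add_neg, add_comm,
    ← neg_smul]
  congr 2 <;> ring

/-- Contracting `∇G = 3 G ⊗ G - K g` with `2 G` gives `d|G|² = (6 |G|² - 2 K) G`. -/
theorem dirDeriv_logGrad_sq {x : M} (hx : x ∈ U) :
    dirDeriv (v 0) (fun y => logGrad g v 0 y * logGrad g v 0 y + logGrad g v 1 y * logGrad g v 1 y) x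
      = logGrad g v 0 x * (6 * (logGrad g v 0 x * logGrad g v 0 x
        + logGrad g v 1 x * logGrad g v 1 x) - 2 * gaussCurv g v x) ∧
    dirDeriv (v 1) (fun y => logGrad g v 0 y * logGrad g v 0 y + logGrad g v 1 y * logGrad g v 1 y) x
      = logGrad g v 1 x * (6 * (logGrad g v 0 x * logGrad g v 0 x
        + logGrad g v 1 x * logGrad g v 1 x) - 2 * gaussCurv g v x) := by
  have hG := fun i => (smooth_logGrad hv hU (fun x hx => hg.gaussCurv_ne_zero hv hU hx)
    i).mdifferentiableAt hU hx
  obtain ⟨E1, E2, E3, E4⟩ := hg.curvature_equation hv hU hx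
  have h : ∀ i, dirDeriv (v i)
      (fun y => logGrad g v 0 y * logGrad g v 0 y + logGrad g v 1 y * logGrad g v 1 y) x
      = 2 * (logGrad g v 0 x * dirDeriv (v i) (logGrad g v 0) x
        + logGrad g v 1 x * dirDeriv (v i) (logGrad g v 1) x) := by
    intro i
    rw [dirDeriv_fun_add (f := fun y => logGrad g v 0 y * logGrad g v 0 y)
      (h := fun y => logGrad g v 1 y * logGrad g v 1 y) ((hG 0).mul (hG 0)) ((hG 1).mul (hG 1)),
      dirDeriv_fun_mul (hG 0) (hG 0), dirDeriv_fun_mul (hG 1) (hG 1)]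
    ring
  constructor
  · rw [h, E1, E2]; ring
  · rw [h, E3, E4]; ring

/-- Adapted coordinates exist near the points where the Killing field does not vanish. -/
theorem exists_isScrewChart {p : M} (hp : p ∈ U) (hV : JGradq g v p ≠ 0) :
    ∃ (ε E : ℝ) (w t : M → ℝ) (N : (x : M) → TangentSpace (𝓡 2) x) (W : Set M),
      p ∈ W ∧ IsScrewChart g v U ε E w t N W := by
  have hK : ∀ x ∈ U, gaussCurv g v x ≠ 0 := fun x hx => hg.gaussCurv_ne_zero hv hU hx
  have hGs := smooth_logGrad hv hU hK
  have hGd := fun i {x} (hx : x ∈ U) => (hGs i).mdifferentiableAt hU hx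
  set a := logGrad g v 0 with ha
  set b := logGrad g v 1 with hb
  set s : M → ℝ := fun y => a y * a y + b y * b y with hs
  have hss : SmoothOn s U := ((hGs 0).mul (hGs 0)).add ((hGs 1).mul (hGs 1))
  have hds := fun {x} (hx : x ∈ U) => dirDeriv_logGrad_sq hg hv hU hx
  have hs0 : s p ≠ 0 := by
    intro h
    refine hV ((JGradq_eq_zero_iff hg hv hU hp).2 ?_)
    have h2 : a p * a p + b p * b p = 0 := h
    constructor
    · show a p = 0
      nlinarith [mul_self_nonneg (a p), mul_self_nonneg (b p)]
    · show b p = 0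
      nlinarith [mul_self_nonneg (a p), mul_self_nonneg (b p)]
  obtain ⟨ε, hε, hεK⟩ := exists_sign_eq_abs (U := U) (hK p hp)
  -- The exponents are matched so that `w² |K| = 1` and `q² = w³`; all later identities are
  -- polynomial consequences of these two.
  set w : M → ℝ := fun x => |gaussCurv g v x| ^ (-(1 / 2) : ℝ) with hw
  set q := qFun g v with hq
  have hws : SmoothOn w U := smooth_abs_gaussCurv_rpow hv hU hK _
  have hqs : SmoothOn q U := smooth_qFun hg hv hU
  have hwp : ∀ x ∈ U, 0 < w x := fun x hx => Real.rpow_pos_of_pos (abs_pos.2 (hK x hx)) _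
  have hqp : ∀ x ∈ U, 0 < q x := fun x hx => qFun_pos hg hv hU hx
  have hwd : ∀ i, ∀ x ∈ U, dirDeriv (v i) w x = -2 * w x * logGrad g v i x := fun i x hx => by
    rw [hw, dirDeriv_abs_gaussCurv_rpow hv hU hK _ i hx]; ring
  have hqd : ∀ i, ∀ x ∈ U, dirDeriv (v i) q x = -3 * q x * logGrad g v i x := fun i x hx =>
    dirDeriv_qFun hg hv hU i hx
  have hwK : ∀ x ∈ U, w x ^ 2 * |gaussCurv g v x| = 1 := fun x hx => by
    have h0 := abs_pos.2 (hK x hx)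
    rw [hw, ← Real.rpow_natCast, ← Real.rpow_mul h0.le]
    norm_num
    rw [Real.rpow_neg_one, inv_mul_cancel₀ h0.ne']
  have hqw : ∀ x ∈ U, q x ^ 2 = w x ^ 3 := fun x hx => by
    have h0 := abs_pos.2 (hK x hx)
    rw [hw, hq, qFun, ← Real.rpow_natCast, ← Real.rpow_mul h0.le, ← Real.rpow_natCast,
      ← Real.rpow_mul h0.le]
    norm_num
  set W₀ : Set M := sameSign g v U p ∩ (U ∩ s ⁻¹' {0}ᶜ) with hW₀
  have hW₀o : IsOpen W₀ := (isOpen_sameSign hv hU p).inter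
    (hss.continuousOn.isOpen_inter_preimage hU isOpen_compl_singleton)
  have hW₀U : W₀ ⊆ U := fun x hx => hx.2.1
  have hpW₀ : p ∈ W₀ := ⟨mem_sameSign hp (hK p hp), hp, hs0⟩
  -- the norm of the Killing field
  set Φ : M → ℝ := fun x => 9 * (q x ^ 2 * s x) - 9 * ε * w x with hΦ
  have hΦs : SmoothOn Φ U := by
    have h1 : SmoothOn (fun x => q x ^ 2 * s x) U := (hqs.pow 2).mul hss
    exact (contMDiffOn_const.mul h1).sub (contMDiffOn_const.mul hws)
  -- Since `V` has length `3 q |G|`, the function is `|V|² - 9 ε w`. Its differential vanishes by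
  -- the formula for `d|G|²`, and its local value is the constant `E` of the chart.
  have hΦd : ∀ x ∈ W₀, ∀ i, dirDeriv (v i) Φ x = 0 := by
    intro x hx i
    have hxU := hW₀U hx
    have hqm := hqs.mdifferentiableAt hU hxU
    have hwm := hws.mdifferentiableAt hU hxU
    have hsm := hss.mdifferentiableAt hU hxU
    have hq2 : dirDeriv (v i) (fun y => q y ^ 2) x = 2 * q x * dirDeriv (v i) q x := by
      have := dirDeriv_comp (X := v i) (h := fun z => z ^ 2) (hasDerivAt_pow 2 (q x)) hqm
      simpa using this
    have hΦ' : dirDeriv (v i) Φ x = 9 * (q x ^ 2 * dirDeriv (v i) s x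
        + s x * (2 * q x * dirDeriv (v i) q x)) - 9 * ε * dirDeriv (v i) w x := by
      have hqm2 : MDifferentiableAt (𝓡 2) 𝓘(ℝ, ℝ) (fun y => q y ^ 2) x :=
        SmoothOn.mdifferentiableAt (hqs.pow 2) hU hxU
      rw [hΦ, dirDeriv_fun_sub (f := fun y => 9 * (q y ^ 2 * s y)) (h := fun y => 9 * ε * w y)
        (mdifferentiableAt_const.mul (hqm2.mul hsm)) (mdifferentiableAt_const.mul hwm),
        dirDeriv_const_mul (f := fun y => q y ^ 2 * s y) _ (hqm2.mul hsm),
        dirDeriv_const_mul (f := w) _ hwm, dirDeriv_fun_mul hqm2 hsm, hq2]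
    have hKx := hεK x hx.1
    have hwKx := hwK x hxU
    have hqwx := hqw x hxU
    have hdsx : dirDeriv (v i) s x = logGrad g v i x * (6 * s x - 2 * gaussCurv g v x) := by
      fin_cases i
      · exact (hds hxU).1
      · exact (hds hxU).2
    rw [hΦ', hdsx, hqd i x hxU, hwd i x hxU, hKx]
    linear_combination (-18 * ε * |gaussCurv g v x| * logGrad g v i x) * hqwx
      - 18 * ε * w x * logGrad g v i x * hwKx
  have hΦc := hv.eventually_eq_of_dirDeriv_eq_zero hW₀o hW₀U hpW₀ (hΦs.mono hW₀U) hΦd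
  obtain ⟨W₁, hW₁, hW₁o, hpW₁⟩ := eventually_nhds_iff.1 hΦc
  -- the coordinate along the Killing field
  set τ : M → ℝ := fun x => (3 * (q x * s x))⁻¹ with hτ
  have hqs0 : ∀ x ∈ W₀, 3 * (q x * s x) ≠ 0 := fun x hx =>
    mul_ne_zero three_ne_zero (mul_ne_zero (hqp x (hW₀U hx)).ne' hx.2.2)
  have hτs : SmoothOn τ W₀ := by
    have h1 : SmoothOn (fun x => 3 * (q x * s x)) W₀ :=
      contMDiffOn_const.mul ((hqs.mul hss).mono hW₀U)
    have h2 : SmoothOn (fun _ => (1 : ℝ)) W₀ := contMDiffOn_const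
    refine (SmoothOn.div' h2 h1 hqs0).congr fun x _ => ?_
    simp [hτ]
  have hτd : ∀ x ∈ W₀, ∀ i, dirDeriv (v i) τ x
      = -τ x * logGrad g v i x * (3 * s x - 2 * gaussCurv g v x) / s x := by
    intro x hx i
    have hxU := hW₀U hx
    have hqm := hqs.mdifferentiableAt hU hxU
    have hsm := hss.mdifferentiableAt hU hxU
    have hdsx : dirDeriv (v i) s x = logGrad g v i x * (6 * s x - 2 * gaussCurv g v x) := by
      fin_cases i
      · exact (hds hxU).1
      · exact (hds hxU).2
    have h1 := dirDeriv_comp (X := v i) (f := fun y => 3 * (q y * s y)) (hasDerivAt_inv (hqs0 x hx))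
      (mdifferentiableAt_const.mul (hqm.mul hsm))
    rw [dirDeriv_const_mul (f := fun y => q y * s y) _ (hqm.mul hsm), dirDeriv_fun_mul hqm hsm,
      hdsx, hqd i x hxU] at h1
    rw [hτ, h1]
    have hs' : s x ≠ 0 := hx.2.2
    have hq' := (hqp x hxU).ne'
    field_simp
    ring
  -- The form `τ (b η¹ - a η²)` is `V♭ / |V|²`. It is closed, and its potential is a coordinate `t`
  -- with `V t = 1` that is constant along the gradient of `w`.
  have hcl : ∀ x ∈ W₀, dirDeriv (v 0) (fun y => -(a y * τ y)) x
      - dirDeriv (v 1) (fun y => b y * τ y) x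
      = structFun g v 0 x * (b x * τ x) + structFun g v 1 x * (-(a x * τ x)) := by
    intro x hx
    have hxU := hW₀U hx
    have hτm := hτs.mdifferentiableAt hW₀o hx
    obtain ⟨E1, E2, E3, E4⟩ := hg.curvature_equation hv hU hxU
    rw [dirDeriv_neg (f := fun y => a y * τ y), dirDeriv_fun_mul (hGd 0 hxU) hτm,
      dirDeriv_fun_mul (hGd 1 hxU) hτm, hτd x hx, hτd x hx, E1, E4]
    have hs' : s x ≠ 0 := hx.2.2
    simp only [← ha, ← hb]
    field_simp
    simp only [hs]
    ring
  obtain ⟨W₂, t, hW₂o, hpW₂, hW₂, hts, htd⟩ := hv.exists_potential hW₀o hW₀U hpW₀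
    (α := ![fun y => b y * τ y, fun y => -(a y * τ y)]) (fun i => by
      fin_cases i
      · exact ((hGs 1).mono hW₀U).mul hτs
      · exact (((hGs 0).mono hW₀U).mul hτs).neg) hcl
  have hW : W₁ ∩ W₂ ⊆ W₀ := Set.inter_subset_right.trans hW₂
  have hWU : W₁ ∩ W₂ ⊆ U := hW.trans hW₀U
  have hφ : ∀ x ∈ W₁ ∩ W₂, Φ p + 9 * ε * w x = 9 * (q x ^ 2 * s x) := fun x hx => by
    rw [← hW₁ x hx.1]; simp only [hΦ]; ring
  -- As `∇w = -2 w G`, the field `c G` is `∇w / |∇w|²`, normalised so that it differentiates `w` to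
  -- `1`.
  set c : M → ℝ := fun x => -1 / (2 * (w x * s x)) with hc
  have hws0 : ∀ x ∈ W₀, 2 * (w x * s x) ≠ 0 := fun x hx =>
    mul_ne_zero two_ne_zero (mul_ne_zero (hwp x (hW₀U hx)).ne' hx.2.2)
  have hcs : SmoothOn c W₀ := by
    have h1 : SmoothOn (fun x => 2 * (w x * s x)) W₀ :=
      contMDiffOn_const.mul ((hws.mul hss).mono hW₀U)
    have h2 : SmoothOn (fun _ => (-1 : ℝ)) W₀ := contMDiffOn_const
    exact SmoothOn.div' h2 h1 hws0
  have hsp : ∀ x ∈ W₀, 0 < s x := fun x hx =>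
    lt_of_le_of_ne (add_nonneg (mul_self_nonneg _) (mul_self_nonneg _)) (Ne.symm hx.2.2)
  have ht0 : ∀ x ∈ W₁ ∩ W₂, dirDeriv (v 0) t x = b x * τ x := fun x hx => htd x hx.2 0
  have ht1 : ∀ x ∈ W₁ ∩ W₂, dirDeriv (v 1) t x = -(a x * τ x) := fun x hx => htd x hx.2 1
  have hw0 : ∀ x ∈ W₁ ∩ W₂, dirDeriv (v 0) w x = -2 * w x * a x := fun x hx => hwd 0 x (hWU hx)
  have hw1 : ∀ x ∈ W₁ ∩ W₂, dirDeriv (v 1) w x = -2 * w x * b x := fun x hx => hwd 1 x (hWU hx)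
  have hVx : ∀ x ∈ W₁ ∩ W₂, JGradq g v x = (3 * q x * b x) • v 0 x + (-(3 * q x * a x)) • v 1 x :=
    fun x hx => JGradq_apply hg hv hU (hWU hx)
  set N : (x : M) → TangentSpace (𝓡 2) x := fun x => (c x * a x) • v 0 x + (c x * b x) • v 1 x
    with hN
  refine ⟨ε, Φ p, w, t, N, W₁ ∩ W₂, ⟨hpW₁, hpW₂⟩, hW₁o.inter hW₂o, hWU, hws.mono hWU,
    hts.mono Set.inter_subset_right, (smooth_JGradq hg hv hU).mono hWU, ?_, hε,
    fun x hx => hwp x (hWU hx), fun x hx => ?_, fun x hx => ?_, fun x hx => ?_, fun x hx => ?_,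
    fun x hx => ?_, fun x hx => ?_, fun x hx => ?_, fun x hx => ?_, fun x hx i => ?_⟩
  · exact ((((hcs.mul ((hGs 0).mono hW₀U)).smul_section ((hv.smooth 0).mono hW₀U))).add_section
      ((hcs.mul ((hGs 1).mono hW₀U)).smul_section ((hv.smooth 1).mono hW₀U))).mono hW
  all_goals
    have hwx := (hwp x (hWU hx)).ne'
    have hqx := (hqp x (hWU hx)).ne'
    have hsx := (hsp x (hW hx)).ne'
    have hse : s x = a x * a x + b x * b x := rfl
  · rw [hφ x hx]
    have := hqp x (hWU hx)
    have := hsp x (hW hx)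
    positivity
  · rw [dirDeriv_comb (hVx x hx), hw0 x hx, hw1 x hx]; ring
  · rw [dirDeriv_comb (X := N) rfl, hw0 x hx, hw1 x hx]
    simp only [hc]
    field_simp
    rw [hse]; ring
  · rw [dirDeriv_comb (hVx x hx), ht0 x hx, ht1 x hx]
    simp only [hτ]
    field_simp
    rw [hse]; ring
  · rw [dirDeriv_comb (X := N) rfl, ht0 x hx, ht1 x hx]; ring
  · rw [hφ x hx, hVx x hx, inner_comb hv (hWU hx), hse]; ring
  · rw [hVx x hx, hN, inner_comb hv (hWU hx)]; ring
  · rw [hφ x hx, hN, inner_comb hv (hWU hx), hqw x (hWU hx)]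
    simp only [hc]
    field_simp
    rw [hse]; ring
  · rw [hVx x hx]
    simp only [hN, smul_add, smul_smul]
    have e : ∀ (A B C D : ℝ), (A • v 0 x + B • v 1 x) + (C • v 0 x + D • v 1 x)
        = (A + C) • v 0 x + (B + D) • v 1 x := fun A B C D => by module
    rw [e]
    fin_cases i
    · simp only [Fin.zero_eta, Fin.isValue, ht0 x hx, hw0 x hx]
      rw [show b x * τ x * (3 * q x * b x) + -2 * w x * a x * (c x * a x) = 1 by
          simp only [hτ, hc]; field_simp; rw [hse]; ring,
        show b x * τ x * -(3 * q x * a x) + -2 * w x * a x * (c x * b x) = 0 by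
          simp only [hτ, hc]; field_simp; ring, one_smul, zero_smul, add_zero]
    · simp only [Fin.mk_one, Fin.isValue, ht1 x hx, hw1 x hx]
      rw [show -(a x * τ x) * (3 * q x * b x) + -2 * w x * b x * (c x * a x) = 0 by
          simp only [hτ, hc]; field_simp; ring,
        show -(a x * τ x) * -(3 * q x * a x) + -2 * w x * b x * (c x * b x) = 1 by
          simp only [hτ, hc]; field_simp; rw [hse]; ring, one_smul, zero_smul]
      exact (zero_add _).symm

end

end ScrewChart

/-! ### The family of screw-invariant surfaces -/

section ScrewMap

variable {ε E y₀ : ℝ}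

/-- The square of the length of the Killing field, as a function of the coordinate `w`. -/
def screwPhi (ε E y : ℝ) : ℝ := E + 9 * ε * y

/-- The factor whose positivity decides which parameters `(m, c)` are admissible. -/
def screwF (ε E : ℝ) (z : (ℝ × ℝ) × ℝ) : ℝ :=
  1 - z.1.2 ^ 2 / screwPhi ε E z.2 - 9 / (z.1.1 ^ 2 * z.2)

/-- The admissible triples of the parameters `m, c` and the coordinate `w`. -/
def screwDomain (ε E : ℝ) : Set ((ℝ × ℝ) × ℝ) :=
  {z | 0 < z.1.1 ∧ 0 < z.2 ∧ 0 < screwPhi ε E z.2 ∧ 0 < screwF ε E z}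

/-- The derivative of the height along a profile. -/
def screwR (ε E : ℝ) (z : (ℝ × ℝ) × ℝ) : ℝ := 3 / 2 * √(z.2 * screwF ε E z / screwPhi ε E z.2)

/-- The distance from the axis. -/
def screwRadius (ε E : ℝ) (z : (ℝ × ℝ) × ℝ) : ℝ := √(screwPhi ε E z.2 - z.1.2 ^ 2) / z.1.1

/-- The derivative, up to a constant factor, of the angle along a profile. -/
def screwTwist (ε E : ℝ) (z : (ℝ × ℝ) × ℝ) : ℝ :=
  screwR ε E z / (screwPhi ε E z.2 - z.1.2 ^ 2)

/-- The angle about the axis. -/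
def screwAngle (ε E y₀ : ℝ) (z : ((ℝ × ℝ) × ℝ) × ℝ) : ℝ :=
  z.1.1.1 * z.2 - z.1.1.2 * z.1.1.1 * primitiveFrom (screwTwist ε E) y₀ z.1

/-- The height along the axis. -/
def screwHeight (ε E y₀ : ℝ) (z : ((ℝ × ℝ) × ℝ) × ℝ) : ℝ :=
  z.1.1.2 * z.2 + primitiveFrom (screwR ε E) y₀ z.1

/-- The point of Euclidean space with the given cylindrical coordinates. -/
def cylindrical (r θ h : ℝ) : E3 := !₂[r * Real.cos θ, r * Real.sin θ, h]

/-- The family of immersions in the coordinates `w, t`. -/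
def screwMap (ε E y₀ : ℝ) (z : ((ℝ × ℝ) × ℝ) × ℝ) : E3 :=
  cylindrical (screwRadius ε E z.1) (screwAngle ε E y₀ z) (screwHeight ε E y₀ z)

/-- Positivity of `screwF` contains `c² < φ`, because the last subtracted term is itself positive.
This quantity is `m² r²`, with `r` the distance from the axis. -/
theorem sub_sq_pos {z : (ℝ × ℝ) × ℝ} (hz : z ∈ screwDomain ε E) :
    0 < screwPhi ε E z.2 - z.1.2 ^ 2 := by
  obtain ⟨hm, hy, hφ, hF⟩ := hz
  have h1 : 0 < 9 / (z.1.1 ^ 2 * z.2) := by positivity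
  have h2 : z.1.2 ^ 2 / screwPhi ε E z.2 < 1 := by unfold screwF at hF; linarith
  rw [div_lt_one hφ] at h2
  linarith

theorem screwRadius_pos {z : (ℝ × ℝ) × ℝ} (hz : z ∈ screwDomain ε E) : 0 < screwRadius ε E z :=
  div_pos (Real.sqrt_pos.2 (sub_sq_pos hz)) hz.1

theorem sq_screwRadius {z : (ℝ × ℝ) × ℝ} (hz : z ∈ screwDomain ε E) :
    z.1.1 ^ 2 * screwRadius ε E z ^ 2 = screwPhi ε E z.2 - z.1.2 ^ 2 := by
  rw [screwRadius, div_pow, Real.sq_sqrt (sub_sq_pos hz).le]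
  have := hz.1.ne'
  field_simp

theorem screwR_pos {z : (ℝ × ℝ) × ℝ} (hz : z ∈ screwDomain ε E) : 0 < screwR ε E z := by
  obtain ⟨hm, hy, hφ, hF⟩ := hz
  unfold screwR
  have : 0 < √(z.2 * screwF ε E z / screwPhi ε E z.2) := Real.sqrt_pos.2 (by positivity)
  positivity

theorem sq_screwR {z : (ℝ × ℝ) × ℝ} (hz : z ∈ screwDomain ε E) :
    screwR ε E z ^ 2 = 9 / 4 * (z.2 * screwF ε E z / screwPhi ε E z.2) := by
  obtain ⟨hm, hy, hφ, hF⟩ := hz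
  rw [screwR, mul_pow, Real.sq_sqrt (by positivity)]
  norm_num

theorem contDiff_screwPhi : ContDiff ℝ ∞ fun z : (ℝ × ℝ) × ℝ => screwPhi ε E z.2 := by
  unfold screwPhi; fun_prop

/-- The part of the admissible set where `screwF` is a smooth function. -/
theorem contDiffOn_screwF : ContDiffOn ℝ ∞ (screwF ε E)
    {z | 0 < z.1.1 ∧ 0 < z.2 ∧ 0 < screwPhi ε E z.2} := by
  refine (contDiffOn_const.sub (ContDiffOn.div (ContDiff.contDiffOn (by fun_prop))
    contDiff_screwPhi.contDiffOn fun _ hz => hz.2.2.ne')).sub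
    (ContDiffOn.div contDiffOn_const (ContDiff.contDiffOn (by fun_prop)) fun z hz => ?_)
  exact mul_ne_zero (pow_ne_zero 2 hz.1.ne') hz.2.1.ne'

theorem isOpen_screwDomain : IsOpen (screwDomain ε E) := by
  have h0 : IsOpen {z : (ℝ × ℝ) × ℝ | 0 < z.1.1} := isOpen_lt continuous_const (by fun_prop)
  have h1 : IsOpen {z : (ℝ × ℝ) × ℝ | 0 < z.2} := isOpen_lt continuous_const (by fun_prop)
  have h2 := contDiffOn_screwF.continuousOn.isOpen_inter_preimage (t := Set.Ioi 0)
    (h0.inter (h1.inter (isOpen_lt continuous_const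
      (contDiff_screwPhi (ε := ε) (E := E)).continuous))) isOpen_Ioi
  have h3 : screwDomain ε E = _ ∩ _ := Set.ext fun z =>
    (show (0 < z.1.1 ∧ 0 < z.2 ∧ 0 < screwPhi ε E z.2 ∧ 0 < screwF ε E z) ↔
      (0 < z.1.1 ∧ 0 < z.2 ∧ 0 < screwPhi ε E z.2) ∧ 0 < screwF ε E z by tauto)
  exact h3 ▸ h2

theorem contDiffOn_screwR : ContDiffOn ℝ ∞ (screwR ε E) (screwDomain ε E) := by
  refine contDiffOn_const.mul (ContDiffOn.sqrt (ContDiffOn.div (contDiff_snd.contDiffOn.mul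
    (contDiffOn_screwF.mono fun z hz => ⟨hz.1, hz.2.1, hz.2.2.1⟩)) contDiff_screwPhi.contDiffOn
      fun z hz => hz.2.2.1.ne') fun z hz => ?_)
  obtain ⟨hm, hy, hφ, hF⟩ := hz
  exact (div_pos (mul_pos hy hF) hφ).ne'

theorem contDiff_screwPhi_sub : ContDiff ℝ ∞ fun z : (ℝ × ℝ) × ℝ =>
    screwPhi ε E z.2 - z.1.2 ^ 2 := contDiff_screwPhi.sub (by fun_prop)

theorem contDiffOn_screwRadius : ContDiffOn ℝ ∞ (screwRadius ε E) (screwDomain ε E) :=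
  (contDiff_screwPhi_sub.contDiffOn.sqrt fun z hz => (sub_sq_pos hz).ne').div
    (ContDiff.contDiffOn (by fun_prop)) fun _ hz => hz.1.ne'

theorem contDiffOn_screwTwist : ContDiffOn ℝ ∞ (screwTwist ε E) (screwDomain ε E) :=
  contDiffOn_screwR.div contDiff_screwPhi_sub.contDiffOn fun _ hz => (sub_sq_pos hz).ne'

/-- The domain of the family. -/
def screwRange (ε E y₀ : ℝ) : Set ((ℝ × ℝ) × ℝ) := segFiber (screwDomain ε E) y₀

theorem isOpen_screwRange : IsOpen (screwRange ε E y₀) := isOpen_segFiber isOpen_screwDomain _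

theorem contDiffOn_cylindrical {A : Type*} [NormedAddCommGroup A] [NormedSpace ℝ A] {O : Set A}
    {r θ h : A → ℝ} (hr : ContDiffOn ℝ ∞ r O) (hθ : ContDiffOn ℝ ∞ θ O) (hh : ContDiffOn ℝ ∞ h O) :
    ContDiffOn ℝ ∞ (fun z => cylindrical (r z) (θ z) (h z)) O := by
  rw [contDiffOn_euclidean]
  intro i
  fin_cases i
  · exact hr.mul hθ.cos
  · exact hr.mul hθ.sin
  · exact hh

theorem contDiffOn_screwMap : ContDiffOn ℝ ∞ (screwMap ε E y₀)
    (Prod.fst ⁻¹' screwRange ε E y₀) := by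
  have hsub : Set.MapsTo (Prod.fst : ((ℝ × ℝ) × ℝ) × ℝ → _) (Prod.fst ⁻¹' screwRange ε E y₀)
    (screwRange ε E y₀) := fun z hz => hz
  have hp : ∀ {h : (ℝ × ℝ) × ℝ → ℝ}, ContDiffOn ℝ ∞ h (screwDomain ε E) →
      ContDiffOn ℝ ∞ (fun z : ((ℝ × ℝ) × ℝ) × ℝ => primitiveFrom h y₀ z.1)
        (Prod.fst ⁻¹' screwRange ε E y₀) := fun hh =>
    (contDiffOn_primitiveFrom isOpen_screwDomain hh y₀).comp contDiff_fst.contDiffOn hsub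
  refine contDiffOn_cylindrical ?_ ?_ ?_
  · exact contDiffOn_screwRadius.comp contDiff_fst.contDiffOn
      fun _ hz => mem_of_mem_segFiber hz
  · exact (ContDiff.contDiffOn (by fun_prop)).sub
      ((ContDiff.contDiffOn (by fun_prop)).mul (hp contDiffOn_screwTwist))
  · exact (ContDiff.contDiffOn (by fun_prop)).add (hp contDiffOn_screwR)

theorem hasDerivAt_screwRadius {a : ℝ × ℝ} {y : ℝ} (h : (a, y) ∈ screwDomain ε E) :
    HasDerivAt (fun y => screwRadius ε E (a, y))
      (9 * ε / (2 * a.1 ^ 2 * screwRadius ε E (a, y))) y := by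
  have h1 : HasDerivAt (fun y => screwPhi ε E y - a.2 ^ 2) (9 * ε) y := by
    have := (((hasDerivAt_id y).const_mul (9 * ε)).const_add E).sub_const (a.2 ^ 2)
    simpa [screwPhi] using this
  have h2 := (h1.sqrt (sub_sq_pos h).ne').div_const a.1
  have h3 : √(screwPhi ε E y - a.2 ^ 2) ≠ 0 := (Real.sqrt_pos.2 (sub_sq_pos h)).ne'
  have h4 : a.1 ≠ 0 := h.1.ne'
  refine h2.congr_deriv ?_
  simp only [screwRadius]
  field_simp

theorem cylindrical_apply (r θ h : ℝ) : cylindrical r θ h 0 = r * Real.cos θ ∧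
    cylindrical r θ h 1 = r * Real.sin θ ∧ cylindrical r θ h 2 = h := ⟨rfl, rfl, rfl⟩

theorem exists_mem_screwDomain (hy : 0 < y₀) (hφ : 0 < screwPhi ε E y₀) :
    ∃ a, (a, y₀) ∈ screwDomain ε E := by
  -- With `c = 0` only `9 / (m² y₀) < 1` is needed; this choice makes it `9/16`.
  refine ⟨(4 / √y₀, 0), div_pos four_pos (Real.sqrt_pos.2 hy), hy, hφ, ?_⟩
  simp only [screwF, div_pow, Real.sq_sqrt hy.le]
  field_simp
  linarith

end ScrewMap

/-! ### The family on the surface -/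

section ScrewFamily

variable {M : Type*} [TopologicalSpace M] [ChartedSpace (EuclideanSpace ℝ (Fin 2)) M]
  [IsManifold (𝓡 2) ∞ M]
  {g : Metric2 M} {v : Fin 2 → (x : M) → TangentSpace (𝓡 2) x} {U : Set M}
  {ε E : ℝ} {w t : M → ℝ} {N : (x : M) → TangentSpace (𝓡 2) x} {W : Set M}

theorem pushforward_comp (X : (x : M) → TangentSpace (𝓡 2) x) {φ : M → E3} {x : M}
    (hφ : MDifferentiableAt (𝓡 2) 𝓘(ℝ, E3) φ x) (i : Fin 3) :
    pushforward φ x (X x) i = dirDeriv X (fun y => φ y i) x := by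
  have := ((EuclideanSpace.proj (𝕜 := ℝ) (ι := Fin 3) i).hasFDerivAt.hasMFDerivAt.comp x
    hφ.hasMFDerivAt).mfderiv
  unfold dirDeriv
  change _ = mfderiv (𝓡 2) 𝓘(ℝ, ℝ) ((EuclideanSpace.proj (𝕜 := ℝ) i) ∘ φ) x (X x)
  rw [this]
  rfl

theorem inner_E3 (a b : E3) : inner ℝ a b = a 0 * b 0 + a 1 * b 1 + a 2 * b 2 := by
  simp [PiLp.inner_apply, Fin.sum_univ_three, mul_comm]

theorem cross_coord (a b : E3) : cross a b 0 = a 1 * b 2 - a 2 * b 1 ∧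
    cross a b 1 = a 2 * b 0 - a 0 * b 2 ∧ cross a b 2 = a 0 * b 1 - a 1 * b 0 := by
  refine ⟨?_, ?_, ?_⟩ <;> simp [cross, _root_.cross_apply]

/-- A map is isometric if it is so on `V` and `N`. -/
theorem IsScrewChart.isometric (hc : IsScrewChart g v U ε E w t N W)
    (hv : IsOrthonormalFrameOn g v U) {φ : M → E3} {x : M} (hx : x ∈ W)
    (hVV : inner ℝ (pushforward φ x (JGradq g v x)) (pushforward φ x (JGradq g v x))
      = E + 9 * ε * w x)
    (hVN : inner ℝ (pushforward φ x (JGradq g v x)) (pushforward φ x (N x)) = 0)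
    (hNN : inner ℝ (pushforward φ x (N x)) (pushforward φ x (N x))
      = 9 * w x / (4 * (E + 9 * ε * w x)))
    (u u' : TangentSpace (𝓡 2) x) :
    inner ℝ (pushforward φ x u) (pushforward φ x u') = g.inner x u u' := by
  have hex : ∀ u : TangentSpace (𝓡 2) x, ∃ a b : ℝ, u = a • JGradq g v x + b • N x := by
    intro u
    refine ⟨g.inner x (v 0 x) u * dirDeriv (v 0) t x + g.inner x (v 1 x) u * dirDeriv (v 1) t x,
      g.inner x (v 0 x) u * dirDeriv (v 0) w x + g.inner x (v 1 x) u * dirDeriv (v 1) w x, ?_⟩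
    have h0 := hv.expand (hc.subset hx) u
    have e0 := hc.frame x hx 0
    have e1 := hc.frame x hx 1
    generalize dirDeriv (v 0) t x = t0 at *
    generalize dirDeriv (v 1) t x = t1 at *
    generalize dirDeriv (v 0) w x = w0 at *
    generalize dirDeriv (v 1) w x = w1 at *
    generalize g.inner x (v 0 x) u = u0 at *
    generalize g.inner x (v 1 x) u = u1 at *
    rw [h0, e0, e1]
    module
  obtain ⟨a, b, rfl⟩ := hex u
  obtain ⟨a', b', rfl⟩ := hex u'
  have hadd : ∀ a b : ℝ, pushforward φ x (a • JGradq g v x + b • N x)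
      = a • pushforward φ x (JGradq g v x) + b • pushforward φ x (N x) := fun a b => by
    unfold pushforward
    rw [map_add, map_smul, map_smul]
    rfl
  rw [hadd, hadd]
  simp only [inner_add_left, inner_add_right, real_inner_smul_left, real_inner_smul_right, map_add,
    map_smul, add_apply, smul_apply, smul_eq_mul, hVV, hVN, hNN, hc.inner_VV x hx,
    hc.inner_VN x hx, hc.inner_NN x hx, g.symm x (N x) (JGradq g v x),
    real_inner_comm (pushforward φ x (JGradq g v x)) (pushforward φ x (N x))]
  ring

theorem dirDeriv_cylindrical (X : (x : M) → TangentSpace (𝓡 2) x) {r θ h : M → ℝ} {x : M}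
    (hr : MDifferentiableAt (𝓡 2) 𝓘(ℝ, ℝ) r x) (hθ : MDifferentiableAt (𝓡 2) 𝓘(ℝ, ℝ) θ x)
    (hφ : MDifferentiableAt (𝓡 2) 𝓘(ℝ, E3) (fun y => cylindrical (r y) (θ y) (h y)) x) :
    pushforward (fun y => cylindrical (r y) (θ y) (h y)) x (X x)
      = !₂[Real.cos (θ x) * dirDeriv X r x - r x * Real.sin (θ x) * dirDeriv X θ x,
        Real.sin (θ x) * dirDeriv X r x + r x * Real.cos (θ x) * dirDeriv X θ x,
        dirDeriv X h x] := by
  have hcos := dirDeriv_comp (X := X) (Real.hasDerivAt_cos (θ x)) hθ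
  have hsin := dirDeriv_comp (X := X) (Real.hasDerivAt_sin (θ x)) hθ
  have hcm : MDifferentiableAt (𝓡 2) 𝓘(ℝ, ℝ) (fun y => Real.cos (θ y)) x :=
    (Real.hasDerivAt_cos (θ x)).hasFDerivAt.hasMFDerivAt.mdifferentiableAt.comp x hθ
  have hsm : MDifferentiableAt (𝓡 2) 𝓘(ℝ, ℝ) (fun y => Real.sin (θ y)) x :=
    (Real.hasDerivAt_sin (θ x)).hasFDerivAt.hasMFDerivAt.mdifferentiableAt.comp x hθ
  ext i
  rw [pushforward_comp X hφ]
  fin_cases i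
  · change dirDeriv X (fun y => r y * Real.cos (θ y)) x
      = Real.cos (θ x) * dirDeriv X r x - r x * Real.sin (θ x) * dirDeriv X θ x
    rw [dirDeriv_fun_mul hr hcm, hcos]; ring
  · change dirDeriv X (fun y => r y * Real.sin (θ y)) x
      = Real.sin (θ x) * dirDeriv X r x + r x * Real.cos (θ x) * dirDeriv X θ x
    rw [dirDeriv_fun_mul hr hsm, hsin]; ring
  · rfl

/-- The family of immersions. -/
def screwFamily (ε E y₀ : ℝ) (w t : M → ℝ) (a : ℝ × ℝ) (x : M) : E3 :=
  screwMap ε E y₀ ((a, w x), t x)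

/-- The domain of the family. -/
def screwFamilyDomain (ε E y₀ : ℝ) (w : M → ℝ) (W : Set M) : Set ((ℝ × ℝ) × M) :=
  {z | z.2 ∈ W ∧ (z.1, w z.2) ∈ screwRange ε E y₀}

theorem contMDiffOn_param_pair {f : M → ℝ}
    (hf : SmoothOn f W) : ContMDiffOn (𝓘(ℝ, ℝ × ℝ).prod (𝓡 2)) 𝓘(ℝ, (ℝ × ℝ) × ℝ) ∞
      (fun z : (ℝ × ℝ) × M => (z.1, f z.2)) (Set.univ ×ˢ W) :=
  contMDiffOn_fst.prodMk_space (hf.comp contMDiffOn_snd fun _ hz => hz.2)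

theorem IsScrewChart.isOpen_screwFamilyDomain (hc : IsScrewChart g v U ε E w t N W) (y₀ : ℝ) :
    IsOpen (screwFamilyDomain ε E y₀ w W) := by
  have h := (contMDiffOn_param_pair hc.smooth_w).continuousOn.isOpen_inter_preimage
    (isOpen_univ.prod hc.isOpen) (isOpen_screwRange (ε := ε) (E := E) (y₀ := y₀))
  convert h using 1
  ext z
  simp [screwFamilyDomain]

theorem IsScrewChart.contMDiffOn_screwFamily (hc : IsScrewChart g v U ε E w t N W) (y₀ : ℝ) :
    ContMDiffOn (𝓘(ℝ, ℝ × ℝ).prod (𝓡 2)) 𝓘(ℝ, E3) ∞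
      (fun z : (ℝ × ℝ) × M => screwFamily ε E y₀ w t z.1 z.2) (screwFamilyDomain ε E y₀ w W) := by
  have h1 : ContMDiffOn (𝓘(ℝ, ℝ × ℝ).prod (𝓡 2)) 𝓘(ℝ, ((ℝ × ℝ) × ℝ) × ℝ) ∞
      (fun z : (ℝ × ℝ) × M => ((z.1, w z.2), t z.2)) (screwFamilyDomain ε E y₀ w W) :=
    ((contMDiffOn_param_pair hc.smooth_w).mono fun z hz => ⟨trivial, hz.1⟩).prodMk_space
      (hc.smooth_t.comp contMDiffOn_snd fun _ hz => hz.1)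
  exact contDiffOn_screwMap.contMDiffOn.comp h1 fun z hz => hz.2

theorem IsScrewChart.contMDiffOn_screwFamily_apply (hc : IsScrewChart g v U ε E w t N W) (y₀ : ℝ)
    (a : ℝ × ℝ) : ContMDiffOn (𝓡 2) 𝓘(ℝ, E3) ∞ (screwFamily ε E y₀ w t a)
      {x | (a, x) ∈ screwFamilyDomain ε E y₀ w W} :=
  (hc.contMDiffOn_screwFamily y₀).comp (contMDiff_const.prodMk contMDiff_id).contMDiffOn
    fun _ hx => hx

/-- The derivatives of the family. -/
theorem IsScrewChart.pushforward_screwFamily (hc : IsScrewChart g v U ε E w t N W) {y₀ : ℝ}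
    {a : ℝ × ℝ} {x : M} (hx : (a, x) ∈ screwFamilyDomain ε E y₀ w W)
    (X : (x : M) → TangentSpace (𝓡 2) x) (r θ : ℝ) (hr : r = screwRadius ε E (a, w x))
    (hθ : θ = screwAngle ε E y₀ ((a, w x), t x)) :
    pushforward (screwFamily ε E y₀ w t a) x (X x)
      = !₂[Real.cos θ * (9 * ε / (2 * a.1 ^ 2 * r) * dirDeriv X w x) - r * Real.sin θ *
          (a.1 * dirDeriv X t x - a.2 * a.1 * (screwTwist ε E (a, w x) * dirDeriv X w x)),
        Real.sin θ * (9 * ε / (2 * a.1 ^ 2 * r) * dirDeriv X w x) + r * Real.cos θ *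
          (a.1 * dirDeriv X t x - a.2 * a.1 * (screwTwist ε E (a, w x) * dirDeriv X w x)),
        a.2 * dirDeriv X t x + screwR ε E (a, w x) * dirDeriv X w x] := by
  subst hr hθ
  have hxW : x ∈ W := hx.1
  have hS : (a, w x) ∈ screwRange ε E y₀ := hx.2
  have hwm := hc.smooth_w.mdifferentiableAt hc.isOpen hxW
  have htm := hc.smooth_t.mdifferentiableAt hc.isOpen hxW
  have hm : ∀ {h : ℝ → ℝ} {h' : ℝ}, HasDerivAt h h' (w x) →
      MDifferentiableAt (𝓡 2) 𝓘(ℝ, ℝ) (fun y => h (w y)) x := fun hh =>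
    hh.hasFDerivAt.hasMFDerivAt.mdifferentiableAt.comp x hwm
  have dr := hasDerivAt_screwRadius (mem_of_mem_segFiber hS)
  have dI := hasDerivAt_primitiveFrom isOpen_screwDomain
    (contDiffOn_screwTwist (ε := ε) (E := E)) hS
  have dJ := hasDerivAt_primitiveFrom isOpen_screwDomain (contDiffOn_screwR (ε := ε) (E := E)) hS
  have hD : IsOpen {x | (a, x) ∈ screwFamilyDomain ε E y₀ w W} :=
    (hc.isOpen_screwFamilyDomain y₀).preimage (by fun_prop)
  have hΨ : MDifferentiableAt (𝓡 2) 𝓘(ℝ, E3) (screwFamily ε E y₀ w t a) x :=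
    (((hc.contMDiffOn_screwFamily_apply y₀ a) x hx).contMDiffAt (hD.mem_nhds hx)).mdifferentiableAt
      (by simp)
  have htm' : MDifferentiableAt (𝓡 2) 𝓘(ℝ, ℝ) (fun y => a.1 * t y) x :=
    mdifferentiableAt_const.mul htm
  have hIm : MDifferentiableAt (𝓡 2) 𝓘(ℝ, ℝ)
      (fun y => a.2 * a.1 * primitiveFrom (screwTwist ε E) y₀ (a, w y)) x :=
    mdifferentiableAt_const.mul (hm dI)
  have htm2 : MDifferentiableAt (𝓡 2) 𝓘(ℝ, ℝ) (fun y => a.2 * t y) x :=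
    mdifferentiableAt_const.mul htm
  have key := dirDeriv_cylindrical X (r := fun y => screwRadius ε E (a, w y))
    (θ := fun y => screwAngle ε E y₀ ((a, w y), t y))
    (h := fun y => screwHeight ε E y₀ ((a, w y), t y)) (hm dr) (htm'.sub hIm) hΨ
  rw [show screwFamily ε E y₀ w t a = fun y => cylindrical (screwRadius ε E (a, w y))
    (screwAngle ε E y₀ ((a, w y), t y)) (screwHeight ε E y₀ ((a, w y), t y)) from rfl, key,
    dirDeriv_comp dr hwm]
  have eθ : dirDeriv X (fun y => screwAngle ε E y₀ ((a, w y), t y)) x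
      = a.1 * dirDeriv X t x - a.2 * a.1 * (screwTwist ε E (a, w x) * dirDeriv X w x) := by
    simp only [screwAngle]
    rw [dirDeriv_fun_sub (f := fun y => a.1 * t y)
      (h := fun y => a.2 * a.1 * primitiveFrom (screwTwist ε E) y₀ (a, w y)) htm' hIm,
      dirDeriv_const_mul (f := t) _ htm,
      dirDeriv_const_mul (f := fun y => primitiveFrom (screwTwist ε E) y₀ (a, w y)) _ (hm dI),
      dirDeriv_comp dI hwm]
  have eh : dirDeriv X (fun y => screwHeight ε E y₀ ((a, w y), t y)) x
      = a.2 * dirDeriv X t x + screwR ε E (a, w x) * dirDeriv X w x := by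
    simp only [screwHeight]
    rw [dirDeriv_fun_add (f := fun y => a.2 * t y)
      (h := fun y => primitiveFrom (screwR ε E) y₀ (a, w y)) htm2 (hm dJ),
      dirDeriv_const_mul (f := t) _ htm, dirDeriv_comp dJ hwm]
  rw [eθ, eh]

/-- The members of the family are isometric immersions. -/
theorem IsScrewChart.isIsometricImmersionOn_screwFamily (hc : IsScrewChart g v U ε E w t N W)
    (hv : IsOrthonormalFrameOn g v U) (y₀ : ℝ) (a : ℝ × ℝ) :
    IsIsometricImmersionOn g (screwFamily ε E y₀ w t a)
      {x | (a, x) ∈ screwFamilyDomain ε E y₀ w W} := by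
  refine ⟨hc.contMDiffOn_screwFamily_apply y₀ a, fun x hx => ?_⟩
  have hxW : x ∈ W := hx.1
  have hS := mem_of_mem_segFiber hx.2
  have hV := hc.pushforward_screwFamily hx (JGradq g v) _ _ rfl rfl
  have hN := hc.pushforward_screwFamily hx N _ _ rfl rfl
  simp only [hc.V_w x hxW, hc.V_t x hxW, hc.N_w x hxW, hc.N_t x hxW, mul_zero, mul_one, sub_zero,
    add_zero, zero_add, zero_sub] at hV hN
  have hcs := Real.cos_sq_add_sin_sq (screwAngle ε E y₀ ((a, w x), t x))
  have hr2 := sq_screwRadius hS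
  have hr0 := (screwRadius_pos hS).ne'
  have hR2 := sq_screwR hS
  have hφc := (sub_sq_pos hS).ne'
  have hT : screwTwist ε E (a, w x) = screwR ε E (a, w x) / (screwPhi ε E (w x) - a.2 ^ 2) := rfl
  obtain ⟨hm, hy, hφ, hF⟩ := hS
  simp only [screwF] at hm hy hφ hR2 hr2 hφc
  have hm' := hm.ne'
  have hy' := hy.ne'
  have hφ' := hφ.ne'
  have hε := hc.sq_eq
  generalize screwAngle ε E y₀ ((a, w x), t x) = θ at *
  generalize screwRadius ε E (a, w x) = r at *
  generalize screwR ε E (a, w x) = R at *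
  generalize screwTwist ε E (a, w x) = T at *
  refine hc.isometric hv hxW ?_ ?_ ?_
  · rw [hV, inner_E3]
    simp only [Matrix.cons_val]
    rw [show E + 9 * ε * w x = screwPhi ε E (w x) from rfl]
    linear_combination (r ^ 2 * a.1 ^ 2) * hcs + hr2
  · rw [hV, hN, inner_E3]
    simp only [Matrix.cons_val]
    -- The twist is chosen so that the angular and vertical parts cancel in the product of the
    -- images of `V` and `N`.
    have hTφ : T * (screwPhi ε E (w x) - a.2 ^ 2) = R := by rw [hT, div_mul_cancel₀ _ hφc]
    linear_combination (-(r ^ 2 * a.1 ^ 2 * a.2 * T)) * hcs - a.2 * T * hr2 - a.2 * hTφ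
  · rw [hN, inner_E3]
    simp only [Matrix.cons_val]
    rw [show E + 9 * ε * w x = screwPhi ε E (w x) from rfl]
    have e1 : (9 * ε / (2 * a.1 ^ 2 * r)) ^ 2
        = 81 / (4 * a.1 ^ 2 * (screwPhi ε E (w x) - a.2 ^ 2)) := by
      rw [← hr2, div_pow, mul_pow, hε]
      field_simp
      ring
    have e2 : (r * (a.2 * a.1 * T)) ^ 2 = a.2 ^ 2 * R ^ 2 / (screwPhi ε E (w x) - a.2 ^ 2) := by
      rw [hT]
      field_simp
      linear_combination (a.2 ^ 2 * R ^ 2) * hr2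
    -- Radial, angular and vertical contributions to the length of the image of `N`. This is the
    -- equation solved by the definition of `screwR`.
    have e3 : 81 / (4 * a.1 ^ 2 * (screwPhi ε E (w x) - a.2 ^ 2))
        + a.2 ^ 2 * R ^ 2 / (screwPhi ε E (w x) - a.2 ^ 2) + R ^ 2
        = 9 * w x / (4 * screwPhi ε E (w x)) := by
      rw [hR2]
      field_simp
      ring
    rw [← e3, ← e1, ← e2]
    linear_combination ((9 * ε / (2 * a.1 ^ 2 * r)) ^ 2 + (r * (a.2 * a.1 * T)) ^ 2) * hcs

/-- The members of the family carry the extrinsic symmetry. -/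
theorem IsScrewChart.hasExtrinsicSymmetryOn_screwFamily (hc : IsScrewChart g v U ε E w t N W)
    {y₀ : ℝ} {a : ℝ × ℝ} (ha : a.1 ≠ 0) :
    HasExtrinsicSymmetryOn (JGradq g v) (screwFamily ε E y₀ w t a)
      {x | (a, x) ∈ screwFamilyDomain ε E y₀ w W} := by
  -- Translation with speed `c` and rotation with speed `m` about the third axis. The minus sign
  -- comes from the order `ρ × Z` of the cross product.
  refine ⟨!₂[0, 0, a.2], !₂[0, 0, -a.1], fun h => ha ?_, fun x hx => ?_⟩
  · have := congrArg (fun u : E3 => u 2) h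
    simpa using this
  · have hxW : x ∈ W := hx.1
    have hV := hc.pushforward_screwFamily hx (JGradq g v) _ _ rfl rfl
    simp only [hc.V_w x hxW, hc.V_t x hxW, mul_zero, mul_one, sub_zero, add_zero, zero_add,
      zero_sub] at hV
    rw [hV]
    obtain ⟨c0, c1, c2⟩ := cross_coord (screwFamily ε E y₀ w t a x) !₂[0, 0, -a.1]
    obtain ⟨s0, s1, s2⟩ := cylindrical_apply (screwRadius ε E (a, w x))
      (screwAngle ε E y₀ ((a, w x), t x)) (screwHeight ε E y₀ ((a, w x), t x))
    change screwFamily ε E y₀ w t a x 0 = _ at s0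
    change screwFamily ε E y₀ w t a x 1 = _ at s1
    ext i
    fin_cases i
    · change _ = (0 : ℝ) + cross (screwFamily ε E y₀ w t a x) !₂[0, 0, -a.1] 0
      rw [c0, s1]
      simp
    · change _ = (0 : ℝ) + cross (screwFamily ε E y₀ w t a x) !₂[0, 0, -a.1] 1
      rw [c1, s0]
      simp
    · change _ = a.2 + cross (screwFamily ε E y₀ w t a x) !₂[0, 0, -a.1] 2
      rw [c2]
      simp

end ScrewFamily

/-! ### The members of the family are not congruent -/

section Trigonometric

open Filter Topology

theorem eventuallyEq_deriv {f h f' h' : ℝ → ℝ} (hf : ∀ s, HasDerivAt f (f' s) s)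
    (hh : ∀ s, HasDerivAt h (h' s) s) (e : f =ᶠ[𝓝 0] h) : f' =ᶠ[𝓝 0] h' := by
  filter_upwards [e.deriv] with s hs
  rwa [(hf s).deriv, (hh s).deriv] at hs

theorem hasDerivAt_sin_mul (m s : ℝ) : HasDerivAt (fun s => Real.sin (m * s)) (Real.cos (m * s) * m) s := by
  simpa using ((hasDerivAt_id s).const_mul m).sin

theorem hasDerivAt_cos_mul (m s : ℝ) :
    HasDerivAt (fun s => Real.cos (m * s)) (-Real.sin (m * s) * m) s := by
  simpa using ((hasDerivAt_id s).const_mul m).cos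

/-- Two differentiations preserve the shape `A cos(ms) + B + C s²`, so the step can be iterated
until the polynomial part has gone. -/
theorem eventuallyEq_cos_deriv {A B C D P Q m n : ℝ}
    (h : (fun s => A * Real.cos (m * s) + B + C * s ^ 2)
      =ᶠ[𝓝 0] fun s => D * Real.cos (n * s) + P + Q * s ^ 2) :
    (fun s => -(A * m ^ 2) * Real.cos (m * s) + 2 * C + 0 * s ^ 2)
      =ᶠ[𝓝 0] fun s => -(D * n ^ 2) * Real.cos (n * s) + 2 * Q + 0 * s ^ 2 := by
  have d1 : ∀ A B C m s : ℝ, HasDerivAt (fun s => A * Real.cos (m * s) + B + C * s ^ 2)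
      (-(A * m) * Real.sin (m * s) + 2 * C * s) s := fun A B C m s => by
    refine ((((hasDerivAt_cos_mul m s).const_mul A).add_const B).add
      ((hasDerivAt_pow 2 s).const_mul C)).congr_deriv ?_
    simp; ring
  have d2 : ∀ A C m s : ℝ, HasDerivAt (fun s => -(A * m) * Real.sin (m * s) + 2 * C * s)
      (-(A * m ^ 2) * Real.cos (m * s) + 2 * C + 0 * s ^ 2) s := fun A C m s => by
    refine (((hasDerivAt_sin_mul m s).const_mul (-(A * m))).add
      ((hasDerivAt_id s).const_mul (2 * C))).congr_deriv ?_
    simp; ring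
  exact eventuallyEq_deriv (d2 A C m) (d2 D Q n) (eventuallyEq_deriv (d1 A B C m) (d1 D P Q n) h)

/-- The distances along two helices determine their parameters. -/
theorem helix_unique {r r' m m' c c' : ℝ} (hr : 0 < r) (hr' : 0 < r') (hm : 0 < m) (hm' : 0 < m')
    (h : (fun s => -(2 * r ^ 2) * Real.cos (m * s) + 2 * r ^ 2 + c ^ 2 * s ^ 2)
      =ᶠ[𝓝 0] fun s => -(2 * r' ^ 2) * Real.cos (m' * s) + 2 * r' ^ 2 + c' ^ 2 * s ^ 2) :
    m = m' ∧ r = r' := by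
  -- The derivatives of orders four and six at `0` give `r² m⁴` and `r² m⁶`; their ratio is `m²`.
  have h2 := eventuallyEq_cos_deriv (eventuallyEq_cos_deriv h)
  have e2 := h2.self_of_nhds
  have e3 := (eventuallyEq_cos_deriv h2).self_of_nhds
  simp only [mul_zero, Real.cos_zero, mul_one, add_zero, zero_pow two_ne_zero] at e2 e3
  have hmm : m ^ 2 = m' ^ 2 := by
    have h0 : r ^ 2 * m ^ 4 ≠ 0 := by positivity
    apply mul_left_cancel₀ h0
    linear_combination (1 / 2) * e3 + m' ^ 2 / 2 * e2
  have hm_eq : m = m' := by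
    rwa [sq_eq_sq₀ hm.le hm'.le] at hmm
  subst hm_eq
  refine ⟨rfl, ?_⟩
  have hrr : r ^ 2 = r' ^ 2 := by
    have h0 : m ^ 4 ≠ 0 := by positivity
    apply mul_left_cancel₀ h0
    linear_combination (-1 / 2) * e2
  rwa [sq_eq_sq₀ hr.le hr'.le] at hrr

/-- The third derivative at `0` forces `A = 0`, and then the first forces `B = 0`. -/
theorem eq_zero_of_sin_eq_linear {A B m : ℝ} (hm : m ≠ 0)
    (h : (fun s => A * Real.sin (m * s)) =ᶠ[𝓝 0] fun s => B * s) : B = 0 := by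
  have d1 : ∀ s, HasDerivAt (fun s => A * Real.sin (m * s)) (A * m * Real.cos (m * s)) s :=
    fun s => ((hasDerivAt_sin_mul m s).const_mul A).congr_deriv (by ring)
  have d1' : ∀ s, HasDerivAt (fun s => B * s) B s := fun s => by
    simpa using (hasDerivAt_id s).const_mul B
  have d2 : ∀ s, HasDerivAt (fun s => A * m * Real.cos (m * s)) (-(A * m ^ 2) * Real.sin (m * s)) s :=
    fun s => ((hasDerivAt_cos_mul m s).const_mul (A * m)).congr_deriv (by ring)
  have d3 : ∀ s, HasDerivAt (fun s => -(A * m ^ 2) * Real.sin (m * s))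
      (-(A * m ^ 3) * Real.cos (m * s)) s :=
    fun s => ((hasDerivAt_sin_mul m s).const_mul (-(A * m ^ 2))).congr_deriv (by ring)
  have h1 := eventuallyEq_deriv d1 d1' h
  have h2 := eventuallyEq_deriv d2 (fun s => hasDerivAt_const s B) h1
  have e3 := (eventuallyEq_deriv d3 (fun s => hasDerivAt_const s 0) h2).self_of_nhds
  have e1 := h1.self_of_nhds
  simp only [mul_zero, Real.cos_zero, mul_one] at e1 e3
  have : A = 0 := by
    have := neg_eq_zero.1 e3
    simpa [hm] using this
  rw [← e1, this, zero_mul]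

theorem norm_sub_cylindrical_sq (r θ h r' θ' h' : ℝ) :
    ‖cylindrical r θ h - cylindrical r' θ' h'‖ ^ 2
      = r ^ 2 + r' ^ 2 - 2 * r * r' * Real.cos (θ - θ') + (h - h') ^ 2 := by
  rw [← real_inner_self_eq_norm_sq, inner_E3]
  simp only [PiLp.sub_apply, cylindrical, Matrix.cons_val]
  rw [Real.cos_sub]
  linear_combination r ^ 2 * Real.sin_sq_add_cos_sq θ + r' ^ 2 * Real.sin_sq_add_cos_sq θ'

theorem primitiveFrom_screwR_pos {ε E y₀ y : ℝ} {a : ℝ × ℝ} (hy : y₀ < y)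
    (h : (a, y) ∈ screwRange ε E y₀) : 0 < primitiveFrom (screwR ε E) y₀ (a, y) := by
  refine mul_pos (sub_pos.2 hy) (intervalIntegral.intervalIntegral_pos_of_pos_on ?_
    (fun s hs => screwR_pos (h s (Set.Ioo_subset_Icc_self hs))) one_pos)
  apply ContinuousOn.intervalIntegrable
  rw [Set.uIcc_of_le zero_le_one]
  exact contDiffOn_screwR.continuousOn.comp (by fun_prop) fun s hs => h s hs

theorem screwRadius_neg (ε E m c y : ℝ) :
    screwRadius ε E ((m, -c), y) = screwRadius ε E ((m, c), y) := by simp [screwRadius]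

theorem screwR_neg (ε E m c y : ℝ) : screwR ε E ((m, -c), y) = screwR ε E ((m, c), y) := by
  simp [screwR, screwF]

theorem screwTwist_neg (ε E m c y : ℝ) :
    screwTwist ε E ((m, -c), y) = screwTwist ε E ((m, c), y) := by
  simp [screwTwist, screwR_neg]

/-- Congruent members of the family have equal parameters. -/
theorem screwMap_congruent {ε E y₀ t₀ : ℝ} {a b : ℝ × ℝ} (ha : (a, y₀) ∈ screwDomain ε E)
    (hb : (b, y₀) ∈ screwDomain ε E) (R : E3 ≃ᵢ E3)
    (h : ∀ᶠ q : ℝ × ℝ in 𝓝 (y₀, t₀),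
      screwMap ε E y₀ ((a, q.1), q.2) = R (screwMap ε E y₀ ((b, q.1), q.2))) : a = b := by
  have h0 := h.self_of_nhds
  -- An isometry preserves distances to the base point; only these distances are used from here on.
  have hd : ∀ᶠ q : ℝ × ℝ in 𝓝 (y₀, t₀),
      ‖screwMap ε E y₀ ((a, q.1), q.2) - screwMap ε E y₀ ((a, y₀), t₀)‖ ^ 2
        = ‖screwMap ε E y₀ ((b, q.1), q.2) - screwMap ε E y₀ ((b, y₀), t₀)‖ ^ 2 := by
    filter_upwards [h] with q hq
    rw [hq, h0, ← dist_eq_norm, ← dist_eq_norm, R.dist_eq]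
  have hc : ∀ᶠ y in 𝓝 y₀, ∀ᶠ s in 𝓝 (0 : ℝ),
      ‖screwMap ε E y₀ ((a, y), t₀ + s) - screwMap ε E y₀ ((a, y₀), t₀)‖ ^ 2
        = ‖screwMap ε E y₀ ((b, y), t₀ + s) - screwMap ε E y₀ ((b, y₀), t₀)‖ ^ 2 := by
    filter_upwards [hd.curry_nhds] with y hy
    have : Tendsto (fun s : ℝ => t₀ + s) (𝓝 0) (𝓝 t₀) := by
      simpa using (tendsto_const_nhds (x := t₀)).add (tendsto_id (α := ℝ) (x := 𝓝 0))
    exact this.eventually hy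
  have hra := screwRadius_pos ha
  have hrb := screwRadius_pos hb
  -- Along the orbit `y = y₀` the squared distance is `2 r² (1 - cos(ms)) + c² s²`.
  obtain ⟨hm, hr⟩ := helix_unique (c := a.2) (c' := b.2) hra hrb ha.1 hb.1 (by
    filter_upwards [hc.self_of_nhds] with s hs
    simp only [screwMap, norm_sub_cylindrical_sq, screwAngle, screwHeight,
      primitiveFrom_self] at hs
    have e : ∀ m : ℝ, m * (t₀ + s) - 0 - (m * t₀ - 0) = m * s := fun m => by ring
    simp only [mul_zero, e, add_zero] at hs
    linear_combination hs)
  have hca := sq_screwRadius ha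
  have hcb := sq_screwRadius hb
  have hcc : a.2 ^ 2 = b.2 ^ 2 := by
    rw [← hr, ← show a.1 = b.1 from hm] at hcb
    simp only at hca hcb
    linear_combination hca - hcb
  rcases sq_eq_sq_iff_eq_or_eq_neg.1 hcc with h1 | h1
  · exact Prod.ext hm h1
  · obtain ⟨m, c⟩ := a
    obtain ⟨m', c'⟩ := b
    simp only at hm h1
    subst hm
    have hc' : c' = -c := by rw [h1, neg_neg]
    subst hc'
    -- Opposite values of `c` give the same distances along each orbit, so points on a second orbit
    -- `y > y₀` must be compared with the base point.
    suffices c = 0 by simp [this]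
    have hO : ∀ᶠ y in 𝓝 y₀, ((m, c), y) ∈ screwRange ε E y₀ :=
      (isOpen_screwRange.preimage (f := fun y : ℝ => ((m, c), y)) (by fun_prop)).mem_nhds
        (base_mem_segFiber ha)
    obtain ⟨y, ⟨hy1, hy2⟩, hy3⟩ := (((hc.and hO).filter_mono
      (nhdsWithin_le_nhds (s := Set.Ioi y₀))).and self_mem_nhdsWithin).exists
    have hJ := primitiveFrom_screwR_pos hy3 hy2
    have hJ' : primitiveFrom (screwR ε E) y₀ ((m, -c), y)
        = primitiveFrom (screwR ε E) y₀ ((m, c), y) := by simp only [primitiveFrom, screwR_neg]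
    have hI' : primitiveFrom (screwTwist ε E) y₀ ((m, -c), y)
        = primitiveFrom (screwTwist ε E) y₀ ((m, c), y) := by simp only [primitiveFrom, screwTwist_neg]
    set J := primitiveFrom (screwR ε E) y₀ ((m, c), y) with hJdef
    set I := primitiveFrom (screwTwist ε E) y₀ ((m, c), y) with hIdef
    -- The difference of the two squared distances is a multiple of `sin(ms)` plus a multiple of `c
    -- J s`. Hence `c J = 0`, whereas the height difference `J` is positive.
    have hlin := eq_zero_of_sin_eq_linear (A := screwRadius ε E ((m, c), y)
      * screwRadius ε E ((m, c), y₀) * Real.sin (c * m * I)) (B := c * J) (m := m) ha.1.ne' (by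
      filter_upwards [hy1] with s hs
      simp only [screwMap, norm_sub_cylindrical_sq, screwAngle, screwHeight, primitiveFrom_self,
        hJ', hI', screwRadius_neg, ← hJdef, ← hIdef] at hs
      rw [show m * (t₀ + s) - c * m * I - (m * t₀ - c * m * 0) = m * s - c * m * I by ring,
        show m * (t₀ + s) - -c * m * I - (m * t₀ - -c * m * 0) = m * s + c * m * I by ring,
        Real.cos_sub, Real.cos_add] at hs
      linear_combination (-1 / 4) * hs)
    exact (mul_eq_zero.1 hlin).resolve_right hJ.ne'

end Trigonometric

/-! ### Transfer of the comparison from the coordinates to the surface. -/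

section NotCongruent

variable {M : Type*} [TopologicalSpace M] [ChartedSpace (EuclideanSpace ℝ (Fin 2)) M]
  [IsManifold (𝓡 2) ∞ M]
  {g : Metric2 M} {v : Fin 2 → (x : M) → TangentSpace (𝓡 2) x} {U : Set M}
  {ε E : ℝ} {w t : M → ℝ} {N : (x : M) → TangentSpace (𝓡 2) x} {W : Set M}

/-- The coordinates `w, t` cover a neighbourhood. -/
theorem IsScrewChart.map_nhds (hc : IsScrewChart g v U ε E w t N W) {p : M} (hp : p ∈ W) :
    Filter.map (fun x => (w x, t x)) (nhds p) = nhds (w p, t p) := by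
  set φ := extChartAt (𝓡 2) p with hφ
  have hps : p ∈ φ.source := mem_extChartAt_source p
  have hz := mem_chartRange hp hps
  have hd := fun {f : M → ℝ} (hf : SmoothOn f W) => (hf.contDiffOn_chartRange p).contDiffAt
    ((isOpen_chartRange p hc.isOpen).mem_nhds hz)
  have hs := fun {f : M → ℝ} (hf : SmoothOn f W) => (hd hf).hasStrictFDerivAt (by simp)
  have hS := (hs hc.smooth_w).prodMk (hs hc.smooth_t)
  have key : ∀ (X : (x : M) → TangentSpace (𝓡 2) x) {f : M → ℝ}, SmoothOn f W →
      fderiv ℝ (f ∘ φ.symm) (φ p) (dirDeriv X (chartCoord p 0) p • EuclideanSpace.single 0 1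
        + dirDeriv X (chartCoord p 1) p • EuclideanSpace.single 1 1) = dirDeriv X f p := by
    intro X f hf
    rw [dirDeriv_eq_chart' X hc.isOpen hf hp hps, map_add, map_smul, map_smul, smul_eq_mul,
      smul_eq_mul, mul_comm, mul_comm (dirDeriv X (chartCoord p 1) p)]
  -- The differential of `(w, t)` sends `N` and `V` to the standard basis, so it is onto.
  have hsurj := hS.map_nhds_eq_of_surj (by
    rw [LinearMap.range_eq_top]
    rintro ⟨α, β⟩
    refine ⟨α • (dirDeriv N (chartCoord p 0) p • EuclideanSpace.single 0 1
        + dirDeriv N (chartCoord p 1) p • EuclideanSpace.single 1 1)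
      + β • (dirDeriv (JGradq g v) (chartCoord p 0) p • EuclideanSpace.single 0 1
        + dirDeriv (JGradq g v) (chartCoord p 1) p • EuclideanSpace.single 1 1), ?_⟩
    rw [map_add, map_smul, map_smul]
    refine Prod.ext ?_ ?_
    · change α * fderiv ℝ (w ∘ φ.symm) (φ p) _ + β * fderiv ℝ (w ∘ φ.symm) (φ p) _ = α
      rw [key N hc.smooth_w, key _ hc.smooth_w, hc.N_w p hp, hc.V_w p hp]
      ring
    · change α * fderiv ℝ (t ∘ φ.symm) (φ p) _ + β * fderiv ℝ (t ∘ φ.symm) (φ p) _ = β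
      rw [key N hc.smooth_t, key _ hc.smooth_t, hc.N_t p hp, hc.V_t p hp]
      ring)
  have e : (fun x => (w x, t x)) =ᶠ[nhds p]
      (fun z => ((w ∘ φ.symm) z, (t ∘ φ.symm) z)) ∘ φ := by
    filter_upwards [(isOpen_extChartAt_source p).mem_nhds hps] with x hx
    simp only [Function.comp]
    rw [φ.left_inv hx]
  rw [Filter.map_congr e, ← Filter.map_map, map_extChartAt_nhds_of_boundaryless, hsurj]
  simp only [Function.comp]
  rw [φ.left_inv hps]

theorem IsScrewChart.eq_of_congruentNear (hc : IsScrewChart g v U ε E w t N W) {p : M}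
    (hp : p ∈ W) {a b : ℝ × ℝ} (ha : (a, w p) ∈ screwDomain ε E) (hb : (b, w p) ∈ screwDomain ε E)
    (h : CongruentNear (screwFamily ε E (w p) w t a) (screwFamily ε E (w p) w t b) p) : a = b := by
  obtain ⟨R, hR⟩ := h
  refine screwMap_congruent (t₀ := t p) ha hb R ?_
  rw [← hc.map_nhds hp, Filter.eventually_map]
  exact hR

end NotCongruent

/-! ### Uniqueness of the screw-invariant immersions -/

theorem orthonormal_three {f : Fin 3 → E3} (h00 : inner ℝ (f 0) (f 0) = 1)
    (h11 : inner ℝ (f 1) (f 1) = 1) (h22 : inner ℝ (f 2) (f 2) = 1)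
    (h01 : inner ℝ (f 0) (f 1) = 0) (h02 : inner ℝ (f 0) (f 2) = 0)
    (h12 : inner ℝ (f 1) (f 2) = 0) : Orthonormal ℝ f := by
  rw [orthonormal_iff_ite]
  have h10 := (real_inner_comm (f 0) (f 1)).trans h01
  have h20 := (real_inner_comm (f 0) (f 2)).trans h02
  have h21 := (real_inner_comm (f 1) (f 2)).trans h12
  intro i j
  fin_cases i <;> fin_cases j <;> simp_all

theorem exists_orthonormalBasis {f : Fin 3 → E3} (hf : Orthonormal ℝ f) :
    ∃ b : OrthonormalBasis (Fin 3) ℝ E3, ∀ i, b i = f i := by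
  obtain ⟨b, hb⟩ := Orthonormal.exists_orthonormalBasis_extension_of_card_eq (ι := Fin 3) (𝕜 := ℝ)
    (E := E3) (by simp) (v := f) (s := Set.univ) (hf.comp _ Subtype.val_injective)
  exact ⟨b, fun i => hb i trivial⟩

/-- A frame adapted to the axis of a screw motion. -/
theorem exists_axis_frame {Z : E3} (hZ : Z ≠ 0) : ∃ (m : ℝ) (b : OrthonormalBasis (Fin 3) ℝ E3),
    0 < m ∧ (∀ u, inner ℝ (b 0) (cross u Z) = -m * inner ℝ (b 1) u) ∧
      (∀ u, inner ℝ (b 1) (cross u Z) = m * inner ℝ (b 0) u) ∧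
      ∀ u, inner ℝ (b 2) (cross u Z) = 0 := by
  have hm : 0 < ‖Z‖ := norm_pos_iff.2 hZ
  set m := ‖Z‖ with hm'
  have hZZ : inner ℝ Z Z = m ^ 2 := real_inner_self_eq_norm_sq Z
  -- Of this basis only `b 0` is kept, as a unit vector `n` orthogonal to `Z`. The second vector is
  -- then taken to be `n × Z / m`, which makes the orientation and the signs in the conclusion
  -- definite.
  obtain ⟨b, hb⟩ := Orthonormal.exists_orthonormalBasis_extension_of_card_eq (ι := Fin 3) (𝕜 := ℝ)
    (E := E3) (by simp) (v := fun _ => (-m⁻¹) • Z) (s := {2}) (by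
      rw [orthonormal_iff_ite]
      rintro ⟨i, hi⟩ ⟨j, hj⟩
      obtain rfl : i = 2 := hi
      obtain rfl : j = 2 := hj
      simp only [Set.domRestrict_apply, real_inner_smul_left, real_inner_smul_right, hZZ, if_true]
      field_simp)
  have h00 : inner ℝ (b 0) (b 0) = 1 := by simp
  have h02 : inner ℝ (b 0) Z = 0 := by
    have h1 : inner ℝ (b 0) (b 2) = 0 := by simp
    rw [hb 2 rfl, real_inner_smul_right] at h1
    exact (mul_eq_zero.1 h1).resolve_left (neg_ne_zero.2 (inv_ne_zero hm.ne'))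
  set n := b 0 with hn
  have hcr : ∀ u w : E3, cross u w 0 = u 1 * w 2 - u 2 * w 1 ∧
      cross u w 1 = u 2 * w 0 - u 0 * w 2 ∧ cross u w 2 = u 0 * w 1 - u 1 * w 0 := cross_coord
  simp only [inner_E3] at h00 h02 hZZ
  have hf : Orthonormal ℝ ![n, m⁻¹ • cross n Z, (-m⁻¹) • Z] := by
    refine orthonormal_three ?_ ?_ ?_ ?_ ?_ ?_ <;>
      simp only [Matrix.cons_val, inner_E3, PiLp.smul_apply, smul_eq_mul, (hcr n Z).1,
        (hcr n Z).2.1, (hcr n Z).2.2]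
    · exact h00
    · field_simp
      linear_combination (Z 0 * Z 0 + Z 1 * Z 1 + Z 2 * Z 2) * h00 + hZZ
        - (n 0 * Z 0 + n 1 * Z 1 + n 2 * Z 2) * h02
    · field_simp
      linear_combination hZZ
    · field_simp
      ring
    · linear_combination (-m⁻¹) * h02
    · field_simp
      ring
  obtain ⟨b', hb'⟩ := exists_orthonormalBasis hf
  refine ⟨m, b', hm, fun u => ?_, fun u => ?_, fun u => ?_⟩ <;> rw [hb'] <;> try rw [hb']
  all_goals
    simp only [Matrix.cons_val, inner_E3, PiLp.smul_apply, smul_eq_mul, (hcr n Z).1,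
      (hcr n Z).2.1, (hcr n Z).2.2, (hcr u Z).1, (hcr u Z).2.1, (hcr u Z).2.2]
  · field_simp
    ring
  · field_simp
    linear_combination (u 0 * n 0 + u 1 * n 1 + u 2 * n 2) * hZZ
      - (u 0 * Z 0 + u 1 * Z 1 + u 2 * Z 2) * h02
  · ring

/-- The function `screwF` cannot have a minimum with value zero. -/
theorem screwF_pos {ε E m c y₀ : ℝ} (hε : ε ^ 2 = 1) (hm : 0 < m) (hy : 0 < y₀)
    (hφ : 0 < screwPhi ε E y₀)
    (h : ∀ᶠ y in nhds y₀, 0 ≤ screwF ε E ((m, c), y)) : 0 < screwF ε E ((m, c), y₀) := by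
  refine lt_of_le_of_ne h.self_of_nhds fun h0 => ?_
  -- This is `y φ F`, a quadratic polynomial in `y`. It has the sign of `screwF` near `y₀`, so a
  -- zero of `screwF` at `y₀` would be a local minimum of `P`, hence a double root.
  set P : ℝ → ℝ := fun y => 9 * ε * y ^ 2 + (E - c ^ 2 - 81 * ε / m ^ 2) * y - 9 * E / m ^ 2 with hP
  have hPF : ∀ y, 0 < y → 0 < screwPhi ε E y →
      P y = y * screwPhi ε E y * screwF ε E ((m, c), y) := by
    intro y hy hφ
    have hφ' := hφ.ne'
    have e : ∀ φ : ℝ, φ ≠ 0 → y * φ * (1 - c ^ 2 / φ - 9 / (m ^ 2 * y))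
        = y * φ - c ^ 2 * y - 9 * φ / m ^ 2 := fun φ hφ => by field_simp
    simp only [screwF]
    rw [e _ hφ']
    simp only [hP, screwPhi]
    ring
  have hpos : ∀ᶠ y in nhds y₀, 0 < y ∧ 0 < screwPhi ε E y := by
    have h1 : IsOpen {y : ℝ | 0 < y ∧ 0 < screwPhi ε E y} := by
      have h2 : Continuous (screwPhi ε E) := by unfold screwPhi; fun_prop
      exact (isOpen_lt continuous_const continuous_id).inter (isOpen_lt continuous_const h2)
    exact h1.mem_nhds ⟨hy, hφ⟩
  have hP0 : P y₀ = 0 := by rw [hPF y₀ hy hφ, ← h0, mul_zero]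
  have hPn : ∀ᶠ y in nhds y₀, 0 ≤ P y := by
    filter_upwards [h, hpos] with y h1 h2
    rw [hPF y h2.1 h2.2]
    exact mul_nonneg (mul_nonneg h2.1.le h2.2.le) h1
  have hmin : IsLocalMin P y₀ := by
    filter_upwards [hPn] with y hy
    rwa [hP0]
  have hd : HasDerivAt P (18 * ε * y₀ + (E - c ^ 2 - 81 * ε / m ^ 2)) y₀ := by
    have := ((((hasDerivAt_pow 2 y₀).const_mul (9 * ε)).add
      ((hasDerivAt_id y₀).const_mul (E - c ^ 2 - 81 * ε / m ^ 2))).sub_const (9 * E / m ^ 2))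
    refine this.congr_deriv ?_
    simp; ring
  have hd0 := hmin.hasDerivAt_eq_zero hd
  have hPy : ∀ y, P y = 9 * ε * (y - y₀) ^ 2 := fun y => by
    have h1 := hP0
    simp only [hP] at h1 ⊢
    linear_combination h1 + (y - y₀) * hd0
  have hε' : (ε - 1) * (ε + 1) = 0 := by linear_combination hε
  rcases mul_eq_zero.1 hε' with h1 | h1
  · obtain rfl : ε = 1 := by linarith
    have hm0 := hm.ne'
    -- For `ε = 1` the polynomial is `9 (y - y₀)²`, and the constant term determines `E`. Positivity
    -- of `φ` then gives `m² y₀ < 9`, and the linear coefficient makes `m² c²` negative.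
    have hE : E = -(m ^ 2 * y₀ ^ 2) := by
      have h2 : m ^ 2 * (9 * 1 * y₀ ^ 2 + (E - c ^ 2 - 81 * 1 / m ^ 2) * y₀ - 9 * E / m ^ 2) = 0 := by
        rw [show 9 * 1 * y₀ ^ 2 + (E - c ^ 2 - 81 * 1 / m ^ 2) * y₀ - 9 * E / m ^ 2 = 0 from hP0,
          mul_zero]
      have h3 : m ^ 2 * (9 * 1 * y₀ ^ 2 + (E - c ^ 2 - 81 * 1 / m ^ 2) * y₀ - 9 * E / m ^ 2)
          = m ^ 2 * (9 * 1 * y₀ ^ 2 + (E - c ^ 2 - 81 * 1 / m ^ 2) * y₀) - 9 * E := by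
        field_simp
      linear_combination (-1 / 9) * h2 + (1 / 9) * h3 + m ^ 2 * y₀ / 9 * hd0
    have hlt : m ^ 2 * y₀ < 9 := by
      unfold screwPhi at hφ
      rw [hE] at hφ
      by_contra! h2
      nlinarith
    have hc2 : m ^ 2 * c ^ 2 = -(m ^ 2 * y₀ - 9) ^ 2 := by
      have h2 : m ^ 2 * (81 * 1 / m ^ 2) = 81 := by field_simp
      rw [hE] at hd0
      linear_combination (-m ^ 2) * hd0 - h2
    nlinarith [mul_nonneg (sq_nonneg m) (sq_nonneg c), mul_pos (sub_pos.2 hlt) (sub_pos.2 hlt)]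
  · obtain rfl : ε = -1 := by linarith
    -- For `ε = -1` the polynomial is `-9 (y - y₀)²`, which is negative at every other point.
    obtain ⟨y, hy1, hy2⟩ := ((hPn.filter_mono
      (nhdsWithin_le_nhds (s := {y₀}ᶜ))).and self_mem_nhdsWithin).exists
    rw [hPy] at hy1
    have : 0 < (y - y₀) ^ 2 := by
      have : y - y₀ ≠ 0 := sub_ne_zero.2 hy2
      positivity
    linarith

/-! ### Radius, angle and height of a screw-invariant immersion. -/

section Uniqueness

variable {M : Type*} [TopologicalSpace M] [ChartedSpace (EuclideanSpace ℝ (Fin 2)) M]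
  [IsManifold (𝓡 2) ∞ M]
  {g : Metric2 M} {v : Fin 2 → (x : M) → TangentSpace (𝓡 2) x} {U : Set M}
  {ε E : ℝ} {w t : M → ℝ} {N : (x : M) → TangentSpace (𝓡 2) x} {W : Set M}

theorem IsScrewChart.mono (hc : IsScrewChart g v U ε E w t N W) {W' : Set M} (hW' : IsOpen W')
    (h : W' ⊆ W) : IsScrewChart g v U ε E w t N W' where
  isOpen := hW'
  subset := h.trans hc.subset
  smooth_w := hc.smooth_w.mono h
  smooth_t := hc.smooth_t.mono h
  smooth_V := hc.smooth_V.mono h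
  smooth_N := hc.smooth_N.mono h
  sq_eq := hc.sq_eq
  w_pos x hx := hc.w_pos x (h hx)
  phi_pos x hx := hc.phi_pos x (h hx)
  V_w x hx := hc.V_w x (h hx)
  N_w x hx := hc.N_w x (h hx)
  V_t x hx := hc.V_t x (h hx)
  N_t x hx := hc.N_t x (h hx)
  inner_VV x hx := hc.inner_VV x (h hx)
  inner_VN x hx := hc.inner_VN x (h hx)
  inner_NN x hx := hc.inner_NN x (h hx)
  frame x hx := hc.frame x (h hx)

/-- The coordinates, with respect to an axis of symmetry, of an isometric immersion. -/
structure IsScrewTriple (V N : (x : M) → TangentSpace (𝓡 2) x) (ε E : ℝ) (w : M → ℝ) (m c : ℝ)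
    (ξ η ζ : M → ℝ) (W : Set M) : Prop where
  smooth_xi : SmoothOn ξ W
  smooth_eta : SmoothOn η W
  smooth_zeta : SmoothOn ζ W
  V_xi : ∀ x ∈ W, dirDeriv V ξ x = -m * η x
  V_eta : ∀ x ∈ W, dirDeriv V η x = m * ξ x
  V_zeta : ∀ x ∈ W, dirDeriv V ζ x = c
  inner_VV : ∀ x ∈ W, dirDeriv V ξ x ^ 2 + dirDeriv V η x ^ 2 + dirDeriv V ζ x ^ 2
    = E + 9 * ε * w x
  inner_VN : ∀ x ∈ W, dirDeriv V ξ x * dirDeriv N ξ x + dirDeriv V η x * dirDeriv N η x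
    + dirDeriv V ζ x * dirDeriv N ζ x = 0
  inner_NN : ∀ x ∈ W, dirDeriv N ξ x ^ 2 + dirDeriv N η x ^ 2 + dirDeriv N ζ x ^ 2
    = 9 * w x / (4 * (E + 9 * ε * w x))

variable {m c : ℝ} {ξ η ζ ξ' η' ζ' : M → ℝ}

theorem IsScrewTriple.mono {V : (x : M) → TangentSpace (𝓡 2) x}
    (h : IsScrewTriple V N ε E w m c ξ η ζ W) {W' : Set M} (hW : W' ⊆ W) :
    IsScrewTriple V N ε E w m c ξ η ζ W' where
  smooth_xi := h.smooth_xi.mono hW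
  smooth_eta := h.smooth_eta.mono hW
  smooth_zeta := h.smooth_zeta.mono hW
  V_xi x hx := h.V_xi x (hW hx)
  V_eta x hx := h.V_eta x (hW hx)
  V_zeta x hx := h.V_zeta x (hW hx)
  inner_VV x hx := h.inner_VV x (hW hx)
  inner_VN x hx := h.inner_VN x (hW hx)
  inner_NN x hx := h.inner_NN x (hW hx)

/-- The length of `V` fixes the distance from the axis as a function of `w`, `m` and `c`. -/
theorem IsScrewTriple.norm_sq (h : IsScrewTriple (JGradq g v) N ε E w m c ξ η ζ W) {x : M}
    (hx : x ∈ W) : m ^ 2 * (ξ x ^ 2 + η x ^ 2) + c ^ 2 = E + 9 * ε * w x := by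
  rw [← h.inner_VV x hx, h.V_xi x hx, h.V_eta x hx, h.V_zeta x hx]
  ring

theorem IsScrewTriple.radial (hc : IsScrewChart g v U ε E w t N W)
    (h : IsScrewTriple (JGradq g v) N ε E w m c ξ η ζ W) {x : M} (hx : x ∈ W) :
    2 * m ^ 2 * (ξ x * dirDeriv N ξ x + η x * dirDeriv N η x) = 9 * ε := by
  have hξ := h.smooth_xi.mdifferentiableAt hc.isOpen hx
  have hη := h.smooth_eta.mdifferentiableAt hc.isOpen hx
  have hw := hc.smooth_w.mdifferentiableAt hc.isOpen hx
  have e : (fun y => m ^ 2 * (ξ y * ξ y + η y * η y)) =ᶠ[nhds x]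
      fun y => 9 * ε * w y + (E - c ^ 2) :=
    Filter.eventuallyEq_of_mem (hc.isOpen.mem_nhds hx) fun y hy => by
      linear_combination h.norm_sq hy
  have h1 := dirDeriv_congr (X := N) e
  rw [dirDeriv_const_mul (f := fun y => ξ y * ξ y + η y * η y) _ ((hξ.mul hξ).add (hη.mul hη)),
    dirDeriv_fun_add (f := fun y => ξ y * ξ y) (h := fun y => η y * η y) (hξ.mul hξ) (hη.mul hη),
    dirDeriv_fun_mul hξ hξ, dirDeriv_fun_mul hη hη,
    dirDeriv_fun_add (f := fun y => 9 * ε * w y) (h := fun _ => E - c ^ 2)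
      (mdifferentiableAt_const.mul hw) mdifferentiableAt_const,
    dirDeriv_const_mul (f := w) _ hw, dirDeriv_const, hc.N_w x hx] at h1
  linear_combination h1

/-- Orthogonality of `V` and `N` ties the rotation of the profile about the axis to its height. -/
theorem IsScrewTriple.angular (h : IsScrewTriple (JGradq g v) N ε E w m c ξ η ζ W) {x : M}
    (hx : x ∈ W) :
    m * (ξ x * dirDeriv N η x - η x * dirDeriv N ξ x) = -(c * dirDeriv N ζ x) := by
  have h1 := h.inner_VN x hx
  rw [h.V_xi x hx, h.V_eta x hx, h.V_zeta x hx] at h1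
  linear_combination h1

/-- By Lagrange's identity the horizontal length of the image of `N` is determined by its radial and
angular parts, which are known from `radial` and `angular`. The length of `N` then leaves one
equation for the square of the height derivative. -/
theorem IsScrewTriple.height_sq (hc : IsScrewChart g v U ε E w t N W)
    (h : IsScrewTriple (JGradq g v) N ε E w m c ξ η ζ W) (hm : m ≠ 0) {x : M} (hx : x ∈ W) :
    dirDeriv N ζ x ^ 2 = 9 / 4 * (w x * screwF ε E ((m, c), w x) / screwPhi ε E (w x)) := by
  have h1 := h.norm_sq hx
  have h2 := h.radial hc hx
  have h3 := h.angular hx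
  have h4 := h.inner_NN x hx
  have hφ := (hc.phi_pos x hx).ne'
  have hw := (hc.w_pos x hx).ne'
  have hε := hc.sq_eq
  simp only [screwF, screwPhi]
  generalize dirDeriv N ξ x = ξn at *
  generalize dirDeriv N η x = ηn at *
  generalize dirDeriv N ζ x = ζn at *
  set φ := E + 9 * ε * w x with hφd
  have h4' : 4 * φ * (ξn ^ 2 + ηn ^ 2 + ζn ^ 2) = 9 * w x := by
    rw [h4]; field_simp
  field_simp
  have key : 4 * m ^ 2 * φ ^ 2 * ζn ^ 2 = 9 * w x * m ^ 2 * (φ - c ^ 2) - 81 * φ := by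
    linear_combination (m ^ 4 * (ξ x ^ 2 + η x ^ 2)) * h4' - (4 * φ * ζn ^ 2 * m ^ 2 - 9 * w x * m ^ 2) * h1
      - φ * (2 * m ^ 2 * (ξ x * ξn + η x * ηn) + 9 * ε) * h2 - 81 * φ * hε
      - 4 * m ^ 2 * φ * (m * (ξ x * ηn - η x * ξn) - c * ζn) * h3
  linear_combination key

end Uniqueness

/-! ### Congruence with a member of the family. -/

section Congruence

variable {M : Type*} [TopologicalSpace M] [ChartedSpace (EuclideanSpace ℝ (Fin 2)) M]
  [IsManifold (𝓡 2) ∞ M]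
  {g : Metric2 M} {v : Fin 2 → (x : M) → TangentSpace (𝓡 2) x} {U : Set M}
  {ε E : ℝ} {w t : M → ℝ} {N : (x : M) → TangentSpace (𝓡 2) x} {W : Set M}
  {m c : ℝ} {ξ η ζ ξ' η' ζ' : M → ℝ}

theorem dirDeriv_div_eq_zero {X : (x : M) → TangentSpace (𝓡 2) x} {n d : M → ℝ} (hW : IsOpen W)
    (hn : SmoothOn n W) (hd : SmoothOn d W) (hd0 : ∀ x ∈ W, d x ≠ 0) {x : M} (hx : x ∈ W)
    (h : dirDeriv X n x * d x = n x * dirDeriv X d x) : dirDeriv X (fun y => n y / d y) x = 0 := by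
  have hq : SmoothOn (fun y => n y / d y) W := SmoothOn.div' hn hd hd0
  have e : n =ᶠ[nhds x] fun y => (n y / d y) * d y :=
    Filter.eventuallyEq_of_mem (hW.mem_nhds hx) fun y hy => (div_mul_cancel₀ _ (hd0 y hy)).symm
  have h1 := dirDeriv_congr (X := X) e
  rw [dirDeriv_fun_mul (f := fun y => n y / d y) (hq.mdifferentiableAt hW hx)
    (hd.mdifferentiableAt hW hx)] at h1
  have hdx := hd0 x hx
  rw [h1] at h
  have h2 : d x * d x * dirDeriv X (fun y => n y / d y) x = 0 := by
    have h3 : n x / d x * d x = n x := div_mul_cancel₀ _ hdx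
    linear_combination h - dirDeriv X d x * h3
  exact (mul_eq_zero.1 h2).resolve_left (mul_ne_zero hdx hdx)

/-- The fields `V` and `N` span the tangent planes, so they may replace the orthonormal frame in the
criterion for local constancy. -/
theorem IsScrewChart.eventually_const (hc : IsScrewChart g v U ε E w t N W)
    (hv : IsOrthonormalFrameOn g v U) {p : M} (hp : p ∈ W) {f : M → ℝ} (hf : SmoothOn f W)
    (hV : ∀ x ∈ W, dirDeriv (JGradq g v) f x = 0) (hN : ∀ x ∈ W, dirDeriv N f x = 0) :
    ∀ᶠ x in nhds p, f x = f p :=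
  hv.eventually_eq_of_dirDeriv_eq_zero hc.isOpen hc.subset hp hf fun x hx i => by
    rw [dirDeriv_comb (hc.frame x hx i), hV x hx, hN x hx, mul_zero, mul_zero, add_zero]

/-- Two screw-invariant isometric immersions with equal invariants differ by a screw motion. -/
theorem IsScrewTriple.congruent (hc : IsScrewChart g v U ε E w t N W)
    (hv : IsOrthonormalFrameOn g v U) (hm : m ≠ 0)
    (h : IsScrewTriple (JGradq g v) N ε E w m c ξ η ζ W)
    (h' : IsScrewTriple (JGradq g v) N ε E w m c ξ' η' ζ' W)
    (hpos : ∀ x ∈ W, 0 < E + 9 * ε * w x - c ^ 2)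
    (hζ : ∀ x ∈ W, dirDeriv N ζ x = dirDeriv N ζ' x) {p : M} (hp : p ∈ W) :
    ∃ α β δ : ℝ, α ^ 2 + β ^ 2 = 1 ∧ ∀ᶠ x in nhds p, ξ x = α * ξ' x - β * η' x ∧
      η x = β * ξ' x + α * η' x ∧ ζ x = ζ' x + δ := by
  have hm2 : m ^ 2 ≠ 0 := pow_ne_zero 2 hm
  -- In complex notation `n / d` and `k / d` are the real and imaginary parts of `(ξ + iη) / (ξ' +
  -- iη')`. This quotient is shown to be constant, and it has modulus one because the radii agree.
  set d : M → ℝ := fun x => ξ' x * ξ' x + η' x * η' x with hd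
  set n : M → ℝ := fun x => ξ x * ξ' x + η x * η' x with hn
  set k : M → ℝ := fun x => η x * ξ' x - ξ x * η' x with hk
  have hds : SmoothOn d W := (h'.smooth_xi.mul h'.smooth_xi).add (h'.smooth_eta.mul h'.smooth_eta)
  have hns : SmoothOn n W := (h.smooth_xi.mul h'.smooth_xi).add (h.smooth_eta.mul h'.smooth_eta)
  have hks : SmoothOn k W := (h.smooth_eta.mul h'.smooth_xi).sub (h.smooth_xi.mul h'.smooth_eta)
  have hrr : ∀ x ∈ W, ξ x ^ 2 + η x ^ 2 = ξ' x ^ 2 + η' x ^ 2 := fun x hx => by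
    apply mul_left_cancel₀ hm2
    linear_combination h.norm_sq hx - h'.norm_sq hx
  have hd0 : ∀ x ∈ W, d x ≠ 0 := fun x hx h0 => by
    have h1 := h'.norm_sq hx
    have h2 := hpos x hx
    simp only [hd] at h0
    have h3 : E + 9 * ε * w x - c ^ 2 = 0 := by linear_combination m ^ 2 * h0 - h1
    exact h2.ne' h3
  have hD : ∀ (X : (x : M) → TangentSpace (𝓡 2) x), ∀ x ∈ W,
      dirDeriv X d x = 2 * (ξ' x * dirDeriv X ξ' x + η' x * dirDeriv X η' x) ∧
      dirDeriv X n x = ξ x * dirDeriv X ξ' x + ξ' x * dirDeriv X ξ x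
        + (η x * dirDeriv X η' x + η' x * dirDeriv X η x) ∧
      dirDeriv X k x = η x * dirDeriv X ξ' x + ξ' x * dirDeriv X η x
        - (ξ x * dirDeriv X η' x + η' x * dirDeriv X ξ x) := by
    intro X x hx
    have m1 := h.smooth_xi.mdifferentiableAt hc.isOpen hx
    have m2 := h.smooth_eta.mdifferentiableAt hc.isOpen hx
    have m1' := h'.smooth_xi.mdifferentiableAt hc.isOpen hx
    have m2' := h'.smooth_eta.mdifferentiableAt hc.isOpen hx
    refine ⟨?_, ?_, ?_⟩
    · rw [hd, dirDeriv_fun_add (f := fun y => ξ' y * ξ' y) (h := fun y => η' y * η' y)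
        (m1'.mul m1') (m2'.mul m2'), dirDeriv_fun_mul m1' m1', dirDeriv_fun_mul m2' m2']
      ring
    · rw [hn, dirDeriv_fun_add (f := fun y => ξ y * ξ' y) (h := fun y => η y * η' y)
        (m1.mul m1') (m2.mul m2'), dirDeriv_fun_mul m1 m1', dirDeriv_fun_mul m2 m2']
    · rw [hk, dirDeriv_fun_sub (f := fun y => η y * ξ' y) (h := fun y => ξ y * η' y)
        (m2.mul m1') (m1.mul m2'), dirDeriv_fun_mul m2 m1', dirDeriv_fun_mul m1 m2']
  -- Equal radial and angular parts mean that `ξ + iη` and `ξ' + iη'` have the same logarithmic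
  -- derivative along `N`; along `V` it is `i m` for both.
  have hK : ∀ x ∈ W, ξ x * dirDeriv N ξ x + η x * dirDeriv N η x
      = ξ' x * dirDeriv N ξ' x + η' x * dirDeriv N η' x := fun x hx => by
    apply mul_left_cancel₀ hm2
    linear_combination (1 / 2) * h.radial hc hx - (1 / 2) * h'.radial hc hx
  have hL : ∀ x ∈ W, ξ x * dirDeriv N η x - η x * dirDeriv N ξ x
      = ξ' x * dirDeriv N η' x - η' x * dirDeriv N ξ' x := fun x hx => by
    apply mul_left_cancel₀ hm
    linear_combination h.angular hx - h'.angular hx - c * hζ x hx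
  have hα := hc.eventually_const hv hp (f := fun x => n x / d x) (SmoothOn.div' hns hds hd0)
    (fun x hx => dirDeriv_div_eq_zero hc.isOpen hns hds hd0 hx (by
      obtain ⟨e1, e2, -⟩ := hD (JGradq g v) x hx
      rw [e1, e2, h.V_xi x hx, h.V_eta x hx, h'.V_xi x hx, h'.V_eta x hx]
      ring))
    (fun x hx => dirDeriv_div_eq_zero hc.isOpen hns hds hd0 hx (by
      obtain ⟨e1, e2, -⟩ := hD N x hx
      rw [e1, e2]
      simp only [hd, hn]
      linear_combination (ξ x * ξ' x + η x * η' x) * hK x hx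
        + (ξ x * η' x - η x * ξ' x) * hL x hx
        - (ξ' x * dirDeriv N ξ x + η' x * dirDeriv N η x) * hrr x hx))
  have hβ := hc.eventually_const hv hp (f := fun x => k x / d x) (SmoothOn.div' hks hds hd0)
    (fun x hx => dirDeriv_div_eq_zero hc.isOpen hks hds hd0 hx (by
      obtain ⟨e1, -, e2⟩ := hD (JGradq g v) x hx
      rw [e1, e2, h.V_xi x hx, h.V_eta x hx, h'.V_xi x hx, h'.V_eta x hx]
      ring))
    (fun x hx => dirDeriv_div_eq_zero hc.isOpen hks hds hd0 hx (by
      obtain ⟨e1, -, e2⟩ := hD N x hx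
      rw [e1, e2]
      simp only [hd, hk]
      linear_combination (η x * ξ' x - ξ x * η' x) * hK x hx
        + (ξ x * ξ' x + η x * η' x) * hL x hx
        - (ξ' x * dirDeriv N η x - η' x * dirDeriv N ξ x) * hrr x hx))
  have hsub : ∀ (X : (x : M) → TangentSpace (𝓡 2) x), ∀ x ∈ W,
      dirDeriv X (fun y => ζ y - ζ' y) x = dirDeriv X ζ x - dirDeriv X ζ' x := fun X x hx =>
    dirDeriv_fun_sub (h.smooth_zeta.mdifferentiableAt hc.isOpen hx)
      (h'.smooth_zeta.mdifferentiableAt hc.isOpen hx)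
  have hδ := hc.eventually_const hv hp (f := fun x => ζ x - ζ' x)
    (h.smooth_zeta.sub h'.smooth_zeta)
    (fun x hx => by rw [hsub _ x hx, h.V_zeta x hx, h'.V_zeta x hx, sub_self])
    (fun x hx => by rw [hsub _ x hx, hζ x hx, sub_self])
  refine ⟨n p / d p, k p / d p, ζ p - ζ' p, ?_, ?_⟩
  · have h0 := hd0 p hp
    have h1 := hrr p hp
    field_simp
    simp only [hn, hk, hd]
    linear_combination (ξ' p ^ 2 + η' p ^ 2) * h1
  · filter_upwards [hα, hβ, hδ, hc.isOpen.mem_nhds hp] with x h1 h2 h3 hx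
    have h0 := hd0 x hx
    rw [← h1, ← h2, ← h3]
    refine ⟨?_, ?_, by ring⟩
    · field_simp
      simp only [hn, hk, hd]
      ring
    · field_simp
      simp only [hn, hk, hd]
      ring

/-- Reflection of the axis. -/
theorem IsScrewTriple.reflect (hW : IsOpen W) (h : IsScrewTriple (JGradq g v) N ε E w m c ξ η ζ W)
    {s : ℝ} (hs : s ^ 2 = 1) :
    IsScrewTriple (JGradq g v) N ε E w m (s * c) ξ η (fun x => s * ζ x) W := by
  have hd : ∀ (X : (x : M) → TangentSpace (𝓡 2) x), ∀ x ∈ W,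
      dirDeriv X (fun y => s * ζ y) x = s * dirDeriv X ζ x := fun X x hx =>
    dirDeriv_const_mul _ (h.smooth_zeta.mdifferentiableAt hW hx)
  refine ⟨h.smooth_xi, h.smooth_eta, contMDiffOn_const.mul h.smooth_zeta, h.V_xi, h.V_eta,
    fun x hx => ?_, fun x hx => ?_, fun x hx => ?_, fun x hx => ?_⟩
  · rw [hd _ x hx, h.V_zeta x hx]
  · rw [hd _ x hx]
    linear_combination h.inner_VV x hx + dirDeriv (JGradq g v) ζ x ^ 2 * hs
  · rw [hd _ x hx, hd _ x hx]
    linear_combination h.inner_VN x hx + dirDeriv (JGradq g v) ζ x * dirDeriv N ζ x * hs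
  · rw [hd _ x hx]
    linear_combination h.inner_NN x hx + dirDeriv N ζ x ^ 2 * hs

theorem dirDeriv_inner_add (X : (x : M) → TangentSpace (𝓡 2) x) {φ : M → E3} {x : M}
    (hφ : MDifferentiableAt (𝓡 2) 𝓘(ℝ, E3) φ x) (f : E3) (k : ℝ) :
    dirDeriv X (fun y => inner ℝ f (φ y) + k) x = inner ℝ f (pushforward φ x (X x)) := by
  have h1 := (((innerSL ℝ f).hasFDerivAt.add_const k).hasMFDerivAt.comp x hφ.hasMFDerivAt).mfderiv
  unfold dirDeriv
  change mfderiv (𝓡 2) 𝓘(ℝ, ℝ) ((fun u => innerSL ℝ f u + k) ∘ φ) x (X x) = _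
  rw [h1]
  rfl

/-- The coordinates of an isometric immersion with extrinsic symmetry. -/
theorem IsScrewChart.isScrewTriple (hc : IsScrewChart g v U ε E w t N W) {φ : M → E3}
    (hφ : IsIsometricImmersionOn g φ W) {A Z : E3}
    (hA : ∀ x ∈ W, pushforward φ x (JGradq g v x) = A + cross (φ x) Z)
    {b : OrthonormalBasis (Fin 3) ℝ E3} (hm : m ≠ 0)
    (h0 : ∀ u, inner ℝ (b 0) (cross u Z) = -m * inner ℝ (b 1) u)
    (h1 : ∀ u, inner ℝ (b 1) (cross u Z) = m * inner ℝ (b 0) u)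
    (h2 : ∀ u, inner ℝ (b 2) (cross u Z) = 0) :
    IsScrewTriple (JGradq g v) N ε E w m (inner ℝ (b 2) A)
      (fun x => inner ℝ (b 0) (φ x) + inner ℝ (b 1) A / m)
      (fun x => inner ℝ (b 1) (φ x) + -(inner ℝ (b 0) A / m))
      (fun x => inner ℝ (b 2) (φ x) + 0) W := by
  have hs : ∀ (f : E3) (k : ℝ), SmoothOn (fun x => inner ℝ f (φ x) + k) W := fun f k =>
    ((contDiff_const.inner ℝ contDiff_id).add contDiff_const).contMDiff.comp_contMDiffOn hφ.1
  have hd : ∀ (X : (x : M) → TangentSpace (𝓡 2) x) (f : E3) (k : ℝ), ∀ x ∈ W,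
      dirDeriv X (fun y => inner ℝ f (φ y) + k) x = inner ℝ f (pushforward φ x (X x)) :=
    fun X f k x hx => dirDeriv_inner_add X
      (((hφ.1 x hx).contMDiffAt (hc.isOpen.mem_nhds hx)).mdifferentiableAt (by simp)) f k
  have hin : ∀ u u' : E3, inner ℝ (b 0) u * inner ℝ (b 0) u' + inner ℝ (b 1) u * inner ℝ (b 1) u'
      + inner ℝ (b 2) u * inner ℝ (b 2) u' = inner ℝ u u' := fun u u' => by
    rw [← b.sum_inner_mul_inner u u', Fin.sum_univ_three]
    simp only [real_inner_comm]
  refine ⟨hs _ _, hs _ _, hs _ _, fun x hx => ?_, fun x hx => ?_, fun x hx => ?_, fun x hx => ?_,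
    fun x hx => ?_, fun x hx => ?_⟩
  -- The shifts in the first two coordinates put the origin on the axis; they absorb the part of `A`
  -- orthogonal to the axis.
  · rw [hd _ _ _ x hx, hA x hx, inner_add_right, h0]
    field_simp
    ring
  · rw [hd _ _ _ x hx, hA x hx, inner_add_right, h1]
    field_simp
    ring
  · rw [hd _ _ _ x hx, hA x hx, inner_add_right, h2, add_zero]
  · rw [hd _ _ _ x hx, hd _ _ _ x hx, hd _ _ _ x hx, ← hc.inner_VV x hx, ← hφ.2 x hx,
      ← hin (pushforward φ x (JGradq g v x)) (pushforward φ x (JGradq g v x))]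
    ring
  · rw [hd _ _ _ x hx, hd _ _ _ x hx, hd _ _ _ x hx, hd _ _ _ x hx, hd _ _ _ x hx, hd _ _ _ x hx,
      ← hc.inner_VN x hx, ← hφ.2 x hx,
      ← hin (pushforward φ x (JGradq g v x)) (pushforward φ x (N x))]
  · rw [hd _ _ _ x hx, hd _ _ _ x hx, hd _ _ _ x hx, ← hc.inner_NN x hx, ← hφ.2 x hx,
      ← hin (pushforward φ x (N x)) (pushforward φ x (N x))]
    ring

/-- The coordinates of a member of the family. -/
theorem IsScrewChart.isScrewTriple_screwFamily (hc : IsScrewChart g v U ε E w t N W)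
    (hv : IsOrthonormalFrameOn g v U) {y₀ : ℝ} {a : ℝ × ℝ} {W' : Set M} (hW' : W' ⊆ W)
    (hD : ∀ x ∈ W', (a, x) ∈ screwFamilyDomain ε E y₀ w W) (hW'o : IsOpen W') :
    IsScrewTriple (JGradq g v) N ε E w a.1 a.2 (fun x => screwFamily ε E y₀ w t a x 0)
      (fun x => screwFamily ε E y₀ w t a x 1) (fun x => screwFamily ε E y₀ w t a x 2) W' ∧
    ∀ x ∈ W', dirDeriv N (fun x => screwFamily ε E y₀ w t a x 2) x = screwR ε E (a, w x) := by
  have hΨ := (hc.contMDiffOn_screwFamily_apply y₀ a).mono hD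
  have hiso := hc.isIsometricImmersionOn_screwFamily hv y₀ a
  have hs : ∀ i : Fin 3, SmoothOn (fun x => screwFamily ε E y₀ w t a x i) W' := fun i =>
    (EuclideanSpace.proj (𝕜 := ℝ) (ι := Fin 3) i).contDiff.contMDiff.comp_contMDiffOn hΨ
  have hd : ∀ (X : (x : M) → TangentSpace (𝓡 2) x) (i : Fin 3), ∀ x ∈ W',
      dirDeriv X (fun x => screwFamily ε E y₀ w t a x i) x
        = pushforward (screwFamily ε E y₀ w t a) x (X x) i := fun X i x hx =>
    (pushforward_comp X (((hΨ x hx).contMDiffAt (hW'o.mem_nhds hx)).mdifferentiableAt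
      (by simp)) i).symm
  have hV : ∀ x ∈ W', _ := fun x hx =>
    hc.pushforward_screwFamily (hD x hx) (JGradq g v) _ _ rfl rfl
  have hN : ∀ x ∈ W', _ := fun x hx => hc.pushforward_screwFamily (hD x hx) N _ _ rfl rfl
  refine ⟨⟨hs 0, hs 1, hs 2, fun x hx => ?_, fun x hx => ?_, fun x hx => ?_, fun x hx => ?_,
    fun x hx => ?_, fun x hx => ?_⟩, fun x hx => ?_⟩
  · rw [hd _ _ x hx, hV x hx, hc.V_w x (hW' hx), hc.V_t x (hW' hx)]
    change _ = -a.1 * (_ * _)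
    simp only [Matrix.cons_val]
    ring
  · rw [hd _ _ x hx, hV x hx, hc.V_w x (hW' hx), hc.V_t x (hW' hx)]
    change _ = a.1 * (_ * _)
    simp only [Matrix.cons_val]
    ring
  · rw [hd _ _ x hx, hV x hx, hc.V_w x (hW' hx), hc.V_t x (hW' hx)]
    simp only [Matrix.cons_val]
    ring
  · rw [hd _ _ x hx, hd _ _ x hx, hd _ _ x hx, ← hc.inner_VV x (hW' hx),
      ← hiso.2 x (hD x hx), inner_E3]
    ring
  · rw [hd _ _ x hx, hd _ _ x hx, hd _ _ x hx, hd _ _ x hx, hd _ _ x hx, hd _ _ x hx,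
      ← hc.inner_VN x (hW' hx), ← hiso.2 x (hD x hx), inner_E3]
  · rw [hd _ _ x hx, hd _ _ x hx, hd _ _ x hx, ← hc.inner_NN x (hW' hx),
      ← hiso.2 x (hD x hx), inner_E3]
    ring
  · rw [hd _ _ x hx, hN x hx, hc.N_w x (hW' hx), hc.N_t x (hW' hx)]
    simp only [Matrix.cons_val]
    ring

theorem exists_sign {z : ℝ} (hz : z ≠ 0) : ∃ s : ℝ, s ^ 2 = 1 ∧ 0 < s * z := by
  rcases lt_or_gt_of_ne hz with h | h
  · exact ⟨-1, by norm_num, by linarith⟩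
  · exact ⟨1, by norm_num, by linarith⟩

/-- Every isometric immersion with extrinsic symmetry is congruent to a member of the family. -/
theorem IsScrewChart.exists_congruentNear (hc : IsScrewChart g v U ε E w t N W)
    (hv : IsOrthonormalFrameOn g v U) {p : M} (hp : p ∈ W) {W' : Set M} (hW' : IsOpen W')
    (hp' : p ∈ W') {φ : M → E3} (hφ : IsIsometricImmersionOn g φ W')
    (hsym : HasExtrinsicSymmetryOn (JGradq g v) φ W') :
    ∃ a, (a, w p) ∈ screwDomain ε E ∧ CongruentNear φ (screwFamily ε E (w p) w t a) p := by
  obtain ⟨A, Z, hZ, hA⟩ := hsym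
  obtain ⟨m, b, hm, b0, b1, b2⟩ := exists_axis_frame hZ
  set W₀ := W ∩ W'
  have hc₀ := hc.mono (hc.isOpen.inter hW') (Set.inter_subset_left (t := W'))
  have hp₀ : p ∈ W₀ := ⟨hp, hp'⟩
  have hT := hc₀.isScrewTriple ⟨hφ.1.mono Set.inter_subset_right, fun x hx => hφ.2 x hx.2⟩
    (fun x hx => hA x hx.2) hm.ne' b0 b1 b2
  set c := inner ℝ (b 2) A with hcdef
  set ξ : M → ℝ := fun x => inner ℝ (b 0) (φ x) + inner ℝ (b 1) A / m with hξ
  set η : M → ℝ := fun x => inner ℝ (b 1) (φ x) + -(inner ℝ (b 0) A / m) with hη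
  set ζ : M → ℝ := fun x => inner ℝ (b 2) (φ x) + 0 with hζ
  -- By `height_sq` the factor is, up to positive quantities, the square of the height derivative.
  have hF0 : ∀ x ∈ W₀, 0 ≤ screwF ε E ((m, c), w x) := fun x hx => by
    have h1 := hT.height_sq hc₀ hm.ne' hx
    have h2 := hc₀.w_pos x hx
    have h3 : 0 < screwPhi ε E (w x) := hc₀.phi_pos x hx
    have h4 : 0 ≤ w x * screwF ε E ((m, c), w x) / screwPhi ε E (w x) := by
      have := sq_nonneg (dirDeriv N ζ x)
      linarith
    have h5 := mul_nonneg h4 h3.le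
    rw [div_mul_cancel₀ _ h3.ne'] at h5
    exact nonneg_of_mul_nonneg_right h5 h2
  -- The values of `w` near `p` fill a neighbourhood of `w p`, so the inequality holds on an
  -- interval, as `screwF_pos` requires.
  have hmap : Filter.map w (nhds p) = nhds (w p) := by
    have h1 := congrArg (Filter.map Prod.fst) (hc.map_nhds hp)
    rwa [Filter.map_map, map_fst_nhds] at h1
  have hwp := hc.w_pos p hp
  have hφp : 0 < screwPhi ε E (w p) := hc.phi_pos p hp
  have hFp : 0 < screwF ε E ((m, c), w p) := screwF_pos hc.sq_eq hm hwp hφp (by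
    rw [← hmap, Filter.eventually_map]
    exact Filter.eventually_of_mem (hc₀.isOpen.mem_nhds hp₀) hF0)
  have hζp : dirDeriv N ζ p ≠ 0 := fun h0 => by
    have h1 := hT.height_sq hc₀ hm.ne' hp₀
    rw [h0] at h1
    have : 0 < w p * screwF ε E ((m, c), w p) / screwPhi ε E (w p) := by positivity
    linarith
  -- The height increases along `N` in every member of the family. A reflection of the axis, which
  -- replaces `c` by `s c`, arranges this here.
  obtain ⟨s, hs, hsp⟩ := exists_sign hζp
  have hTs := hT.reflect hc₀.isOpen hs
  have ha : ((m, s * c), w p) ∈ screwDomain ε E := by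
    refine ⟨hm, hwp, hφp, ?_⟩
    have : screwF ε E ((m, s * c), w p) = screwF ε E ((m, c), w p) := by
      simp only [screwF, mul_pow, hs, one_mul]
    rwa [this]
  set W₁ : Set M := (W₀ ∩ (fun x => s * dirDeriv N ζ x) ⁻¹' Set.Ioi 0)
    ∩ {x | ((m, s * c), x) ∈ screwFamilyDomain ε E (w p) w W} with hW₁
  have hcont : ContinuousOn (fun x => s * dirDeriv N ζ x) W₀ :=
    continuousOn_const.mul (hT.smooth_zeta.dirDeriv hc₀.smooth_N hc₀.isOpen).continuousOn
  have hW₁o : IsOpen W₁ := (hcont.isOpen_inter_preimage hc₀.isOpen isOpen_Ioi).inter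
    ((hc.isOpen_screwFamilyDomain (w p)).preimage (by fun_prop))
  have hW₁₀ : W₁ ⊆ W₀ := fun x hx => hx.1.1
  have hp₁ : p ∈ W₁ := ⟨⟨hp₀, hsp⟩, hp, base_mem_segFiber ha⟩
  obtain ⟨hΨ, hΨN⟩ := hc.isScrewTriple_screwFamily hv (a := (m, s * c)) (y₀ := w p) (W' := W₁)
    (fun x hx => hx.1.1.1) (fun x hx => hx.2) hW₁o
  have hdom : ∀ x ∈ W₁, ((m, s * c), w x) ∈ screwDomain ε E := fun x hx =>
    mem_of_mem_segFiber hx.2.2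
  obtain ⟨α, β, δ, hαβ, hev⟩ := (hTs.mono hW₁₀).congruent (hc₀.mono hW₁o hW₁₀) hv hm.ne' hΨ
    (fun x hx => sub_sq_pos (hdom x hx)) (fun x hx => by
      have h1 := hTs.height_sq hc₀ hm.ne' (hW₁₀ hx)
      have h2 := sq_screwR (hdom x hx)
      have h3 : dirDeriv N (fun y => s * ζ y) x = s * dirDeriv N ζ x :=
        dirDeriv_const_mul _ (hT.smooth_zeta.mdifferentiableAt hc₀.isOpen (hW₁₀ hx))
      have h4 : 0 < dirDeriv N (fun y => s * ζ y) x := by rw [h3]; exact hx.1.2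
      rw [hΨN x hx]
      exact (sq_eq_sq₀ h4.le (screwR_pos (hdom x hx)).le).1 (h1.trans h2.symm)) hp₁
  have hb : ∀ i j, inner ℝ (b i) (b j) = if i = j then (1 : ℝ) else 0 := fun i j =>
    orthonormal_iff_ite.1 b.orthonormal i j
  -- The axis frame, turned by the angle with cosine `α` and sine `β` and reflected by `s`. Together
  -- with the translation below it forms the isometry that carries the family member to `φ`.
  obtain ⟨b', hb'⟩ := exists_orthonormalBasis
    (f := ![α • b 0 + β • b 1, -β • b 0 + α • b 1, s • b 2]) (by
      apply orthonormal_three <;>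
      simp only [Matrix.cons_val, inner_add_left, inner_add_right, real_inner_smul_left,
        real_inner_smul_right, hb] <;> simp
      · linear_combination hαβ
      · linear_combination hαβ
      · linear_combination hs
      · ring)
  refine ⟨(m, s * c), ha, b'.repr.symm.toIsometryEquiv.trans (IsometryEquiv.addRight
    (-(inner ℝ (b 1) A / m) • b 0 + (inner ℝ (b 0) A / m) • b 1 + (s * δ) • b 2)), ?_⟩
  filter_upwards [hev] with x hx
  obtain ⟨e0, e1, e2⟩ := hx
  have hr := b'.sum_repr_symm (screwFamily ε E (w p) w t (m, s * c) x)
  rw [Fin.sum_univ_three, hb', hb', hb'] at hr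
  have hφx := b.sum_repr' (φ x)
  rw [Fin.sum_univ_three] at hφx
  have e2' : inner ℝ (b 2) (φ x) = s * (screwFamily ε E (w p) w t (m, s * c) x 2 + δ) := by
    rw [← e2]
    simp only [hζ]
    linear_combination (-inner ℝ (b 2) (φ x)) * hs
  have e0' : inner ℝ (b 0) (φ x) = α * screwFamily ε E (w p) w t (m, s * c) x 0
      - β * screwFamily ε E (w p) w t (m, s * c) x 1 - inner ℝ (b 1) A / m := by
    rw [← e0]; simp only [hξ]; ring
  have e1' : inner ℝ (b 1) (φ x) = β * screwFamily ε E (w p) w t (m, s * c) x 0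
      + α * screwFamily ε E (w p) w t (m, s * c) x 1 + inner ℝ (b 0) A / m := by
    rw [← e1]; simp only [hη]; ring
  change φ x = b'.repr.symm (screwFamily ε E (w p) w t (m, s * c) x)
    + (-(inner ℝ (b 1) A / m) • b 0 + (inner ℝ (b 0) A / m) • b 1 + (s * δ) • b 2)
  rw [← hr, ← hφx, e0', e1', e2']
  simp only [Matrix.cons_val]
  module

end Congruence

end

end IsoEmb

/-! ### Assembly of the main theorem. -/

theorem mainTheorem7 {M : Type*} [TopologicalSpace M]
    [ChartedSpace (EuclideanSpace ℝ (Fin 2)) M] [IsManifold (𝓡 2) ∞ M]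
    (g : IsoEmb.Metric2 M) (hg : IsoEmb.IsDarbouxIntegrable g)
    (U : Set M) (hU : IsOpen U) (v : Fin 2 → (x : M) → TangentSpace (𝓡 2) x)
    (hv : IsoEmb.IsOrthonormalFrameOn g v U) :
    IsoEmb.IsKillingOn g v (IsoEmb.JGradq g v) U ∧
    (∀ W : Set M, IsOpen W → W ⊆ U → W.Nonempty → ∃ p ∈ W, IsoEmb.JGradq g v p ≠ 0) ∧
    ∀ p ∈ U, IsoEmb.JGradq g v p ≠ 0 →
      ∃ (P : Set (ℝ × ℝ)) (D : Set ((ℝ × ℝ) × M)) (Ψ : ℝ × ℝ → M → IsoEmb.E3),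
        IsOpen P ∧ P.Nonempty ∧ IsOpen D ∧ (∀ z ∈ D, z.1 ∈ P ∧ z.2 ∈ U) ∧
        (∀ a ∈ P, (a, p) ∈ D) ∧
        ContMDiffOn (𝓘(ℝ, ℝ × ℝ).prod (𝓡 2)) 𝓘(ℝ, IsoEmb.E3) ∞
          (fun z : (ℝ × ℝ) × M => Ψ z.1 z.2) D ∧
        (∀ a ∈ P, IsoEmb.IsIsometricImmersionOn g (Ψ a) {x | (a, x) ∈ D} ∧
          IsoEmb.HasExtrinsicSymmetryOn (IsoEmb.JGradq g v) (Ψ a) {x | (a, x) ∈ D}) ∧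
        (∀ a ∈ P, ∀ b ∈ P, IsoEmb.CongruentNear (Ψ a) (Ψ b) p → a = b) ∧
        (∀ (W : Set M) (φ : M → IsoEmb.E3), IsOpen W → p ∈ W → W ⊆ U →
          IsoEmb.IsIsometricImmersionOn g φ W →
          IsoEmb.HasExtrinsicSymmetryOn (IsoEmb.JGradq g v) φ W →
          ∃ a ∈ P, IsoEmb.CongruentNear φ (Ψ a) p) := by
  refine ⟨IsoEmb.isKillingOn_JGradq hg hv hU, fun W hW hWU hne =>
    IsoEmb.exists_JGradq_ne_zero hg hv hU hW hWU hne, fun p hp hV => ?_⟩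
  obtain ⟨ε, E, w, t, N, W, hpW, hc⟩ := IsoEmb.exists_isScrewChart hg hv hU hp hV
  -- Admissibility of a parameter is tested at the level `w p` alone. For each parameter the domain
  -- retains the points whose level is joined to `w p` by admissible levels, so that the integrals
  -- for angle and height make sense.
  refine ⟨{a | (a, w p) ∈ IsoEmb.screwDomain ε E}, IsoEmb.screwFamilyDomain ε E (w p) w W,
    IsoEmb.screwFamily ε E (w p) w t, IsoEmb.isOpen_screwDomain.preimage (by fun_prop),
    IsoEmb.exists_mem_screwDomain (hc.w_pos p hpW) (hc.phi_pos p hpW),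
    hc.isOpen_screwFamilyDomain (w p),
    fun z hz => ⟨IsoEmb.base_mem_of_mem_segFiber (z := (z.1, w z.2)) hz.2, hc.subset hz.1⟩,
    fun a ha => ⟨hpW, IsoEmb.base_mem_segFiber ha⟩, hc.contMDiffOn_screwFamily (w p),
    fun a ha => ⟨hc.isIsometricImmersionOn_screwFamily hv (w p) a,
      hc.hasExtrinsicSymmetryOn_screwFamily ha.1.ne'⟩,
    fun a ha b hb h => hc.eq_of_congruentNear hpW ha hb h,
    fun W' φ hW' hpW' _ hφ hsym => hc.exists_congruentNear hv hpW hW' hpW' hφ hsym⟩
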